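/- Let $N\ge 1$, $\alpha\in(0,2)$, and let $\Omega_0\subset\mathbb R^N$ be open. Let $p_\alpha(x,t)$ be the fundamental solution of $W_t-L^\alpha W=0$ in $\mathbb R^N\times(0,\infty)$, where $L^\alpha W(x)=\int |y-x|^{-(N+\alpha)}(W(y)-W(x))\,dy$ (principal value if $\alpha\ge1$); that is, $$p_\alpha(x,t)=(2\pi)^{-N}\int_{\mathbb R^N} \cos(x\cdot\xi)\,e^{-t m_\alpha(\xi)}\,d\xi,\qquad m_\alpha(\xi)=\int_{\mathbb R^N}(1-\cos(\xi\cdot y))|y|^{-(N+\alpha)}dy,$$ and put $P_\alpha=p_\alpha(\cdot,1)$. For $h>0$ let $\sigma_\alpha(h)=h^{\alpha/(1+\alpha)}$ if $\alpha<1$, $\sigma_\alpha(h)=h^{\alpha/2}$ if $\alpha>1$, and, if $\alpha=1$ (and $h$ is small), let $\sigma_1(h)>0$ be the solution of $h=\sigma_1(h)^2|\ln\sigma_1(h)|$ with $\sigma_1(h)\to0$ as $h\to0$. With $\operatorname{sign}(s)=1$ for $s>0$ and $\operatorname{sign}(s)=-1$ for $s\le0$, define the threshold scheme $$u_h(\cdot,0)=\mathbf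 1_{\Omega_0}-\mathbf 1_{\mathbb R^N\setminus\overline{\Omega_0}},\qquad u_h(\cdot,(n+1)h)=\operatorname{sign}\big(p_\alpha(\cdot,\sigma_\alpha(h))*u_h(\cdot,nh)\big)\quad(n\ge0),$$ and the half-relaxed limits, for $x\in\mathbb R^N$, $t>0$, $$u^*(x,t)=\limsup_{h\to0^+,\,y\to x,\,nh\to t}u_h(y,nh),\qquad u_*(x,t)=\liminf_{h\to0^+,\,y\to x,\,nh\to t}u_h(y,nh).$$ Write points of $\mathbb R^N$ as $(y_1,y')$ with $y'=(y_2,\dots,y_N)\in\mathbb R^{N-1}$, and let $$C_\alpha=\Big(2\int_{\mathbb R^{N-1}}P_\alpha(0,y')\,dy'\Big)^{-1}K_\alpha,\qquad K_\alpha=\begin{cases}C_{N,\alpha}&(\alpha<1),\\ \frac{\omega_{N-1}}{N-1}\lim_{R\to\infty}R^{N+1}P_1(0,R)&(\alpha=1),\\ \int_{\mathbb R^{N-1}}y_2^2P_\alpha(0,y')\,dy'&(\alpha>1),\end{cases}$$ where $C_{N,\alpha}$ is the constant with $\lim_{t\to0}t^{-1}p_\alpha(x,t)=C_{N,\alpha}|x|^{-(N+\alpha)}$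 for $x\ne0$, $\omega_{N-1}$ is the area of the unit sphere of $\mathbb R^{N-1}$, and $P_1(0,R)$ is the value of the radial function $P_1$ at distance $R$ from the origin. (If $N=1$ and $\alpha\ge1$ the second-order term below vanishes and $C_\alpha$ is irrelevant.) (a) If $\alpha\in[1,2)$, then $u^*$ is a viscosity subsolution and $u_*$ a viscosity supersolution of $$u_t-C_\alpha\operatorname{tr}\big((I-\widehat{Du}\otimes\widehat{Du})D^2u\big)=0\quad\text{in }\mathbb R^N\times(0,\infty),\qquad \hat p=p/|p|.$$ Here a subsolution (resp. supersolution) is an upper (resp. lower) semicontinuous function $u$ on $\mathbb R^N\times(0,\infty)$ such that, for every $\phi\in C^2(\mathbb R^N\times(0,\infty))$ and every maximum (resp. minimum) point of $u-\phi$ over $\mathbb R^N\times(0,\infty)$, one has at that point $\phi_t\le$ (resp. $\ge$) $C_\alpha\operatorname{tr}((I-\widehat{D\phi}\otimes\widehat{D\phi})D^2\phi)$ if $D\phi\ne0$, and $\phi_t\le0$ (resp. $\ge0$) if $D\phi=0$ and $D^2\phi=0$. (b) If $\alpha\in(0,1)$, then $u^*$ is a viscosity subsolution and $u_*$ a viscosity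 supersolution of $$u_t-C_\alpha|Du|\int_{\mathbb R^N}\big(\mathbf 1_{[0,\infty)}-\mathbf 1_{(-\infty,0)}\big)(u(x+y,t)-u(x,t))\,|y|^{-(N+\alpha)}dy=0\quad\text{in }\mathbb R^N\times(0,\infty).$$ Here, for $A\subset\mathbb R^N$, let $$\bar I_A[v](x,t)=\int_A(\mathbf 1_{[0,\infty)}-\mathbf 1_{(-\infty,0)})(v(x+y,t)-v(x,t))|y|^{-(N+\alpha)}dy,\qquad \underline I_A[v](x,t)=\int_A(\mathbf 1_{(0,\infty)}-\mathbf 1_{(-\infty,0]})(v(x+y,t)-v(x,t))|y|^{-(N+\alpha)}dy,$$ the integrals being taken in polar coordinates $y=r\omega$, first over the unit sphere in $\omega$ and then over $r\in(0,\infty)$. A subsolution (resp. supersolution) is a locally bounded upper (resp. lower) semicontinuous function $u$ on $\mathbb R^N\times(0,\infty)$ such that, for every $\phi\in C^2(\mathbb R^N\times(0,\infty))$, every maximum (resp. minimum) point $(x,t)$ of $u-\phi$ over $\mathbb R^N\times(0,\infty)$ and every $\delta>0$, with $B_\delta$ the ball of radius $\delta$ centred at $0$, one has at $(x,t)$ $$\phi_t\le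 C_\alpha|D\phi|\big(\bar I_{B_\delta}[\phi]+\bar I_{\mathbb R^N\setminus B_\delta}[u]\big)\qquad\Big(\text{resp. }\phi_t\ge C_\alpha|D\phi|\big(\underline I_{B_\delta}[\phi]+\underline I_{\mathbb R^N\setminus B_\delta}[u]\big)\Big),$$ the right-hand sides being $0$ when $D\phi=0$. -/

import Mathlib

open MeasureTheory Filter Topology Set

noncomputable section

namespace Threshold

/-- Euclidean space `ℝ^N` with the Euclidean norm. -/
abbrev Space (N : ℕ) := EuclideanSpace ℝ (Fin N)

/-! ### The fractional heat kernel -/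

/-- The Fourier symbol of `-L^α`, where `L^α W (x) = ∫ |y - x|^{-(N+α)} (W y - W x) dy`
(a principal value when `α ≥ 1`): `L^α` maps `exp (i ξ·x)` to `-symbol α ξ * exp (i ξ·x)`. -/
def symbol {N : ℕ} (α : ℝ) (ξ : Space N) : ℝ :=
  ∫ y : Space N, (1 - Real.cos (inner ℝ ξ y)) * ‖y‖ ^ (-((N : ℝ) + α))

/-- The fundamental solution `p_α(x,t)` of `W_t - L^α W = 0` in `ℝ^N × (0,∞)`, i.e. the inverse
Fourier transform of `ξ ↦ exp (-t * symbol α ξ)` (the symbol is even, so only the cosine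
contributes). -/
def kernel {N : ℕ} (α : ℝ) (x : Space N) (t : ℝ) : ℝ :=
  ((2 * Real.pi) ^ N)⁻¹ *
    ∫ ξ : Space N, Real.cos (inner ℝ x ξ) * Real.exp (-(t * symbol α ξ))

/-- `P_α = p_α(·,1)`. -/
def profile {N : ℕ} (α : ℝ) (x : Space N) : ℝ := kernel α x 1

/-! ### The threshold scheme -/

/-- `1` on `[0,∞)` and `-1` on `(-∞,0)`: the difference of the characteristic functions of
`[0,∞)` and `(-∞,0)`. -/
def signUpper (s : ℝ) : ℝ := if 0 ≤ s then 1 else -1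

/-- `1` on `(0,∞)` and `-1` on `(-∞,0]`: the difference of the characteristic functions of
`(0,∞)` and `(-∞,0]`. It is the sign function of the scheme. -/
def signLower (s : ℝ) : ℝ := if 0 < s then 1 else -1

/-- The scaling `σ_α`: `h^{α/(1+α)}` for `α < 1`, `h^{α/2}` for `α > 1`, and for `α = 1` the
small solution `σ` of `h = σ² |ln σ|`, for small `h`. -/
structure IsScaling (α : ℝ) (σ : ℝ → ℝ) : Prop where
  lt_one : α < 1 → ∀ h, 0 < h → σ h = h ^ (α / (1 + α))
  one_lt : 1 < α → ∀ h, 0 < h → σ h = h ^ (α / 2)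
  eq_one : α = 1 → Tendsto σ (𝓝[>] 0) (𝓝[>] 0) ∧
    ∀ᶠ h in 𝓝[>] (0 : ℝ), h = σ h ^ 2 * |Real.log (σ h)|

/-- The functions `u_h(·,nh)` of the threshold scheme with initial set `Ω₀`. -/
def scheme {N : ℕ} (α : ℝ) (σ : ℝ → ℝ) (Ω₀ : Set (Space N)) (h : ℝ) : ℕ → Space N → ℝ
  | 0 => fun x => Ω₀.indicator 1 x - (closure Ω₀)ᶜ.indicator 1 x
  | n + 1 => fun x =>
      signLower (∫ y, kernel α (x - y) (σ h) * scheme α σ Ω₀ h n y)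

/-- The triples `(h, y, n)` with `h → 0⁺`, `y → x` and `n h → t`. -/
def relaxedFilter {N : ℕ} (z : Space N × ℝ) : Filter (ℝ × Space N × ℕ) :=
  comap (fun q => q.1) (𝓝[>] 0) ⊓ comap (fun q => (q.2.1, (q.2.2 : ℝ) * q.1)) (𝓝 z)

/-- The half-relaxed upper limit `limsup^* u_h`, where `U h n y = u_h(y,nh)`. -/
def upperRelaxed {N : ℕ} (U : ℝ → ℕ → Space N → ℝ) (z : Space N × ℝ) : ℝ :=
  limsup (fun q : ℝ × Space N × ℕ => U q.1 q.2.2 q.2.1) (relaxedFilter z)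

/-- The half-relaxed lower limit `liminf_* u_h`, where `U h n y = u_h(y,nh)`. -/
def lowerRelaxed {N : ℕ} (U : ℝ → ℕ → Space N → ℝ) (z : Space N × ℝ) : ℝ :=
  liminf (fun q : ℝ × Space N × ℕ => U q.1 q.2.2 q.2.1) (relaxedFilter z)

/-! ### The constants `C_α`, in dimension `N = d + 1` -/

/-- The point `(0, y')` of `ℝ × ℝ^{N-1}`. -/
def zeroCons {d : ℕ} (y' : Space d) : Space (d + 1) :=
  WithLp.toLp 2 (Fin.cons 0 (fun i => y' i))

/-- The constant `C_{N,α}` with `lim_{t → 0} p_α(x,t) / t = C_{N,α} |x|^{-(N+α)}`,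
read off at a unit vector. -/
def tailConst (d : ℕ) (α : ℝ) : ℝ :=
  limUnder (𝓝[>] (0 : ℝ))
    (fun t => t⁻¹ * kernel α (EuclideanSpace.single (0 : Fin (d + 1)) (1 : ℝ)) t)

/-- `2 ∫_{ℝ^{N-1}} P_α(0,y') dy'`. -/
def hyperplaneMass (d : ℕ) (α : ℝ) : ℝ := 2 * ∫ y' : Space d, profile α (zeroCons y')

/-- The constant `C_α` for `α < 1`. -/
def nonlocalConst (d : ℕ) (α : ℝ) : ℝ := (hyperplaneMass d α)⁻¹ * tailConst d α

/-- The constant `C_α` for `α ≥ 1`. For `1 < α` it is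
`(2 ∫ P_α(0,y') dy')⁻¹ ∫ y₂² P_α(0,y') dy'`; for `α = 1` it is
`(2 ∫ P_1(0,y') dy')⁻¹ (ω_{N-1} / (N-1)) lim_{R → ∞} R^{N+1} P_1(0,R)`, with `ω_{N-1}` the area of
the unit sphere of `ℝ^{N-1}`. The index `1 : Fin (d + 1)` is the second coordinate. (For `N = 1`
the curvature term vanishes identically, so that the value is irrelevant.) -/
def curvatureConst (d : ℕ) (α : ℝ) : ℝ :=
  (hyperplaneMass d α)⁻¹ *
    if α = 1 then
      (volume : Measure (Space d)).toSphere.real univ / (d : ℝ) *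
        limUnder atTop (fun R : ℝ =>
          R ^ (d + 2) * profile 1 (EuclideanSpace.single (1 : Fin (d + 1)) R))
    else
      ∫ y' : Space d, (zeroCons y' 1) ^ 2 * profile α (zeroCons y')

/-! ### Viscosity sub- and supersolutions -/

/-- `ℝ^N × (0,∞)`. -/
def spaceTime (N : ℕ) : Set (Space N × ℝ) := univ ×ˢ Ioi 0

/-- `φ_t`. -/
def timeDeriv {N : ℕ} (φ : Space N × ℝ → ℝ) (z : Space N × ℝ) : ℝ :=
  deriv (fun s => φ (z.1, s)) z.2

/-- The spatial gradient `Dφ`. -/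
def grad {N : ℕ} (φ : Space N × ℝ → ℝ) (z : Space N × ℝ) : Space N :=
  gradient (fun y => φ (y, z.2)) z.1

/-- The spatial Hessian `D²φ`. -/
def hess {N : ℕ} (φ : Space N × ℝ → ℝ) (z : Space N × ℝ) : Matrix (Fin N) (Fin N) ℝ :=
  Matrix.of fun i j => fderiv ℝ (fderiv ℝ (fun y => φ (y, z.2))) z.1
    (EuclideanSpace.single i 1) (EuclideanSpace.single j 1)

/-- `tr ((I - p̂ ⊗ p̂) X)` with `p̂ = p / |p|`. -/
def curvatureTerm {N : ℕ} (p : Space N) (X : Matrix (Fin N) (Fin N) ℝ) : ℝ :=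
  Matrix.trace
    ((1 - Matrix.vecMulVec (fun i => (‖p‖⁻¹ • p) i) (fun i => (‖p‖⁻¹ • p) i)) * X)

/-- Viscosity subsolution of `u_t - C tr ((I - D̂u ⊗ D̂u) D²u) = 0` in `ℝ^N × (0,∞)`. -/
structure IsCurvatureSubsolution {N : ℕ} (C : ℝ) (u : Space N × ℝ → ℝ) : Prop where
  usc : UpperSemicontinuousOn u (spaceTime N)
  test : ∀ φ : Space N × ℝ → ℝ, ContDiffOn ℝ 2 φ (spaceTime N) →
    ∀ z ∈ spaceTime N, IsMaxOn (fun w => u w - φ w) (spaceTime N) z →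
      (grad φ z ≠ 0 → timeDeriv φ z ≤ C * curvatureTerm (grad φ z) (hess φ z)) ∧
      (grad φ z = 0 → hess φ z = 0 → timeDeriv φ z ≤ 0)

/-- Viscosity supersolution of `u_t - C tr ((I - D̂u ⊗ D̂u) D²u) = 0` in `ℝ^N × (0,∞)`. -/
structure IsCurvatureSupersolution {N : ℕ} (C : ℝ) (u : Space N × ℝ → ℝ) : Prop where
  lsc : LowerSemicontinuousOn u (spaceTime N)
  test : ∀ φ : Space N × ℝ → ℝ, ContDiffOn ℝ 2 φ (spaceTime N) →
    ∀ z ∈ spaceTime N, IsMinOn (fun w => u w - φ w) (spaceTime N) z →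
      (grad φ z ≠ 0 → C * curvatureTerm (grad φ z) (hess φ z) ≤ timeDeriv φ z) ∧
      (grad φ z = 0 → hess φ z = 0 → 0 ≤ timeDeriv φ z)

/-- `∫_A s(v(x+y,t) - v(x,t)) |y|^{-(N+α)} dy` at `z = (x,t)`, in polar coordinates `y = r ω`. Near
the origin the integral converges only thanks to the cancellations on spheres, so the spherical
integral is taken first. -/
def nonlocalTerm {N : ℕ} (s : ℝ → ℝ) (α : ℝ) (A : Set (Space N)) (v : Space N × ℝ → ℝ)
    (z : Space N × ℝ) : ℝ :=
  ∫ r in Ioi (0 : ℝ), r ^ (-(1 + α)) *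
    ∫ ω : Metric.sphere (0 : Space N) 1,
      A.indicator (fun y => s (v (z.1 + y, z.2) - v z)) (r • (ω : Space N))
      ∂(volume : Measure (Space N)).toSphere

/-- Local boundedness in `ℝ^N × (0,∞)`. -/
def LocallyBounded {N : ℕ} (u : Space N × ℝ → ℝ) : Prop :=
  ∀ z ∈ spaceTime N, ∃ M : ℝ, ∀ᶠ w in 𝓝[spaceTime N] z, |u w| ≤ M

/-- Viscosity subsolution of the nonlocal equation
`u_t - C |Du| ∫ (1^+ - 1^-)(u(x+y,t) - u(x,t)) |y|^{-(N+α)} dy = 0` in `ℝ^N × (0,∞)`. -/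
structure IsNonlocalSubsolution {N : ℕ} (α C : ℝ) (u : Space N × ℝ → ℝ) : Prop where
  bounded : LocallyBounded u
  usc : UpperSemicontinuousOn u (spaceTime N)
  test : ∀ φ : Space N × ℝ → ℝ, ContDiffOn ℝ 2 φ (spaceTime N) →
    ∀ z ∈ spaceTime N, IsMaxOn (fun w => u w - φ w) (spaceTime N) z → ∀ δ : ℝ, 0 < δ →
      timeDeriv φ z ≤ C * ‖grad φ z‖ *
        (nonlocalTerm signUpper α (Metric.ball 0 δ) φ z +
          nonlocalTerm signUpper α (Metric.ball 0 δ)ᶜ u z)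

/-- Viscosity supersolution of the nonlocal equation
`u_t - C |Du| ∫ (1^+ - 1^-)(u(x+y,t) - u(x,t)) |y|^{-(N+α)} dy = 0` in `ℝ^N × (0,∞)`; the strict
superlevel sets are used here. -/
structure IsNonlocalSupersolution {N : ℕ} (α C : ℝ) (u : Space N × ℝ → ℝ) : Prop where
  bounded : LocallyBounded u
  lsc : LowerSemicontinuousOn u (spaceTime N)
  test : ∀ φ : Space N × ℝ → ℝ, ContDiffOn ℝ 2 φ (spaceTime N) →
    ∀ z ∈ spaceTime N, IsMinOn (fun w => u w - φ w) (spaceTime N) z → ∀ δ : ℝ, 0 < δ →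
      C * ‖grad φ z‖ *
        (nonlocalTerm signLower α (Metric.ball 0 δ) φ z +
          nonlocalTerm signLower α (Metric.ball 0 δ)ᶜ u z) ≤ timeDeriv φ z

end Threshold

end

open MeasureTheory Filter Topology Set

noncomputable section

namespace Threshold

/-! ### The symbol -/

/-! Both limits are governed by one property (`IsFlow`): the functions take values `±1` after the
first step, and the value one at `x` forces the kernel average of the preceding function at `x` to
be nonnegative. The scheme and its negative both have it, and the lower limit is the negative of the
upper limit of the negated scheme. So only the subsolution inequalities have to be proved.

At positive times the upper limit is `1` on a closed set (`contactSet`) and `-1` elsewhere. Where it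
is `-1`, a touching test function `φ` has a minimum and its first derivatives vanish. At a contact
point `z₀` the contact set lies in `{φ ≥ φ z₀}`. If `Dφ ≠ 0`, this set lies locally above a
parabolic graph, and an arbitrarily small change of coefficients makes the separation strict. Almost
minimizing the graph function over the discrete points with value one (`IsFlow.exists_contact`)
produces points `(x, (n+1)h)` tending to `z₀` with value one, such that near `x` the points with
value one at time `nh` lie above a graph displaced by about `a h`, where `a = φ_t / |Dφ|`. The
kernel average at `x` is then at most that of the sign of the graph, up to a tail.

In units of the length `r` with `r^α = σ(h)`, evenness of the profile `P` turns the average of this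
sign into minus its mass in a thin slab of half-thickness `(h/r) a - r B(z',z')/2`
(`integral_mul_signUpper_eq_neg_slab`). The scaling makes `h/r` (`rate`) match the second effect.
For `α > 1` the second moment of `P` on the hyperplane is finite and both terms are of order `r`.
For `α = 1` it diverges logarithmically, only the tail of `P` counts, and the order is `r |log r|`.
For `α < 1` the curvature inside a ball of radius `ρ` costs `O(r^α ρ^(1-α))`, which disappears as `ρ
→ 0`, while the mass outside, also of order `r^α`, sees the limit function and produces the nonlocal
integral. The cancellation of the sign on small spheres makes this integral meaningful at the
origin.

If `Dφ = 0` (and `D²φ = 0` when `α ≥ 1`), a positive `φ_t` would confine the value one locally to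
the exterior of a large ball whose centre may be far away. Averaging over `z` and `-z` shows that
the kernel average is then negative (`exists_integral_profile_mul_neg`), a contradiction.

What is needed about `P` is positivity, continuity and the limit of `|x|^(N+α) P(x)`. These come
from subordination: `exp (-t q^(α/2))` is a limit of Laplace transforms, so linear inequalities
between a Gaussian and exponentials pass to the stable kernel (`kernel_add_sum_nonneg`). Combined
with the Weierstrass theorem this gives the tail (`exists_tendsto_kernel_div`). -/

theorem integrableOn_min_rpow_mul_rpow {K M j γ : ℝ} (hK : 0 ≤ K) (hM : 0 ≤ M) (hγ : 0 < γ)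
    (hj : γ < j) :
    IntegrableOn (fun s : ℝ => min (K * s ^ j) M * s ^ (-1 - γ)) (Ioi 0) := by
  rw [← Ioc_union_Ioi_eq_Ioi zero_le_one]
  have hmeas : Measurable (fun s : ℝ => min (K * s ^ j) M * s ^ (-1 - γ)) := by fun_prop
  refine IntegrableOn.union ?_ ?_
  · have h1 : IntegrableOn (fun s : ℝ => K * s ^ (j - 1 - γ)) (Ioc 0 1) := by
      have := (intervalIntegral.intervalIntegrable_rpow' (a := 0) (b := 1)
        (show -1 < j - 1 - γ by linarith)).const_mul K
      rwa [intervalIntegrable_iff_integrableOn_Ioc_of_le zero_le_one] at this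
    refine Integrable.mono' h1 hmeas.aestronglyMeasurable ?_
    filter_upwards [ae_restrict_mem measurableSet_Ioc] with s hs
    have hs0 : 0 < s := hs.1
    rw [Real.norm_of_nonneg (by positivity)]
    calc min (K * s ^ j) M * s ^ (-1 - γ) ≤ K * s ^ j * s ^ (-1 - γ) := by
          gcongr; exact min_le_left _ _
      _ = K * s ^ (j - 1 - γ) := by
          rw [mul_assoc, ← Real.rpow_add hs0]; ring_nf
  · have h1 : IntegrableOn (fun s : ℝ => M * s ^ (-1 - γ)) (Ioi 1) :=
      (integrableOn_Ioi_rpow_of_lt (by linarith) one_pos).const_mul M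
    refine Integrable.mono' h1 hmeas.aestronglyMeasurable ?_
    filter_upwards [ae_restrict_mem measurableSet_Ioi] with s hs
    have hs0 : 0 < s := zero_lt_one.trans hs
    rw [Real.norm_of_nonneg (by positivity)]
    gcongr; exact min_le_right _ _

variable {d : ℕ} {α : ℝ}

/-- The factor `1 - cos` is quadratic at the origin and bounded at infinity, which is what `0 < α <
2` requires of it. -/
theorem symbol_integrable (hα₀ : 0 < α) (hα₂ : α < 2) (ξ : Space (d + 1)) :
    Integrable (fun y : Space (d + 1) =>
      (1 - Real.cos (inner ℝ ξ y)) * ‖y‖ ^ (-(((d + 1 : ℕ) : ℝ) + α))) := by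
  have h1 : Integrable (fun y : Space (d + 1) =>
      min (‖ξ‖ ^ 2 / 2 * ‖y‖ ^ (2 : ℝ)) 2 * ‖y‖ ^ (-(((d + 1 : ℕ) : ℝ) + α))) := by
    rw [integrable_fun_norm_addHaar volume
      (f := fun s : ℝ => min (‖ξ‖ ^ 2 / 2 * s ^ (2 : ℝ)) 2 * s ^ (-(((d + 1 : ℕ) : ℝ) + α)))]
    refine (integrableOn_min_rpow_mul_rpow (K := ‖ξ‖ ^ 2 / 2) (M := 2) (by positivity)
      zero_le_two hα₀ hα₂).congr_fun (fun s hs => ?_) measurableSet_Ioi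
    have hs0 : 0 < s := hs
    simp only [finrank_euclideanSpace, Fintype.card_fin, smul_eq_mul, Nat.add_sub_cancel]
    rw [← Real.rpow_natCast s d, mul_left_comm, ← Real.rpow_add hs0]
    congr 2
    push_cast; ring
  refine h1.mono' (by fun_prop) (Eventually.of_forall fun y => ?_)
  have hc := Real.cos_le_one (inner ℝ ξ y)
  rw [Real.norm_of_nonneg (mul_nonneg (by linarith) (by positivity))]
  gcongr
  refine le_min ?_ (by linarith [Real.neg_one_le_cos (inner ℝ ξ y)])
  have h2 := Real.one_sub_sq_div_two_le_cos (x := inner ℝ ξ y)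
  have h3 : (inner ℝ ξ y) ^ 2 ≤ (‖ξ‖ * ‖y‖) ^ 2 := by
    rw [← sq_abs]; gcongr; exact abs_real_inner_le_norm ξ y
  rw [Real.rpow_two]
  nlinarith

theorem symbol_map_isometry (O : Space d ≃ₗᵢ[ℝ] Space d) (ξ : Space d) :
    symbol α (O ξ) = symbol α ξ := by
  unfold symbol
  rw [← O.measurePreserving.integral_comp O.toHomeomorph.measurableEmbedding]
  simp

/-- All radial symmetry below is used through this transitivity of the orthogonal group on spheres.
-/
theorem exists_isometry_map {x y : Space d} (h : ‖x‖ = ‖y‖) :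
    ∃ O : Space d ≃ₗᵢ[ℝ] Space d, O x = y :=
  ⟨Submodule.reflection (ℝ ∙ (x - y))ᗮ, Submodule.reflection_sub h⟩

theorem symbol_smul {c : ℝ} (hc : 0 < c) (ξ : Space d) :
    symbol α (c • ξ) = c ^ α * symbol α ξ := by
  unfold symbol
  have h := Measure.integral_comp_smul (volume : Measure (Space d))
    (fun y : Space d => (1 - Real.cos (inner ℝ ξ y)) * ‖y‖ ^ (-((d : ℝ) + α))) c
  rw [finrank_euclideanSpace, Fintype.card_fin, abs_of_pos (by positivity), smul_eq_mul] at h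
  have h2 : ∀ y : Space d, (1 - Real.cos (inner ℝ (c • ξ) y)) * ‖y‖ ^ (-((d : ℝ) + α)) =
      c ^ ((d : ℝ) + α) *
        ((1 - Real.cos (inner ℝ ξ (c • y))) * ‖c • y‖ ^ (-((d : ℝ) + α))) := by
    intro y
    rw [norm_smul, Real.norm_of_nonneg hc.le, Real.mul_rpow hc.le (norm_nonneg _),
      Real.rpow_neg hc.le, inner_smul_left, inner_smul_right]
    simp only [conj_trivial]
    have : c ^ ((d : ℝ) + α) ≠ 0 := by positivity
    field_simp
  simp_rw [h2]
  rw [integral_const_mul, h, ← mul_assoc, Real.rpow_add hc, Real.rpow_natCast]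
  congr 1
  field_simp

/-- The value of the symbol on unit vectors. -/
def symbolConst (d : ℕ) (α : ℝ) : ℝ := symbol α (EuclideanSpace.single (0 : Fin (d + 1)) (1 : ℝ))

/-- Rotation invariance and homogeneity leave only the value at a unit vector free. -/
theorem symbol_eq (hα₀ : 0 < α) (ξ : Space (d + 1)) :
    symbol α ξ = symbolConst d α * ‖ξ‖ ^ α := by
  rcases eq_or_ne ξ 0 with rfl | hξ
  · simp [symbol, Real.zero_rpow hα₀.ne']
  · obtain ⟨O, hO⟩ := exists_isometry_map (x := ξ)
      (y := ‖ξ‖ • EuclideanSpace.single (0 : Fin (d + 1)) (1 : ℝ)) (by simp [norm_smul])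
    rw [← symbol_map_isometry O, hO, symbol_smul (norm_pos_iff.2 hξ), mul_comm, symbolConst]

theorem symbolConst_pos (hα₀ : 0 < α) (hα₂ : α < 2) : 0 < symbolConst d α := by
  unfold symbolConst symbol
  rw [integral_pos_iff_support_of_nonneg]
  -- On the open slab `0 < y 0 < 1` the integrand is positive, because `cos (y 0) < 1` there.
  · refine lt_of_lt_of_le ?_ (measure_mono (s := {y : Space (d + 1) | y 0 ∈ Ioo (0:ℝ) 1}) ?_)
    · refine IsOpen.measure_pos _ (isOpen_Ioo.preimage (by fun_prop)) ?_
      exact ⟨EuclideanSpace.single 0 (1/2), by simp; norm_num⟩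
    · intro y hy
      have hy0 : y ≠ 0 := by rintro rfl; simp at hy
      have h1 : Real.cos (y 0) < 1 := by
        rw [← Real.cos_zero]
        exact Real.cos_lt_cos_of_nonneg_of_le_pi le_rfl (by linarith [hy.2, Real.pi_gt_three]) hy.1
      have h2 : 0 < ‖y‖ := norm_pos_iff.2 hy0
      simp only [Function.mem_support]
      refine mul_ne_zero ?_ (by positivity)
      simp only [EuclideanSpace.inner_single_left, map_one, one_mul]
      linarith
  · intro y
    have := Real.cos_le_one (inner ℝ (EuclideanSpace.single (0 : Fin (d + 1)) (1 : ℝ)) y)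
    exact mul_nonneg (by linarith) (by positivity)
  · exact symbol_integrable hα₀ hα₂ _

/-! ### Fourier representation, symmetry and scaling of the kernel -/

theorem integrable_exp_neg_mul_norm_rpow (hα₀ : 0 < α) {b : ℝ} (hb : 0 < b) :
    Integrable (fun ξ : Space (d + 1) => Real.exp (-(b * ‖ξ‖ ^ α))) := by
  rw [integrable_fun_norm_addHaar volume (f := fun s : ℝ => Real.exp (-(b * s ^ α)))]
  refine (integrableOn_rpow_mul_exp_neg_mul_rpow (s := d) (p := α) (b := b)
    (by linarith [(Nat.cast_nonneg d : (0:ℝ) ≤ d)]) hα₀ hb).congr_fun (fun s hs => ?_)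
    measurableSet_Ioi
  simp [Real.rpow_natCast]

theorem kernel_eq (hα₀ : 0 < α) (x : Space (d + 1)) (t : ℝ) :
    kernel α x t = ((2 * Real.pi) ^ (d + 1))⁻¹ *
      ∫ ξ : Space (d + 1), Real.cos (inner ℝ x ξ) *
        Real.exp (-(t * symbolConst d α * ‖ξ‖ ^ α)) := by
  simp only [kernel, symbol_eq hα₀, mul_assoc]

theorem kernel_map_isometry (O : Space d ≃ₗᵢ[ℝ] Space d) (x : Space d) (t : ℝ) :
    kernel α (O x) t = kernel α x t := by
  unfold kernel
  rw [← O.measurePreserving.integral_comp O.toHomeomorph.measurableEmbedding]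
  simp [symbol_map_isometry]

theorem profile_map_isometry (O : Space d ≃ₗᵢ[ℝ] Space d) (x : Space d) :
    profile α (O x) = profile α x := kernel_map_isometry O x 1

theorem profile_eq_of_norm_eq {x y : Space d} (h : ‖x‖ = ‖y‖) : profile α x = profile α y := by
  obtain ⟨O, rfl⟩ := exists_isometry_map h
  exact (profile_map_isometry O x).symm

theorem kernel_scaling (hα₀ : 0 < α) {t : ℝ} (ht : 0 < t) (x : Space (d + 1)) :
    kernel α x t = t ^ (-(((d : ℝ) + 1) / α)) * profile α (t ^ (-(1 / α)) • x) := by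
  unfold profile
  rw [kernel_eq hα₀, kernel_eq hα₀]
  set c : ℝ := t ^ (-(1 / α)) with hc
  have hc0 : 0 < c := by positivity
  have hcα : t * c ^ α = 1 := by
    rw [hc, ← Real.rpow_mul ht.le]
    rw [show -(1 / α) * α = -1 by field_simp, Real.rpow_neg_one, mul_inv_cancel₀ ht.ne']
  have h := Measure.integral_comp_smul (volume : Measure (Space (d + 1)))
    (fun ξ => Real.cos (inner ℝ x ξ) * Real.exp (-(t * symbolConst d α * ‖ξ‖ ^ α))) c
  rw [finrank_euclideanSpace, Fintype.card_fin, abs_of_pos (by positivity), smul_eq_mul] at h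
  have hcN : t ^ (-(((d : ℝ) + 1) / α)) = c ^ (d + 1) := by
    rw [hc, ← Real.rpow_natCast, ← Real.rpow_mul ht.le]
    congr 1; push_cast; ring
  have h2 : ∀ ξ : Space (d + 1),
      Real.cos (inner ℝ (c • x) ξ) * Real.exp (-(1 * symbolConst d α * ‖ξ‖ ^ α)) =
      Real.cos (inner ℝ x (c • ξ)) * Real.exp (-(t * symbolConst d α * ‖c • ξ‖ ^ α)) := by
    intro ξ
    rw [norm_smul, Real.norm_of_nonneg hc0.le, Real.mul_rpow hc0.le (norm_nonneg _),
      inner_smul_left, inner_smul_right]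
    simp only [conj_trivial]
    rw [show t * symbolConst d α * (c ^ α * ‖ξ‖ ^ α) = (t * c ^ α) * symbolConst d α * ‖ξ‖ ^ α by
      ring, hcα]
  simp_rw [h2]
  rw [h, hcN]
  field_simp

theorem profile_continuous (hα₀ : 0 < α) (hα₂ : α < 2) :
    Continuous (profile α : Space (d + 1) → ℝ) := by
  unfold profile
  simp only [kernel_eq hα₀]
  refine continuous_const.mul ?_
  refine continuous_of_dominated (bound := fun ξ => Real.exp (-(1 * symbolConst d α * ‖ξ‖ ^ α)))
    (fun x => by fun_prop) (fun x => Eventually.of_forall fun ξ => ?_)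
    (integrable_exp_neg_mul_norm_rpow hα₀ (by simpa using symbolConst_pos hα₀ hα₂))
    (Eventually.of_forall fun ξ => by fun_prop)
  rw [norm_mul, Real.norm_of_nonneg (Real.exp_nonneg _)]
  exact mul_le_of_le_one_left (Real.exp_nonneg _) (Real.abs_cos_le_one _)

theorem profile_zero_pos (hα₀ : 0 < α) (hα₂ : α < 2) : 0 < profile α (0 : Space (d + 1)) := by
  unfold profile
  rw [kernel_eq hα₀]
  refine mul_pos (by positivity) ?_
  simp only [inner_zero_left, Real.cos_zero, one_mul]
  exact integral_exp_pos (f := fun ξ : Space (d+1) => -(symbolConst d α * ‖ξ‖ ^ α))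
    (integrable_exp_neg_mul_norm_rpow hα₀ (symbolConst_pos hα₀ hα₂))

/-! ### Subordination: mixtures of Gaussians -/

/-- `f` is the Laplace transform of a finite measure on `[0,∞)`. -/
def IsLaplace (f : ℝ → ℝ) : Prop :=
  ∃ μ : Measure ℝ, IsFiniteMeasure μ ∧ (∀ᵐ s ∂μ, 0 ≤ s) ∧
    ∀ q, 0 ≤ q → f q = ∫ s, Real.exp (-(s * q)) ∂μ

theorem integrable_exp_neg_mul {μ : Measure ℝ} [IsFiniteMeasure μ] (hμ : ∀ᵐ s ∂μ, 0 ≤ s)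
    {q : ℝ} (hq : 0 ≤ q) : Integrable (fun s => Real.exp (-(s * q))) μ := by
  refine (integrable_const (1 : ℝ)).mono' (by fun_prop) ?_
  filter_upwards [hμ] with s hs
  rw [Real.norm_of_nonneg (Real.exp_nonneg _), Real.exp_le_one_iff]
  have := mul_nonneg hs hq
  linarith

/-- A product of transforms is the transform of the convolution, that is, of the image of the
product measure under addition. -/
theorem IsLaplace.mul {f g : ℝ → ℝ} (hf : IsLaplace f) (hg : IsLaplace g) :
    IsLaplace (fun q => f q * g q) := by
  obtain ⟨μ, hμ, hμ0, hfμ⟩ := hf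
  obtain ⟨ν, hν, hν0, hgν⟩ := hg
  have hm : Measurable (fun p : ℝ × ℝ => p.1 + p.2) := by fun_prop
  refine ⟨(μ.prod ν).map (fun p => p.1 + p.2), inferInstance, ?_, fun q hq => ?_⟩
  · rw [ae_map_iff hm.aemeasurable measurableSet_Ici]
    have h1 := Measure.quasiMeasurePreserving_fst (μ := μ) (ν := ν) |>.ae hμ0
    have h2 := Measure.quasiMeasurePreserving_snd (μ := μ) (ν := ν) |>.ae hν0
    filter_upwards [h1, h2] with p hp1 hp2 using add_nonneg hp1 hp2
  · simp only
    rw [integral_map hm.aemeasurable (by fun_prop), hfμ q hq, hgν q hq, ← integral_prod_mul]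
    congr 1; ext p; rw [← Real.exp_add]; ring_nf

theorem isLaplace_one : IsLaplace (fun _ => 1) :=
  ⟨Measure.dirac 0, inferInstance, by simp [ae_dirac_eq], fun q _ => by simp⟩

theorem IsLaplace.pow {f : ℝ → ℝ} (hf : IsLaplace f) (n : ℕ) : IsLaplace (fun q => f q ^ n) := by
  induction n with
  | zero => simpa using isLaplace_one
  | succ n ih => simpa [pow_succ] using ih.mul hf

theorem isLaplace_integral_Ioi {β ε b : ℝ} (hβ : 0 < β) (hε : 0 < ε) (hb : 0 ≤ b) :
    IsLaplace (fun q => ∫ s in Ioi ε, Real.exp (-(s * q)) * (b * s ^ (-1 - β))) := by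
  have hinteg : IntegrableOn (fun s : ℝ => b * s ^ (-1 - β)) (Ioi ε) :=
    (integrableOn_Ioi_rpow_of_lt (by linarith) hε).const_mul b
  have hpos : ∀ᵐ s ∂volume.restrict (Ioi ε), 0 ≤ b * s ^ (-1 - β) := by
    filter_upwards [ae_restrict_mem measurableSet_Ioi] with s hs
    have : 0 < s := hε.trans hs
    positivity
  refine ⟨(volume.restrict (Ioi ε)).withDensity (fun s => ENNReal.ofReal (b * s ^ (-1 - β))),
    isFiniteMeasure_withDensity_ofReal hinteg.2, ?_, fun q _ => ?_⟩
  · refine (withDensity_absolutelyContinuous _ _).ae_le ?_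
    filter_upwards [ae_restrict_mem measurableSet_Ioi] with s hs using (hε.trans hs).le
  · rw [integral_withDensity_eq_integral_toReal_smul (by fun_prop) (by simp)]
    refine integral_congr_ae ?_
    filter_upwards [hpos] with s hs
    rw [ENNReal.toReal_ofReal hs, smul_eq_mul, mul_comm]

theorem integrableOn_one_sub_exp_mul_rpow {β q : ℝ} (hβ : 0 < β) (hβ1 : β < 1) (hq : 0 ≤ q) :
    IntegrableOn (fun s : ℝ => (1 - Real.exp (-(s * q))) * s ^ (-1 - β)) (Ioi 0) := by
  refine Integrable.mono' (integrableOn_min_rpow_mul_rpow (K := q) (M := 1) (j := 1) hq zero_le_one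
    hβ hβ1) (by fun_prop) ?_
  filter_upwards [ae_restrict_mem measurableSet_Ioi] with s hs
  have hs0 : 0 < s := hs
  have h1 : Real.exp (-(s * q)) ≤ 1 := Real.exp_le_one_iff.2 (by nlinarith)
  rw [Real.norm_of_nonneg (mul_nonneg (by linarith) (by positivity))]
  gcongr
  refine le_min ?_ (by linarith [Real.exp_nonneg (-(s * q))])
  rw [Real.rpow_one]
  linarith [Real.add_one_le_exp (-(s * q))]

/-- Substitution `s ↦ q s`. This represents `q ^ β`, up to a constant, by the Lévy measure `s ^ (-1
- β) ds`. -/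
theorem integral_one_sub_exp_mul_rpow {β q : ℝ} (hβ : 0 < β) (hq : 0 ≤ q) :
    ∫ s in Ioi (0:ℝ), (1 - Real.exp (-(s * q))) * s ^ (-1 - β) =
      q ^ β * ∫ s in Ioi (0:ℝ), (1 - Real.exp (-s)) * s ^ (-1 - β) := by
  rcases hq.eq_or_lt with rfl | hq
  · simp [Real.zero_rpow hβ.ne']
  · have h := integral_comp_mul_left_Ioi
      (fun s : ℝ => (1 - Real.exp (-s)) * s ^ (-1 - β)) 0 hq
    rw [mul_zero, smul_eq_mul] at h
    rw [← mul_inv_cancel_left₀ hq.ne' (∫ s in Ioi (0:ℝ), (1 - Real.exp (-s)) * s ^ (-1 - β)), ← h,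
      ← mul_assoc, ← integral_const_mul]
    refine setIntegral_congr_fun measurableSet_Ioi fun s hs => ?_
    have hs0 : 0 < s := hs
    rw [Real.mul_rpow hq.le hs0.le, show -1 - β = -(β + 1) by ring, Real.rpow_neg hq.le,
      Real.rpow_add hq, Real.rpow_one, mul_comm q s]
    have : q ^ β ≠ 0 := by positivity
    field_simp

theorem integral_one_sub_exp_mul_rpow_pos {β : ℝ} (hβ : 0 < β) (hβ1 : β < 1) :
    0 < ∫ s in Ioi (0:ℝ), (1 - Real.exp (-s)) * s ^ (-1 - β) := by
  have hi := integrableOn_one_sub_exp_mul_rpow hβ hβ1 zero_le_one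
  simp only [mul_one] at hi
  rw [setIntegral_pos_iff_support_of_nonneg_ae ?_ hi]
  · rw [inter_eq_self_of_subset_right]
    · simp
    · intro s hs
      have hs0 : 0 < s := hs
      have : Real.exp (-s) < 1 := Real.exp_lt_one_iff.2 (by linarith)
      exact mul_ne_zero (by linarith) (by positivity)
  · filter_upwards [ae_restrict_mem measurableSet_Ioi] with s hs
    have hs0 : 0 < s := hs
    have : Real.exp (-s) < 1 := Real.exp_lt_one_iff.2 (by linarith)
    exact mul_nonneg (by linarith) (by positivity)

theorem IsLaplace.abs_le_zero {f : ℝ → ℝ} (hf : IsLaplace f) {q : ℝ} (hq : 0 ≤ q) :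
    |f q| ≤ f 0 := by
  obtain ⟨μ, hμ, hμ0, h⟩ := hf
  rw [h q hq, h 0 le_rfl, abs_of_nonneg (integral_nonneg fun s => Real.exp_nonneg _)]
  refine integral_mono_ae (integrable_exp_neg_mul hμ0 hq) (integrable_exp_neg_mul hμ0 le_rfl) ?_
  filter_upwards [hμ0] with s hs
  have := mul_nonneg hs hq
  simp only [Real.exp_le_exp]; linarith

/-- `exp (-t q^β)` is a limit of Laplace transforms of probability measures on `[0,∞)`. -/
theorem exists_isLaplace_tendsto {β t : ℝ} (hβ : 0 < β) (hβ1 : β < 1) (ht : 0 < t) :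
    ∃ f : ℕ → ℝ → ℝ, (∀ n, IsLaplace (f n)) ∧ (∀ n, f n 0 = 1) ∧
      ∀ q, 0 ≤ q → Tendsto (fun n => f n q) atTop (𝓝 (Real.exp (-(t * q ^ β)))) := by
  set Λ := ∫ s in Ioi (0:ℝ), (1 - Real.exp (-s)) * s ^ (-1 - β) with hΛ
  have hΛ0 : 0 < Λ := integral_one_sub_exp_mul_rpow_pos hβ hβ1
  set T := t / Λ with hT
  have hT0 : 0 < T := by positivity
  -- The cutoff is chosen so that `T / (n + 1) * s ^ (-1 - β)` has mass one on `(ε n, ∞)`. The `(n +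
  -- 1)`-fold convolution power of this probability measure approximates the stable subordinator.
  set ε : ℕ → ℝ := fun n => (T / (β * (n + 1))) ^ (1 / β) with hε
  have hε0 : ∀ n, 0 < ε n := fun n => by positivity
  have hεlim : Tendsto ε atTop (𝓝 0) := by
    have h1 : Tendsto (fun n : ℕ => T / (β * (n + 1))) atTop (𝓝 0) := by
      refine Tendsto.div_atTop tendsto_const_nhds (Tendsto.const_mul_atTop hβ ?_)
      exact tendsto_atTop_add_const_right _ _ tendsto_natCast_atTop_atTop
    have h2 := h1.rpow_const (p := 1 / β) (Or.inr (by positivity))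
    rwa [Real.zero_rpow (by positivity)] at h2
  set g : ℕ → ℝ → ℝ := fun n q =>
    ∫ s in Ioi (ε n), Real.exp (-(s * q)) * (T / (n + 1) * s ^ (-1 - β)) with hg
  have hmass : ∀ n, ∫ s in Ioi (ε n), T / ((n : ℝ) + 1) * s ^ (-1 - β) = 1 := by
    intro n
    rw [integral_const_mul, integral_Ioi_rpow_of_lt (by linarith) (hε0 n)]
    have : ε n ^ (-1 - β + 1) = (T / (β * (n + 1)))⁻¹ := by
      rw [hε]
      simp only
      rw [← Real.rpow_mul (by positivity), ← Real.rpow_neg_one]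
      congr 1; field_simp; ring
    rw [this]
    have : (-1 - β + 1) = -β := by ring
    rw [this]
    field_simp
  have hgeq : ∀ n q, 0 ≤ q → g n q = 1 + -(T / (n + 1) *
      ∫ s in Ioi (ε n), (1 - Real.exp (-(s * q))) * s ^ (-1 - β)) := by
    intro n q hq
    have hsub : IntegrableOn (fun s : ℝ => (1 - Real.exp (-(s * q))) * s ^ (-1 - β)) (Ioi (ε n)) :=
      (integrableOn_one_sub_exp_mul_rpow hβ hβ1 hq).mono_set (Ioi_subset_Ioi (hε0 n).le)
    have hinteg : IntegrableOn (fun s : ℝ => T / ((n : ℝ) + 1) * s ^ (-1 - β)) (Ioi (ε n)) :=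
      (integrableOn_Ioi_rpow_of_lt (by linarith) (hε0 n)).const_mul _
    rw [← sub_eq_add_neg, ← integral_const_mul]
    nth_rw 1 [← hmass n]
    rw [← integral_sub hinteg (hsub.const_mul _)]
    refine setIntegral_congr_fun measurableSet_Ioi fun s hs => ?_
    ring
  have hlim : ∀ q, 0 ≤ q → Tendsto (fun n => ∫ s in Ioi (ε n),
      (1 - Real.exp (-(s * q))) * s ^ (-1 - β)) atTop (𝓝 (q ^ β * Λ)) := by
    intro q hq
    rw [hΛ, ← integral_one_sub_exp_mul_rpow hβ hq]
    have hI := integrableOn_one_sub_exp_mul_rpow hβ hβ1 hq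
    have : ∀ n, ∫ s in Ioi (ε n), (1 - Real.exp (-(s * q))) * s ^ (-1 - β) =
        ∫ s in Ioi 0, (Ioi (ε n)).indicator
          (fun s => (1 - Real.exp (-(s * q))) * s ^ (-1 - β)) s := by
      intro n
      rw [setIntegral_indicator measurableSet_Ioi, inter_eq_self_of_subset_right
        (Ioi_subset_Ioi (hε0 n).le)]
    simp_rw [this]
    refine tendsto_integral_of_dominated_convergence
      (fun s => ‖(1 - Real.exp (-(s * q))) * s ^ (-1 - β)‖)
      (fun n => hI.aestronglyMeasurable.indicator measurableSet_Ioi) hI.norm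
      (fun n => Eventually.of_forall fun s => norm_indicator_le_norm_self _ _) ?_
    filter_upwards [ae_restrict_mem measurableSet_Ioi] with s hs
    refine tendsto_const_nhds.congr' ?_
    filter_upwards [hεlim.eventually_lt_const hs] with n hn
    rw [indicator_of_mem (mem_Ioi.2 hn)]
  refine ⟨fun n q => g n q ^ (n + 1), fun n => ?_, fun n => ?_, fun q hq => ?_⟩
  · exact (isLaplace_integral_Ioi hβ (hε0 n) (by positivity)).pow _
  · have : g n 0 = 1 := by
      rw [hgeq n 0 le_rfl]; simp
    simp [this]
  -- The index is shifted so that the exponent and the denominator are both `n`, as in `(1 + x / n)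
  -- ^ n → exp x`; it is shifted back afterwards.
  · have key : Tendsto (fun n : ℕ => (1 + -(T / n * ∫ s in Ioi (ε (n - 1)),
        (1 - Real.exp (-(s * q))) * s ^ (-1 - β))) ^ n) atTop (𝓝 (Real.exp (-(t * q ^ β)))) := by
      refine Real.tendsto_one_add_pow_exp_of_tendsto ?_
      have h1 := ((hlim q hq).comp (tendsto_sub_atTop_nat 1)).const_mul (-T)
      rw [show -T * (q ^ β * Λ) = -(t * q ^ β) by rw [hT]; field_simp] at h1
      refine h1.congr' ?_
      filter_upwards [eventually_gt_atTop 0] with n hn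
      have : (n : ℝ) ≠ 0 := by positivity
      simp only [Function.comp]
      rw [mul_neg, ← mul_assoc, mul_div_cancel₀ _ this, neg_mul]
    have := (tendsto_add_atTop_iff_nat 1).2 key
    refine this.congr fun n => ?_
    simp only [hgeq n q hq, Nat.add_sub_cancel, Nat.cast_add, Nat.cast_one]

/-- The Gaussian heat kernel. -/
def gauss (x : Space (d + 1)) (s : ℝ) : ℝ :=
  (4 * Real.pi * s) ^ (-(((d : ℝ) + 1) / 2)) * Real.exp (-(‖x‖ ^ 2 / (4 * s)))

theorem gauss_fourier (x : Space (d + 1)) {s : ℝ} (hs : 0 < s) :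
    ((2 * Real.pi) ^ (d + 1))⁻¹ *
      ∫ ξ : Space (d + 1), Real.cos (inner ℝ x ξ) * Real.exp (-(s * ‖ξ‖ ^ 2)) = gauss x s := by
  have hs' : 0 < (s : ℂ).re := by simpa using hs
  have h := GaussianFourier.integral_cexp_neg_mul_sq_norm_add_of_euclideanSpace hs' Complex.I x
  have hi := GaussianFourier.integrable_cexp_neg_mul_sq_norm_add_of_euclideanSpace hs' Complex.I x
  have hre : ∫ ξ : Space (d + 1), Real.cos (inner ℝ x ξ) * Real.exp (-(s * ‖ξ‖ ^ 2)) =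
      (∫ v : Space (d + 1), Complex.exp (-(s : ℂ) * ‖v‖ ^ 2 +
        Complex.I * ((inner ℝ x v : ℝ) : ℂ))).re := by
    rw [← RCLike.re_eq_complex_re, ← integral_re hi]
    congr 1; ext ξ
    have e : -(s : ℂ) * ‖ξ‖ ^ 2 + Complex.I * ((inner ℝ x ξ : ℝ) : ℂ) =
        ((-(s * ‖ξ‖ ^ 2) : ℝ) : ℂ) + ((inner ℝ x ξ : ℝ) : ℂ) * Complex.I := by
      push_cast; ring
    rw [RCLike.re_eq_complex_re, e, Complex.exp_re]
    simp only [Complex.add_re, Complex.add_im, Complex.ofReal_re, Complex.ofReal_im,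
      Complex.re_ofReal_mul, Complex.im_ofReal_mul, Complex.I_re, Complex.I_im]
    simp [mul_comm]
  have hval : ((Real.pi : ℂ) / s) ^ ((Fintype.card (Fin (d + 1)) : ℂ) / 2) *
      Complex.exp (Complex.I ^ 2 * ‖x‖ ^ 2 / (4 * s)) =
      (((Real.pi / s) ^ (((d : ℝ) + 1) / 2) * Real.exp (-(‖x‖ ^ 2 / (4 * s))) : ℝ) : ℂ) := by
    push_cast
    rw [Complex.ofReal_cpow (by positivity)]
    push_cast
    simp only [Complex.I_sq, Fintype.card_fin]
    push_cast
    congr 2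
    ring
  rw [hre, h, hval, Complex.ofReal_re, gauss, ← mul_assoc]
  congr 1
  have h2 : ((2 * Real.pi) ^ (d + 1))⁻¹ = ((2 * Real.pi) ^ (2 : ℝ)) ^ (-(((d : ℝ) + 1) / 2)) := by
    rw [← Real.rpow_mul (by positivity), ← Real.rpow_natCast, ← Real.rpow_neg (by positivity)]
    congr 1; push_cast; ring
  have h3 : (Real.pi / s) ^ (((d : ℝ) + 1) / 2) = (s / Real.pi) ^ (-(((d : ℝ) + 1) / 2)) := by
    rw [Real.rpow_neg (by positivity), ← Real.inv_rpow (by positivity), inv_div]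
  rw [h2, h3, ← Real.mul_rpow (by positivity) (by positivity)]
  congr 1
  rw [Real.rpow_two]
  field_simp
  ring

theorem integrable_exp_neg_mul_norm_sq {η : ℝ} (hη : 0 < η) :
    Integrable (fun ξ : Space (d + 1) => Real.exp (-(η * ‖ξ‖ ^ 2))) := by
  simpa using integrable_exp_neg_mul_norm_rpow (d := d) (α := 2) two_pos hη

/-- The shift `η > 0` is what allows Fubini: `μ` may charge `s = 0`, and `exp (-η ‖ξ‖²)` is an
integrable majorant for every `s ≥ 0`. -/
theorem integral_gauss_eq {μ : Measure ℝ} [IsFiniteMeasure μ] (hμ : ∀ᵐ s ∂μ, 0 ≤ s)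
    {η : ℝ} (hη : 0 < η) (x : Space (d + 1)) :
    Integrable (fun s => gauss x (s + η)) μ ∧
    ∫ s, gauss x (s + η) ∂μ = ((2 * Real.pi) ^ (d + 1))⁻¹ *
      ∫ ξ : Space (d + 1), Real.cos (inner ℝ x ξ) * Real.exp (-(η * ‖ξ‖ ^ 2)) *
        ∫ s, Real.exp (-(s * ‖ξ‖ ^ 2)) ∂μ := by
  have hI : Integrable (fun p : ℝ × Space (d + 1) =>
      Real.cos (inner ℝ x p.2) * Real.exp (-((p.1 + η) * ‖p.2‖ ^ 2))) (μ.prod volume) := by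
    refine Integrable.mono' ((integrable_exp_neg_mul_norm_sq hη).comp_snd μ) (by fun_prop) ?_
    filter_upwards [Measure.quasiMeasurePreserving_fst (μ := μ)
      (ν := (volume : Measure (Space (d + 1)))) |>.ae hμ] with p hp
    rw [norm_mul, Real.norm_of_nonneg (Real.exp_nonneg _)]
    refine (mul_le_of_le_one_left (Real.exp_nonneg _) (Real.abs_cos_le_one _)).trans ?_
    rw [Real.exp_le_exp]
    have := mul_nonneg hp (sq_nonneg ‖p.2‖)
    nlinarith
  have heq : (fun s => gauss x (s + η)) =ᵐ[μ] fun s => ((2 * Real.pi) ^ (d + 1))⁻¹ *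
      ∫ ξ : Space (d + 1), Real.cos (inner ℝ x ξ) * Real.exp (-((s + η) * ‖ξ‖ ^ 2)) := by
    filter_upwards [hμ] with s hs
    rw [gauss_fourier x (by linarith)]
  refine ⟨(integrable_congr heq).2 (hI.integral_prod_left.const_mul _), ?_⟩
  rw [integral_congr_ae heq, integral_const_mul, integral_integral_swap hI]
  congr 2; ext ξ
  rw [← integral_const_mul]
  congr 1; ext s
  rw [mul_assoc, ← Real.exp_add]
  ring_nf

/-- Positivity of subordination: an inequality between `gauss x` and exponentials is inherited
by `kernel α x` and the corresponding stable exponentials. -/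
theorem kernel_add_sum_nonneg (hα₀ : 0 < α) (hα₂ : α < 2) {t : ℝ} (ht : 0 < t)
    (x : Space (d + 1)) (a : ℝ) {ι : Type*} (S : Finset ι) (b l : ι → ℝ) (hl : ∀ i, 0 ≤ l i)
    (h : ∀ s, 0 < s → 0 ≤ a * gauss x s + ∑ i ∈ S, b i * Real.exp (-(s * l i))) :
    0 ≤ a * kernel α x t +
      ∑ i ∈ S, b i * Real.exp (-(t * symbolConst d α * l i ^ (α / 2))) := by
  have hc := symbolConst_pos (d := d) hα₀ hα₂
  obtain ⟨f, hf, hf0, hflim⟩ := exists_isLaplace_tendsto (β := α / 2) (t := t * symbolConst d α)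
    (by linarith) (by linarith) (by positivity)
  have hnorm : ∀ ξ : Space (d + 1), (‖ξ‖ ^ 2) ^ (α / 2) = ‖ξ‖ ^ α := fun ξ => by
    rw [← Real.rpow_two, ← Real.rpow_mul (norm_nonneg _)]; congr 1; ring
  -- The hypothesis at `s + η`, integrated against the measure whose transform is `f n`.
  have step1 : ∀ η, 0 < η → ∀ n, 0 ≤ a * (((2 * Real.pi) ^ (d + 1))⁻¹ *
      ∫ ξ : Space (d + 1), Real.cos (inner ℝ x ξ) * Real.exp (-(η * ‖ξ‖ ^ 2)) * f n (‖ξ‖ ^ 2)) +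
      ∑ i ∈ S, b i * (Real.exp (-(η * l i)) * f n (l i)) := by
    intro η hη n
    obtain ⟨μ, hμ, hμ0, hfμ⟩ := hf n
    obtain ⟨h1, h2⟩ := integral_gauss_eq hμ0 hη x
    have h3 : ∫ s, (a * gauss x (s + η) + ∑ i ∈ S, b i * Real.exp (-((s + η) * l i))) ∂μ =
        a * (((2 * Real.pi) ^ (d + 1))⁻¹ *
      ∫ ξ : Space (d + 1), Real.cos (inner ℝ x ξ) * Real.exp (-(η * ‖ξ‖ ^ 2)) * f n (‖ξ‖ ^ 2)) +
      ∑ i ∈ S, b i * (Real.exp (-(η * l i)) * f n (l i)) := by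
      have h4 : ∀ i, (fun s => b i * Real.exp (-((s + η) * l i))) =
          fun s => b i * (Real.exp (-(η * l i)) * Real.exp (-(s * l i))) := by
        intro i; ext s; rw [← Real.exp_add]; ring_nf
      have h5 : ∀ i ∈ S, Integrable (fun s => b i * Real.exp (-((s + η) * l i))) μ := by
        intro i _
        rw [h4]
        exact ((integrable_exp_neg_mul hμ0 (hl i)).const_mul _).const_mul _
      rw [integral_add (h1.const_mul a) (integrable_finsetSum _ h5), integral_const_mul, h2,
        integral_finsetSum _ h5]
      congr 1
      · congr 3; ext ξ; rw [hfμ _ (by positivity)]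
      · refine Finset.sum_congr rfl fun i _ => ?_
        rw [h4, integral_const_mul, integral_const_mul, hfμ _ (hl i)]
    rw [← h3]
    refine integral_nonneg_of_ae ?_
    filter_upwards [hμ0] with s hs using h _ (by linarith)
  -- Limit `n → ∞`: the transforms are bounded by one and converge pointwise, and the Gaussian
  -- factor left by `η` dominates.
  have step2 : ∀ η, 0 < η → 0 ≤ a * (((2 * Real.pi) ^ (d + 1))⁻¹ *
      ∫ ξ : Space (d + 1), Real.cos (inner ℝ x ξ) * Real.exp (-(η * ‖ξ‖ ^ 2)) *
        Real.exp (-(t * symbolConst d α * ‖ξ‖ ^ α))) +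
      ∑ i ∈ S, b i * (Real.exp (-(η * l i)) *
        Real.exp (-(t * symbolConst d α * l i ^ (α / 2)))) := by
    intro η hη
    refine ge_of_tendsto' (Tendsto.add (Tendsto.const_mul _ (Tendsto.const_mul _ ?_))
      (tendsto_finsetSum _ fun i _ => ((hflim _ (hl i)).const_mul _).const_mul _)) (step1 η hη)
    refine tendsto_integral_of_dominated_convergence (fun ξ => Real.exp (-(η * ‖ξ‖ ^ 2)))
      (fun n => ?_) (integrable_exp_neg_mul_norm_sq hη) (fun n => Eventually.of_forall fun ξ => ?_)
      (Eventually.of_forall fun ξ => ?_)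
    · obtain ⟨μ, hμ, hμ0, hfμ⟩ := hf n
      have : (fun ξ : Space (d + 1) => Real.cos (inner ℝ x ξ) * Real.exp (-(η * ‖ξ‖ ^ 2)) *
          f n (‖ξ‖ ^ 2)) = fun ξ => Real.cos (inner ℝ x ξ) * Real.exp (-(η * ‖ξ‖ ^ 2)) *
          ∫ s, Real.exp (-(s * ‖ξ‖ ^ 2)) ∂μ := by
        ext ξ; rw [hfμ _ (by positivity)]
      rw [this]
      refine AEStronglyMeasurable.mul (by fun_prop) ?_
      have : StronglyMeasurable
          (Function.uncurry fun (ξ : Space (d + 1)) (s : ℝ) => Real.exp (-(s * ‖ξ‖ ^ 2))) :=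
        Continuous.stronglyMeasurable (by fun_prop)
      exact this.integral_prod_right.aestronglyMeasurable
    · rw [norm_mul, norm_mul, Real.norm_of_nonneg (Real.exp_nonneg _)]
      have h1 : ‖f n (‖ξ‖ ^ 2)‖ ≤ 1 := by
        rw [← hf0 n]; exact (hf n).abs_le_zero (by positivity)
      have h2 : ‖Real.cos (inner ℝ x ξ)‖ ≤ 1 := Real.abs_cos_le_one _
      calc _ ≤ 1 * Real.exp (-(η * ‖ξ‖ ^ 2)) * 1 := by gcongr
        _ = _ := by ring
    · have := hflim (‖ξ‖ ^ 2) (by positivity)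
      rw [hnorm] at this
      exact this.const_mul _
  rw [kernel_eq hα₀]
  -- Limit `η → 0`: now the stable exponential itself is the majorant.
  have hlimit : Tendsto (fun η : ℝ => a * (((2 * Real.pi) ^ (d + 1))⁻¹ *
      ∫ ξ : Space (d + 1), Real.cos (inner ℝ x ξ) * Real.exp (-(η * ‖ξ‖ ^ 2)) *
        Real.exp (-(t * symbolConst d α * ‖ξ‖ ^ α))) +
      ∑ i ∈ S, b i * (Real.exp (-(η * l i)) *
        Real.exp (-(t * symbolConst d α * l i ^ (α / 2))))) (𝓝[>] 0)
      (𝓝 (a * (((2 * Real.pi) ^ (d + 1))⁻¹ *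
      ∫ ξ : Space (d + 1), Real.cos (inner ℝ x ξ) *
        Real.exp (-(t * symbolConst d α * ‖ξ‖ ^ α))) +
      ∑ i ∈ S, b i * Real.exp (-(t * symbolConst d α * l i ^ (α / 2))))) := by
    refine Tendsto.add (Tendsto.const_mul _ (Tendsto.const_mul _ ?_))
      (tendsto_finsetSum _ fun i _ => Tendsto.const_mul _ ?_)
    · refine tendsto_integral_filter_of_dominated_convergence
        (fun ξ => Real.exp (-(t * symbolConst d α * ‖ξ‖ ^ α)))
        (Eventually.of_forall fun η => by fun_prop) ?_
        (integrable_exp_neg_mul_norm_rpow hα₀ (by positivity)) (Eventually.of_forall fun ξ => ?_)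
      · filter_upwards [self_mem_nhdsWithin] with η hη
        refine Eventually.of_forall fun ξ => ?_
        rw [norm_mul, norm_mul, Real.norm_of_nonneg (Real.exp_nonneg (-(t * _ * _)))]
        have h1 : ‖Real.exp (-(η * ‖ξ‖ ^ 2))‖ ≤ 1 := by
          rw [Real.norm_of_nonneg (Real.exp_nonneg _), Real.exp_le_one_iff]
          have := mul_nonneg (le_of_lt hη) (sq_nonneg ‖ξ‖)
          linarith
        have h2 : ‖Real.cos (inner ℝ x ξ)‖ ≤ 1 := Real.abs_cos_le_one _
        calc _ ≤ 1 * 1 * Real.exp (-(t * symbolConst d α * ‖ξ‖ ^ α)) := by gcongr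
          _ = _ := by ring
      · have : Tendsto (fun η : ℝ => Real.cos (inner ℝ x ξ) * Real.exp (-(η * ‖ξ‖ ^ 2)) *
            Real.exp (-(t * symbolConst d α * ‖ξ‖ ^ α))) (𝓝 0)
            (𝓝 (Real.cos (inner ℝ x ξ) * Real.exp (-((0:ℝ) * ‖ξ‖ ^ 2)) *
            Real.exp (-(t * symbolConst d α * ‖ξ‖ ^ α)))) := Continuous.tendsto (by fun_prop) 0
        simp only [zero_mul, neg_zero, Real.exp_zero, mul_one] at this
        exact this.mono_left nhdsWithin_le_nhds
    · have : Tendsto (fun η : ℝ => Real.exp (-(η * l i)) *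
            Real.exp (-(t * symbolConst d α * l i ^ (α / 2)))) (𝓝 0)
            (𝓝 (Real.exp (-((0:ℝ) * l i)) *
            Real.exp (-(t * symbolConst d α * l i ^ (α / 2))))) :=
              Continuous.tendsto (by fun_prop) 0
      simp only [zero_mul, neg_zero, Real.exp_zero, one_mul] at this
      exact this.mono_left nhdsWithin_le_nhds
  refine ge_of_tendsto hlimit ?_
  filter_upwards [self_mem_nhdsWithin] with η hη using step2 η hη

theorem gauss_nonneg (x : Space (d + 1)) {s : ℝ} (hs : 0 < s) : 0 ≤ gauss x s := by
  unfold gauss; positivity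

theorem kernel_nonneg (hα₀ : 0 < α) (hα₂ : α < 2) {t : ℝ} (ht : 0 < t) (x : Space (d + 1)) :
    0 ≤ kernel α x t := by
  simpa using kernel_add_sum_nonneg hα₀ hα₂ ht x 1 (∅ : Finset ℕ) (fun _ => 0) (fun _ => 0)
    (fun _ => le_rfl) (fun s hs => by simpa using gauss_nonneg x hs)

theorem profile_nonneg (hα₀ : 0 < α) (hα₂ : α < 2) (x : Space (d + 1)) : 0 ≤ profile α x :=
  kernel_nonneg hα₀ hα₂ one_pos x

/-! ### The tail of the kernel -/

theorem tendsto_gauss_atTop (x : Space (d + 1)) : Tendsto (gauss x) atTop (𝓝 0) := by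
  have h1 : Tendsto (fun s : ℝ => (4 * Real.pi * s) ^ (-(((d : ℝ) + 1) / 2))) atTop (𝓝 0) :=
    (tendsto_rpow_neg_atTop (by positivity)).comp
      (Tendsto.const_mul_atTop (by positivity) tendsto_id)
  refine squeeze_zero' ?_ ?_ h1
  · filter_upwards [eventually_gt_atTop 0] with s hs using gauss_nonneg x hs
  · filter_upwards [eventually_gt_atTop 0] with s hs
    unfold gauss
    refine mul_le_of_le_one_right (by positivity) (Real.exp_le_one_iff.2 ?_)
    have : 0 ≤ ‖x‖ ^ 2 / (4 * s) := by positivity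
    linarith

/-- Away from the origin the Gaussian decays like `exp (-c / s)` as `s → 0`, faster than any power,
so dividing by `1 - exp (-s)`, which is of order `s`, does no harm. -/
theorem tendsto_gauss_div_one_sub_exp {x : Space (d + 1)} (hx : x ≠ 0) :
    Tendsto (fun s => gauss x s / (1 - Real.exp (-s))) (𝓝[>] 0) (𝓝 0) := by
  have hx0 : 0 < ‖x‖ := norm_pos_iff.2 hx
  set m : ℝ := ((d : ℝ) + 1) / 2 with hm
  have h1 : Tendsto (fun s : ℝ => (4 * Real.pi) ^ (-m) *
      ((s⁻¹) ^ (m + 1) * Real.exp (-(‖x‖ ^ 2 / 4) * s⁻¹)) * Real.exp s) (𝓝[>] 0) (𝓝 0) := by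
    have h2 := (tendsto_rpow_mul_exp_neg_mul_atTop_nhds_zero (m + 1) (‖x‖ ^ 2 / 4)
      (by positivity)).comp tendsto_inv_nhdsGT_zero
    have h3 : Tendsto Real.exp (𝓝[>] 0) (𝓝 1) := by
      have := Real.continuous_exp.tendsto 0
      rw [Real.exp_zero] at this
      exact this.mono_left nhdsWithin_le_nhds
    simpa using (h2.const_mul ((4 * Real.pi) ^ (-m))).mul h3
  refine squeeze_zero' ?_ ?_ h1
  · filter_upwards [self_mem_nhdsWithin] with s (hs : 0 < s)
    have : Real.exp (-s) < 1 := Real.exp_lt_one_iff.2 (by linarith)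
    exact div_nonneg (gauss_nonneg x hs) (by linarith)
  · filter_upwards [self_mem_nhdsWithin] with s (hs : 0 < s)
    have he : s * Real.exp (-s) ≤ 1 - Real.exp (-s) := by
      have := Real.add_one_le_exp s
      have h3 : Real.exp s * Real.exp (-s) = 1 := by rw [← Real.exp_add]; simp
      nlinarith [Real.exp_pos (-s)]
    have hpos : 0 < s * Real.exp (-s) := by positivity
    calc gauss x s / (1 - Real.exp (-s)) ≤ gauss x s / (s * Real.exp (-s)) := by
          gcongr; exact gauss_nonneg x hs
      _ = _ := by
          unfold gauss
          rw [← hm, Real.mul_rpow (by positivity) hs.le, Real.rpow_neg hs.le,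
            Real.inv_rpow hs.le, Real.rpow_add hs, Real.rpow_one, Real.exp_neg s]
          rw [show -(‖x‖ ^ 2 / 4) * s⁻¹ = -(‖x‖ ^ 2 / (4 * s)) by field_simp]
          field_simp

/-- In the variable `u = exp (-s)` the half-line becomes a bounded interval, where polynomials are
dense. The endpoint `u = 0` is `s = ∞` and `u = 1` is `s = 0`. -/
theorem continuousOn_gauss_neg_log_div {x : Space (d + 1)} (hx : x ≠ 0) :
    ContinuousOn (fun u : ℝ => gauss x (-Real.log u) / (1 - u)) (Icc 0 1) := by
  -- The conventions `log 0 = 0`, `0 ^ y = 0` for `y ≠ 0` and division by zero give the function the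
  -- value zero at both endpoints, which is also its limit there.
  have hz : gauss x 0 = 0 := by
    unfold gauss
    rw [mul_zero, Real.zero_rpow (by
      have : (0:ℝ) < ((d : ℝ) + 1) / 2 := by positivity
      linarith), zero_mul]
  intro u hu
  rcases hu.1.eq_or_lt with rfl | h0
  · refine ContinuousWithinAt.mono (t := Ici 0) ?_ Icc_subset_Ici_self
    rw [← continuousWithinAt_Ioi_iff_Ici]
    unfold ContinuousWithinAt
    simp only [Real.log_zero, neg_zero, hz, sub_zero, zero_div]
    have h1 : Tendsto (fun u : ℝ => gauss x (-Real.log u)) (𝓝[>] 0) (𝓝 0) :=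
      (tendsto_gauss_atTop x).comp
        (tendsto_neg_atBot_atTop.comp Real.tendsto_log_nhdsGT_zero)
    have h2 : Tendsto (fun u : ℝ => 1 - u) (𝓝[>] 0) (𝓝 1) := by
      have : Tendsto (fun u : ℝ => 1 - u) (𝓝 0) (𝓝 (1 - 0)) := Continuous.tendsto (by fun_prop) 0
      rw [sub_zero] at this
      exact this.mono_left nhdsWithin_le_nhds
    have h3 := h1.div h2 one_ne_zero
    rw [zero_div] at h3
    exact h3
  rcases hu.2.eq_or_lt with rfl | h1
  · refine ContinuousWithinAt.mono (t := Iic 1) ?_ Icc_subset_Iic_self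
    rw [← continuousWithinAt_Iio_iff_Iic]
    unfold ContinuousWithinAt
    simp only [Real.log_one, neg_zero, hz, sub_self, zero_div]
    have h2 : Tendsto (fun u : ℝ => -Real.log u) (𝓝[<] 1) (𝓝[>] 0) := by
      refine tendsto_nhdsWithin_iff.2 ⟨?_, ?_⟩
      · have := (Real.continuousAt_log one_ne_zero).tendsto.neg
        rw [Real.log_one, neg_zero] at this
        exact this.mono_left nhdsWithin_le_nhds
      · filter_upwards [Ioo_mem_nhdsLT (zero_lt_one)] with u hu
        simpa using Real.log_neg hu.1 hu.2
    refine ((tendsto_gauss_div_one_sub_exp hx).comp h2).congr' ?_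
    filter_upwards [Ioo_mem_nhdsLT (zero_lt_one)] with u hu
    simp only [Function.comp, neg_neg, Real.exp_log hu.1]
  · have hl : Real.log u < 0 := Real.log_neg h0 h1
    refine ContinuousAt.continuousWithinAt ?_
    refine ContinuousAt.div ?_ (by fun_prop) (by linarith)
    unfold gauss
    have hlog : ContinuousAt Real.log u := Real.continuousAt_log h0.ne'
    refine ContinuousAt.mul (ContinuousAt.rpow_const (by fun_prop) (Or.inl ?_)) ?_
    · have : 0 < 4 * Real.pi * -Real.log u := by have := Real.pi_pos; apply mul_pos <;> linarith
      exact this.ne'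
    · refine Real.continuous_exp.continuousAt.comp (ContinuousAt.neg
        (ContinuousAt.div (by fun_prop) (by fun_prop) (by linarith)))

/-- The functional `X ^ i ↦ exp (-t c i^{α/2})`. -/
def stableFunctional (d : ℕ) (α t : ℝ) : Polynomial ℝ →ₗ[ℝ] ℝ :=
  Polynomial.lsum fun i =>
    Real.exp (-(t * symbolConst d α * (i : ℝ) ^ (α / 2))) • LinearMap.id

theorem stableFunctional_apply (t : ℝ) (Q : Polynomial ℝ) :
    stableFunctional d α t Q = ∑ i ∈ Q.support,
      Q.coeff i * Real.exp (-(t * symbolConst d α * (i : ℝ) ^ (α / 2))) := by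
  simp [stableFunctional, Polynomial.lsum_apply, Polynomial.sum_def, mul_comm]

theorem mul_kernel_add_stableFunctional_nonneg (hα₀ : 0 < α) (hα₂ : α < 2) {t : ℝ} (ht : 0 < t)
    (x : Space (d + 1)) (a : ℝ) (Q : Polynomial ℝ)
    (h : ∀ s, 0 < s → 0 ≤ a * gauss x s + Q.eval (Real.exp (-s))) :
    0 ≤ a * kernel α x t + stableFunctional d α t Q := by
  rw [stableFunctional_apply]
  refine kernel_add_sum_nonneg hα₀ hα₂ ht x a Q.support Q.coeff (fun i => (i : ℝ))
    (fun i => Nat.cast_nonneg i) fun s hs => ?_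
  convert h s hs using 2
  rw [Polynomial.eval_eq_sum, Polynomial.sum_def]
  refine Finset.sum_congr rfl fun i _ => ?_
  rw [← Real.exp_nat_mul]; ring_nf

/-- As a function of `t` the functional is differentiable, and at `t = 0` it is `Q(1) = 0`; the
quotient tends to its derivative. -/
theorem tendsto_stableFunctional_div {Q : Polynomial ℝ} (hQ : Q.eval 1 = 0) :
    ∃ D, Tendsto (fun t => t⁻¹ * stableFunctional d α t Q) (𝓝[>] 0) (𝓝 D) := by
  have hd : DifferentiableAt ℝ (fun t => stableFunctional d α t Q) 0 := by
    simp only [stableFunctional_apply]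
    fun_prop
  have h0 : stableFunctional d α 0 Q = 0 := by
    rw [Polynomial.eval_eq_sum, Polynomial.sum_def] at hQ
    simpa [stableFunctional_apply] using hQ
  refine ⟨_, (hd.hasDerivAt.tendsto_slope_zero.mono_left
    (nhdsWithin_mono 0 fun t ht => ne_of_gt ht)).congr fun t => ?_⟩
  simp [h0]

theorem stableFunctional_one_sub_X (hα₀ : 0 < α) (t : ℝ) :
    stableFunctional d α t (1 - Polynomial.X) = 1 - Real.exp (-(t * symbolConst d α)) := by
  have h1 : stableFunctional d α t (Polynomial.monomial 0 1) = 1 := by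
    simp only [stableFunctional, Polynomial.lsum_apply]
    rw [Polynomial.sum_monomial_index _ _ (by simp)]
    simp [Real.zero_rpow (show α / 2 ≠ 0 by positivity)]
  have h2 : stableFunctional d α t (Polynomial.monomial 1 1) =
      Real.exp (-(t * symbolConst d α)) := by
    simp only [stableFunctional, Polynomial.lsum_apply]
    rw [Polynomial.sum_monomial_index _ _ (by simp)]
    simp
  rw [map_sub, ← Polynomial.C_1, ← Polynomial.monomial_zero_left, Polynomial.X, h1, h2]

/-- A polynomial `Q` approximates `gauss x s / (1 - exp (-s))` uniformly in `u = exp (-s)`.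
Multiplied by `1 - u`, the error becomes a small multiple of `1 - exp (-s)`. Subordination carries
this two-sided inequality over to the kernel with an error `O(ε t)`, while `Q (1 - X)` vanishes at
`1`, so its functional divided by `t` converges. -/
theorem exists_tendsto_kernel_div (hα₀ : 0 < α) (hα₂ : α < 2) {x : Space (d + 1)} (hx : x ≠ 0) :
    ∃ A, Tendsto (fun t => t⁻¹ * kernel α x t) (𝓝[>] 0) (𝓝 A) := by
  have hc := symbolConst_pos (d := d) hα₀ hα₂
  set c := symbolConst d α with hcdef
  have key : ∀ ε, 0 < ε → ∃ D, ∀ᶠ t in 𝓝[>] (0:ℝ), |t⁻¹ * kernel α x t - D| ≤ 2 * ε := by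
    intro ε hε
    -- The tolerance `ε / c` compensates the factor in `1 - exp (-t c) ≤ c t`, so that the final
    -- error is `ε t`.
    obtain ⟨Q, hQ⟩ := exists_polynomial_near_of_continuousOn 0 1 _
      (continuousOn_gauss_neg_log_div hx) (ε / c) (by positivity)
    have hQ' : ∀ s, 0 < s → |Q.eval (Real.exp (-s)) * (1 - Real.exp (-s)) - gauss x s| ≤
        ε / c * (1 - Real.exp (-s)) := by
      intro s hs
      have h1 : Real.exp (-s) < 1 := Real.exp_lt_one_iff.2 (by linarith)
      have h2 := (hQ (Real.exp (-s)) ⟨Real.exp_nonneg _, h1.le⟩).le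
      simp only [Real.log_exp, neg_neg] at h2
      have h3 : 0 < 1 - Real.exp (-s) := by linarith
      rw [show Q.eval (Real.exp (-s)) * (1 - Real.exp (-s)) - gauss x s =
        (Q.eval (Real.exp (-s)) - gauss x s / (1 - Real.exp (-s))) * (1 - Real.exp (-s)) by
          field_simp, abs_mul, abs_of_pos h3]
      gcongr
    have hbd : ∀ t, 0 < t → |kernel α x t - stableFunctional d α t (Q * (1 - Polynomial.X))| ≤
        ε * t := by
      intro t ht
      have h1 := mul_kernel_add_stableFunctional_nonneg hα₀ hα₂ ht x 1
        ((ε / c) • (1 - Polynomial.X) - Q * (1 - Polynomial.X)) (fun s hs => by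
          have := abs_le.1 (hQ' s hs)
          simp only [Polynomial.eval_sub, Polynomial.eval_smul, Polynomial.eval_mul,
            Polynomial.eval_one, Polynomial.eval_X, smul_eq_mul]
          linarith [this.2])
      have h2 := mul_kernel_add_stableFunctional_nonneg hα₀ hα₂ ht x (-1)
        ((ε / c) • (1 - Polynomial.X) + Q * (1 - Polynomial.X)) (fun s hs => by
          have := abs_le.1 (hQ' s hs)
          simp only [Polynomial.eval_add, Polynomial.eval_smul, Polynomial.eval_mul,
            Polynomial.eval_one, Polynomial.eval_X, smul_eq_mul, Polynomial.eval_sub]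
          linarith [this.1])
      rw [map_sub, map_smul, stableFunctional_one_sub_X hα₀, smul_eq_mul] at h1
      rw [map_add, map_smul, stableFunctional_one_sub_X hα₀, smul_eq_mul] at h2
      have h3 : ε / c * (1 - Real.exp (-(t * c))) ≤ ε * t := by
        calc _ ≤ ε / c * (t * c) := by
              gcongr; linarith [Real.add_one_le_exp (-(t * c))]
          _ = ε * t := by field_simp
      rw [abs_le]; constructor <;> linarith
    obtain ⟨D, hD⟩ := tendsto_stableFunctional_div (d := d) (α := α)
      (Q := Q * (1 - Polynomial.X)) (by simp)
    refine ⟨D, ?_⟩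
    filter_upwards [self_mem_nhdsWithin, Metric.tendsto_nhds.1 hD ε hε] with t (ht : 0 < t) h
    rw [Real.dist_eq] at h
    have h4 : |t⁻¹ * kernel α x t - t⁻¹ * stableFunctional d α t (Q * (1 - Polynomial.X))| ≤ ε := by
      rw [← mul_sub, abs_mul, abs_of_pos (inv_pos.2 ht)]
      calc _ ≤ t⁻¹ * (ε * t) := by gcongr; exact hbd t ht
        _ = ε := by field_simp
    have := abs_sub_le (t⁻¹ * kernel α x t)
      (t⁻¹ * stableFunctional d α t (Q * (1 - Polynomial.X))) D
    linarith
  -- For each `ε` only an approximate limit `D` is known, so convergence is obtained from the Cauchy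
  -- criterion.
  refine cauchy_map_iff_exists_tendsto.1 (Metric.cauchy_iff.2 ⟨inferInstance, fun ε hε => ?_⟩)
  obtain ⟨D, hD⟩ := key (ε / 6) (by positivity)
  refine ⟨Metric.closedBall D (ε / 3), ?_, fun y hy z hz => ?_⟩
  · rw [mem_map]
    filter_upwards [hD] with t ht
    simp only [mem_preimage, Metric.mem_closedBall, Real.dist_eq]
    linarith
  · have := dist_triangle_right y z D
    rw [Metric.mem_closedBall] at hy hz
    linarith

/-- `lim_{|x| → ∞} |x|^{N+α} P_α(x)`. -/
theorem tendsto_rpow_mul_profile (hα₀ : 0 < α) (hα₂ : α < 2) :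
    Tendsto (fun x : Space (d + 1) => ‖x‖ ^ ((d : ℝ) + 1 + α) * profile α x)
      (Bornology.cobounded _) (𝓝 (tailConst d α)) := by
  have he : EuclideanSpace.single (0 : Fin (d + 1)) (1 : ℝ) ≠ 0 := by
    rw [← norm_pos_iff]; simp
  have h := tendsto_nhds_limUnder (exists_tendsto_kernel_div hα₀ hα₂ he)
  change Tendsto _ _ (𝓝 (tailConst d α)) at h
  -- At the time `t = ‖x‖ ^ (-α)` the scaling law turns `t⁻¹ p_α(e, t)` into `‖x‖ ^ (N + α) P_α(‖x‖
  -- e)`.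
  have h2 : Tendsto (fun x : Space (d + 1) => ‖x‖ ^ (-α)) (Bornology.cobounded _) (𝓝[>] 0) := by
    refine tendsto_nhdsWithin_iff.2
      ⟨(tendsto_rpow_neg_atTop hα₀).comp tendsto_norm_cobounded_atTop, ?_⟩
    filter_upwards [tendsto_norm_cobounded_atTop.eventually_gt_atTop 0] with x hx
    exact Real.rpow_pos_of_pos hx _
  refine (h.comp h2).congr' ?_
  filter_upwards [tendsto_norm_cobounded_atTop.eventually_gt_atTop 0] with x hx
  simp only [Function.comp]
  rw [kernel_scaling hα₀ (by positivity), ← mul_assoc]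
  congr 1
  · rw [← Real.rpow_mul hx.le, ← Real.rpow_neg_one, ← Real.rpow_mul hx.le, ← Real.rpow_add hx]
    congr 1; field_simp; ring
  · refine profile_eq_of_norm_eq ?_
    rw [← Real.rpow_mul hx.le, norm_smul, show -α * -(1 / α) = 1 by field_simp]
    simp

theorem tailConst_nonneg (hα₀ : 0 < α) (hα₂ : α < 2) : 0 ≤ tailConst d α :=
  ge_of_tendsto (tendsto_rpow_mul_profile hα₀ hα₂)
    (Eventually.of_forall fun x => mul_nonneg (by positivity) (profile_nonneg hα₀ hα₂ x))

/-- The tail limit controls the profile outside a ball, and continuity on a compact ball controls it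
inside. -/
theorem exists_profile_le (hα₀ : 0 < α) (hα₂ : α < 2) :
    ∃ C, 0 < C ∧ ∀ x : Space (d + 1), profile α x ≤ C * (1 + ‖x‖) ^ (-((d : ℝ) + 1 + α)) := by
  set m : ℝ := (d : ℝ) + 1 + α with hm
  have hm0 : 0 < m := by positivity
  have h1 := (tendsto_rpow_mul_profile (d := d) hα₀ hα₂).eventually_lt_const
    (lt_add_one (tailConst d α))
  have h2 := h1.and (tendsto_norm_cobounded_atTop.eventually_ge_atTop (1 : ℝ))
  rw [← comap_norm_atTop, eventually_comap] at h2
  obtain ⟨R, hR⟩ := eventually_atTop.1 h2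
  obtain ⟨M, hM⟩ := (isCompact_closedBall (0 : Space (d + 1)) (max R 1)).exists_bound_of_continuousOn
    (profile_continuous (d := d) hα₀ hα₂).continuousOn
  set R' := max R 1
  have hR1 : 1 ≤ R' := le_max_right _ _
  have hA := tailConst_nonneg (d := d) hα₀ hα₂
  have hM0 : 0 ≤ M := (norm_nonneg _).trans (hM 0 (by simp; linarith))
  refine ⟨M * (1 + R') ^ m + (tailConst d α + 1) * 2 ^ m, by positivity, fun x => ?_⟩
  rw [Real.rpow_neg (by positivity), ← div_eq_mul_inv, le_div_iff₀ (by positivity)]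
  by_cases hx : ‖x‖ ≤ R'
  · have h3 := hM x (by simpa using hx)
    have h4 : profile α x ≤ M := (le_abs_self _).trans h3
    have h5 : profile α x * (1 + ‖x‖) ^ m ≤ M * (1 + R') ^ m := by
      gcongr
    have : 0 ≤ (tailConst d α + 1) * 2 ^ m := by positivity
    linarith
  · push Not at hx
    have h3 := hR ‖x‖ ((le_max_left _ _).trans hx.le) x rfl
    have hP := profile_nonneg hα₀ hα₂ x
    have h5 : profile α x * (1 + ‖x‖) ^ m ≤ profile α x * (2 * ‖x‖) ^ m := by
      gcongr; linarith [h3.2]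
    rw [Real.mul_rpow zero_le_two (norm_nonneg _)] at h5
    have h6 : profile α x * (2 ^ m * ‖x‖ ^ m) ≤ (tailConst d α + 1) * 2 ^ m := by
      have : (0:ℝ) < 2 ^ m := by positivity
      nlinarith [h3.1]
    have : 0 ≤ M * (1 + R') ^ m := by positivity
    linarith

theorem profile_integrable (hα₀ : 0 < α) (hα₂ : α < 2) :
    Integrable (profile α : Space (d + 1) → ℝ) := by
  obtain ⟨C, hC, h⟩ := exists_profile_le (d := d) hα₀ hα₂
  refine ((integrable_one_add_norm (r := (d : ℝ) + 1 + α) (by simp; linarith)).const_mul C).mono'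
    (profile_continuous hα₀ hα₂).aestronglyMeasurable (Eventually.of_forall fun x => ?_)
  rw [Real.norm_of_nonneg (profile_nonneg hα₀ hα₂ x)]
  exact h x

/-! ### Coordinates -/

/-- The point `(v, z)` of `ℝ × ℝ^d`. -/
def consPoint (v : ℝ) (z : Space d) : Space (d + 1) :=
  WithLp.toLp 2 (Fin.cons v (fun i => z i))

@[simp] theorem consPoint_zero (v : ℝ) (z : Space d) : consPoint v z 0 = v := rfl

@[simp] theorem consPoint_succ (v : ℝ) (z : Space d) (i : Fin d) :
    consPoint v z i.succ = z i := rfl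

theorem zeroCons_eq (z : Space d) : zeroCons z = consPoint 0 z := rfl

/-- The last coordinates of a point. -/
def tailPoint (x : Space (d + 1)) : Space d := WithLp.toLp 2 (fun i => x i.succ)

@[simp] theorem tailPoint_apply (x : Space (d + 1)) (i : Fin d) : tailPoint x i = x i.succ := rfl

@[simp] theorem tailPoint_consPoint (v : ℝ) (z : Space d) : tailPoint (consPoint v z) = z := by
  ext i; simp

@[simp] theorem consPoint_tailPoint (x : Space (d + 1)) : consPoint (x 0) (tailPoint x) = x := by
  ext i; refine Fin.cases ?_ (fun i => ?_) i <;> simp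

theorem norm_consPoint_sq (v : ℝ) (z : Space d) : ‖consPoint v z‖ ^ 2 = v ^ 2 + ‖z‖ ^ 2 := by
  simp [EuclideanSpace.norm_sq_eq, Fin.sum_univ_succ]

theorem norm_le_norm_consPoint (v : ℝ) (z : Space d) : ‖z‖ ≤ ‖consPoint v z‖ := by
  refine le_of_sq_le_sq ?_ (norm_nonneg _)
  rw [norm_consPoint_sq]; nlinarith [sq_nonneg v]

theorem abs_le_norm_consPoint (v : ℝ) (z : Space d) : |v| ≤ ‖consPoint v z‖ := by
  refine le_of_sq_le_sq ?_ (norm_nonneg _)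
  rw [norm_consPoint_sq, sq_abs]; nlinarith [sq_nonneg ‖z‖]

theorem norm_consPoint_le (v : ℝ) (z : Space d) : ‖consPoint v z‖ ≤ |v| + ‖z‖ := by
  refine le_of_sq_le_sq ?_ (by positivity)
  rw [norm_consPoint_sq]
  nlinarith [sq_abs v, mul_nonneg (abs_nonneg v) (norm_nonneg z)]

@[fun_prop]
theorem continuous_consPoint : Continuous (fun p : ℝ × Space d => consPoint p.1 p.2) := by
  unfold consPoint
  refine (PiLp.continuous_toLp 2 _).comp (continuous_pi fun i => ?_)
  refine Fin.cases ?_ (fun i => ?_) i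
  · exact continuous_fst
  · simp only [Fin.cons_succ]; fun_prop

theorem continuous_consPoint_comp {X : Type*} [TopologicalSpace X] {f : X → ℝ} {g : X → Space d}
    (hf : Continuous f) (hg : Continuous g) : Continuous (fun x => consPoint (f x) (g x)) :=
  continuous_consPoint.comp (hf.prodMk hg)

/-- `(v, z) ↦ consPoint v z` as a measurable equivalence. -/
def consEquiv (d : ℕ) : ℝ × Space d ≃ᵐ Space (d + 1) :=
  (MeasurableEquiv.prodCongr (MeasurableEquiv.refl ℝ) (MeasurableEquiv.toLp 2 (Fin d → ℝ)).symm).trans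
    ((MeasurableEquiv.piFinSuccAbove (fun _ : Fin (d + 1) => ℝ) 0).symm.trans
      (MeasurableEquiv.toLp 2 (Fin (d + 1) → ℝ)))

theorem consEquiv_apply (p : ℝ × Space d) : consEquiv d p = consPoint p.1 p.2 := by
  ext i
  simp only [consEquiv, MeasurableEquiv.trans_apply, MeasurableEquiv.piFinSuccAbove_symm_apply]
  refine Fin.cases ?_ (fun i => ?_) i <;> rfl

theorem measurePreserving_consEquiv : MeasurePreserving (consEquiv d) := by
  refine MeasurePreserving.trans (μb := volume) ?_ (MeasurePreserving.trans (μb := volume) ?_ ?_)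
  · exact (MeasurePreserving.id _).prod
      (EuclideanSpace.volume_preserving_symm_measurableEquiv_toLp (Fin d))
  · exact (volume_preserving_piFinSuccAbove (fun _ : Fin (d + 1) => ℝ) 0).symm
  · exact (EuclideanSpace.volume_preserving_symm_measurableEquiv_toLp (Fin (d + 1))).symm

theorem integral_consPoint (f : Space (d + 1) → ℝ) :
    ∫ p : ℝ × Space d, f (consPoint p.1 p.2) = ∫ x, f x := by
  rw [← measurePreserving_consEquiv.integral_comp (consEquiv d).measurableEmbedding]
  simp [consEquiv_apply]

theorem integrable_consPoint {f : Space (d + 1) → ℝ} :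
    Integrable (fun p : ℝ × Space d => f (consPoint p.1 p.2)) ↔ Integrable f := by
  rw [← measurePreserving_consEquiv.integrable_comp_emb (consEquiv d).measurableEmbedding]
  simp [Function.comp_def, consEquiv_apply]

theorem profile_consPoint_neg_left (v : ℝ) (z : Space d) :
    profile α (consPoint (-v) z) = profile α (consPoint v z) := by
  refine profile_eq_of_norm_eq ?_
  rw [← sq_eq_sq₀ (norm_nonneg _) (norm_nonneg _), norm_consPoint_sq, norm_consPoint_sq, neg_sq]

theorem profile_consPoint_neg_right (v : ℝ) (z : Space d) :
    profile α (consPoint v (-z)) = profile α (consPoint v z) := by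
  refine profile_eq_of_norm_eq ?_
  rw [← sq_eq_sq₀ (norm_nonneg _) (norm_nonneg _), norm_consPoint_sq, norm_consPoint_sq, norm_neg]

/-! ### Second moments of radial functions -/

section Radial

variable {f : Space d → ℝ}

theorem integrable_radial_mul_inner (hi : Integrable (fun z => f z * ‖z‖ ^ 2))
    (hm : AEStronglyMeasurable f) (x y : Space d) :
    Integrable (fun z => f z * (inner ℝ x z * inner ℝ y z)) := by
  refine (hi.norm.mul_const (‖x‖ * ‖y‖)).mono' (hm.mul (by fun_prop))
    (Eventually.of_forall fun z => ?_)
  rw [norm_mul, norm_mul, norm_mul, Real.norm_of_nonneg (sq_nonneg ‖z‖)]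
  have h1 := norm_inner_le_norm (𝕜 := ℝ) x z
  have h2 := norm_inner_le_norm (𝕜 := ℝ) y z
  calc ‖f z‖ * (‖inner ℝ x z‖ * ‖inner ℝ y z‖) ≤ ‖f z‖ * ((‖x‖ * ‖z‖) * (‖y‖ * ‖z‖)) := by gcongr
    _ = _ := by ring

theorem integral_radial_mul_inner_sq
    (hf : ∀ (O : Space d ≃ₗᵢ[ℝ] Space d) z, f (O z) = f z) {x y : Space d} (h : ‖x‖ = ‖y‖) :
    ∫ z, f z * (inner ℝ x z * inner ℝ x z) = ∫ z, f z * (inner ℝ y z * inner ℝ y z) := by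
  obtain ⟨O, rfl⟩ := exists_isometry_map h
  rw [← O.measurePreserving.integral_comp O.toHomeomorph.measurableEmbedding
    (fun z => f z * (inner ℝ (O x) z * inner ℝ (O x) z))]
  simp [hf]

/-- Since `e i + e j` and `e i - e j` have the same norm, polarization kills the mixed second
moments. A rotation identifies the pure ones, so that only the trace of the form survives. -/
theorem integral_radial_mul_bilin
    (hf : ∀ (O : Space d ≃ₗᵢ[ℝ] Space d) z, f (O z) = f z)
    (hi : Integrable (fun z => f z * ‖z‖ ^ 2)) (hm : AEStronglyMeasurable f)
    (B : Space d →L[ℝ] Space d →L[ℝ] ℝ) (i₀ : Fin d) :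
    ∫ z, f z * B z z =
      (∑ i, B (EuclideanSpace.single i 1) (EuclideanSpace.single i 1)) * ∫ z, f z * (z i₀) ^ 2 := by
  set e : Fin d → Space d := fun i => EuclideanSpace.single i 1 with he
  set T : Fin d → Fin d → ℝ := fun i j => ∫ z, f z * (inner ℝ (e i) z * inner ℝ (e j) z) with hT
  have hin : ∀ i (z : Space d), inner ℝ (e i) z = z i := fun i z => by
    simp [he, EuclideanSpace.inner_single_left]
  have hoff : ∀ i j, i ≠ j → T i j = 0 := by
    intro i j hij
    have h1 := integral_radial_mul_inner_sq hf (x := e i + e j) (y := e i - e j) (by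
      rw [← sq_eq_sq₀ (norm_nonneg _) (norm_nonneg _), norm_add_sq_real, norm_sub_sq_real, hin]
      simp [he, hij])
    have h2 : ∀ z : Space d, f z * (inner ℝ (e i + e j) z * inner ℝ (e i + e j) z) =
        f z * (inner ℝ (e i - e j) z * inner ℝ (e i - e j) z) +
          4 * (f z * (inner ℝ (e i) z * inner ℝ (e j) z)) := by
      intro z; rw [inner_add_left, inner_sub_left]; ring
    simp_rw [h2] at h1
    rw [integral_add (integrable_radial_mul_inner hi hm _ _)
      ((integrable_radial_mul_inner hi hm _ _).const_mul 4), integral_const_mul] at h1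
    change _ + 4 * T i j = _ at h1
    linarith
  have hdiag : ∀ i, T i i = ∫ z, f z * (z i₀) ^ 2 := by
    intro i
    have h1 := integral_radial_mul_inner_sq hf (x := e i) (y := e i₀) (by simp [he])
    change T i i = _ at h1
    rw [h1]; simp [hin, sq]
  have hexp : ∀ z : Space d, f z * B z z =
      ∑ i, ∑ j, B (e i) (e j) * (f z * (inner ℝ (e i) z * inner ℝ (e j) z)) := by
    intro z
    have hz : z = ∑ i, z i • e i := by
      ext j; simp [he, Finset.sum_apply, Pi.single_apply]
    have : B z z = ∑ i, ∑ j, z i * (z j * B (e i) (e j)) := by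
      conv_lhs => rw [hz]
      simp only [map_sum, map_smul, sum_apply, smul_apply, smul_eq_mul, Finset.mul_sum]
      rw [Finset.sum_comm]
      exact Finset.sum_congr rfl fun i _ => Finset.sum_congr rfl fun j _ => by ring
    rw [this, Finset.mul_sum]
    refine Finset.sum_congr rfl fun i _ => ?_
    rw [Finset.mul_sum]
    refine Finset.sum_congr rfl fun j _ => ?_
    rw [hin, hin]; ring
  simp_rw [hexp]
  rw [integral_finsetSum _ fun i _ => integrable_finsetSum _ fun j _ =>
    (integrable_radial_mul_inner hi hm _ _).const_mul _, Finset.sum_mul]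
  refine Finset.sum_congr rfl fun i _ => ?_
  rw [integral_finsetSum _ fun j _ => (integrable_radial_mul_inner hi hm _ _).const_mul _,
    Finset.sum_eq_single i]
  · rw [integral_const_mul]; rw [← hdiag i]
  · intro j _ hj
    rw [integral_const_mul]
    change _ * T i j = 0
    rw [hoff i j hj.symm, mul_zero]
  · simp

theorem natCast_mul_integral_radial_mul_sq
    (hf : ∀ (O : Space d ≃ₗᵢ[ℝ] Space d) z, f (O z) = f z)
    (hi : Integrable (fun z => f z * ‖z‖ ^ 2)) (hm : AEStronglyMeasurable f)
    (i₀ : Fin d) :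
    (d : ℝ) * ∫ z, f z * (z i₀) ^ 2 = ∫ z, f z * ‖z‖ ^ 2 := by
  have h := integral_radial_mul_bilin hf hi hm (innerSL ℝ) i₀
  have hB : ∀ z : Space d, (innerSL ℝ : Space d →L[ℝ] Space d →L[ℝ] ℝ) z z = ‖z‖ ^ 2 :=
    fun z => real_inner_self_eq_norm_sq z
  simp only [hB] at h
  rw [h]; simp

end Radial

/-! ### Integrals of a sign over a half-space bounded by a graph -/

theorem signUpper_eq (s : ℝ) : signUpper s = 1 - 2 * (Iio (0:ℝ)).indicator 1 s := by
  unfold signUpper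
  by_cases h : 0 ≤ s
  · simp [h]
  · simp [h, not_le.1 h]; norm_num

@[fun_prop]
theorem measurable_signUpper : Measurable signUpper :=
  Measurable.ite measurableSet_Ici measurable_const measurable_const

theorem abs_signUpper (s : ℝ) : |signUpper s| = 1 := by
  unfold signUpper; split_ifs <;> simp

/-- The two halves of an even function balance; what remains is twice the piece between `0` and the
displaced zero `c`. -/
theorem integral_even_mul_signUpper {f : ℝ → ℝ} (hf : Integrable f) (he : ∀ v, f (-v) = f v)
    (c : ℝ) : ∫ v, f v * signUpper (v - c) = -(2 * ∫ v in (0:ℝ)..c, f v) := by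
  have h1 : ∀ v, f v * signUpper (v - c) = f v - 2 * (Iio c).indicator f v := by
    intro v
    rw [signUpper_eq]
    by_cases h : v < c
    · simp [h]; ring
    · simp [h]
  simp_rw [h1]
  rw [integral_sub hf ((hf.indicator measurableSet_Iio).const_mul 2), integral_const_mul,
    integral_indicator measurableSet_Iio, ← integral_Iic_eq_integral_Iio]
  have h2 := intervalIntegral.integral_Iic_sub_Iic (a := 0) (b := c) hf.integrableOn hf.integrableOn
  have h3 : ∫ v in Iic (0:ℝ), f v = ∫ v in Ioi (0:ℝ), f v := by
    have := integral_comp_neg_Iic (0:ℝ) f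
    simp only [he, neg_zero] at this
    exact this
  have h4 := intervalIntegral.integral_Iic_add_Ioi (b := (0:ℝ)) hf.integrableOn hf.integrableOn
  linarith

/-- The integral of `W (· + q z) z` over the interval of radius `κ z`. -/
def slab (W : ℝ → Space d → ℝ) (κ q : Space d → ℝ) (z : Space d) : ℝ :=
  ∫ v in (-κ z)..(κ z), W (v + q z) z

theorem slab_eq (W : ℝ → Space d → ℝ) (κ q : Space d → ℝ) (z : Space d) :
    slab W κ q z = κ z * ∫ w in (-1:ℝ)..1, W (κ z * w + q z) z := by
  rw [intervalIntegral.mul_integral_comp_mul_left (f := fun v => W (v + q z) z)]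
  simp [slab]

theorem measurable_slab {W : ℝ → Space d → ℝ} {κ q : Space d → ℝ}
    (hW : Measurable (Function.uncurry W)) (hκ : Measurable κ) (hq : Measurable q) :
    Measurable (slab W κ q) := by
  have : slab W κ q = fun z => κ z * ∫ w in (-1:ℝ)..1, W (κ z * w + q z) z := by
    ext z; exact slab_eq W κ q z
  rw [this]
  refine hκ.mul ?_
  simp only [intervalIntegral.integral_of_le (show (-1:ℝ) ≤ 1 by norm_num)]
  refine StronglyMeasurable.measurable (StronglyMeasurable.integral_prod_right
    (f := fun z w => W (κ z * w + q z) z) (Measurable.stronglyMeasurable ?_))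
  exact hW.comp (f := fun p : Space d × ℝ => (κ p.1 * p.2 + q p.1, p.1)) (by fun_prop)

theorem abs_slab_le {W : ℝ → Space d → ℝ} {κ q : Space d → ℝ} {z : Space d} {b : ℝ}
    (hb : ∀ v, |W v z| ≤ b) : |slab W κ q z| ≤ 2 * |κ z| * b := by
  have := intervalIntegral.norm_integral_le_of_norm_le_const (a := -κ z) (b := κ z)
    (f := fun v => W (v + q z) z) (C := b) (fun v _ => hb _)
  rw [Real.norm_eq_abs] at this
  unfold slab
  refine this.trans (le_of_eq ?_)
  rw [show κ z - -κ z = 2 * κ z by ring, abs_mul, abs_two]; ring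

/-- On the fibre over `z` the integral is `-2 ∫_0^(κ - q) W`. Averaging over `z` and `-z` keeps `κ`
and reverses `q`, and by evenness of `W` the two pieces join to the interval `[q - κ, q + κ]`. Thus
the odd part displaces the slab without changing its thickness, which is why a linear perturbation
of the graph need only tend to zero, at no particular rate. -/
theorem integral_mul_signUpper_eq_neg_slab {W : ℝ → Space d → ℝ} {κ q : Space d → ℝ}
    (hWi : Integrable (fun p : ℝ × Space d => W p.1 p.2)) (hWz : ∀ z, Integrable (fun v => W v z))
    (hWv : ∀ v z, W (-v) z = W v z) (hWe : ∀ v z, W v (-z) = W v z)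
    (hκm : Measurable κ) (hqm : Measurable q)
    (hκ : ∀ z, κ (-z) = κ z) (hq : ∀ z, q (-z) = -q z) :
    ∫ p : ℝ × Space d, W p.1 p.2 * signUpper (p.1 + q p.2 - κ p.2) = -∫ z, slab W κ q z := by
  have hI : Integrable (fun p : ℝ × Space d => W p.1 p.2 * signUpper (p.1 + q p.2 - κ p.2)) := by
    refine hWi.mul_bdd (c := 1) (measurable_signUpper.comp (by fun_prop)).aestronglyMeasurable (Eventually.of_forall fun p => ?_)
    rw [Real.norm_eq_abs, abs_signUpper]
  have h0 : ∀ z, ∫ v, W v z * signUpper (v + q z - κ z) =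
      -(2 * ∫ v in (0:ℝ)..(κ z - q z), W v z) := by
    intro z
    rw [← integral_even_mul_signUpper (hWz z) (fun v => hWv v z)]
    congr 1; ext v; congr 2; ring
  have hHi := hI.integral_prod_right
  have hE : ∫ p : ℝ × Space d, W p.1 p.2 * signUpper (p.1 + q p.2 - κ p.2) =
      ∫ z, ∫ v, W v z * signUpper (v + q z - κ z) := integral_prod_symm _ hI
  simp only [h0] at hE hHi
  set H : Space d → ℝ := fun z => -(2 * ∫ v in (0:ℝ)..(κ z - q z), W v z) with hH
  have hsym : ∫ z, H z = ∫ z, H (-z) := (integral_neg_eq_self H volume).symm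
  have hsum : ∀ z, H z + H (-z) = 2 * -slab W κ q z := by
    intro z
    have hii : ∀ a b : ℝ, IntervalIntegrable (fun v => W v z) volume a b :=
      fun a b => (hWz z).intervalIntegrable
    simp only [hH, hκ, hq, hWe, slab]
    have h1 : ∫ v in (0:ℝ)..(κ z - q z), W v z = ∫ v in (q z - κ z)..0, W v z := by
      have := intervalIntegral.integral_comp_neg (a := 0) (b := κ z - q z) (fun v => W v z)
      simp only [hWv, neg_zero, neg_sub] at this
      exact this
    have h2 := intervalIntegral.integral_add_adjacent_intervals (hii (q z - κ z) 0)
      (hii 0 (κ z - -q z))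
    have h3 := intervalIntegral.integral_comp_add_right (a := -κ z) (b := κ z)
      (fun v => W v z) (q z)
    rw [h1, h3, show -κ z + q z = q z - κ z by ring, show κ z + q z = κ z - -q z by ring, ← h2]
    ring
  rw [hE, ← integral_neg]
  have h4 : ∫ z, H z + H (-z) = 2 * ∫ z, H z := by
    rw [integral_add hHi hHi.comp_neg, ← hsym]; ring
  simp_rw [hsum] at h4
  rw [integral_const_mul] at h4
  linarith

/-! ### Asymptotics of the slab integrals -/

/-- To first order a slab of half-thickness `θ A` has mass `2 θ A W₀`. The majorant `b` does not
depend on `v`, so the displacement `q` does not disturb dominated convergence. -/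
theorem tendsto_integral_slab_div {W : ℕ → ℝ → Space d → ℝ} {W₀ b g A₀ : Space d → ℝ}
    {A : ℕ → Space d → ℝ} {θ : ℕ → ℝ} {q : ℕ → Space d → ℝ}
    (hWm : ∀ k, Measurable (Function.uncurry (W k))) (hAm : ∀ k, Measurable (A k))
    (hqm : ∀ k, Measurable (q k)) (hWb : ∀ k v z, |W k v z| ≤ b z) (hg : ∀ k z, |A k z| ≤ g z)
    (hgb : Integrable (fun z => g z * b z)) (hA : ∀ z, Tendsto (fun k => A k z) atTop (𝓝 (A₀ z)))
    (hθ : Tendsto θ atTop (𝓝 0)) (hθ0 : ∀ k, θ k ≠ 0)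
    (hq : ∀ z, Tendsto (fun k => q k z) atTop (𝓝 0))
    (hW : ∀ z, Tendsto (fun p : ℕ × ℝ => W p.1 p.2 z) (atTop ×ˢ 𝓝 0) (𝓝 (W₀ z))) :
    Tendsto (fun k => (θ k)⁻¹ * ∫ z, slab (W k) (fun z => θ k * A k z) (q k) z) atTop
      (𝓝 (2 * ∫ z, A₀ z * W₀ z)) := by
  have h1 : ∀ k, (θ k)⁻¹ * ∫ z, slab (W k) (fun z => θ k * A k z) (q k) z =
      ∫ z, (θ k)⁻¹ * slab (W k) (fun z => θ k * A k z) (q k) z := fun k => by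
    rw [integral_const_mul]
  have h2 : 2 * ∫ z, A₀ z * W₀ z = ∫ z, A₀ z * (2 * W₀ z) := by
    rw [← integral_const_mul]; congr 1; ext z; ring
  simp_rw [h1, h2]
  refine tendsto_integral_of_dominated_convergence (fun z => 2 * (g z * b z)) (fun k => ?_)
    (hgb.const_mul 2) (fun k => Eventually.of_forall fun z => ?_)
    (Eventually.of_forall fun z => ?_)
  · exact ((measurable_slab (hWm k) ((hAm k).const_mul _) (hqm k)).const_mul _).aestronglyMeasurable
  · rw [Real.norm_eq_abs, abs_mul, abs_inv]
    have h3 := abs_slab_le (W := W k) (κ := fun z => θ k * A k z) (q := q k) (fun v => hWb k v z)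
    rw [abs_mul] at h3
    have h4 : 0 < |θ k| := abs_pos.2 (hθ0 k)
    have hb : 0 ≤ b z := (abs_nonneg _).trans (hWb k 0 z)
    calc _ ≤ |θ k|⁻¹ * (2 * (|θ k| * |A k z|) * b z) := by gcongr
      _ = 2 * (|A k z| * b z) := by field_simp
      _ ≤ _ := by gcongr; exact hg k z
  · have h3 : ∀ k, (θ k)⁻¹ * slab (W k) (fun z => θ k * A k z) (q k) z =
        A k z * ∫ w in (-1:ℝ)..1, W k (θ k * A k z * w + q k z) z := fun k => by
      rw [slab_eq, ← mul_assoc, inv_mul_cancel_left₀ (hθ0 k)]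
    simp_rw [h3]
    refine (hA z).mul ?_
    have h4 : 2 * W₀ z = ∫ w in (-1:ℝ)..1, W₀ z := by
      rw [intervalIntegral.integral_const, smul_eq_mul]; norm_num
    rw [h4]
    refine intervalIntegral.tendsto_integral_filter_of_dominated_convergence (fun _ => b z)
      (Eventually.of_forall fun k => ?_)
      (Eventually.of_forall fun k => Eventually.of_forall fun w _ => hWb k _ z)
      intervalIntegrable_const (Eventually.of_forall fun w _ => ?_)
    · have : Measurable fun w : ℝ => W k (θ k * A k z * w + q k z) z :=
        (hWm k).comp (f := fun w : ℝ => (θ k * A k z * w + q k z, z)) (by fun_prop)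
      exact this.aestronglyMeasurable
    · refine (hW z).comp (tendsto_id.prodMk ?_)
      have := ((hθ.mul (hA z)).mul_const w).add (hq z)
      simpa using this

/-- Two slabs with the same centre differ by two intervals of length `|κ - s|`, on which `W` is
compared with a constant. With `c = 0` this is a crude bound; with `c` the tail of the profile it
gives the logarithm at `α = 1`. -/
theorem abs_slab_sub_le {W : ℝ → Space d → ℝ} {κ s q : Space d → ℝ} {z : Space d} {b c : ℝ}
    (hWz : Integrable (fun v => W v z))
    (hb : ∀ v, |v| ≤ max |κ z| |s z| → |W (v + q z) z - c| ≤ b) :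
    |slab W κ q z - slab W s q z - 2 * (κ z - s z) * c| ≤ 2 * |κ z - s z| * b := by
  have hii : ∀ x y : ℝ, IntervalIntegrable (fun v => W (v + q z) z) volume x y :=
    fun x y => (hWz.comp_add_right (q z)).intervalIntegrable
  have hsplit : slab W κ q z - slab W s q z - 2 * (κ z - s z) * c =
      (∫ v in (s z)..(κ z), (W (v + q z) z - c)) +
        ∫ v in (-κ z)..(-s z), (W (v + q z) z - c) := by
    rw [intervalIntegral.integral_sub (hii _ _) intervalIntegrable_const,
      intervalIntegral.integral_sub (hii _ _) intervalIntegrable_const,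
      intervalIntegral.integral_const, intervalIntegral.integral_const]
    have h1 := intervalIntegral.integral_add_adjacent_intervals (hii (-κ z) (-s z))
      (hii (-s z) (s z))
    have h2 := intervalIntegral.integral_add_adjacent_intervals (hii (-κ z) (s z))
      (hii (s z) (κ z))
    simp only [slab, smul_eq_mul]
    linarith
  have hm1 : ∀ v ∈ uIoc (s z) (κ z), ‖W (v + q z) z - c‖ ≤ b := by
    intro v hv
    refine hb v ?_
    have := uIoc_subset_uIcc hv
    rw [mem_uIcc] at this
    rcases this with h | h
    · exact (abs_le_max_abs_abs h.1 h.2).trans_eq (max_comm _ _)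
    · exact abs_le_max_abs_abs h.1 h.2
  have hm2 : ∀ v ∈ uIoc (-κ z) (-s z), ‖W (v + q z) z - c‖ ≤ b := by
    intro v hv
    refine hb v ?_
    have := uIoc_subset_uIcc hv
    rw [mem_uIcc] at this
    rcases this with h | h
    · have := abs_le_max_abs_abs h.1 h.2
      rwa [abs_neg, abs_neg] at this
    · have := abs_le_max_abs_abs h.1 h.2
      rw [abs_neg, abs_neg, max_comm] at this
      exact this
  have h1 := intervalIntegral.norm_integral_le_of_norm_le_const hm1
  have h2 := intervalIntegral.norm_integral_le_of_norm_le_const hm2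
  rw [hsplit]
  rw [Real.norm_eq_abs] at h1 h2
  have h3 : |-s z - -κ z| = |κ z - s z| := by congr 1; ring
  rw [h3] at h2
  have := abs_add_le (∫ v in (s z)..(κ z), (W (v + q z) z - c))
    (∫ v in (-κ z)..(-s z), (W (v + q z) z - c))
  linarith

/-- The bound in `z`, uniform in `v`, dominates the slab integrals; the bound in `v` makes every
fibre integrable. -/
theorem exists_profile_consPoint_le (hα₀ : 0 < α) (hα₂ : α < 2) :
    ∃ C, 0 < C ∧ (∀ v (z : Space d), |profile α (consPoint v z)| ≤
        C * (1 + ‖z‖) ^ (-((d : ℝ) + 1 + α))) ∧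
      ∀ v (z : Space d), |profile α (consPoint v z)| ≤ C * (1 + |v|) ^ (-((d : ℝ) + 1 + α)) := by
  obtain ⟨C, hC, h⟩ := exists_profile_le (d := d) hα₀ hα₂
  have hm : -((d : ℝ) + 1 + α) ≤ 0 := by
    have : (0:ℝ) ≤ d := Nat.cast_nonneg d
    linarith
  refine ⟨C, hC, fun v z => ?_, fun v z => ?_⟩
  · rw [abs_of_nonneg (profile_nonneg hα₀ hα₂ _)]
    refine (h _).trans ?_
    gcongr 1
    exact Real.rpow_le_rpow_of_nonpos (by positivity)
      (by linarith [norm_le_norm_consPoint v z]) hm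
  · rw [abs_of_nonneg (profile_nonneg hα₀ hα₂ _)]
    refine (h _).trans ?_
    gcongr 1
    exact Real.rpow_le_rpow_of_nonpos (by positivity)
      (by linarith [abs_le_norm_consPoint v z]) hm

theorem continuous_profile_consPoint (hα₀ : 0 < α) (hα₂ : α < 2) :
    Continuous (fun p : ℝ × Space d => profile α (consPoint p.1 p.2)) :=
  (profile_continuous hα₀ hα₂).comp continuous_consPoint

theorem integrable_profile_consPoint_left (hα₀ : 0 < α) (hα₂ : α < 2) (z : Space d) :
    Integrable (fun v => profile α (consPoint v z)) := by
  obtain ⟨C, hC, -, h⟩ := exists_profile_consPoint_le (d := d) hα₀ hα₂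
  have hm : ((Module.finrank ℝ ℝ : ℕ) : ℝ) < (d : ℝ) + 1 + α := by
    have : (0:ℝ) ≤ d := Nat.cast_nonneg d
    simp; linarith
  exact ((integrable_one_add_norm hm).const_mul C).mono'
    ((continuous_profile_consPoint hα₀ hα₂).comp
      (by fun_prop : Continuous fun v : ℝ => (v, z))).aestronglyMeasurable
    (Eventually.of_forall fun v => h v z)

/-- The second moment on the hyperplane converges because `2 - (d + 1 + α) < -d`, and this is where
`α > 1` enters. -/
theorem integrable_norm_sq_mul_rpow {C : ℝ} (hα₁ : 1 < α) (M K : ℝ) :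
    Integrable (fun z : Space d => (M + K * ‖z‖ ^ 2) * (C * (1 + ‖z‖) ^ (-((d : ℝ) + 1 + α)))) := by
  have hm : ((Module.finrank ℝ (Space d) : ℕ) : ℝ) < (d : ℝ) + α - 1 := by
    simp; linarith
  have hI := (integrable_one_add_norm (μ := (volume : Measure (Space d))) hm).const_mul
    ((|M| + |K|) * |C|)
  refine hI.mono' (by fun_prop) (Eventually.of_forall fun z => ?_)
  have h0 : 0 ≤ ‖z‖ := norm_nonneg z
  rw [norm_mul, norm_mul, Real.norm_eq_abs, Real.norm_eq_abs,
    Real.norm_of_nonneg (by positivity : (0:ℝ) ≤ (1 + ‖z‖) ^ (-((d : ℝ) + 1 + α)))]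
  have h1 : |M + K * ‖z‖ ^ 2| ≤ (|M| + |K|) * (1 + ‖z‖) ^ (2 : ℝ) := by
    rw [Real.rpow_two]
    have h2 := abs_add_le M (K * ‖z‖ ^ 2)
    rw [abs_mul, abs_of_nonneg (by positivity : 0 ≤ ‖z‖ ^ 2)] at h2
    nlinarith [abs_nonneg M, abs_nonneg K, mul_nonneg (abs_nonneg M) h0,
      mul_nonneg (abs_nonneg K) h0, mul_nonneg (abs_nonneg M) (mul_nonneg h0 h0)]
  calc _ ≤ (|M| + |K|) * (1 + ‖z‖) ^ (2 : ℝ) * (|C| * (1 + ‖z‖) ^ (-((d : ℝ) + 1 + α))) := by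
        gcongr
    _ = (|M| + |K|) * |C| * ((1 + ‖z‖) ^ (2 : ℝ) * (1 + ‖z‖) ^ (-((d : ℝ) + 1 + α))) := by ring
    _ = _ := by
        rw [← Real.rpow_add (by positivity)]; congr 2; ring

theorem integrable_const_mul_rpow {C : ℝ} (hα₀ : 0 < α) (M : ℝ) :
    Integrable (fun z : Space d => M * (C * (1 + ‖z‖) ^ (-((d : ℝ) + 1 + α)))) :=
  ((integrable_one_add_norm (by simp; linarith)).const_mul C).const_mul M

theorem tendsto_clm_apply_zero {q : ℕ → Space d →L[ℝ] ℝ} (hq : Tendsto q atTop (𝓝 0))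
    (z : Space d) : Tendsto (fun k => q k z) atTop (𝓝 0) := by
  have := ((ContinuousLinearMap.apply ℝ ℝ z).continuous.tendsto 0).comp hq
  rw [map_zero] at this
  exact this

theorem tendsto_profile_consPoint (hα₀ : 0 < α) (hα₂ : α < 2) (z : Space d) :
    Tendsto (fun p : ℕ × ℝ => profile α (consPoint p.2 z)) (atTop ×ˢ 𝓝 0)
      (𝓝 (profile α (consPoint 0 z))) := by
  have h1 : Continuous fun v : ℝ => profile α (consPoint v z) :=
    (profile_continuous hα₀ hα₂).comp (continuous_consPoint_comp continuous_id continuous_const)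
  exact (h1.tendsto 0).comp tendsto_snd

/-- Displacement and curvature contribute at the same order `r`, and the finite second moment
dominates the rescaled slabs, so no truncation is needed. -/
theorem tendsto_signIntegral_of_one_lt (hα₁ : 1 < α) (hα₂ : α < 2)
    (B : Space d →L[ℝ] Space d →L[ℝ] ℝ) {r a : ℕ → ℝ} {a₀ : ℝ} {q : ℕ → Space d →L[ℝ] ℝ}
    (hr0 : ∀ k, 0 < r k) (hr : Tendsto r atTop (𝓝 0)) (ha : Tendsto a atTop (𝓝 a₀))
    (hq : Tendsto q atTop (𝓝 0)) :
    Tendsto (fun k => (r k)⁻¹ * ∫ p : ℝ × Space d, profile α (consPoint p.1 p.2) *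
      signUpper (p.1 + q k p.2 - r k * (a k - B p.2 p.2 / 2))) atTop
      (𝓝 (-(2 * ∫ z : Space d, (a₀ - B z z / 2) * profile α (zeroCons z)))) := by
  have hα₀ : 0 < α := by linarith
  obtain ⟨C, hC, hb, -⟩ := exists_profile_consPoint_le (d := d) hα₀ hα₂
  obtain ⟨M, hM⟩ := ha.abs.bddAbove_range
  have hM' : ∀ k, |a k| ≤ M := fun k => hM ⟨k, rfl⟩
  have hBm : Measurable fun z : Space d => B z z :=
    (by fun_prop : Continuous fun z : Space d => B z z).measurable
  have h := tendsto_integral_slab_div (W := fun _ v z => profile α (consPoint v z))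
    (W₀ := fun z : Space d => profile α (consPoint 0 z)) (A := fun k z => a k - B z z / 2)
    (A₀ := fun z => a₀ - B z z / 2) (g := fun z => M + ‖B‖ / 2 * ‖z‖ ^ 2)
    (q := fun k z => q k z) (θ := r)
    (fun k => (continuous_profile_consPoint hα₀ hα₂).measurable)
    (fun k => by fun_prop) (fun k => by fun_prop) (fun k v z => hb v z) (fun k z => ?_)
    (integrable_norm_sq_mul_rpow hα₁ M (‖B‖ / 2)) (fun z => ha.sub_const _) hr
    (fun k => (hr0 k).ne') (tendsto_clm_apply_zero hq) (tendsto_profile_consPoint hα₀ hα₂)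
  · refine h.neg.congr fun k => ?_
    rw [← mul_neg]
    congr 1
    refine (integral_mul_signUpper_eq_neg_slab (W := fun v z => profile α (consPoint v z))
      (κ := fun z => r k * (a k - B z z / 2)) (q := fun z => q k z)
      (integrable_consPoint.2 (profile_integrable hα₀ hα₂))
      (integrable_profile_consPoint_left hα₀ hα₂) profile_consPoint_neg_left
      profile_consPoint_neg_right (by fun_prop) (by fun_prop) (fun z => by simp)
      (fun z => by simp)).symm
  · have h1 := abs_sub (a k) (B z z / 2)
    have h2 : |B z z| ≤ ‖B‖ * ‖z‖ * ‖z‖ := B.le_opNorm₂ z z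
    rw [abs_div, abs_two] at h1
    have := hM' k
    nlinarith

/-! ### Growth of the truncated second moment -/

theorem setIntegral_ball_rpow_le [NeZero d] {L : ℝ} (hL : 0 < L) :
    ∫ z in Metric.ball (0 : Space d) L, (1 + ‖z‖) ^ (1 - (d : ℝ) - α) ≤
      (volume : Measure (Space d)).toSphere.real univ * ∫ s in (0:ℝ)..L, (1 + s) ^ (-α) := by
  have hd : 0 < d := Nat.pos_of_ne_zero (NeZero.ne d)
  have : Nontrivial (Space d) := by
    have : Nonempty (Fin d) := ⟨⟨0, hd⟩⟩
    infer_instance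
  have h1 : ∫ z in Metric.ball (0 : Space d) L, (1 + ‖z‖) ^ (1 - (d : ℝ) - α) =
      ∫ z : Space d, (fun s : ℝ => (Iio L).indicator (fun s => (1 + s) ^ (1 - (d : ℝ) - α)) s) ‖z‖ := by
    rw [← integral_indicator measurableSet_ball]
    congr 1; ext z
    by_cases hz : ‖z‖ < L <;> simp [hz]
  rw [h1, integral_fun_norm_addHaar, Measure.toSphere_real_apply_univ, nsmul_eq_mul, smul_eq_mul,
    mul_assoc]
  gcongr
  have h2 : ∀ s : ℝ, s ^ (Module.finrank ℝ (Space d) - 1) •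
      (Iio L).indicator (fun s => (1 + s) ^ (1 - (d : ℝ) - α)) s =
      (Iio L).indicator (fun s => s ^ (d - 1) * (1 + s) ^ (1 - (d : ℝ) - α)) s := by
    intro s
    by_cases hs : s < L <;> simp [hs]
  simp_rw [h2]
  rw [setIntegral_indicator measurableSet_Iio, Ioi_inter_Iio, ← integral_Ioc_eq_integral_Ioo,
    ← intervalIntegral.integral_of_le hL.le]
  have hc : ∀ β : ℝ, ContinuousOn (fun s : ℝ => (1 + s) ^ β) (uIcc 0 L) := by
    intro β s hs
    rw [uIcc_of_le hL.le] at hs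
    exact (ContinuousAt.rpow_const (by fun_prop) (Or.inl (by linarith [hs.1]))).continuousWithinAt
  refine intervalIntegral.integral_mono_on hL.le
    (ContinuousOn.mul (by fun_prop) (hc _)).intervalIntegrable (hc _).intervalIntegrable
    fun s hs => ?_
  have hs0 : 0 ≤ s := hs.1
  calc s ^ (d - 1) * (1 + s) ^ (1 - (d : ℝ) - α)
      ≤ (1 + s) ^ (d - 1) * (1 + s) ^ (1 - (d : ℝ) - α) := by gcongr; linarith
    _ = (1 + s) ^ (-α) := by
      rw [← Real.rpow_natCast, ← Real.rpow_add (by positivity), Nat.cast_sub hd]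
      congr 1; push_cast; ring

/-- The hypothesis `1 ≤ F L` serves the case `d = 0`, where the space is a point and there are no
polar coordinates. -/
theorem exists_setIntegral_ball_le {F : ℝ → ℝ} (hF : ∀ L, 1 ≤ L → 1 ≤ F L)
    (hF' : ∀ L, 1 ≤ L → ∫ s in (0:ℝ)..L, (1 + s) ^ (-α) ≤ F L) :
    ∃ C, 0 ≤ C ∧ ∀ L, 1 ≤ L →
      ∫ z in Metric.ball (0 : Space d) L, (1 + ‖z‖) ^ (1 - (d : ℝ) - α) ≤ C * F L := by
  rcases Nat.eq_zero_or_pos d with rfl | hd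
  · refine ⟨(volume : Measure (Space 0)).real univ, by positivity, fun L hL => ?_⟩
    have hb : Metric.ball (0 : Space 0) L = univ := by
      ext z; simp [Subsingleton.elim z 0]; linarith
    have hz : ∀ z : Space 0, (1 + ‖z‖) ^ (1 - ((0 : ℕ) : ℝ) - α) = 1 := fun z => by
      simp [Subsingleton.elim z 0]
    simp_rw [hz, hb]
    rw [setIntegral_univ, integral_const, smul_eq_mul, mul_one]
    exact le_mul_of_one_le_right measureReal_nonneg (hF L hL)
  · have : NeZero d := ⟨hd.ne'⟩
    refine ⟨(volume : Measure (Space d)).toSphere.real univ, by positivity, fun L hL => ?_⟩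
    refine (setIntegral_ball_rpow_le (by linarith)).trans ?_
    gcongr
    exact hF' L hL

theorem exists_setIntegral_ball_le_of_lt_one (hα₀ : 0 < α) (hα₁ : α < 1) :
    ∃ C, 0 ≤ C ∧ ∀ L, 1 ≤ L →
      ∫ z in Metric.ball (0 : Space d) L, (1 + ‖z‖) ^ (1 - (d : ℝ) - α) ≤ C * L ^ (1 - α) := by
  have hF : ∀ L : ℝ, 1 ≤ L → 1 ≤ L ^ (1 - α) / (1 - α) := fun L hL => by
    rw [le_div_iff₀ (by linarith)]
    have := Real.one_le_rpow hL (show 0 ≤ 1 - α by linarith)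
    linarith
  have hF' : ∀ L : ℝ, 1 ≤ L →
      ∫ s in (0:ℝ)..L, (1 + s) ^ (-α) ≤ L ^ (1 - α) / (1 - α) := fun L hL => by
    have h1 : ∫ s in (0:ℝ)..L, s ^ (-α) = L ^ (1 - α) / (1 - α) := by
      rw [integral_rpow (Or.inl (by linarith)), Real.zero_rpow (by linarith)]
      ring_nf
    rw [← h1]
    have hc : ContinuousOn (fun s : ℝ => (1 + s) ^ (-α)) (uIcc 0 L) := by
      intro s hs
      rw [uIcc_of_le (by linarith)] at hs
      exact (ContinuousAt.rpow_const (by fun_prop) (Or.inl (by linarith [hs.1]))).continuousWithinAt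
    refine intervalIntegral.integral_mono_on_of_le_Ioo (by linarith) hc.intervalIntegrable
      (intervalIntegral.intervalIntegrable_rpow' (by linarith)) fun s hs => ?_
    exact Real.rpow_le_rpow_of_nonpos hs.1 (by linarith) (by linarith)
  obtain ⟨C, hC, h⟩ := exists_setIntegral_ball_le (d := d) hF hF'
  exact ⟨C / (1 - α), div_nonneg hC (by linarith), fun L hL => (h L hL).trans_eq (by ring)⟩

theorem exists_setIntegral_ball_le_log :
    ∃ C, 0 ≤ C ∧ ∀ L, 1 ≤ L →
      ∫ z in Metric.ball (0 : Space d) L, (1 + ‖z‖) ^ (1 - (d : ℝ) - 1) ≤ C * (1 + Real.log L) := by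
  refine exists_setIntegral_ball_le (fun L hL => ?_) (fun L hL => ?_)
  · linarith [Real.log_nonneg hL]
  · have h1 : ∫ s in (0:ℝ)..L, (1 + s) ^ (-1 : ℝ) = Real.log (1 + L) := by
      simp_rw [Real.rpow_neg_one]
      rw [intervalIntegral.integral_comp_add_left (fun s => s⁻¹), integral_inv_of_pos] <;>
        norm_num
      linarith
    rw [h1]
    have h2 : Real.log (1 + L) ≤ Real.log (2 * L) :=
      Real.log_le_log (by linarith) (by linarith)
    rw [Real.log_mul (by norm_num) (by linarith)] at h2
    linarith [Real.log_two_lt_d9]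

/-! ### Truncated profiles and their slab integrals -/

/-- The profile restricted to a set, in coordinates. -/
def truncProfile (α : ℝ) (G : Set (Space (d + 1))) (v : ℝ) (z : Space d) : ℝ :=
  G.indicator (profile α) (consPoint v z)

theorem abs_truncProfile_le (G : Set (Space (d + 1))) (v : ℝ) (z : Space d) :
    |truncProfile α G v z| ≤ |profile α (consPoint v z)| :=
  norm_indicator_le_norm_self (profile α) _

theorem measurable_truncProfile (hα₀ : 0 < α) (hα₂ : α < 2) {G : Set (Space (d + 1))}
    (hG : MeasurableSet G) : Measurable (Function.uncurry (truncProfile (d := d) α G)) :=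
  ((profile_continuous hα₀ hα₂).measurable.indicator hG).comp continuous_consPoint.measurable

theorem integrable_truncProfile_left (hα₀ : 0 < α) (hα₂ : α < 2) {G : Set (Space (d + 1))}
    (hG : MeasurableSet G) (z : Space d) : Integrable (fun v => truncProfile α G v z) :=
  (integrable_profile_consPoint_left hα₀ hα₂ z).norm.mono'
    ((measurable_truncProfile hα₀ hα₂ hG).comp
      (measurable_id.prodMk measurable_const)).aestronglyMeasurable
    (Eventually.of_forall fun v => abs_truncProfile_le G v z)

theorem integrable_truncProfile (hα₀ : 0 < α) (hα₂ : α < 2) {G : Set (Space (d + 1))}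
    (hG : MeasurableSet G) : Integrable (fun p : ℝ × Space d => truncProfile α G p.1 p.2) :=
  integrable_consPoint.2 ((profile_integrable hα₀ hα₂).indicator hG)

/-- Invariance under the reflections of the two factors of `ℝ × ℝ^d`. -/
def IsBisymmetric (G : Set (Space (d + 1))) : Prop :=
  (∀ v z, consPoint (-v) z ∈ G ↔ consPoint v z ∈ G) ∧ ∀ v z, consPoint v (-z) ∈ G ↔ consPoint v z ∈ G

theorem IsBisymmetric.truncProfile_neg_left {G : Set (Space (d + 1))} (hG : IsBisymmetric G)
    (v : ℝ) (z : Space d) : truncProfile α G (-v) z = truncProfile α G v z := by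
  unfold truncProfile
  by_cases h : consPoint v z ∈ G
  · rw [indicator_of_mem h, indicator_of_mem ((hG.1 v z).2 h), profile_consPoint_neg_left]
  · rw [indicator_of_notMem h, indicator_of_notMem (mt (hG.1 v z).1 h)]

theorem IsBisymmetric.truncProfile_neg_right {G : Set (Space (d + 1))} (hG : IsBisymmetric G)
    (v : ℝ) (z : Space d) : truncProfile α G v (-z) = truncProfile α G v z := by
  unfold truncProfile
  by_cases h : consPoint v z ∈ G
  · rw [indicator_of_mem h, indicator_of_mem ((hG.2 v z).2 h), profile_consPoint_neg_right]
  · rw [indicator_of_notMem h, indicator_of_notMem (mt (hG.2 v z).1 h)]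

theorem isBisymmetric_ball (L : ℝ) : IsBisymmetric (Metric.ball (0 : Space (d + 1)) L) := by
  have h : ∀ v w : ℝ, ∀ z y : Space d, v ^ 2 = w ^ 2 → ‖z‖ = ‖y‖ →
      (consPoint v z ∈ Metric.ball (0 : Space (d + 1)) L ↔ consPoint w y ∈ Metric.ball 0 L) := by
    intro v w z y h1 h2
    have : ‖consPoint v z‖ = ‖consPoint w y‖ := by
      rw [← sq_eq_sq₀ (norm_nonneg _) (norm_nonneg _), norm_consPoint_sq, norm_consPoint_sq, h1, h2]
    simp [this]
  exact ⟨fun v z => h _ _ _ _ (neg_sq v) rfl, fun v z => h _ _ _ _ rfl (norm_neg z)⟩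

theorem isBisymmetric_cylinder (L : ℝ) :
    IsBisymmetric {x : Space (d + 1) | ‖tailPoint x‖ < L} := by
  constructor <;> intro v z <;> simp

/-- The first term in the expansion of the slab integral. -/
theorem tendsto_integral_slab_const (hα₀ : 0 < α) (hα₂ : α < 2)
    {G : ℕ → Set (Space (d + 1))} (hG : ∀ k, MeasurableSet (G k))
    (hGlim : ∀ R : ℝ, ∀ᶠ k in atTop, Metric.ball 0 R ⊆ G k)
    {θ a : ℕ → ℝ} {a₀ : ℝ} {q : ℕ → Space d →L[ℝ] ℝ}
    (hθ0 : ∀ k, 0 < θ k) (hθ : Tendsto θ atTop (𝓝 0)) (ha : Tendsto a atTop (𝓝 a₀))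
    (hq : Tendsto q atTop (𝓝 0)) :
    Tendsto (fun k => (θ k)⁻¹ * ∫ z : Space d, slab (truncProfile α (G k))
      (fun _ => θ k * a k) (fun z => q k z) z) atTop
      (𝓝 (2 * a₀ * ∫ z : Space d, profile α (zeroCons z))) := by
  obtain ⟨C, hC, hb, -⟩ := exists_profile_consPoint_le (d := d) hα₀ hα₂
  obtain ⟨M, hM⟩ := ha.abs.bddAbove_range
  have hM' : ∀ k, |a k| ≤ M := fun k => hM ⟨k, rfl⟩
  have h := tendsto_integral_slab_div (W := fun k => truncProfile α (G k))
    (W₀ := fun z : Space d => profile α (consPoint 0 z)) (A := fun k _ => a k)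
    (A₀ := fun _ => a₀) (g := fun _ => M)
    (q := fun k z => q k z) (θ := θ)
    (fun k => measurable_truncProfile hα₀ hα₂ (hG k))
    (fun k => by fun_prop) (fun k => by fun_prop)
    (fun k v z => (abs_truncProfile_le _ v z).trans (hb v z)) (fun k z => hM' k)
    (integrable_const_mul_rpow hα₀ M) (fun z => ha) hθ
    (fun k => (hθ0 k).ne') (tendsto_clm_apply_zero hq) (fun z => ?_)
  · rw [integral_const_mul, ← mul_assoc] at h
    exact h
  · refine (tendsto_profile_consPoint hα₀ hα₂ z).congr' ?_
    have h1 : ∀ᶠ v in 𝓝 (0:ℝ), |v| < 1 := by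
      have : Tendsto (fun v : ℝ => |v|) (𝓝 0) (𝓝 0) := by simpa using (continuous_abs.tendsto (0:ℝ))
      exact this.eventually_lt_const one_pos
    filter_upwards [(hGlim (1 + ‖z‖)).prod_mk h1] with p hp
    unfold truncProfile
    rw [indicator_of_mem (hp.1 _)]
    rw [mem_ball_zero_iff]
    have := norm_consPoint_le p.2 z
    linarith [hp.2]

theorem integrable_slab_of_le {W : ℝ → Space d → ℝ} {κ q g b : Space d → ℝ}
    (hW : Measurable (Function.uncurry W)) (hκ : Measurable κ) (hq : Measurable q)
    (hb : ∀ v z, |W v z| ≤ b z) (hg : Integrable g) (hκb : ∀ z, 2 * |κ z| * b z ≤ g z) :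
    Integrable (slab W κ q) :=
  hg.mono' (measurable_slab hW hκ hq).aestronglyMeasurable
    (Eventually.of_forall fun z => (abs_slab_le fun v => hb v z).trans (hκb z))

theorem one_add_norm_rpow_sq_mul_le (z : Space d) :
    ‖z‖ ^ 2 * (1 + ‖z‖) ^ (-((d : ℝ) + 1 + α)) ≤ (1 + ‖z‖) ^ (1 - (d : ℝ) - α) := by
  have h0 := norm_nonneg z
  calc ‖z‖ ^ 2 * (1 + ‖z‖) ^ (-((d : ℝ) + 1 + α))
      ≤ (1 + ‖z‖) ^ (2:ℝ) * (1 + ‖z‖) ^ (-((d : ℝ) + 1 + α)) := by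
        rw [Real.rpow_two]; gcongr; linarith
    _ = _ := by rw [← Real.rpow_add (by positivity)]; congr 1; ring

theorem integrableOn_ball_rpow (L β : ℝ) :
    IntegrableOn (fun z : Space d => (1 + ‖z‖) ^ β) (Metric.ball 0 L) := by
  have hc : Continuous fun z : Space d => (1 + ‖z‖) ^ β :=
    Continuous.rpow_const (by fun_prop) fun z => Or.inl (by positivity)
  exact ((hc.continuousOn).integrableOn_compact (isCompact_closedBall 0 L)).mono_set
    Metric.ball_subset_closedBall

/-- If the truncation set is contained in a cylinder, the slab integral splits. -/
theorem signIntegral_eq_of_cylinder (hα₀ : 0 < α) (hα₂ : α < 2)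
    (B : Space d →L[ℝ] Space d →L[ℝ] ℝ) {G : Set (Space (d + 1))} (hG : MeasurableSet G)
    (hGs : IsBisymmetric G) {L : ℝ} (hGL : ∀ v z, consPoint v z ∈ G → ‖z‖ < L)
    (s r : ℝ) (q : Space d →L[ℝ] ℝ) :
    Integrable (fun z => slab (truncProfile α G) (fun z => s - r * (B z z / 2)) (fun z => q z) z -
        slab (truncProfile α G) (fun _ => s) (fun z => q z) z) ∧
    ∫ p : ℝ × Space d, truncProfile α G p.1 p.2 *
        signUpper (p.1 + q p.2 - (s - r * (B p.2 p.2 / 2))) =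
      -(∫ z, slab (truncProfile α G) (fun _ => s) (fun z => q z) z) -
        ∫ z, (slab (truncProfile α G) (fun z => s - r * (B z z / 2)) (fun z => q z) z -
          slab (truncProfile α G) (fun _ => s) (fun z => q z) z) := by
  obtain ⟨C, hC, hb, -⟩ := exists_profile_consPoint_le (d := d) hα₀ hα₂
  have hBm : Measurable fun z : Space d => B z z :=
    (by fun_prop : Continuous fun z : Space d => B z z).measurable
  have hm := measurable_truncProfile hα₀ hα₂ hG
  -- Because the truncated profile vanishes over `‖z‖ ≥ L`, the majorant has bounded support, and
  -- the quadratic thickness stays integrable for every `α`.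
  set b : Space d → ℝ := fun z => (Metric.ball 0 L).indicator
    (fun z => C * (1 + ‖z‖) ^ (-((d : ℝ) + 1 + α))) z with hbdef
  have hWb : ∀ v z, |truncProfile α G v z| ≤ b z := by
    intro v z
    by_cases h : consPoint v z ∈ G
    · have := hGL v z h
      rw [hbdef]
      simp only
      rw [indicator_of_mem (mem_ball_zero_iff.2 this)]
      exact (abs_truncProfile_le _ v z).trans (hb v z)
    · rw [truncProfile, indicator_of_notMem h, abs_zero]
      exact indicator_nonneg (fun z _ => by positivity) z
  have hi1 : Integrable (slab (truncProfile α G) (fun z => s - r * (B z z / 2)) (fun z => q z)) := by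
    refine integrable_slab_of_le hm (by fun_prop) (by fun_prop) hWb
      (g := (Metric.ball 0 L).indicator fun z => 2 * |s - r * (B z z / 2)| *
        (C * (1 + ‖z‖) ^ (-((d : ℝ) + 1 + α)))) ?_ fun z => ?_
    · rw [integrable_indicator_iff measurableSet_ball]
      have hc : Continuous fun z : Space d => 2 * |s - r * (B z z / 2)| *
          (C * (1 + ‖z‖) ^ (-((d : ℝ) + 1 + α))) := by
        refine Continuous.mul (by fun_prop) (continuous_const.mul ?_)
        exact Continuous.rpow_const (by fun_prop) fun z => Or.inl (by positivity)
      exact ((hc.continuousOn).integrableOn_compact (isCompact_closedBall 0 L)).mono_set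
        Metric.ball_subset_closedBall
    · by_cases hz : z ∈ Metric.ball 0 L
      · simp [hbdef, indicator_of_mem hz]
      · simp [hbdef, indicator_of_notMem hz]
  have hi2 : Integrable (slab (truncProfile α G) (fun _ => s) (fun z => q z)) :=
    integrable_slab_of_le hm (by fun_prop) (by fun_prop)
      (fun v z => (abs_truncProfile_le _ v z).trans (hb v z))
      (integrable_const_mul_rpow hα₀ (2 * |s|)) fun z => le_rfl
  refine ⟨hi1.sub hi2, ?_⟩
  rw [integral_sub hi1 hi2, integral_mul_signUpper_eq_neg_slab (W := truncProfile α G)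
    (κ := fun z => s - r * (B z z / 2)) (q := fun z => q z) (integrable_truncProfile hα₀ hα₂ hG)
    (integrable_truncProfile_left hα₀ hα₂ hG) hGs.truncProfile_neg_left hGs.truncProfile_neg_right
    (by fun_prop) (by fun_prop) (fun z => by simp) (fun z => by simp)]
  ring

/-- The curvature term changes the half-thickness by at most `r ‖B‖ ‖z‖² / 2`, and the profile over
`z` is at most a multiple of `(1 + ‖z‖) ^ (-(d + 1 + α))`. The constant depends on neither the
truncation nor `s` nor `q`. -/
theorem abs_slab_sub_slab_le (hα₀ : 0 < α) (hα₂ : α < 2) :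
    ∃ C, 0 < C ∧ ∀ (B : Space d →L[ℝ] Space d →L[ℝ] ℝ) {G : Set (Space (d + 1))}
    (_ : MeasurableSet G) (s : ℝ) {r : ℝ} (_ : 0 < r) (q : Space d →L[ℝ] ℝ) (z : Space d),
    |slab (truncProfile α G) (fun z => s - r * (B z z / 2)) (fun z => q z) z -
        slab (truncProfile α G) (fun _ => s) (fun z => q z) z| ≤
      r * (C * ‖B‖ * (1 + ‖z‖) ^ (1 - (d : ℝ) - α)) := by
  obtain ⟨C, hC, hb, -⟩ := exists_profile_consPoint_le (d := d) hα₀ hα₂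
  refine ⟨C, hC, fun B G hG s r hr q z => ?_⟩
  have h1 := abs_slab_sub_le (W := truncProfile α G) (κ := fun z => s - r * (B z z / 2))
    (s := fun _ => s) (q := fun z => q z) (c := 0) (z := z)
    (b := C * (1 + ‖z‖) ^ (-((d : ℝ) + 1 + α))) (integrable_truncProfile_left hα₀ hα₂ hG z)
    (fun v _ => by rw [sub_zero]; exact (abs_truncProfile_le _ _ z).trans (hb _ z))
  simp only [mul_zero, sub_zero] at h1
  refine h1.trans ?_
  have h2 : |B z z| ≤ ‖B‖ * ‖z‖ * ‖z‖ := B.le_opNorm₂ z z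
  have h3 : |s - r * (B z z / 2) - s| = r * (|B z z| / 2) := by
    rw [show s - r * (B z z / 2) - s = -(r * (B z z / 2)) by ring, abs_neg, abs_mul, abs_div,
      abs_two, abs_of_pos hr]
  rw [h3]
  calc 2 * (r * (|B z z| / 2)) * (C * (1 + ‖z‖) ^ (-((d : ℝ) + 1 + α)))
      = r * (C * |B z z| * (1 + ‖z‖) ^ (-((d : ℝ) + 1 + α))) := by ring
    _ ≤ r * (C * (‖B‖ * ‖z‖ * ‖z‖) * (1 + ‖z‖) ^ (-((d : ℝ) + 1 + α))) := by gcongr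
    _ = r * (C * ‖B‖ * (‖z‖ ^ 2 * (1 + ‖z‖) ^ (-((d : ℝ) + 1 + α)))) := by ring
    _ ≤ _ := by gcongr; exact one_add_norm_rpow_sq_mul_le z

theorem slab_sub_slab_eq_zero {G : Set (Space (d + 1))} {L : ℝ}
    (hGL : ∀ v z, consPoint v z ∈ G → ‖z‖ < L) {z : Space d} (hz : z ∉ Metric.ball 0 L)
    (κ s q : Space d → ℝ) :
    slab (truncProfile α G) κ q z - slab (truncProfile α G) s q z = 0 := by
  have : ∀ v, truncProfile α G v z = 0 := fun v =>
    indicator_of_notMem (fun h => hz (mem_ball_zero_iff.2 (hGL v z h))) _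
  simp [slab, this]

/-- The slab of constant half-thickness `r^α a` gives the main term. The curvature adds at most a
multiple of `r (ρ / r) ^ (1 - α) = r^α ρ ^ (1 - α)`, of the same order in `r` but small with `ρ`.
The constant is chosen before `ρ` and the sequences, so `ρ → 0` is possible later. -/
theorem eventually_signIntegral_le_of_lt_one (hα₀ : 0 < α) (hα₁ : α < 1)
    (B : Space d →L[ℝ] Space d →L[ℝ] ℝ) :
    ∃ C, 0 ≤ C ∧ ∀ {r a : ℕ → ℝ} {a₀ : ℝ} {q : ℕ → Space d →L[ℝ] ℝ}
    (_ : ∀ k, 0 < r k) (_ : Tendsto r atTop (𝓝 0)) (_ : Tendsto a atTop (𝓝 a₀))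
    (_ : Tendsto q atTop (𝓝 0)), ∀ ρ, 0 < ρ → ∀ ε, 0 < ε → ∀ᶠ k in atTop,
      (r k ^ α)⁻¹ * (∫ p : ℝ × Space d, truncProfile α (Metric.ball 0 (ρ / r k)) p.1 p.2 *
        signUpper (p.1 + q k p.2 - (r k ^ α * a k - r k * (B p.2 p.2 / 2)))) ≤
      -(2 * a₀ * ∫ z : Space d, profile α (zeroCons z)) + C * ρ ^ (1 - α) + ε := by
  have hα₂ : α < 2 := by linarith
  obtain ⟨C, hC, hD⟩ := abs_slab_sub_slab_le (d := d) hα₀ hα₂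
  obtain ⟨V, hV, hVb⟩ := exists_setIntegral_ball_le_of_lt_one (d := d) hα₀ hα₁
  refine ⟨C * ‖B‖ * V, by positivity, fun {r a a₀ q} hr0 hr ha hq ρ hρ ε hε => ?_⟩
  have hrlim : Tendsto (fun k => ρ / r k) atTop atTop := by
    refine Tendsto.const_mul_atTop hρ (tendsto_inv_nhdsGT_zero.comp ?_)
    exact tendsto_nhdsWithin_iff.2 ⟨hr, Eventually.of_forall hr0⟩
  have hθ : Tendsto (fun k => r k ^ α) atTop (𝓝 0) := by
    have := hr.rpow_const (p := α) (Or.inr hα₀.le)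
    rwa [Real.zero_rpow hα₀.ne'] at this
  have hmain := tendsto_integral_slab_const (d := d) hα₀ hα₂
    (G := fun k => Metric.ball 0 (ρ / r k)) (fun k => measurableSet_ball)
    (fun R => (hrlim.eventually_ge_atTop R).mono fun k hk => Metric.ball_subset_ball hk)
    (fun k => Real.rpow_pos_of_pos (hr0 k) α) hθ ha hq
  filter_upwards [hmain.eventually_const_lt (sub_lt_self _ hε), hrlim.eventually_ge_atTop 1]
    with k hk hL
  have hGL : ∀ v (z : Space d), consPoint v z ∈ Metric.ball (0 : Space (d + 1)) (ρ / r k) →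
      ‖z‖ < ρ / r k := fun v z h =>
    (norm_le_norm_consPoint v z).trans_lt (mem_ball_zero_iff.1 h)
  obtain ⟨hDi, hS⟩ := signIntegral_eq_of_cylinder hα₀ hα₂ B measurableSet_ball
    (isBisymmetric_ball (ρ / r k)) hGL (r k ^ α * a k) (r k) (q k)
  rw [hS, mul_sub, mul_neg]
  set D : Space d → ℝ := fun z => slab (truncProfile α (Metric.ball 0 (ρ / r k)))
    (fun z => r k ^ α * a k - r k * (B z z / 2)) (fun z => q k z) z -
      slab (truncProfile α (Metric.ball 0 (ρ / r k))) (fun _ => r k ^ α * a k)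
        (fun z => q k z) z with hDdef
  have h1 : -(∫ z, D z) ≤ r k * (C * ‖B‖ * (V * (ρ / r k) ^ (1 - α))) := by
    rw [← integral_neg]
    calc ∫ z, -D z ≤ ∫ z : Space d, (Metric.ball 0 (ρ / r k)).indicator
          (fun z => r k * (C * ‖B‖ * (1 + ‖z‖) ^ (1 - (d : ℝ) - α))) z := by
          refine integral_mono hDi.neg ?_ fun z => ?_
          · rw [integrable_indicator_iff measurableSet_ball]
            exact ((integrableOn_ball_rpow _ _).const_mul _).const_mul _
          · by_cases hz : z ∈ Metric.ball 0 (ρ / r k)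
            · rw [indicator_of_mem hz]
              exact (neg_le_abs _).trans (hD B measurableSet_ball _ (hr0 k) (q k) z)
            · rw [indicator_of_notMem hz, hDdef]
              simp only
              rw [slab_sub_slab_eq_zero hGL hz, neg_zero]
      _ = r k * (C * ‖B‖ * ∫ z in Metric.ball (0 : Space d) (ρ / r k),
          (1 + ‖z‖) ^ (1 - (d : ℝ) - α)) := by
          rw [integral_indicator measurableSet_ball, integral_const_mul, integral_const_mul]
      _ ≤ _ := by
          have := hVb _ hL
          have := (hr0 k).le
          gcongr
  have h2 : (r k ^ α)⁻¹ * (r k * (C * ‖B‖ * (V * (ρ / r k) ^ (1 - α)))) =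
      C * ‖B‖ * V * ρ ^ (1 - α) := by
    have hrk := hr0 k
    rw [Real.div_rpow hρ.le hrk.le]
    have : r k = r k ^ α * r k ^ (1 - α) := by
      rw [← Real.rpow_add hrk]; simp
    have h3 : 0 < r k ^ (1 - α) := by positivity
    have h4 : 0 < r k ^ α := by positivity
    field_simp
    nth_rw 1 [this]
    ring
  have h3 : -((r k ^ α)⁻¹ * ∫ z, D z) ≤ C * ‖B‖ * V * ρ ^ (1 - α) := by
    rw [← h2, ← mul_neg]
    have : 0 < r k ^ α := Real.rpow_pos_of_pos (hr0 k) _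
    gcongr
  linarith

/-! ### The critical exponent -/

/-- In the cone `|v| ≤ η ‖z‖` the ratio `‖z‖ / ‖(v, z)‖` is close to one, so the tail limit may be
written in terms of `‖z‖` alone, with a relative error. -/
theorem exists_profile_consPoint_near_tail (hα₀ : 0 < α) (hα₂ : α < 2) {ε : ℝ} (hε : 0 < ε) :
    ∃ η R : ℝ, 0 < η ∧ 1 ≤ R ∧ ∀ (v : ℝ) (z : Space d), R ≤ ‖z‖ → |v| ≤ η * ‖z‖ →
      |profile α (consPoint v z) - tailConst d α * ‖z‖ ^ (-((d : ℝ) + 1 + α))| ≤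
        ε * ‖z‖ ^ (-((d : ℝ) + 1 + α)) := by
  set m : ℝ := (d : ℝ) + 1 + α with hm
  set A := tailConst d α with hA
  have hcont : Tendsto (fun p : ℝ × ℝ => p.1 * p.2 ^ m) (𝓝 A ×ˢ 𝓝 1) (𝓝 A) := by
    have : ContinuousAt (fun p : ℝ × ℝ => p.1 * p.2 ^ m) (A, 1) := by
      refine continuousAt_fst.mul (ContinuousAt.rpow_const continuousAt_snd (Or.inl ?_))
      exact one_ne_zero
    have h := this.tendsto
    rw [nhds_prod_eq] at h
    simpa using h
  have hev := Metric.tendsto_nhds.1 hcont ε hε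
  rw [eventually_prod_iff] at hev
  obtain ⟨pa, hpa, pb, hpb, hp⟩ := hev
  obtain ⟨δ, hδ, hpb'⟩ := Metric.eventually_nhds_iff.1 hpb
  have h2 := (tendsto_rpow_mul_profile (d := d) hα₀ hα₂).eventually hpa
  rw [← comap_norm_atTop, eventually_comap] at h2
  obtain ⟨R, hR⟩ := eventually_atTop.1 h2
  refine ⟨δ / 2, max R 1, by positivity, le_max_right _ _, fun v z hz hv => ?_⟩
  have hz1 : 1 ≤ ‖z‖ := (le_max_right _ _).trans hz
  have hz0 : 0 < ‖z‖ := by linarith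
  have hxz := norm_le_norm_consPoint v z
  have hxz' := norm_consPoint_le v z
  have hx0 : 0 < ‖consPoint v z‖ := by linarith
  have h3 := hR ‖consPoint v z‖ (((le_max_left _ _).trans hz).trans hxz) _ rfl
  have h4 : dist (‖z‖ / ‖consPoint v z‖) 1 < δ := by
    have h5 : ‖z‖ / ‖consPoint v z‖ ≤ 1 := (div_le_one hx0).2 hxz
    have h6 : 1 - δ / 2 ≤ ‖z‖ / ‖consPoint v z‖ := by
      rw [le_div_iff₀ hx0]
      nlinarith
    rw [Real.dist_eq, abs_sub_comm, abs_of_nonneg (by linarith)]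
    linarith
  have h7 := hp h3 (hpb' h4)
  simp only [Real.dist_eq] at h7
  rw [Real.div_rpow hz0.le hx0.le] at h7
  have h8 : ‖consPoint v z‖ ^ m * profile α (consPoint v z) * (‖z‖ ^ m / ‖consPoint v z‖ ^ m) =
      profile α (consPoint v z) * ‖z‖ ^ m := by
    have : 0 < ‖consPoint v z‖ ^ m := by positivity
    field_simp
  rw [h8] at h7
  have hzm : 0 < ‖z‖ ^ m := by positivity
  rw [Real.rpow_neg hz0.le]
  have h9 : profile α (consPoint v z) - A * (‖z‖ ^ m)⁻¹ =
      (profile α (consPoint v z) * ‖z‖ ^ m - A) * (‖z‖ ^ m)⁻¹ := by field_simp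
  rw [h9, abs_mul, abs_of_pos (inv_pos.2 hzm)]
  gcongr

/-- The annulus `{R ≤ ‖z‖ < L}`. -/
def annulus (d : ℕ) (R L : ℝ) : Set (Space d) := {z | R ≤ ‖z‖ ∧ ‖z‖ < L}

theorem measurableSet_annulus (R L : ℝ) : MeasurableSet (annulus d R L) :=
  (measurableSet_le measurable_const measurable_norm).inter
    (measurableSet_lt measurable_norm measurable_const)

theorem integrableOn_annulus {R L : ℝ} (hR : 0 < R) {f : Space d → ℝ}
    (hf : ContinuousOn f {0}ᶜ) : IntegrableOn f (annulus d R L) := by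
  have hK : IsCompact {z : Space d | R ≤ ‖z‖ ∧ ‖z‖ ≤ L} := by
    refine (isCompact_closedBall (0 : Space d) L).of_isClosed_subset ?_ fun z hz => ?_
    · exact (isClosed_le continuous_const continuous_norm).inter
        (isClosed_le continuous_norm continuous_const)
    · simpa using hz.2
  refine (ContinuousOn.integrableOn_compact hK (hf.mono fun z hz => ?_)).mono_set
    fun z hz => ⟨hz.1, hz.2.le⟩
  have := hR.trans_le hz.1
  exact norm_pos_iff.1 this

theorem continuousOn_norm_rpow (β : ℝ) : ContinuousOn (fun z : Space d => ‖z‖ ^ β) {0}ᶜ :=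
  fun z hz => (ContinuousAt.rpow_const (by fun_prop)
    (Or.inl (norm_ne_zero_iff.2 hz))).continuousWithinAt

theorem setIntegral_annulus_inv [NeZero d] {R L : ℝ} (hR : 0 < R) (hRL : R ≤ L) :
    ∫ z in annulus d R L, ‖z‖ ^ (-(d : ℝ)) =
      (volume : Measure (Space d)).toSphere.real univ * Real.log (L / R) := by
  have hd : 0 < d := Nat.pos_of_ne_zero (NeZero.ne d)
  have : Nontrivial (Space d) := by
    have : Nonempty (Fin d) := ⟨⟨0, hd⟩⟩
    infer_instance
  have h1 : ∫ z in annulus d R L, ‖z‖ ^ (-(d : ℝ)) =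
      ∫ z : Space d, (fun s : ℝ => (Ico R L).indicator (fun s => s ^ (-(d : ℝ))) s) ‖z‖ := by
    rw [← integral_indicator (measurableSet_annulus R L)]
    congr 1
  rw [h1, integral_fun_norm_addHaar, Measure.toSphere_real_apply_univ, nsmul_eq_mul, smul_eq_mul,
    mul_assoc]
  congr 2
  have h2 : ∀ s ∈ Ioi (0:ℝ), s ^ (Module.finrank ℝ (Space d) - 1) •
      (Ico R L).indicator (fun s => s ^ (-(d : ℝ))) s = (Ico R L).indicator (fun s => s⁻¹) s := by
    intro s hs
    have hs0 : 0 < s := hs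
    by_cases h : s ∈ Ico R L
    · rw [indicator_of_mem h, indicator_of_mem h, finrank_euclideanSpace, Fintype.card_fin,
        smul_eq_mul, ← Real.rpow_natCast, ← Real.rpow_add hs0, Nat.cast_sub hd, ← Real.rpow_neg_one]
      congr 1; push_cast; ring
    · rw [indicator_of_notMem h, indicator_of_notMem h, smul_zero]
  rw [setIntegral_congr_fun measurableSet_Ioi h2, setIntegral_indicator measurableSet_Ico,
    inter_eq_self_of_subset_right (show Ico R L ⊆ Ioi 0 from fun s hs => hR.trans_le hs.1), integral_Ico_eq_integral_Ioo,
    ← integral_Ioc_eq_integral_Ioo, ← intervalIntegral.integral_of_le hRL,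
    integral_inv_of_pos hR (hR.trans_le hRL)]

/-- A radial weight replaces `B z z` by the trace of `B` over `d` times `‖z‖²`, which leaves the
weight `‖z‖ ^ (-d)`, whose integral is logarithmic. -/
theorem setIntegral_annulus_bilin [NeZero d] {R L : ℝ} (hR : 0 < R) (hRL : R ≤ L)
    (B : Space d →L[ℝ] Space d →L[ℝ] ℝ) :
    ∫ z in annulus d R L, ‖z‖ ^ (-((d : ℝ) + 1 + 1)) * B z z =
      (∑ i, B (EuclideanSpace.single i 1) (EuclideanSpace.single i 1)) / d *
      ((volume : Measure (Space d)).toSphere.real univ * Real.log (L / R)) := by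
  have hd : 0 < d := Nat.pos_of_ne_zero (NeZero.ne d)
  set f : Space d → ℝ := (annulus d R L).indicator fun z => ‖z‖ ^ (-((d : ℝ) + 1 + 1)) with hf
  have hrad : ∀ (O : Space d ≃ₗᵢ[ℝ] Space d) z, f (O z) = f z := by
    intro O z
    by_cases h : z ∈ annulus d R L
    · have h' : O z ∈ annulus d R L := by simpa [annulus] using h
      rw [hf, indicator_of_mem h, indicator_of_mem h', O.norm_map]
    · have h' : O z ∉ annulus d R L := by simpa [annulus] using h
      rw [hf, indicator_of_notMem h, indicator_of_notMem h']
  have hmul : ∀ g : Space d → ℝ, ∫ z, f z * g z =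
      ∫ z in annulus d R L, ‖z‖ ^ (-((d : ℝ) + 1 + 1)) * g z := by
    intro g
    rw [← integral_indicator (measurableSet_annulus R L)]
    congr 1; ext z
    by_cases h : z ∈ annulus d R L
    · rw [hf, indicator_of_mem h, indicator_of_mem h]
    · rw [hf, indicator_of_notMem h, indicator_of_notMem h, zero_mul]
  have hi : Integrable fun z => f z * ‖z‖ ^ 2 := by
    have : (fun z => f z * ‖z‖ ^ 2) = (annulus d R L).indicator
        fun z => ‖z‖ ^ (-((d : ℝ) + 1 + 1)) * ‖z‖ ^ 2 := by
      ext z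
      by_cases h : z ∈ annulus d R L
      · rw [hf, indicator_of_mem h, indicator_of_mem h]
      · rw [hf, indicator_of_notMem h, indicator_of_notMem h, zero_mul]
    rw [this, integrable_indicator_iff (measurableSet_annulus R L)]
    exact integrableOn_annulus hR ((continuousOn_norm_rpow _).mul (by fun_prop))
  have hm : AEStronglyMeasurable f :=
    ((by fun_prop : Measurable fun z : Space d => ‖z‖ ^ (-((d : ℝ) + 1 + 1))).indicator
      (measurableSet_annulus R L)).aestronglyMeasurable
  have h1 := integral_radial_mul_bilin hrad hi hm B ⟨0, hd⟩
  have h2 := natCast_mul_integral_radial_mul_sq hrad hi hm ⟨0, hd⟩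
  rw [hmul] at h1
  have h3 : ∫ z, f z * ‖z‖ ^ 2 = ∫ z in annulus d R L, ‖z‖ ^ (-(d : ℝ)) := by
    rw [hmul]
    refine setIntegral_congr_fun (measurableSet_annulus R L) fun z hz => ?_
    have : 0 < ‖z‖ := hR.trans_le hz.1
    rw [← Real.rpow_two, ← Real.rpow_add this]
    congr 1; ring
  rw [h3, setIntegral_annulus_inv hR hRL] at h2
  have hd' : (d : ℝ) ≠ 0 := by positivity
  rw [h1, ← h2]
  field_simp

theorem tendsto_log_div_div_abs_log {r : ℕ → ℝ} (hr0 : ∀ k, 0 < r k)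
    (hr : Tendsto r atTop (𝓝 0)) {c : ℝ} (hc : 0 < c) :
    Tendsto (fun k => |Real.log (r k)|⁻¹ * Real.log (c / r k)) atTop (𝓝 1) := by
  have hlog : Tendsto (fun k => Real.log (r k)) atTop atBot :=
    Real.tendsto_log_nhdsGT_zero.comp (tendsto_nhdsWithin_iff.2 ⟨hr, Eventually.of_forall hr0⟩)
  have h1 : Tendsto (fun k => |Real.log (r k)|⁻¹) atTop (𝓝 0) :=
    tendsto_inv_atTop_zero.comp (tendsto_abs_atBot_atTop.comp hlog)
  have h2 := (h1.mul_const (Real.log c)).add_const 1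
  rw [zero_mul, zero_add] at h2
  refine h2.congr' ?_
  filter_upwards [hlog.eventually_lt_atBot 0] with k hk
  rw [Real.log_div hc.ne' (hr0 k).ne', abs_of_neg hk]
  have : Real.log (r k) ≠ 0 := hk.ne
  field_simp
  ring

theorem tendsto_mul_abs_log {r : ℕ → ℝ} (hr0 : ∀ k, 0 < r k) (hr : Tendsto r atTop (𝓝 0)) :
    Tendsto (fun k => r k * |Real.log (r k)|) atTop (𝓝 0) := by
  have h := (tendsto_log_mul_rpow_nhdsGT_zero one_pos).comp
    (tendsto_nhdsWithin_iff.2 ⟨hr, Eventually.of_forall hr0⟩)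
  have h2 := h.abs
  rw [abs_zero] at h2
  refine h2.congr fun k => ?_
  simp only [Function.comp, Real.rpow_one]
  rw [abs_mul, abs_of_pos (hr0 k), mul_comm]

theorem measurableSet_cylinder (L : ℝ) :
    MeasurableSet {x : Space (d + 1) | ‖tailPoint x‖ < L} := by
  have : Continuous (fun x : Space (d + 1) => tailPoint x) := by
    unfold tailPoint
    exact (PiLp.continuous_toLp 2 _).comp (continuous_pi fun i => by fun_prop)
  exact (isOpen_lt this.norm continuous_const).measurableSet

/-- For `α = 1` the difference of the slab integrals is a logarithm. -/
theorem eventually_signIntegral_le_of_eq_one (B : Space d →L[ℝ] Space d →L[ℝ] ℝ) {ε : ℝ}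
    (hε : 0 < ε) :
    ∃ ρ₀, 0 < ρ₀ ∧ ∀ {r a : ℕ → ℝ} {a₀ : ℝ} {q : ℕ → Space d →L[ℝ] ℝ}
    (_ : ∀ k, 0 < r k) (_ : ∀ k, r k < 1) (_ : Tendsto r atTop (𝓝 0))
    (_ : Tendsto a atTop (𝓝 a₀)) (_ : Tendsto q atTop (𝓝 0)), ∀ ρ, 0 < ρ → ρ ≤ ρ₀ →
      ∀ᶠ k in atTop, (r k * |Real.log (r k)|)⁻¹ * (∫ p : ℝ × Space d,
        truncProfile 1 {x | ‖tailPoint x‖ < ρ / r k} p.1 p.2 *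
        signUpper (p.1 + q k p.2 - (r k * |Real.log (r k)| * a k - r k * (B p.2 p.2 / 2)))) ≤
      -(2 * a₀ * ∫ z : Space d, profile 1 (zeroCons z)) +
        (∑ i, B (EuclideanSpace.single i 1) (EuclideanSpace.single i 1)) *
        ((volume : Measure (Space d)).toSphere.real univ / d * tailConst d 1) + ε := by
  have hα₀ : (0:ℝ) < 1 := one_pos
  have hα₂ : (1:ℝ) < 2 := one_lt_two
  set ω := (volume : Measure (Space d)).toSphere.real univ with hω
  have hω0 : 0 ≤ ω := measureReal_nonneg
  set τ := ∑ i, B (EuclideanSpace.single i 1) (EuclideanSpace.single i 1) with hτ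
  set A := tailConst d 1 with hA
  -- The relative error of the tail is later multiplied by `‖B‖ ω` and by a normalized logarithm
  -- tending to one; this choice makes its cost at most `ε / 4`.
  set ε' := ε / (4 * (‖B‖ * ω + 1)) with hε'
  have hε'0 : 0 < ε' := by positivity
  have hε'b : ε' * (‖B‖ * ω) ≤ ε / 4 := by
    rw [hε', div_mul_eq_mul_div, div_le_div_iff₀ (by positivity) (by positivity)]
    nlinarith [norm_nonneg B, mul_nonneg (norm_nonneg B) hω0]
  obtain ⟨η, R, hη, hR1, htail⟩ := exists_profile_consPoint_near_tail (d := d) hα₀ hα₂ hε'0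
  have hR0 : 0 < R := by linarith
  obtain ⟨C, hC, hD⟩ := abs_slab_sub_slab_le (d := d) hα₀ hα₂
  -- For `‖z‖ < ρ / r` the displacement by curvature is at most `ρ ‖B‖ ‖z‖ / 2 ≤ η ‖z‖ / 4`, so the
  -- slab stays in the cone where the tail approximation holds.
  refine ⟨η / (2 * (‖B‖ + 1)), by positivity, fun {r a a₀ q} hr0 hr1 hr ha hq ρ hρ hρ₀ => ?_⟩
  have hlog0 : ∀ k, 0 < |Real.log (r k)| := fun k =>
    abs_pos.2 (Real.log_neg (hr0 k) (hr1 k)).ne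
  have hθ0 : ∀ k, 0 < r k * |Real.log (r k)| := fun k => mul_pos (hr0 k) (hlog0 k)
  have hθ := tendsto_mul_abs_log hr0 hr
  have hrlim : Tendsto (fun k => ρ / r k) atTop atTop := by
    refine Tendsto.const_mul_atTop hρ (tendsto_inv_nhdsGT_zero.comp ?_)
    exact tendsto_nhdsWithin_iff.2 ⟨hr, Eventually.of_forall hr0⟩
  -- The truncation is by a cylinder and not by a ball: it keeps entire fibres, so along a slab over
  -- the annulus the truncated profile is the profile itself.
  have hmain := tendsto_integral_slab_const (d := d) hα₀ hα₂
    (G := fun k => {x | ‖tailPoint x‖ < ρ / r k}) (fun k => measurableSet_cylinder _)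
    (fun R => (hrlim.eventually_ge_atTop R).mono fun k hk x hx => by
      have h1 := norm_le_norm_consPoint (x 0) (tailPoint x)
      rw [consPoint_tailPoint] at h1
      have h2 := mem_ball_zero_iff.1 hx
      simp only [mem_ofPred_eq]
      linarith) hθ0 hθ ha hq
  set V := (volume : Measure (Space d)).real (Metric.ball 0 R) with hV
  have hlim : Tendsto (fun k => |Real.log (r k)|⁻¹ * (C * ‖B‖ * V) +
      (A * (τ / d) + ε' * ‖B‖) * ω * (|Real.log (r k)|⁻¹ * Real.log (ρ / R / r k))) atTop
      (𝓝 (0 * (C * ‖B‖ * V) + (A * (τ / d) + ε' * ‖B‖) * ω * 1)) := by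
    refine Tendsto.add (Tendsto.mul_const _ ?_)
      (Tendsto.const_mul _ (tendsto_log_div_div_abs_log hr0 hr (by positivity)))
    have hlog : Tendsto (fun k => Real.log (r k)) atTop atBot :=
      Real.tendsto_log_nhdsGT_zero.comp (tendsto_nhdsWithin_iff.2 ⟨hr, Eventually.of_forall hr0⟩)
    exact tendsto_inv_atTop_zero.comp (tendsto_abs_atBot_atTop.comp hlog)
  rw [zero_mul, zero_add, mul_one] at hlim
  have hsmall : ∀ᶠ k in atTop, r k * |Real.log (r k)| * |a k| + ‖q k‖ < η / 2 := by
    have := (hθ.mul ha.abs).add hq.norm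
    rw [zero_mul, norm_zero, add_zero] at this
    exact this.eventually_lt_const (by positivity)
  filter_upwards [hmain.eventually_const_lt (sub_lt_self _ (half_pos hε)),
    hrlim.eventually_ge_atTop R, hlim.eventually_lt_const (lt_add_of_pos_right _ (show 0 < ε / 4 by
      positivity)), hsmall] with k hk hL hlimk hsm
  have hGL : ∀ v (z : Space d), consPoint v z ∈ {x : Space (d + 1) | ‖tailPoint x‖ < ρ / r k} →
      ‖z‖ < ρ / r k := fun v z h => by simpa using h
  obtain ⟨hDi, hS⟩ := signIntegral_eq_of_cylinder hα₀ hα₂ B (measurableSet_cylinder _)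
    (isBisymmetric_cylinder (ρ / r k)) hGL (r k * |Real.log (r k)| * a k) (r k) (q k)
  rw [hS, mul_sub, mul_neg]
  set s := r k * |Real.log (r k)| * a k with hs
  clear_value s
  set D : Space d → ℝ := fun z => slab (truncProfile 1 {x | ‖tailPoint x‖ < ρ / r k})
    (fun z => s - r k * (B z z / 2)) (fun z => q k z) z -
      slab (truncProfile 1 {x | ‖tailPoint x‖ < ρ / r k}) (fun _ => s)
        (fun z => q k z) z with hDdef
  have hrk := hr0 k
  have hBz : ∀ z : Space d, |B z z| ≤ ‖B‖ * ‖z‖ ^ 2 := fun z =>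
    (B.le_opNorm₂ z z).trans_eq (by ring)
  -- Over the fixed ball of radius `R` a contribution `O(r)` is negligible against `r |log r|`.
  have hpt1 : ∀ z : Space d, -D z ≤ r k * (C * ‖B‖) := by
    intro z
    refine ((neg_le_abs _).trans (hD B (measurableSet_cylinder _) _ hrk (q k) z)).trans ?_
    refine mul_le_mul_of_nonneg_left ?_ hrk.le
    refine mul_le_of_le_one_right (by positivity) ?_
    have h0 := norm_nonneg z
    have h1 : (0:ℝ) ≤ d := Nat.cast_nonneg d
    refine Real.rpow_le_one_of_one_le_of_nonpos ?_ ?_ <;> linarith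
  -- Over the annulus the thickness changes by exactly `-r B(z,z) / 2` on each side, and the profile
  -- is replaced by its tail with relative error.
  have hpt2 : ∀ z ∈ annulus d R (ρ / r k), -D z ≤
      r k * (A * (‖z‖ ^ (-((d : ℝ) + 1 + 1)) * B z z) + ε' * ‖B‖ * ‖z‖ ^ (-(d : ℝ))) := by
    intro z hz
    have hz1 : 1 ≤ ‖z‖ := hR1.trans hz.1
    have hz0 : 0 < ‖z‖ := by linarith
    have hrz : r k * ‖z‖ < ρ := by
      have := hz.2
      rw [lt_div_iff₀ hrk] at this
      linarith
    have hκ : |s - r k * (B z z / 2)| ≤ |s| + ρ * ‖B‖ / 2 * ‖z‖ := by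
      have h1 := abs_sub s (r k * (B z z / 2))
      rw [abs_mul (r k), abs_of_pos hrk, abs_div, abs_two] at h1
      have h2 : r k * (|B z z| / 2) ≤ ρ * ‖B‖ / 2 * ‖z‖ := by
        calc r k * (|B z z| / 2) ≤ r k * (‖B‖ * ‖z‖ ^ 2 / 2) := by gcongr; exact hBz z
          _ = (r k * ‖z‖) * (‖B‖ / 2 * ‖z‖) := by ring
          _ ≤ ρ * (‖B‖ / 2 * ‖z‖) := by gcongr
          _ = _ := by ring
      linarith
    have hρB : ρ * ‖B‖ ≤ η / 2 := by
      calc ρ * ‖B‖ ≤ η / (2 * (‖B‖ + 1)) * ‖B‖ := by gcongr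
        _ ≤ η / 2 := by
          rw [div_mul_eq_mul_div, div_le_div_iff₀ (by positivity) (by positivity)]
          nlinarith [norm_nonneg B]
    have h1 := abs_slab_sub_le (W := truncProfile 1 {x | ‖tailPoint x‖ < ρ / r k})
      (κ := fun z => s - r k * (B z z / 2)) (s := fun _ => s) (q := fun z => q k z) (z := z)
      (b := ε' * ‖z‖ ^ (-((d : ℝ) + 1 + 1))) (c := A * ‖z‖ ^ (-((d : ℝ) + 1 + 1)))
      (integrable_truncProfile_left hα₀ hα₂ (measurableSet_cylinder _) z) (fun v hv => by
        have hin : consPoint (v + q k z) z ∈ {x : Space (d + 1) | ‖tailPoint x‖ < ρ / r k} := by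
          simpa using hz.2
        rw [truncProfile, indicator_of_mem hin]
        refine htail _ z hz.1 ?_
        have h2 : |v| ≤ |s| + ρ * ‖B‖ / 2 * ‖z‖ := by
          refine hv.trans (max_le hκ ?_)
          have : 0 ≤ ρ * ‖B‖ / 2 * ‖z‖ := by positivity
          linarith
        have h3 : |q k z| ≤ ‖q k‖ * ‖z‖ := (q k).le_opNorm z
        have h4 := abs_add_le v (q k z)
        have h5 : |s| = r k * |Real.log (r k)| * |a k| := by
          rw [hs, abs_mul, abs_of_pos (hθ0 k)]
        have h6 : |s| ≤ |s| * ‖z‖ := le_mul_of_one_le_right (abs_nonneg _) hz1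
        have h7 : |v + q k z| ≤ (|s| + ‖q k‖ + ρ * ‖B‖ / 2) * ‖z‖ := by linarith
        refine h7.trans ?_
        gcongr
        rw [h5]
        linarith)
    change |D z - 2 * (s - r k * (B z z / 2) - s) * (A * ‖z‖ ^ (-((d : ℝ) + 1 + 1)))| ≤
      2 * |s - r k * (B z z / 2) - s| * (ε' * ‖z‖ ^ (-((d : ℝ) + 1 + 1))) at h1
    have h3 : |s - r k * (B z z / 2) - s| = r k * (|B z z| / 2) := by
      rw [show s - r k * (B z z / 2) - s = -(r k * (B z z / 2)) by ring, abs_neg, abs_mul, abs_div,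
        abs_two, abs_of_pos hrk]
    rw [h3] at h1
    have h4 := (abs_le.1 h1).1
    have h5 : 2 * (r k * (|B z z| / 2)) * (ε' * ‖z‖ ^ (-((d : ℝ) + 1 + 1))) ≤
        r k * (ε' * ‖B‖ * ‖z‖ ^ (-(d : ℝ))) := by
      have h6 : ‖z‖ ^ (-(d : ℝ)) = ‖z‖ ^ 2 * ‖z‖ ^ (-((d : ℝ) + 1 + 1)) := by
        rw [← Real.rpow_two, ← Real.rpow_add hz0]; congr 1; ring
      rw [h6]
      calc 2 * (r k * (|B z z| / 2)) * (ε' * ‖z‖ ^ (-((d : ℝ) + 1 + 1)))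
          = r k * (ε' * |B z z| * ‖z‖ ^ (-((d : ℝ) + 1 + 1))) := by ring
        _ ≤ r k * (ε' * (‖B‖ * ‖z‖ ^ 2) * ‖z‖ ^ (-((d : ℝ) + 1 + 1))) := by
            gcongr; exact hBz z
        _ = _ := by ring
    linarith
  have hI : -(∫ z, D z) ≤ r k * (C * ‖B‖ * V + (A * (τ / d) + ε' * ‖B‖) * ω *
      Real.log (ρ / R / r k)) := by
    set F : Space d → ℝ := fun z => r k * (A * (‖z‖ ^ (-((d : ℝ) + 1 + 1)) * B z z) +
      ε' * ‖B‖ * ‖z‖ ^ (-(d : ℝ))) with hF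
    have hi1 : IntegrableOn (fun z : Space d => ‖z‖ ^ (-((d : ℝ) + 1 + 1)) * B z z)
        (annulus d R (ρ / r k)) :=
      integrableOn_annulus hR0 ((continuousOn_norm_rpow _).mul (by fun_prop))
    have hi2 : IntegrableOn (fun z : Space d => ‖z‖ ^ (-(d : ℝ))) (annulus d R (ρ / r k)) :=
      integrableOn_annulus hR0 (continuousOn_norm_rpow _)
    have hFi : IntegrableOn F (annulus d R (ρ / r k)) :=
      ((hi1.const_mul A).add (hi2.const_mul (ε' * ‖B‖))).const_mul (r k)
    have hFint : ∫ z in annulus d R (ρ / r k), F z =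
        r k * ((A * (τ / d) + ε' * ‖B‖) * ω * Real.log (ρ / R / r k)) := by
      -- For `d = 0` the annulus is empty, as `R > 0`, and the area `ω` is zero, so both sides
      -- vanish.
      rcases Nat.eq_zero_or_pos d with rfl | hd
      · have he : annulus 0 R (ρ / r k) = ∅ := by
          ext z; simp [annulus, Subsingleton.elim z 0]; intro; linarith
        have hω' : ω = 0 := by simp [hω]
        simp [he, hω']
      · have : NeZero d := ⟨hd.ne'⟩
        rw [hF, integral_const_mul, integral_add (hi1.const_mul A) (hi2.const_mul (ε' * ‖B‖)),
          integral_const_mul, integral_const_mul, setIntegral_annulus_bilin hR0 hL,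
          setIntegral_annulus_inv hR0 hL, div_right_comm ρ R (r k)]
        ring
    rw [← integral_neg, mul_add, ← hFint]
    have hball : ∫ z : Space d, (Metric.ball 0 R).indicator (fun _ => r k * (C * ‖B‖)) z =
        r k * (C * ‖B‖ * V) := by
      rw [integral_indicator measurableSet_ball, setIntegral_const, smul_eq_mul, ← hV]
      ring
    rw [← hball, ← integral_indicator (measurableSet_annulus R (ρ / r k)), ← integral_add]
    · refine integral_mono hDi.neg ?_ fun z => ?_
      · refine Integrable.add ?_ ?_
        · rw [integrable_indicator_iff measurableSet_ball]
          exact integrableOn_const measure_ball_lt_top.ne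
        · rwa [integrable_indicator_iff (measurableSet_annulus R (ρ / r k))]
      · by_cases hz1 : ‖z‖ < R
        · have h1 : z ∉ annulus d R (ρ / r k) := fun h => absurd h.1 (not_le.2 hz1)
          simp only [indicator_of_mem (mem_ball_zero_iff.2 hz1), indicator_of_notMem h1, add_zero]
          exact hpt1 z
        · have h1 : z ∉ Metric.ball 0 R := fun h => hz1 (mem_ball_zero_iff.1 h)
          by_cases hz2 : ‖z‖ < ρ / r k
          · have h2 : z ∈ annulus d R (ρ / r k) := ⟨not_lt.1 hz1, hz2⟩
            simp only [indicator_of_notMem h1, indicator_of_mem h2, zero_add]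
            exact hpt2 z h2
          · have h2 : z ∉ annulus d R (ρ / r k) := fun h => hz2 h.2
            have h3 : z ∉ Metric.ball 0 (ρ / r k) := fun h => hz2 (mem_ball_zero_iff.1 h)
            have h4 : D z = 0 := slab_sub_slab_eq_zero hGL h3 _ _ _
            simp [indicator_of_notMem h1, indicator_of_notMem h2, h4]
    · rw [integrable_indicator_iff measurableSet_ball]
      exact integrableOn_const measure_ball_lt_top.ne
    · rwa [integrable_indicator_iff (measurableSet_annulus R (ρ / r k))]
  have h3 : -((r k * |Real.log (r k)|)⁻¹ * ∫ z, D z) ≤ |Real.log (r k)|⁻¹ * (C * ‖B‖ * V) +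
      (A * (τ / d) + ε' * ‖B‖) * ω * (|Real.log (r k)|⁻¹ * Real.log (ρ / R / r k)) := by
    rw [← mul_neg]
    have := hlog0 k
    calc _ ≤ (r k * |Real.log (r k)|)⁻¹ * (r k * (C * ‖B‖ * V + (A * (τ / d) + ε' * ‖B‖) * ω *
      Real.log (ρ / R / r k))) := by gcongr
      _ = _ := by field_simp
  have h4 : (A * (τ / d) + ε' * ‖B‖) * ω ≤ τ * (ω / d * A) + ε / 4 := by
    have : (A * (τ / d) + ε' * ‖B‖) * ω = τ * (ω / d * A) + ε' * (‖B‖ * ω) := by ring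
    linarith
  linarith

/-! ### Half-relaxed limits -/

theorem eventually_relaxedFilter_iff {N : ℕ} {z : Space N × ℝ} {p : ℝ × Space N × ℕ → Prop} :
    (∀ᶠ q in relaxedFilter z, p q) ↔ ∃ ε > 0, ∀ h y (n : ℕ), 0 < h → h < ε →
      dist (y, (n : ℝ) * h) z < ε → p (h, y, n) := by
  have hb : (relaxedFilter z).HasBasis (fun i : ℝ × ℝ => 0 < i.1 ∧ 0 < i.2)
      (fun i => (fun q : ℝ × Space N × ℕ => q.1) ⁻¹' Ioo 0 i.1 ∩
        (fun q : ℝ × Space N × ℕ => (q.2.1, (q.2.2 : ℝ) * q.1)) ⁻¹' Metric.ball z i.2) :=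
    ((nhdsGT_basis (0 : ℝ)).comap _).inf (Metric.nhds_basis_ball.comap _)
  rw [hb.eventually_iff]
  constructor
  · rintro ⟨⟨a, b⟩, ⟨ha, hb⟩, H⟩
    refine ⟨min a b, lt_min ha hb, fun h y n h0 h1 h2 => H ⟨⟨h0, h1.trans_le (min_le_left _ _)⟩, ?_⟩⟩
    exact h2.trans_le (min_le_right _ _)
  · rintro ⟨ε, hε, H⟩
    exact ⟨(ε, ε), ⟨hε, hε⟩, fun q hq => H q.1 q.2.1 q.2.2 hq.1.1 hq.1.2 hq.2⟩

/-- A positive time is approximated by multiples of the step, with index `⌈t / h⌉`. -/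
theorem relaxedFilter_neBot {N : ℕ} {z : Space N × ℝ} (hz : z ∈ spaceTime N) :
    (relaxedFilter z).NeBot := by
  have hz2 : 0 < z.2 := hz.2
  rw [← frequently_true_iff_neBot]
  intro H
  obtain ⟨ε, hε, H⟩ := eventually_relaxedFilter_iff.1 H
  refine H (ε / 2) z.1 ⌈z.2 / (ε / 2)⌉₊ (by positivity) (by linarith) ?_ trivial
  rw [Prod.dist_eq, max_lt_iff]
  refine ⟨by simpa using hε, ?_⟩
  have h1 := Nat.le_ceil (z.2 / (ε / 2))
  have h2 := Nat.ceil_lt_add_one (a := z.2 / (ε / 2)) (by positivity)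
  rw [div_le_iff₀ (by positivity)] at h1
  have h3 : (⌈z.2 / (ε / 2)⌉₊ : ℝ) * (ε / 2) < z.2 + ε / 2 := by
    calc (⌈z.2 / (ε / 2)⌉₊ : ℝ) * (ε / 2) < (z.2 / (ε / 2) + 1) * (ε / 2) := by gcongr
      _ = _ := by field_simp
  rw [Real.dist_eq, abs_lt]
  constructor <;> linarith

/-- The properties of the threshold scheme, and of its opposite, on which the passage to the limit
rests. -/
structure IsFlow (α : ℝ) (σ : ℝ → ℝ) (U : ℝ → ℕ → Space (d + 1) → ℝ) : Prop where
  measurable : ∀ h n, Measurable (U h n)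
  abs_le_one : ∀ h n x, |U h n x| ≤ 1
  eq_or_eq : ∀ h n x, U h (n + 1) x = 1 ∨ U h (n + 1) x = -1
  integral_nonneg : ∀ h n x, U h (n + 1) x = 1 → 0 ≤ ∫ y, kernel α (x - y) (σ h) * U h n y

/-- The set where the upper relaxed limit equals one. -/
def contactSet {N : ℕ} (U : ℝ → ℕ → Space N → ℝ) : Set (Space N × ℝ) :=
  {z | ∃ᶠ q in relaxedFilter z, U q.1 q.2.2 q.2.1 = 1}

theorem notMem_contactSet_iff {N : ℕ} {U : ℝ → ℕ → Space N → ℝ} {z : Space N × ℝ} :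
    z ∉ contactSet U ↔ ∃ ε > 0, ∀ h y (n : ℕ), 0 < h → h < ε →
      dist (y, (n : ℝ) * h) z < ε → U h n y ≠ 1 := by
  rw [contactSet, mem_ofPred_eq, not_frequently, eventually_relaxedFilter_iff]

theorem isClosed_contactSet {N : ℕ} (U : ℝ → ℕ → Space N → ℝ) : IsClosed (contactSet U) := by
  rw [← isOpen_compl_iff, Metric.isOpen_iff]
  intro z hz
  obtain ⟨ε, hε, H⟩ := notMem_contactSet_iff.1 hz
  refine ⟨ε / 2, by positivity, fun w hw => notMem_contactSet_iff.2 ⟨ε / 2, by positivity, ?_⟩⟩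
  intro h y n h0 h1 h2
  refine H h y n h0 (by linarith) ?_
  have := dist_triangle (y, (n : ℝ) * h) w z
  have hw' : dist w z < ε / 2 := hw
  linarith

namespace IsFlow

variable {σ : ℝ → ℝ} {U : ℝ → ℕ → Space (d + 1) → ℝ}

/-- Near a positive time the index is not zero. This excludes the initial function, whose values are
not confined to `±1`. -/
theorem eventually_eq_or_eq (hU : IsFlow α σ U)
    {z : Space (d + 1) × ℝ} (hz : z ∈ spaceTime (d + 1)) :
    ∀ᶠ q in relaxedFilter z, U q.1 q.2.2 q.2.1 = 1 ∨ U q.1 q.2.2 q.2.1 = -1 := by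
  have hz2 : 0 < z.2 := hz.2
  refine eventually_relaxedFilter_iff.2 ⟨z.2, hz2, fun h y n h0 h1 h2 => ?_⟩
  cases n with
  | zero =>
    rw [Prod.dist_eq, max_lt_iff] at h2
    have := h2.2
    simp [Real.dist_eq, abs_of_pos hz2] at this
  | succ n => exact hU.eq_or_eq h n y

theorem isBoundedUnder_le (hU : IsFlow α σ U) (z : Space (d + 1) × ℝ) :
    IsBoundedUnder (· ≤ ·) (relaxedFilter z)
    (fun q : ℝ × Space (d + 1) × ℕ => U q.1 q.2.2 q.2.1) :=
  isBoundedUnder_of ⟨1, fun _ => (abs_le.1 (hU.abs_le_one _ _ _)).2⟩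

theorem isBoundedUnder_ge (hU : IsFlow α σ U) (z : Space (d + 1) × ℝ) :
    IsBoundedUnder (· ≥ ·) (relaxedFilter z)
    (fun q : ℝ × Space (d + 1) × ℕ => U q.1 q.2.2 q.2.1) :=
  isBoundedUnder_of ⟨-1, fun _ => (abs_le.1 (hU.abs_le_one _ _ _)).1⟩

theorem upperRelaxed_of_mem (hU : IsFlow α σ U) {z : Space (d + 1) × ℝ} (hz : z ∈ spaceTime (d + 1))
    (h : z ∈ contactSet U) : upperRelaxed U z = 1 := by
  have := relaxedFilter_neBot hz
  refine le_antisymm (limsup_le_of_le (hU.isBoundedUnder_ge z).isCoboundedUnder_le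
    (Eventually.of_forall fun q => (abs_le.1 (hU.abs_le_one _ _ _)).2)) ?_
  exact le_limsup_of_frequently_le (h.mono fun q hq => hq.ge) (hU.isBoundedUnder_le z)

theorem upperRelaxed_of_notMem (hU : IsFlow α σ U)
    {z : Space (d + 1) × ℝ} (hz : z ∈ spaceTime (d + 1))
    (h : z ∉ contactSet U) : upperRelaxed U z = -1 := by
  have := relaxedFilter_neBot hz
  refine Tendsto.limsup_eq ?_
  refine tendsto_const_nhds.congr' ?_
  filter_upwards [hU.eventually_eq_or_eq hz, not_frequently.1 h] with q h1 h2
  exact (h1.resolve_left h2).symm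

theorem abs_upperRelaxed (hU : IsFlow α σ U) {z : Space (d + 1) × ℝ} (hz : z ∈ spaceTime (d + 1)) :
    |upperRelaxed U z| = 1 := by
  by_cases h : z ∈ contactSet U
  · simp [hU.upperRelaxed_of_mem hz h]
  · simp [hU.upperRelaxed_of_notMem hz h]

theorem upperSemicontinuousOn (hU : IsFlow α σ U) :
    UpperSemicontinuousOn (upperRelaxed U) (spaceTime (d + 1)) := by
  intro z hz c hc
  by_cases h : z ∈ contactSet U
  · rw [hU.upperRelaxed_of_mem hz h] at hc
    filter_upwards [self_mem_nhdsWithin] with w hw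
    exact (le_abs_self _).trans_lt ((hU.abs_upperRelaxed hw).trans_lt hc)
  · rw [hU.upperRelaxed_of_notMem hz h] at hc
    filter_upwards [self_mem_nhdsWithin,
      mem_nhdsWithin_of_mem_nhds ((isClosed_contactSet U).isOpen_compl.mem_nhds h)] with w hw hw'
    rwa [hU.upperRelaxed_of_notMem hw hw']

theorem locallyBounded (hU : IsFlow α σ U) : LocallyBounded (upperRelaxed U) := fun _ _ => ⟨1, by
  filter_upwards [self_mem_nhdsWithin] with w hw
  exact (hU.abs_upperRelaxed hw).le⟩

/-- At a strict contact point there are discrete points of contact, which converge to it. -/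
theorem exists_contact (hU : IsFlow α σ U) {z₀ : Space (d + 1) × ℝ} (hz₀ : z₀ ∈ spaceTime (d + 1))
    (hc : z₀ ∈ contactSet U) {ψ : Space (d + 1) × ℝ → ℝ} (hψ : Continuous ψ) (hψ₀ : ψ z₀ = 0)
    {ρ : ℝ} (hρ : 0 < ρ)
    (hpos : ∀ z ∈ Metric.closedBall z₀ ρ, z ∈ contactSet U → z ≠ z₀ → 0 < ψ z)
    {ε : ℝ} (hε : 0 < ε) :
    ∃ h x, ∃ n : ℕ, 0 < h ∧ h < ε ∧ dist (x, ((n : ℝ) + 1) * h) z₀ < ε ∧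
      (∀ y, U h n y = 1 ∨ U h n y = -1) ∧ U h (n + 1) x = 1 ∧
      ∀ y ∈ Metric.closedBall z₀.1 ρ, U h n y = 1 →
        ψ (x, ((n : ℝ) + 1) * h) - h ^ 2 ≤ ψ (y, n * h) := by
  have ht₀ : 0 < z₀.2 := hz₀.2
  -- points with value one at a fixed distance from `z₀`
  set ε' : ℝ := min ε (min (ρ / 2) (z₀.2 / 4)) with hε'
  have hε'0 : 0 < ε' := by positivity
  have hcpt : IsCompact (Metric.closedBall z₀ ρ \ Metric.ball z₀ ε') :=
    (isCompact_closedBall z₀ ρ).diff Metric.isOpen_ball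
  -- Compactness makes `ψ` bounded below on these points for all small steps: around a contact point
  -- `ψ` stays positive, and around any other point the value one does not occur for small steps.
  have key : ∃ c > 0, ∃ δ > 0, ∀ h y (n : ℕ), 0 < h → h < δ →
      (y, (n : ℝ) * h) ∈ Metric.closedBall z₀ ρ \ Metric.ball z₀ ε' → U h n y = 1 →
        c ≤ ψ (y, n * h) := by
    refine hcpt.induction_on (p := fun s => ∃ c > 0, ∃ δ > 0, ∀ h y (n : ℕ), 0 < h → h < δ →
      (y, (n : ℝ) * h) ∈ s → U h n y = 1 → c ≤ ψ (y, n * h)) ?_ ?_ ?_ ?_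
    · exact ⟨1, one_pos, 1, one_pos, by simp⟩
    · rintro s t hst ⟨c, hc, δ, hδ, H⟩
      exact ⟨c, hc, δ, hδ, fun h y n h0 h1 h2 => H h y n h0 h1 (hst h2)⟩
    · rintro s t ⟨c, hc, δ, hδ, H⟩ ⟨c', hc', δ', hδ', H'⟩
      refine ⟨min c c', lt_min hc hc', min δ δ', lt_min hδ hδ', fun h y n h0 h1 h2 h3 => ?_⟩
      rw [lt_min_iff] at h1
      rcases h2 with h2 | h2
      · exact (min_le_left _ _).trans (H h y n h0 h1.1 h2 h3)
      · exact (min_le_right _ _).trans (H' h y n h0 h1.2 h2 h3)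
    · intro z hz
      by_cases hzc : z ∈ contactSet U
      · have hzne : z ≠ z₀ := by
          rintro rfl
          exact hz.2 (Metric.mem_ball_self hε'0)
        have hψz := hpos z hz.1 hzc hzne
        refine ⟨{w | ψ z / 2 < ψ w}, mem_nhdsWithin_of_mem_nhds
          ((isOpen_lt continuous_const hψ).mem_nhds (by simp [hψz])), ψ z / 2, by positivity,
          1, one_pos, fun h y n _ _ h2 _ => le_of_lt h2⟩
      · obtain ⟨δ, hδ, H⟩ := notMem_contactSet_iff.1 hzc
        exact ⟨Metric.ball z δ, mem_nhdsWithin_of_mem_nhds (Metric.ball_mem_nhds z hδ), 1, one_pos,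
          δ, hδ, fun h y n h0 h1 h2 h3 => absurd h3 (H h y n h0 h1 h2)⟩
  obtain ⟨c, hc0, δ, hδ, hfar⟩ := key
  obtain ⟨η, hη, hnear⟩ := Metric.continuousAt_iff.1 hψ.continuousAt c hc0
  -- a step and a point with value one close to `z₀`
  obtain ⟨h, y₀, m₀, h0, hlt, hd₀, hU₀⟩ : ∃ h y, ∃ n : ℕ, 0 < h ∧
      h < min (min δ η) (min ε (min (ρ / 2) (z₀.2 / 4))) ∧
      dist (y, (n : ℝ) * h) z₀ < min η (min (ρ / 2) (z₀.2 / 4)) ∧ U h n y = 1 := by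
    by_contra H
    push Not at H
    refine notMem_contactSet_iff.2 ⟨min (min (min δ η) (min ε (min (ρ / 2) (z₀.2 / 4))))
      (min η (min (ρ / 2) (z₀.2 / 4))), by positivity, fun h y n h0 h1 h2 => ?_⟩ hc
    rw [lt_min_iff] at h1 h2
    exact H h y n h0 h1.1 h2.2
  simp only [lt_min_iff] at hlt hd₀
  obtain ⟨⟨hhδ, hhη⟩, hhε, hhρ, hht⟩ := hlt
  have hψ₀' : ψ (y₀, m₀ * h) < c := by
    have := hnear hd₀.1
    rw [hψ₀, Real.dist_eq, sub_zero] at this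
    exact (le_abs_self _).trans_lt this
  set S : Set ℝ := {s | ∃ y, ∃ n : ℕ, (y, (n : ℝ) * h) ∈ Metric.closedBall z₀ ρ ∧ U h n y = 1 ∧
    s = ψ (y, n * h)} with hS
  have hSne : S.Nonempty := ⟨_, y₀, m₀, by
    rw [Metric.mem_closedBall]; linarith [hd₀.2.1], hU₀, rfl⟩
  have hSbdd : BddBelow S := by
    refine ((isCompact_closedBall z₀ ρ).bddBelow_image hψ.continuousOn).mono ?_
    rintro s ⟨y, n, h1, -, rfl⟩
    exact ⟨_, h1, rfl⟩
  have hinf : sInf S ≤ ψ (y₀, m₀ * h) := csInf_le hSbdd ⟨y₀, m₀, by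
    rw [Metric.mem_closedBall]; linarith [hd₀.2.1], hU₀, rfl⟩
  -- The infimum need not be attained. The slack `h ^ 2` is negligible against the time step `h`,
  -- and the second entry of the minimum keeps the value below `c`, hence the point close to `z₀`.
  obtain ⟨s, ⟨x, m, hxm, hUx, rfl⟩, hs⟩ := exists_lt_of_csInf_lt hSne
    (show sInf S < sInf S + min (h ^ 2) (c - ψ (y₀, m₀ * h)) from
      lt_add_of_pos_right _ (lt_min (by positivity) (by linarith)))
  have hs1 : ψ (x, m * h) < c := by
    have := min_le_right (h ^ 2) (c - ψ (y₀, m₀ * h))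
    linarith
  have hs2 : ψ (x, m * h) < sInf S + h ^ 2 := by
    have := min_le_left (h ^ 2) (c - ψ (y₀, m₀ * h))
    linarith
  have hxd : dist (x, (m : ℝ) * h) z₀ < ε' := by
    by_contra H
    exact absurd (hfar h x m h0 hhδ ⟨hxm, H⟩ hUx) (not_le.2 hs1)
  have hεle : ε' ≤ ε ∧ ε' ≤ ρ / 2 ∧ ε' ≤ z₀.2 / 4 :=
    ⟨min_le_left _ _, (min_le_right _ _).trans (min_le_left _ _),
      (min_le_right _ _).trans (min_le_right _ _)⟩
  have hxt : |(m : ℝ) * h - z₀.2| < ε' := by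
    rw [Prod.dist_eq, max_lt_iff] at hxd
    exact hxd.2
  have hmh := (abs_lt.1 hxt).1
  -- Here `m h > 3 z₀.2 / 4` while `h < z₀.2 / 4`, which leaves `m ≥ 2`: the preceding function is
  -- not the initial one and takes only the values `±1`.
  match m, hxm, hUx, hs1, hs2, hxd, hxt, hmh with
  | 0, _, _, _, _, _, _, hmh => simp at hmh; linarith [hεle.2.2]
  | 1, _, _, _, _, _, _, hmh => simp at hmh; linarith [hεle.2.2]
  | n + 2, hxm, hUx, hs1, hs2, hxd, hxt, hmh =>
    have hcast : (((n + 1 : ℕ) : ℝ) + 1) = ((n + 2 : ℕ) : ℝ) := by push_cast; ring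
    refine ⟨h, x, n + 1, h0, hhε, ?_, fun y => hU.eq_or_eq h n y, hUx, fun y hy hUy => ?_⟩
    · rw [hcast]; exact hxd.trans_le hεle.1
    · rw [hcast]
      have h1 : sInf S ≤ ψ (y, ((n + 1 : ℕ) : ℝ) * h) := by
        refine csInf_le hSbdd ⟨y, n + 1, ?_, hUy, rfl⟩
        rw [Metric.mem_closedBall, Prod.dist_eq, max_le_iff]
        refine ⟨hy, ?_⟩
        have h2 : ((n + 1 : ℕ) : ℝ) * h = ((n + 2 : ℕ) : ℝ) * h - h := by push_cast; ring
        rw [Real.dist_eq, h2]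
        rw [abs_lt] at hxt
        rw [abs_le]
        constructor <;> linarith [hεle.2.1]
      linarith

end IsFlow

/-! ### The scheme is a flow -/

theorem measurable_symbol (hα₀ : 0 < α) : Measurable (symbol α : Space (d + 1) → ℝ) := by
  have : (symbol α : Space (d + 1) → ℝ) = fun ξ => symbolConst d α * ‖ξ‖ ^ α := by
    ext ξ; exact symbol_eq hα₀ ξ
  rw [this]
  fun_prop

theorem measurable_kernel (hα₀ : 0 < α) (t : ℝ) :
    Measurable (fun x : Space (d + 1) => kernel α x t) := by
  unfold kernel
  refine Measurable.const_mul ?_ _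
  have h1 := measurable_symbol (d := d) hα₀
  refine StronglyMeasurable.measurable (StronglyMeasurable.integral_prod_right'
    (f := fun p : Space (d + 1) × Space (d + 1) =>
      Real.cos (inner ℝ p.1 p.2) * Real.exp (-(t * symbol α p.2))) ?_)
  refine Measurable.stronglyMeasurable ?_
  fun_prop

theorem measurable_signLower : Measurable signLower :=
  Measurable.ite measurableSet_Ioi measurable_const measurable_const

theorem measurable_scheme (hα₀ : 0 < α) (σ : ℝ → ℝ) {Ω₀ : Set (Space (d + 1))} (hΩ₀ : IsOpen Ω₀)
    (h : ℝ) (n : ℕ) : Measurable (scheme α σ Ω₀ h n) := by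
  induction n with
  | zero =>
    exact (measurable_one.indicator hΩ₀.measurableSet).sub
      (measurable_one.indicator isClosed_closure.measurableSet.compl)
  | succ n ih =>
    refine measurable_signLower.comp (StronglyMeasurable.measurable
      (StronglyMeasurable.integral_prod_right' (f := fun p : Space (d + 1) × Space (d + 1) =>
        kernel α (p.1 - p.2) (σ h) * scheme α σ Ω₀ h n p.2) ?_))
    exact (((measurable_kernel hα₀ (σ h)).comp (measurable_fst.sub measurable_snd)).mul
      (ih.comp measurable_snd)).stronglyMeasurable

theorem signLower_eq_or_eq (s : ℝ) : signLower s = 1 ∨ signLower s = -1 := by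
  unfold signLower; split_ifs <;> simp

theorem abs_scheme_le_one (σ : ℝ → ℝ) (Ω₀ : Set (Space (d + 1))) (h : ℝ) (n : ℕ)
    (x : Space (d + 1)) : |scheme α σ Ω₀ h n x| ≤ 1 := by
  cases n with
  | zero =>
    simp only [scheme, indicator, Pi.one_apply]
    split_ifs <;> simp
  | succ n =>
    rcases signLower_eq_or_eq (∫ y, kernel α (x - y) (σ h) * scheme α σ Ω₀ h n y) with h1 | h1 <;>
      simp [scheme, h1]

theorem isFlow_scheme (hα₀ : 0 < α) (σ : ℝ → ℝ) {Ω₀ : Set (Space (d + 1))} (hΩ₀ : IsOpen Ω₀) :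
    IsFlow α σ (scheme α σ Ω₀) where
  measurable := measurable_scheme hα₀ σ hΩ₀
  abs_le_one := abs_scheme_le_one σ Ω₀
  eq_or_eq h n x := signLower_eq_or_eq _
  integral_nonneg h n x hx := by
    by_contra H
    simp only [scheme, signLower] at hx
    rw [if_neg (by linarith)] at hx
    norm_num at hx

/-- The sign of the scheme is `-1` at zero, so its value `-1` only says that the convolution is at
most zero. The weak inequality in `IsFlow` is what the scheme and its negative share. -/
theorem isFlow_neg_scheme (hα₀ : 0 < α) (σ : ℝ → ℝ) {Ω₀ : Set (Space (d + 1))} (hΩ₀ : IsOpen Ω₀) :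
    IsFlow α σ (fun h n x => -scheme α σ Ω₀ h n x) where
  measurable h n := (measurable_scheme hα₀ σ hΩ₀ h n).neg
  abs_le_one h n x := by rw [abs_neg]; exact abs_scheme_le_one σ Ω₀ h n x
  eq_or_eq h n x := by
    rcases signLower_eq_or_eq (∫ y, kernel α (x - y) (σ h) * scheme α σ Ω₀ h n y) with h1 | h1 <;>
      simp [scheme, h1]
  integral_nonneg h n x hx := by
    simp only [mul_neg, integral_neg]
    by_contra H
    simp only [scheme, signLower] at hx
    rw [if_pos (by linarith)] at hx
    norm_num at hx

theorem lowerRelaxed_eq {N : ℕ} {U : ℝ → ℕ → Space N → ℝ} (hU : ∀ h n x, |U h n x| ≤ 1)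
    {z : Space N × ℝ} (hz : z ∈ spaceTime N) :
    lowerRelaxed U z = -upperRelaxed (fun h n x => -U h n x) z := by
  have := relaxedFilter_neBot hz
  have h1 : IsBoundedUnder (· ≤ ·) (relaxedFilter z)
      (fun q : ℝ × Space N × ℕ => -U q.1 q.2.2 q.2.1) :=
    isBoundedUnder_of ⟨1, fun q => by linarith [(abs_le.1 (hU q.1 q.2.2 q.2.1)).1]⟩
  have h2 : IsBoundedUnder (· ≥ ·) (relaxedFilter z)
      (fun q : ℝ × Space N × ℕ => -U q.1 q.2.2 q.2.1) :=
    isBoundedUnder_of ⟨-1, fun q => by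
      simp only [ge_iff_le]; linarith [(abs_le.1 (hU q.1 q.2.2 q.2.1)).2]⟩
  have h := (Antitone.map_limsup_of_continuousAt (F := relaxedFilter z) (f := fun s : ℝ => -s)
    (fun a b hab => neg_le_neg hab) (fun q : ℝ × Space N × ℕ => -U q.1 q.2.2 q.2.1)
    continuous_neg.continuousAt h1 h2.isCoboundedUnder_le)
  rw [lowerRelaxed, upperRelaxed, h]
  simp [Function.comp_def]

/-! ### Rescaling and tails -/

/-- At time `r ^ α` the kernel has the spatial scale `r`. The rotation, free by radial symmetry,
will carry the first coordinate axis to a prescribed direction. -/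
theorem integral_kernel_mul (hα₀ : 0 < α) {r : ℝ} (hr : 0 < r)
    (O : Space (d + 1) ≃ₗᵢ[ℝ] Space (d + 1)) (x : Space (d + 1)) (f : Space (d + 1) → ℝ) :
    ∫ y, kernel α (x - y) (r ^ α) * f y = ∫ z, profile α z * f (x + r • O z) := by
  set F : Space (d + 1) → ℝ := fun y => kernel α (x - y) (r ^ α) * f y with hF
  have h1 : ∫ z, F (x + r • O z) = (r ^ (d + 1))⁻¹ * ∫ y, F y := by
    rw [O.measurePreserving.integral_comp O.toHomeomorph.measurableEmbedding
      (fun z => F (x + r • z)), Measure.integral_comp_smul volume (fun z => F (x + z)),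
      integral_add_left_eq_self F x]
    simp [abs_of_pos hr]
  have h2 : ∀ z, F (x + r • O z) = (r ^ (d + 1))⁻¹ * (profile α z * f (x + r • O z)) := by
    intro z
    have e1 : x - (x + r • O z) = (O.trans (LinearIsometryEquiv.neg ℝ)) (r • z) := by simp
    have hrα : 0 < r ^ α := by positivity
    simp only [hF]
    rw [e1, kernel_map_isometry, kernel_scaling hα₀ hrα, ← Real.rpow_mul hr.le,
      ← Real.rpow_mul hr.le, smul_smul]
    have e2 : α * -(1 / α) = -1 := by field_simp
    have e3 : α * -(((d : ℝ) + 1) / α) = -((d + 1 : ℕ) : ℝ) := by push_cast; field_simp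
    rw [e2, e3, Real.rpow_neg hr.le, Real.rpow_neg hr.le, Real.rpow_natCast, Real.rpow_one,
      inv_mul_cancel₀ hr.ne', one_smul, mul_assoc]
  simp only [h2] at h1
  rw [integral_const_mul] at h1
  exact (mul_left_cancel₀ (by positivity) h1).symm

theorem integrableOn_norm_rpow_compl_ball (hα₀ : 0 < α) {ρ : ℝ} (hρ : 0 < ρ) :
    IntegrableOn (fun y : Space (d + 1) => ‖y‖ ^ (-((d : ℝ) + 1 + α))) (Metric.ball 0 ρ)ᶜ := by
  have h1 : Integrable (fun y : Space (d + 1) => (1 + ‖y‖) ^ (-((d : ℝ) + 1 + α))) :=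
    integrable_one_add_norm (by simp; linarith)
  refine Integrable.mono' (h1.const_mul ((1 / ρ + 1) ^ ((d : ℝ) + 1 + α))).integrableOn
    (measurable_norm.pow_const _).aestronglyMeasurable ?_
  refine (ae_restrict_iff' measurableSet_ball.compl).2 (Eventually.of_forall fun y hy => ?_)
  have hy' : ρ ≤ ‖y‖ := by simpa using hy
  have hy0 : 0 < ‖y‖ := hρ.trans_le hy'
  have hs : 0 ≤ (d : ℝ) + 1 + α := by positivity
  rw [Real.norm_of_nonneg (by positivity), Real.rpow_neg hy0.le, Real.rpow_neg (by positivity),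
    ← div_eq_mul_inv, inv_eq_one_div, div_le_div_iff₀ (by positivity) (by positivity), one_mul,
    ← Real.mul_rpow (by positivity) (by positivity)]
  refine Real.rpow_le_rpow (by positivity) ?_ hs
  have : 1 ≤ 1 / ρ * ‖y‖ := by rw [one_div, inv_mul_eq_div, one_le_div hρ]; exact hy'
  linarith

theorem setIntegral_norm_rpow_compl_ball {L : ℝ} (hL : 0 < L) :
    ∫ y in (Metric.ball (0 : Space (d + 1)) L)ᶜ, ‖y‖ ^ (-((d : ℝ) + 1 + α)) =
      L ^ (-α) * ∫ y in (Metric.ball (0 : Space (d + 1)) 1)ᶜ, ‖y‖ ^ (-((d : ℝ) + 1 + α)) := by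
  rw [← integral_indicator measurableSet_ball.compl, ← integral_indicator measurableSet_ball.compl]
  set f := (Metric.ball (0 : Space (d + 1)) L)ᶜ.indicator
    (fun y => ‖y‖ ^ (-((d : ℝ) + 1 + α))) with hf
  have h1 : ∀ y, f (L • y) = L ^ (-((d : ℝ) + 1 + α)) *
      (Metric.ball (0 : Space (d + 1)) 1)ᶜ.indicator (fun y => ‖y‖ ^ (-((d : ℝ) + 1 + α))) y := by
    intro y
    have hm : L • y ∈ (Metric.ball (0 : Space (d + 1)) L)ᶜ ↔ y ∈ (Metric.ball (0 : Space (d + 1)) 1)ᶜ := by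
      simp [norm_smul, abs_of_pos hL, hL]
    by_cases hy : y ∈ (Metric.ball (0 : Space (d + 1)) 1)ᶜ
    · rw [hf, indicator_of_mem (hm.2 hy), indicator_of_mem hy, norm_smul, Real.norm_of_nonneg hL.le,
        Real.mul_rpow hL.le (norm_nonneg _)]
    · rw [hf, indicator_of_notMem (mt hm.1 hy), indicator_of_notMem hy, mul_zero]
  have h2 := Measure.integral_comp_smul volume f L
  simp only [h1] at h2
  rw [integral_const_mul] at h2
  simp only [finrank_euclideanSpace, Fintype.card_fin, smul_eq_mul, abs_inv, abs_pow,
    abs_of_pos hL] at h2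
  have h3 : L ^ (-α) = L ^ (d + 1) * L ^ (-((d : ℝ) + 1 + α)) := by
    rw [← Real.rpow_natCast, ← Real.rpow_add hL]; congr 1; push_cast; ring
  rw [h3, mul_assoc, h2, mul_inv_cancel_left₀ (by positivity)]

theorem exists_setIntegral_profile_compl_ball_le (hα₀ : 0 < α) (hα₂ : α < 2) :
    ∃ C > 0, ∀ L > 0, ∫ z in (Metric.ball (0 : Space (d + 1)) L)ᶜ, profile α z ≤ C * L ^ (-α) := by
  obtain ⟨C, hC, hle⟩ := exists_profile_le (d := d) hα₀ hα₂
  refine ⟨C * (∫ y in (Metric.ball (0 : Space (d + 1)) 1)ᶜ, ‖y‖ ^ (-((d : ℝ) + 1 + α))) + 1,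
    ?_, fun L hL => ?_⟩
  · have : 0 ≤ ∫ y in (Metric.ball (0 : Space (d + 1)) 1)ᶜ, ‖y‖ ^ (-((d : ℝ) + 1 + α)) :=
      integral_nonneg fun _ => by positivity
    positivity
  have h1 : ∫ z in (Metric.ball (0 : Space (d + 1)) L)ᶜ, profile α z ≤
      ∫ z in (Metric.ball (0 : Space (d + 1)) L)ᶜ, C * ‖z‖ ^ (-((d : ℝ) + 1 + α)) := by
    refine setIntegral_mono_on (profile_integrable hα₀ hα₂).integrableOn
      ((integrableOn_norm_rpow_compl_ball hα₀ hL).const_mul C) measurableSet_ball.compl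
      fun z hz => ?_
    have hz' : L ≤ ‖z‖ := by simpa using hz
    have hz0 : 0 < ‖z‖ := hL.trans_le hz'
    refine (hle z).trans ?_
    refine mul_le_mul_of_nonneg_left (Real.rpow_le_rpow_of_nonpos hz0 (by linarith) ?_) hC.le
    have : (0:ℝ) ≤ d := Nat.cast_nonneg d
    linarith
  rw [integral_const_mul, setIntegral_norm_rpow_compl_ball hL] at h1
  have : 0 < L ^ (-α) := by positivity
  linarith

/-! ### Second-order expansions of test functions -/

/-- The mean value inequality is applied to the remainder on the ball of radius `‖w‖`. Symmetry of
the second derivative makes the derivative of `D w w / 2` equal to `D w`, and differentiability of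
the first derivative makes what is left at most `η ‖w‖`. -/
theorem eventually_abs_taylor_le {E : Type*} [NormedAddCommGroup E] [NormedSpace ℝ E] {f : E → ℝ}
    {x : E} (hf : ContDiffAt ℝ 2 f x) {η : ℝ} (hη : 0 < η) :
    ∀ᶠ w in 𝓝 (0 : E), |f (x + w) - f x - fderiv ℝ f x w -
      fderiv ℝ (fderiv ℝ f) x w w / 2| ≤ η * ‖w‖ ^ 2 := by
  have hsymm : IsSymmSndFDerivAt ℝ f x := hf.isSymmSndFDerivAt (by simp)
  set D := fderiv ℝ (fderiv ℝ f) x with hD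
  have hd2 : HasFDerivAt (fderiv ℝ f) D x :=
    ((hf.fderiv_right (m := 1) (by norm_num)).differentiableAt (by norm_num)).hasFDerivAt
  have hd1 : ∀ᶠ w in 𝓝 (0 : E), DifferentiableAt ℝ f (x + w) := by
    have h1 : ∀ᶠ y in 𝓝 x, DifferentiableAt ℝ f y :=
      (hf.eventually (by simp)).mono fun y hy => hy.differentiableAt (by norm_num)
    have h2 : Tendsto (fun w : E => x + w) (𝓝 0) (𝓝 x) := by
      have : Continuous (fun w : E => x + w) := by fun_prop
      simpa using this.tendsto 0
    exact h2.eventually h1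
  have hlit : ∀ᶠ w in 𝓝 (0 : E), ‖fderiv ℝ f (x + w) - fderiv ℝ f x - D w‖ ≤ η * ‖w‖ := by
    have := (hasFDerivAt_iff_isLittleO_nhds_zero.1 hd2).def hη
    exact this
  obtain ⟨δ, hδ, H⟩ := Metric.eventually_nhds_iff_ball.1 (hd1.and hlit)
  refine Metric.eventually_nhds_iff_ball.2 ⟨δ, hδ, fun w hw => ?_⟩
  set g : E → ℝ := fun w => f (x + w) - fderiv ℝ f x w - D w w / 2 with hg
  have hder : ∀ y ∈ Metric.closedBall (0 : E) ‖w‖,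
      HasFDerivWithinAt g (fderiv ℝ f (x + y) - fderiv ℝ f x - D y)
        (Metric.closedBall (0 : E) ‖w‖) y := by
    intro y hy
    have hyδ : y ∈ Metric.ball (0 : E) δ := by
      simp only [Metric.mem_closedBall, dist_zero_right, Metric.mem_ball] at hy hw ⊢
      exact hy.trans_lt hw
    have h1 : HasFDerivAt (fun w => f (x + w)) (fderiv ℝ f (x + y)) y := by
      have := (H y hyδ).1.hasFDerivAt
      exact (this.comp y ((hasFDerivAt_id y).const_add x)).congr_fderiv (by ext v; simp)
    have h2 : HasFDerivAt (fun w => D w w) (D y + D.flip y) y := by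
      have := D.hasFDerivAt_of_bilinear (hasFDerivAt_id y) (hasFDerivAt_id y)
      refine this.congr_fderiv ?_
      ext v
      simp
    have h3 : D.flip y = D y := by
      ext v
      exact hsymm v y
    have h4 := ((h1.sub (fderiv ℝ f x).hasFDerivAt).sub (h2.mul_const (2⁻¹ : ℝ))).hasFDerivWithinAt
      (s := Metric.closedBall (0 : E) ‖w‖)
    refine (h4.congr_fderiv ?_).congr (fun _ _ => ?_) ?_
    · rw [h3]
      ext v
      simp
      ring
    · simp [hg, div_eq_mul_inv]
    · simp [hg, div_eq_mul_inv]
  have hbd : ∀ y ∈ Metric.closedBall (0 : E) ‖w‖,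
      ‖fderiv ℝ f (x + y) - fderiv ℝ f x - D y‖ ≤ η * ‖w‖ := by
    intro y hy
    have hyw : ‖y‖ ≤ ‖w‖ := by simpa using hy
    have hyδ : y ∈ Metric.ball (0 : E) δ := by
      simp only [dist_zero_right, Metric.mem_ball] at hw ⊢
      exact hyw.trans_lt hw
    exact (H y hyδ).2.trans (by gcongr)
  have := (convex_closedBall (0 : E) ‖w‖).norm_image_sub_le_of_norm_hasFDerivWithin_le hder hbd
    (x := 0) (y := w) (by simp) (by simp)
  simp only [hg, Real.norm_eq_abs] at this
  simp only [add_zero, map_zero, sub_zero, zero_div] at this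
  calc _ = |f (x + w) - fderiv ℝ f x w - D w w / 2 - f x| := by congr 1; ring
    _ ≤ _ := this
    _ = _ := by ring

section Slices

variable {φ : Space (d + 1) × ℝ → ℝ} {z₀ : Space (d + 1) × ℝ}

theorem contDiffAt_of_contDiffOn {N : ℕ} {φ : Space N × ℝ → ℝ} (hφ : ContDiffOn ℝ 2 φ (spaceTime N))
    {z : Space N × ℝ} (hz : z ∈ spaceTime N) : ContDiffAt ℝ 2 φ z :=
  hφ.contDiffAt ((isOpen_univ.prod isOpen_Ioi).mem_nhds hz)

/-- The spatial Hessian as a bilinear form. -/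
def hessForm (φ : Space (d + 1) × ℝ → ℝ) (z : Space (d + 1) × ℝ) :
    Space (d + 1) →L[ℝ] Space (d + 1) →L[ℝ] ℝ :=
  fderiv ℝ (fderiv ℝ (fun y => φ (y, z.2))) z.1

theorem contDiffAt_slice (hφ : ContDiffAt ℝ 2 φ z₀) :
    ContDiffAt ℝ 2 (fun y => φ (y, z₀.2)) z₀.1 :=
  ContDiffAt.comp (g := φ) (f := fun y => (y, z₀.2)) z₀.1 hφ (by fun_prop)

theorem fderiv_slice_apply (hφ : ContDiffAt ℝ 2 φ z₀) (ξ : Space (d + 1)) :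
    fderiv ℝ (fun y => φ (y, z₀.2)) z₀.1 ξ = inner ℝ (grad φ z₀) ξ := by
  have h := ((contDiffAt_slice hφ).differentiableAt (by norm_num)).hasGradientAt
  rw [h.hasFDerivAt.fderiv]
  rfl

theorem fderiv_apply_eq (hφ : ContDiffAt ℝ 2 φ z₀) (ξ : Space (d + 1)) (τ : ℝ) :
    fderiv ℝ φ z₀ (ξ, τ) = inner ℝ (grad φ z₀) ξ + timeDeriv φ z₀ * τ := by
  have hd : HasFDerivAt φ (fderiv ℝ φ z₀) z₀ := (hφ.differentiableAt (by norm_num)).hasFDerivAt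
  have h1 : HasFDerivAt (fun y => φ (y, z₀.2))
      ((fderiv ℝ φ z₀).comp (ContinuousLinearMap.inl ℝ _ _)) z₀.1 :=
    HasFDerivAt.comp (g := φ) z₀.1 hd (hasFDerivAt_prodMk_left z₀.1 z₀.2)
  have h2 : HasFDerivAt (fun s => φ (z₀.1, s))
      ((fderiv ℝ φ z₀).comp (ContinuousLinearMap.inr ℝ _ _)) z₀.2 :=
    HasFDerivAt.comp (g := φ) z₀.2 hd (hasFDerivAt_prodMk_right z₀.1 z₀.2)
  rw [← fderiv_slice_apply hφ, h1.fderiv, timeDeriv, h2.hasDerivAt.deriv]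
  have : ((ξ, τ) : Space (d + 1) × ℝ) = (ξ, 0) + τ • (0, 1) := by simp
  rw [this, map_add, map_smul]
  simp [mul_comm]

theorem hessForm_apply (hφ : ContDiffAt ℝ 2 φ z₀) (ξ ζ : Space (d + 1)) :
    hessForm φ z₀ ξ ζ = fderiv ℝ (fderiv ℝ φ) z₀ (ξ, 0) (ζ, 0) := by
  have hd2 : HasFDerivAt (fderiv ℝ φ) (fderiv ℝ (fderiv ℝ φ) z₀) z₀ :=
    ((hφ.fderiv_right (m := 1) (by norm_num)).differentiableAt (by norm_num)).hasFDerivAt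
  have h1 : HasFDerivAt (fun y => fderiv ℝ φ (y, z₀.2))
      ((fderiv ℝ (fderiv ℝ φ) z₀).comp (ContinuousLinearMap.inl ℝ _ _)) z₀.1 :=
    HasFDerivAt.comp (g := fderiv ℝ φ) z₀.1 hd2 (hasFDerivAt_prodMk_left z₀.1 z₀.2)
  have h2 : HasFDerivAt (fun y => (fderiv ℝ φ (y, z₀.2)).comp (ContinuousLinearMap.inl ℝ
      (Space (d + 1)) ℝ)) _ z₀.1 :=
    (((ContinuousLinearMap.compL ℝ (Space (d + 1)) (Space (d + 1) × ℝ) ℝ).flip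
      (ContinuousLinearMap.inl ℝ (Space (d + 1)) ℝ)).hasFDerivAt).comp z₀.1 h1
  have h3 : fderiv ℝ (fun y => φ (y, z₀.2)) =ᶠ[𝓝 z₀.1]
      fun y => (fderiv ℝ φ (y, z₀.2)).comp (ContinuousLinearMap.inl ℝ (Space (d + 1)) ℝ) := by
    have h4 : ∀ᶠ z in 𝓝 z₀, DifferentiableAt ℝ φ z :=
      (hφ.eventually (by simp)).mono fun y hy => hy.differentiableAt (by norm_num)
    have h5 : Tendsto (fun y : Space (d + 1) => (y, z₀.2)) (𝓝 z₀.1) (𝓝 z₀) :=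
      Continuous.tendsto (f := fun y : Space (d + 1) => (y, z₀.2)) (by fun_prop) z₀.1
    filter_upwards [h5.eventually h4] with y hy
    exact (HasFDerivAt.comp (g := φ) y hy.hasFDerivAt (hasFDerivAt_prodMk_left y z₀.2)).fderiv
  rw [hessForm, h3.fderiv_eq, h2.fderiv]
  simp

/-- The mixed space-time terms are absorbed by Young's inequality into a small multiple of `‖w.1‖²`
and a large multiple of `w.2²`; the latter is harmless beside the linear term in time. -/
theorem exists_eventually_expansion_le (hφ : ContDiffAt ℝ 2 φ z₀) {η : ℝ} (hη : 0 < η) :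
    ∃ K ≥ 0, ∀ᶠ w in 𝓝 (0 : Space (d + 1) × ℝ), φ (z₀ + w) - φ z₀ ≤
      inner ℝ (grad φ z₀) w.1 + hessForm φ z₀ w.1 w.1 / 2 + η * ‖w.1‖ ^ 2 +
        timeDeriv φ z₀ * w.2 + K * w.2 ^ 2 := by
  set D := fderiv ℝ (fderiv ℝ φ) z₀ with hD
  refine ⟨η + ‖D‖ ^ 2 / (2 * η) + ‖D‖, by positivity, ?_⟩
  filter_upwards [eventually_abs_taylor_le hφ (half_pos hη)] with w hw
  obtain ⟨ξ, τ⟩ := w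
  rw [fderiv_apply_eq hφ, ← hD] at hw
  have hw := (abs_le.1 hw).2
  have hsplit : D (ξ, τ) (ξ, τ) = hessForm φ z₀ ξ ξ + D (ξ, 0) (0, τ) + D (0, τ) (ξ, 0) +
      D (0, τ) (0, τ) := by
    rw [hessForm_apply hφ, ← hD]
    have : ((ξ, τ) : Space (d + 1) × ℝ) = (ξ, 0) + (0, τ) := by simp
    rw [this]
    simp only [map_add, add_apply]
    ring
  have hn1 : ‖((ξ, 0) : Space (d + 1) × ℝ)‖ = ‖ξ‖ := by simp [Prod.norm_def]
  have hn2 : ‖((0, τ) : Space (d + 1) × ℝ)‖ = |τ| := by simp [Prod.norm_def]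
  have e1 : D (ξ, 0) (0, τ) ≤ ‖D‖ * ‖ξ‖ * |τ| := by
    have := D.le_opNorm₂ (ξ, 0) (0, τ)
    rw [hn1, hn2] at this
    exact (le_abs_self _).trans this
  have e2 : D (0, τ) (ξ, 0) ≤ ‖D‖ * |τ| * ‖ξ‖ := by
    have := D.le_opNorm₂ (0, τ) (ξ, 0)
    rw [hn1, hn2] at this
    exact (le_abs_self _).trans this
  have e3 : D (0, τ) (0, τ) ≤ ‖D‖ * |τ| * |τ| := by
    have := D.le_opNorm₂ (0, τ) (0, τ)
    rw [hn2] at this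
    exact (le_abs_self _).trans this
  have e4 : ‖((ξ, τ) : Space (d + 1) × ℝ)‖ ^ 2 ≤ ‖ξ‖ ^ 2 + τ ^ 2 := by
    rw [Prod.norm_def]
    rcases max_cases ‖ξ‖ ‖τ‖ with h | h
    · simp only [h.1]; nlinarith [sq_nonneg τ]
    · rw [h.1, Real.norm_eq_abs, sq_abs]; nlinarith [sq_nonneg ‖ξ‖]
  have e5 : ‖D‖ * ‖ξ‖ * |τ| ≤ η / 2 * ‖ξ‖ ^ 2 + ‖D‖ ^ 2 / (2 * η) * τ ^ 2 := by
    have h1 : ‖D‖ ^ 2 / (2 * η) * τ ^ 2 = η / 2 * (‖D‖ * |τ| / η) ^ 2 := by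
      rw [div_pow, mul_pow, sq_abs]; field_simp
    have h2 : ‖D‖ * ‖ξ‖ * |τ| = η / 2 * (2 * ‖ξ‖ * (‖D‖ * |τ| / η)) := by field_simp
    rw [h1, h2, ← mul_add]
    exact mul_le_mul_of_nonneg_left (two_mul_le_add_sq _ _) (by positivity)
  have e6 : η / 2 * ‖((ξ, τ) : Space (d + 1) × ℝ)‖ ^ 2 ≤ η / 2 * (‖ξ‖ ^ 2 + τ ^ 2) :=
    mul_le_mul_of_nonneg_left e4 (by positivity)
  have e7 : |τ| * |τ| = τ ^ 2 := by rw [abs_mul_abs_self, sq]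
  rw [mul_assoc, e7] at e3
  have e8 : 0 ≤ ‖D‖ * τ ^ 2 := by positivity
  have e9 : 0 ≤ η * τ ^ 2 := by positivity
  simp only
  linarith

/-- An inequality solved for its dominant variable. -/
theorem exists_graph_bound {P C η : ℝ} (a : ℝ) {K : ℝ} (hP : 0 < P) (hC : 0 ≤ C) (hη : 0 < η)
    (hK : 0 ≤ K) : ∃ K' ≥ 0, ∃ ρ > 0, ∀ s b τ Q : ℝ, |s| ≤ ρ → 0 ≤ b → b ≤ ρ → |τ| ≤ ρ →
      |Q| ≤ C * b ^ 2 →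
      0 ≤ P * s + a * τ + Q + C * |s| * (|s| + b) + η * b ^ 2 + K * τ ^ 2 →
      0 ≤ P * s + a * τ + Q + 2 * η * b ^ 2 + K' * τ ^ 2 := by
  set c := 2 * C / P with hc
  have hc0 : 0 ≤ c := by positivity
  set M := |a| + C + η + K with hM
  have hM0 : 0 < M := by positivity
  set ρ : ℝ := min 1 (min (P / (4 * (C + 1))) (η / (2 * (c * (4 * M ^ 2 / P + M) + 1)))) with hρ
  have hρ0 : 0 < ρ := by positivity
  have hρ1 : ρ ≤ 1 := min_le_left _ _
  have hρ2 : ρ * (4 * (C + 1)) ≤ P := by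
    rw [← le_div_iff₀ (by positivity)]; exact (min_le_right _ _).trans (min_le_left _ _)
  have hρ3 : ρ * (2 * (c * (4 * M ^ 2 / P + M) + 1)) ≤ η := by
    rw [← le_div_iff₀ (by positivity)]; exact (min_le_right _ _).trans (min_le_right _ _)
  refine ⟨K + (c * (4 * M ^ 2 / P) + c ^ 2 * M ^ 2 / (2 * η)), by positivity, ρ, hρ0, ?_⟩
  intro s b τ Q hs hb hbρ hτ hQ hF
  -- The terms free of `s`, of size `O(|τ| + b²)`.
  set R := a * τ + Q + η * b ^ 2 + K * τ ^ 2 with hR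
  have hτ1 : |τ| ≤ 1 := hτ.trans hρ1
  have hτsq : τ ^ 2 ≤ |τ| := by
    rw [← sq_abs]; nlinarith [abs_nonneg τ]
  have hRM : |R| ≤ M * (|τ| + b ^ 2) := by
    have h1 : |R| ≤ |a| * |τ| + |Q| + η * b ^ 2 + K * τ ^ 2 := by
      rw [hR]
      refine (abs_add_le _ _).trans ?_
      rw [abs_of_nonneg (show 0 ≤ K * τ ^ 2 by positivity)]
      gcongr
      refine (abs_add_le _ _).trans ?_
      rw [abs_of_nonneg (show 0 ≤ η * b ^ 2 by positivity)]
      gcongr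
      refine (abs_add_le _ _).trans ?_
      rw [abs_mul]
    have h2 : K * τ ^ 2 ≤ K * |τ| := by gcongr
    have h3 : 0 ≤ |a| * b ^ 2 := by positivity
    have h4 : 0 ≤ C * |τ| := by positivity
    have h5 : 0 ≤ η * |τ| := by positivity
    have h6 : 0 ≤ K * b ^ 2 := by positivity
    rw [hM]
    linarith
  -- the error absorbed
  have herr : ∀ x, 0 ≤ x → x ≤ 2 * |R| / P →
      c * (x + b) * |R| ≤ η * b ^ 2 + (c * (4 * M ^ 2 / P) + c ^ 2 * M ^ 2 / (2 * η)) * τ ^ 2 := by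
    intro x hx hxR
    have hR2 : |R| ^ 2 ≤ 2 * M ^ 2 * (τ ^ 2 + ρ * b ^ 2) := by
      calc |R| ^ 2 ≤ (M * (|τ| + b ^ 2)) ^ 2 := by gcongr
        _ = M ^ 2 * (|τ| + b ^ 2) ^ 2 := by ring
        _ ≤ M ^ 2 * (2 * (τ ^ 2 + ρ * b ^ 2)) := by
          gcongr
          have h1 : b ^ 2 * b ^ 2 ≤ ρ * b ^ 2 := by
            gcongr; nlinarith
          have h2 : (|τ| + b ^ 2) ^ 2 ≤ 2 * (|τ| ^ 2 + (b ^ 2) ^ 2) := add_sq_le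
          rw [sq_abs] at h2
          nlinarith
        _ = _ := by ring
    have hbR : b * |R| ≤ M * (b * |τ| + ρ * b ^ 2) := by
      calc b * |R| ≤ b * (M * (|τ| + b ^ 2)) := by gcongr
        _ = M * (b * |τ| + b * b ^ 2) := by ring
        _ ≤ _ := by gcongr
    have hbt : c * M * (b * |τ|) ≤ η / 2 * b ^ 2 + c ^ 2 * M ^ 2 / (2 * η) * τ ^ 2 := by
      have h1 : c ^ 2 * M ^ 2 / (2 * η) * τ ^ 2 = η / 2 * (c * M * |τ| / η) ^ 2 := by
        rw [← sq_abs τ]; field_simp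
      have h2 : c * M * (b * |τ|) = η / 2 * (2 * b * (c * M * |τ| / η)) := by field_simp
      rw [h1, h2, ← mul_add]
      exact mul_le_mul_of_nonneg_left (two_mul_le_add_sq _ _) (by positivity)
    calc c * (x + b) * |R| = c * (x * |R| + b * |R|) := by ring
      _ ≤ c * (2 * |R| / P * |R| + M * (b * |τ| + ρ * b ^ 2)) := by gcongr
      _ = c * (2 / P * |R| ^ 2 + M * (b * |τ| + ρ * b ^ 2)) := by ring
      _ ≤ c * (2 / P * (2 * M ^ 2 * (τ ^ 2 + ρ * b ^ 2)) + M * (b * |τ| + ρ * b ^ 2)) := by gcongr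
      _ = c * (4 * M ^ 2 / P) * τ ^ 2 + c * M * (b * |τ|) +
          ρ * (c * (4 * M ^ 2 / P + M)) * b ^ 2 := by ring
      _ ≤ c * (4 * M ^ 2 / P) * τ ^ 2 + (η / 2 * b ^ 2 + c ^ 2 * M ^ 2 / (2 * η) * τ ^ 2) +
          η / 2 * b ^ 2 := by gcongr; linarith
      _ = _ := by ring
  -- Either `P s + R ≥ 0` and nothing is lost, or the hypothesis forces `|s| ≤ 2 |R| / P`. Then the
  -- error `C |s| (|s| + b)` is bounded by a multiple of `(|R| + b) |R|` and can be absorbed.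
  suffices hgoal : 0 ≤ P * s + R ∨
      (|s| ≤ 2 * |R| / P ∧ -(c * (|s| + b) * |R|) ≤ P * s + R) by
    rcases hgoal with h | ⟨h1, h2⟩
    · have : 0 ≤ η * b ^ 2 + (c * (4 * M ^ 2 / P) + c ^ 2 * M ^ 2 / (2 * η)) * τ ^ 2 := by positivity
      linarith
    · have := herr |s| (abs_nonneg s) h1
      linarith
  by_cases hPR : 0 ≤ P * s + R
  · exact Or.inl hPR
  right
  push Not at hPR
  have hF' : 0 ≤ P * s + R + C * (|s| + b) * |s| := by linarith
  have hsm : C * (|s| + b) ≤ P / 2 := by nlinarith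
  have hsP : C * (|s| + b) * |s| ≤ P / 2 * |s| := by gcongr
  have hsR : |s| ≤ 2 * |R| / P := by
    rw [le_div_iff₀ hP]
    rcases le_total 0 s with h | h
    · rw [abs_of_nonneg h] at *
      linarith [neg_le_abs R, abs_nonneg R]
    · rw [abs_of_nonpos h] at *
      linarith [le_abs_self R]
  refine ⟨hsR, ?_⟩
  have : C * (|s| + b) * |s| ≤ c * (|s| + b) * |R| := by
    calc C * (|s| + b) * |s| ≤ C * (|s| + b) * (2 * |R| / P) := by gcongr
      _ = _ := by rw [hc]; ring
  linarith

end Slices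

/-! ### Tangential forms -/

/-- The map `z ↦ (0, z)` as a continuous linear map. -/
def zeroConsL (d : ℕ) : Space d →L[ℝ] Space (d + 1) :=
  LinearMap.toContinuousLinearMap
    { toFun := zeroCons
      map_add' := fun x y => by
        ext i; refine Fin.cases ?_ (fun i => ?_) i <;> simp [zeroCons_eq]
      map_smul' := fun c x => by
        ext i; refine Fin.cases ?_ (fun i => ?_) i <;> simp [zeroCons_eq] }

@[simp] theorem zeroConsL_apply (z : Space d) : zeroConsL d z = zeroCons z := rfl

/-- The restriction of a bilinear form to the image under `O` of the hyperplane `{v = 0}`. -/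
def tangentForm (O : Space (d + 1) ≃ₗᵢ[ℝ] Space (d + 1))
    (X : Space (d + 1) →L[ℝ] Space (d + 1) →L[ℝ] ℝ) : Space d →L[ℝ] Space d →L[ℝ] ℝ :=
  X.bilinearComp ((O.toContinuousLinearEquiv : Space (d + 1) →L[ℝ] Space (d + 1)).comp (zeroConsL d))
    ((O.toContinuousLinearEquiv : Space (d + 1) →L[ℝ] Space (d + 1)).comp (zeroConsL d))

@[simp] theorem tangentForm_apply (O : Space (d + 1) ≃ₗᵢ[ℝ] Space (d + 1))
    (X : Space (d + 1) →L[ℝ] Space (d + 1) →L[ℝ] ℝ) (x y : Space d) :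
    tangentForm O X x y = X (O (zeroCons x)) (O (zeroCons y)) := by
  simp [tangentForm]

theorem zeroCons_single (i : Fin d) :
    zeroCons (EuclideanSpace.single i (1 : ℝ)) = EuclideanSpace.single i.succ 1 := by
  ext j
  refine Fin.cases ?_ (fun j => ?_) j
  · simp [zeroCons_eq, Fin.succ_ne_zero]
  · simp [zeroCons_eq]

/-- The trace may be computed in any orthonormal basis. -/
theorem sum_form_isometry (O : Space d ≃ₗᵢ[ℝ] Space d)
    (X : Space d →L[ℝ] Space d →L[ℝ] ℝ) :
    ∑ i, X (O (EuclideanSpace.single i 1)) (O (EuclideanSpace.single i 1)) =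
      ∑ i, X (EuclideanSpace.single i 1) (EuclideanSpace.single i 1) := by
  let T : Space d →ₗ[ℝ] Space d :=
    { toFun := fun x => (InnerProductSpace.toDual ℝ (Space d)).symm (X x)
      map_add' := fun x y => by simp
      map_smul' := fun c x => by simp }
  have hT : ∀ x y, inner ℝ y (T x) = X x y := fun x y => by
    rw [real_inner_comm]
    exact InnerProductSpace.toDual_symm_apply
  have h1 := T.trace_eq_sum_inner (EuclideanSpace.basisFun (Fin d) ℝ)
  have h2 := T.trace_eq_sum_inner ((EuclideanSpace.basisFun (Fin d) ℝ).map O)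
  rw [h1] at h2
  simp only [hT, OrthonormalBasis.map_apply, EuclideanSpace.basisFun_apply] at h2
  exact h2.symm

theorem form_eq_sum (X : Space d →L[ℝ] Space d →L[ℝ] ℝ) (x y : Space d) :
    X x y = ∑ i, ∑ j, x i * y j * X (EuclideanSpace.single i 1) (EuclideanSpace.single j 1) := by
  have hx : ∀ x : Space d, x = ∑ i, x i • EuclideanSpace.single i (1 : ℝ) := fun x => by
    ext j; simp [Pi.single_apply]
  conv_lhs => rw [hx x, hx y]
  simp only [map_sum, map_smul, sum_apply, smul_apply, smul_eq_mul, Finset.mul_sum]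
  rw [Finset.sum_comm]
  exact Finset.sum_congr rfl fun i _ => Finset.sum_congr rfl fun j _ => by ring

theorem curvatureTerm_eq (X : Space d →L[ℝ] Space d →L[ℝ] ℝ) (p : Space d) :
    curvatureTerm p (Matrix.of fun i j => X (EuclideanSpace.single i 1) (EuclideanSpace.single j 1)) =
      ∑ i, X (EuclideanSpace.single i 1) (EuclideanSpace.single i 1) -
        X (‖p‖⁻¹ • p) (‖p‖⁻¹ • p) := by
  rw [curvatureTerm, sub_mul, Matrix.trace_sub, one_mul, form_eq_sum X (‖p‖⁻¹ • p)]
  congr 1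
  simp only [Matrix.trace, Matrix.diag_apply, Matrix.mul_apply, Matrix.vecMulVec_apply,
    Matrix.of_apply]
  rw [Finset.sum_comm]
  exact Finset.sum_congr rfl fun i _ => Finset.sum_congr rfl fun j _ => by ring

/-- As `O` carries the first basis vector to the unit normal, omitting it from the trace subtracts
exactly the normal entry. -/
theorem sum_tangentForm (X : Space (d + 1) →L[ℝ] Space (d + 1) →L[ℝ] ℝ) {p : Space (d + 1)}
    {O : Space (d + 1) ≃ₗᵢ[ℝ] Space (d + 1)}
    (hO : O (EuclideanSpace.single 0 1) = ‖p‖⁻¹ • p) :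
    ∑ i, tangentForm O X (EuclideanSpace.single i 1) (EuclideanSpace.single i 1) =
      curvatureTerm p
        (Matrix.of fun i j => X (EuclideanSpace.single i 1) (EuclideanSpace.single j 1)) := by
  rw [curvatureTerm_eq, ← hO, ← sum_form_isometry O X, Fin.sum_univ_succ]
  simp [zeroCons_single]

theorem hess_eq (φ : Space (d + 1) × ℝ → ℝ) (z : Space (d + 1) × ℝ) :
    hess φ z = Matrix.of fun i j =>
      hessForm φ z (EuclideanSpace.single i 1) (EuclideanSpace.single j 1) := rfl

theorem hessForm_eq_zero {φ : Space (d + 1) × ℝ → ℝ} {z : Space (d + 1) × ℝ}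
    (h : hess φ z = 0) : hessForm φ z = 0 := by
  ext x y
  rw [form_eq_sum]
  refine Finset.sum_eq_zero fun i _ => Finset.sum_eq_zero fun j _ => ?_
  have := congrFun (congrFun h i) j
  rw [hess_eq, Matrix.of_apply] at this
  rw [this]
  simp

@[simp] theorem tailPoint_add (x y : Space (d + 1)) :
    tailPoint (x + y) = tailPoint x + tailPoint y := by
  ext; simp

@[simp] theorem tailPoint_smul (c : ℝ) (x : Space (d + 1)) :
    tailPoint (c • x) = c • tailPoint x := by
  ext; simp

theorem norm_tailPoint_le (x : Space (d + 1)) : ‖tailPoint x‖ ≤ ‖x‖ := by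
  have := norm_le_norm_consPoint (x 0) (tailPoint x)
  rwa [consPoint_tailPoint] at this

theorem abs_apply_zero_le (x : Space (d + 1)) : |x 0| ≤ ‖x‖ := by
  have := abs_le_norm_consPoint (x 0) (tailPoint x)
  rwa [consPoint_tailPoint] at this

theorem eq_smul_add_zeroCons (x : Space (d + 1)) :
    x = x 0 • EuclideanSpace.single 0 (1 : ℝ) + zeroCons (tailPoint x) := by
  ext i
  refine Fin.cases ?_ (fun i => ?_) i
  · simp [zeroCons_eq]
  · simp [zeroCons_eq, Fin.succ_ne_zero]

/-! ### Superlevel sets of test functions as epigraphs -/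

/-- The superlevel set of a test function lies locally above a parabolic graph. -/
theorem exists_superlevel_subset {φ : Space (d + 1) × ℝ → ℝ} {z₀ : Space (d + 1) × ℝ}
    (hφ : ContDiffAt ℝ 2 φ z₀) (hp : grad φ z₀ ≠ 0) {O : Space (d + 1) ≃ₗᵢ[ℝ] Space (d + 1)}
    (hO : O (EuclideanSpace.single 0 1) = ‖grad φ z₀‖⁻¹ • grad φ z₀) {η : ℝ} (hη : 0 < η) :
    ∃ K ≥ 0, ∃ ρ > 0, ∀ (w : Space (d + 1)) (τ : ℝ), ‖w‖ ≤ ρ → |τ| ≤ ρ →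
      φ z₀ ≤ φ (z₀.1 + O w, z₀.2 + τ) →
      0 ≤ w 0 + timeDeriv φ z₀ / ‖grad φ z₀‖ * τ +
        (‖grad φ z₀‖⁻¹ * tangentForm O (hessForm φ z₀) (tailPoint w) (tailPoint w) +
          η * ‖tailPoint w‖ ^ 2) / 2 + K * τ ^ 2 := by
  set P := ‖grad φ z₀‖ with hP
  have hP0 : 0 < P := norm_pos_iff.2 hp
  set X := hessForm φ z₀ with hX
  set e : Space (d + 1) := ‖grad φ z₀‖⁻¹ • grad φ z₀ with he
  -- The Taylor error is doubled by `exists_graph_bound` and then divided by `P`, which leaves `η /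
  -- 2`.
  have hη' : 0 < P * η / 4 := by positivity
  obtain ⟨K, hK, hexp⟩ := exists_eventually_expansion_le hφ hη'
  obtain ⟨δ, hδ, hexp⟩ := Metric.eventually_nhds_iff_ball.1 hexp
  obtain ⟨K', hK', ρ, hρ, hgr⟩ := exists_graph_bound (C := ‖X‖ + P * η / 4) (timeDeriv φ z₀) hP0
    (by positivity) hη' hK
  refine ⟨K' / P, by positivity, min ρ (δ / 2), by positivity, fun w τ hw hτ hle => ?_⟩
  have hwρ := hw.trans (min_le_left _ _)
  have hτρ := hτ.trans (min_le_left _ _)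
  have hwδ := hw.trans (min_le_right _ _)
  have hτδ := hτ.trans (min_le_right _ _)
  have h1 := hexp (O w, τ) (by
    rw [mem_ball_zero_iff, Prod.norm_def, max_lt_iff]
    simp only [LinearIsometryEquiv.norm_map, Real.norm_eq_abs]
    constructor <;> linarith)
  have h2 : φ (z₀ + (O w, τ)) = φ (z₀.1 + O w, z₀.2 + τ) := rfl
  rw [h2] at h1
  simp only [LinearIsometryEquiv.norm_map] at h1
  have hOw : O w = w 0 • e + O (zeroCons (tailPoint w)) := by
    conv_lhs => rw [eq_smul_add_zeroCons w]
    rw [map_add, map_smul, hO]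
  have hen : ‖e‖ = 1 := by rw [← hO]; simp
  have hin : inner ℝ (grad φ z₀) (O w) = P * w 0 := by
    have h3 : grad φ z₀ = P • O (EuclideanSpace.single 0 1) := by
      rw [hO, he, smul_smul, mul_inv_cancel₀ hP0.ne', one_smul]
    rw [h3, inner_smul_left, O.inner_map_map, EuclideanSpace.inner_single_left]
    simp
  set y := O (zeroCons (tailPoint w)) with hy
  have hyn : ‖y‖ = ‖tailPoint w‖ := by
    rw [hy, O.norm_map, ← sq_eq_sq₀ (norm_nonneg _) (norm_nonneg _), zeroCons_eq, norm_consPoint_sq]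
    simp
  -- Only the tangential part of the Hessian is kept; terms with a normal factor are among the
  -- errors absorbed by `exists_graph_bound`.
  have hXs : X (O w) (O w) = X y y + (w 0 * X e y + w 0 * X y e + w 0 ^ 2 * X e e) := by
    rw [hOw]
    simp only [map_add, map_smul, add_apply, smul_apply, smul_eq_mul]
    ring
  have hb1 : w 0 * X e y ≤ ‖X‖ * |w 0| * ‖tailPoint w‖ := by
    refine (le_abs_self _).trans ?_
    rw [abs_mul]
    have := X.le_opNorm₂ e y
    rw [hen, hyn, Real.norm_eq_abs] at this
    calc |w 0| * |X e y| ≤ |w 0| * (‖X‖ * 1 * ‖tailPoint w‖) := by gcongr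
      _ = _ := by ring
  have hb2 : w 0 * X y e ≤ ‖X‖ * |w 0| * ‖tailPoint w‖ := by
    refine (le_abs_self _).trans ?_
    rw [abs_mul]
    have := X.le_opNorm₂ y e
    rw [hen, hyn, Real.norm_eq_abs] at this
    calc |w 0| * |X y e| ≤ |w 0| * (‖X‖ * ‖tailPoint w‖ * 1) := by gcongr
      _ = _ := by ring
  have hb3 : w 0 ^ 2 * X e e ≤ ‖X‖ * |w 0| * |w 0| := by
    have := X.le_opNorm₂ e e
    rw [hen, Real.norm_eq_abs] at this
    calc w 0 ^ 2 * X e e ≤ w 0 ^ 2 * (‖X‖ * 1 * 1) := by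
          gcongr; exact (le_abs_self _).trans this
      _ = _ := by rw [← sq_abs]; ring
  have hb4 : |X y y / 2| ≤ (‖X‖ + P * η / 4) * ‖tailPoint w‖ ^ 2 := by
    have := X.le_opNorm₂ y y
    rw [hyn, Real.norm_eq_abs] at this
    rw [abs_div, abs_two]
    have h3 : 0 ≤ P * η / 4 * ‖tailPoint w‖ ^ 2 := by positivity
    have h4 := abs_nonneg (X y y)
    linarith
  have hwn : ‖w‖ ^ 2 = |w 0| ^ 2 + ‖tailPoint w‖ ^ 2 := by
    have := norm_consPoint_sq (w 0) (tailPoint w)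
    rwa [consPoint_tailPoint, ← sq_abs (w 0)] at this
  have hfin := hgr (w 0) ‖tailPoint w‖ τ (X y y / 2) ((abs_apply_zero_le w).trans hwρ)
    (norm_nonneg _) ((norm_tailPoint_le w).trans hwρ) hτρ hb4 (by
      rw [hin, hXs, hwn] at h1
      have h5 : 0 ≤ P * η / 4 * |w 0| * ‖tailPoint w‖ := by positivity
      have h6 : 0 ≤ ‖X‖ * |w 0| * |w 0| := by positivity
      linarith)
  have : w 0 + timeDeriv φ z₀ / P * τ + (P⁻¹ * tangentForm O X (tailPoint w) (tailPoint w) +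
      η * ‖tailPoint w‖ ^ 2) / 2 + K' / P * τ ^ 2 = P⁻¹ * (P * w 0 + timeDeriv φ z₀ * τ +
        X y y / 2 + 2 * (P * η / 4) * ‖tailPoint w‖ ^ 2 + K' * τ ^ 2) := by
    rw [tangentForm_apply, ← hy]
    field_simp
    ring
  rw [this]
  positivity

/-! ### Contact sequences where the gradient does not vanish -/

namespace IsFlow

variable {σ : ℝ → ℝ} {U : ℝ → ℕ → Space (d + 1) → ℝ}

/-- Contact sequences at a point where the limit set lies strictly above a parabolic graph. -/
theorem exists_contact_graph (hU : IsFlow α σ U)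
    {z₀ : Space (d + 1) × ℝ} (hz₀ : z₀ ∈ spaceTime (d + 1))
    (hc : z₀ ∈ contactSet U) (O : Space (d + 1) ≃ₗᵢ[ℝ] Space (d + 1)) (a : ℝ)
    (B : Space d →L[ℝ] Space d →L[ℝ] ℝ) (K : ℝ) {ρ : ℝ} (hρ : 0 < ρ)
    (hpos : ∀ (w : Space (d + 1)) (τ : ℝ), ‖w‖ ≤ ρ → |τ| ≤ ρ →
      (z₀.1 + O w, z₀.2 + τ) ∈ contactSet U → (w, τ) ≠ 0 →
        0 < w 0 + a * τ + B (tailPoint w) (tailPoint w) / 2 + K * τ ^ 2) :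
    ∃ (h : ℕ → ℝ) (x : ℕ → Space (d + 1)) (n : ℕ → ℕ) (a' : ℕ → ℝ) (q : ℕ → Space d →L[ℝ] ℝ),
      (∀ k, 0 < h k) ∧ Tendsto h atTop (𝓝 0) ∧
      Tendsto (fun k => (x k, (n k : ℝ) * h k)) atTop (𝓝 z₀) ∧
      Tendsto a' atTop (𝓝 a) ∧ Tendsto q atTop (𝓝 0) ∧
      (∀ k y, U (h k) (n k) y = 1 ∨ U (h k) (n k) y = -1) ∧
      (∀ k, U (h k) (n k + 1) (x k) = 1) ∧
      ∀ᶠ k in atTop, ∀ r > 0, ∀ z : Space (d + 1), ‖z‖ ≤ ρ / 2 / r →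
        U (h k) (n k) (x k + r • O z) = 1 →
        0 ≤ z 0 + q k (tailPoint z) -
          (h k / r * a' k - r * (B (tailPoint z) (tailPoint z) / 2)) := by
  set ψ : Space (d + 1) × ℝ → ℝ := fun z => (O.symm (z.1 - z₀.1)) 0 + a * (z.2 - z₀.2) +
    B (tailPoint (O.symm (z.1 - z₀.1))) (tailPoint (O.symm (z.1 - z₀.1))) / 2 +
      K * (z.2 - z₀.2) ^ 2 with hψ
  have htail : Continuous (tailPoint : Space (d + 1) → Space d) := by
    unfold tailPoint; fun_prop
  have hcont : Continuous ψ := by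
    have h1 : Continuous (fun z : Space (d + 1) × ℝ => O.symm (z.1 - z₀.1)) := by fun_prop
    have h2 : Continuous (fun z : Space (d + 1) × ℝ => tailPoint (O.symm (z.1 - z₀.1))) :=
      htail.comp h1
    rw [hψ]
    fun_prop
  have hψ0 : ψ z₀ = 0 := by
    have : tailPoint (0 : Space (d + 1)) = 0 := by ext; simp
    simp [hψ, this]
  have hψpos : ∀ z ∈ Metric.closedBall z₀ ρ, z ∈ contactSet U → z ≠ z₀ → 0 < ψ z := by
    intro z hz hzc hne
    rw [Metric.mem_closedBall, Prod.dist_eq, max_le_iff, dist_eq_norm, Real.dist_eq] at hz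
    refine hpos (O.symm (z.1 - z₀.1)) (z.2 - z₀.2) (by rw [O.symm.norm_map]; exact hz.1) hz.2
      (by simpa using hzc) ?_
    intro h0
    rw [Prod.mk_eq_zero] at h0
    refine hne (Prod.ext ?_ ?_)
    · have := h0.1
      rw [map_eq_zero_iff _ O.symm.injective] at this
      exact sub_eq_zero.1 this
    · exact sub_eq_zero.1 h0.2
  choose h x n h0 hlt hd hpm hone hcmp using fun k : ℕ =>
    hU.exists_contact hz₀ hc hcont hψ0 hρ hψpos (ε := 1 / ((k : ℝ) + 1)) (by positivity)
  have hε : Tendsto (fun k : ℕ => 1 / ((k : ℝ) + 1)) atTop (𝓝 0) :=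
    tendsto_one_div_add_atTop_nhds_zero_nat
  have hh : Tendsto h atTop (𝓝 0) := squeeze_zero (fun k => (h0 k).le) (fun k => (hlt k).le) hε
  have hz : Tendsto (fun k => (x k, ((n k : ℝ) + 1) * h k)) atTop (𝓝 z₀) := by
    rw [tendsto_iff_dist_tendsto_zero]
    exact squeeze_zero (fun k => dist_nonneg) (fun k => (hd k).le) hε
  have hx : Tendsto x atTop (𝓝 z₀.1) := (continuous_fst.tendsto z₀).comp hz
  have ht : Tendsto (fun k => ((n k : ℝ) + 1) * h k) atTop (𝓝 z₀.2) :=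
    (continuous_snd.tendsto z₀).comp hz
  set w : ℕ → Space (d + 1) := fun k => O.symm (x k - z₀.1) with hw
  have hw0 : Tendsto w atTop (𝓝 0) := by
    have h1 : Continuous (fun y => O.symm (y - z₀.1)) := by fun_prop
    have := (h1.tendsto z₀.1).comp hx
    rwa [sub_self, map_zero] at this
  set τ : ℕ → ℝ := fun k => ((n k : ℝ) + 1) * h k - z₀.2 with hτ
  have hτ0 : Tendsto τ atTop (𝓝 0) := by simpa using ht.sub_const z₀.2
  -- Expansion of `ψ` about the contact point. The increment in time gives `-h a'`, whose last
  -- summand is the slack `h ^ 2`; the mixed terms of `B` between `z` and the displacement `w` of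
  -- the contact point give the linear form `q`, which vanishes in the limit with `w`.
  refine ⟨h, x, n, fun k => a - K * h k + 2 * K * τ k - h k,
    fun k => (2⁻¹ : ℝ) • (B (tailPoint (w k)) + B.flip (tailPoint (w k))), h0, hh, ?_, ?_, ?_, hpm,
    hone, ?_⟩
  · have h1 : Tendsto (fun k => ((n k : ℝ) + 1) * h k - h k) atTop (𝓝 (z₀.2 - 0)) := ht.sub hh
    rw [sub_zero] at h1
    refine Tendsto.congr (fun k => ?_) (hx.prodMk_nhds h1)
    simp only [Prod.mk.injEq, true_and]
    ring
  · have h1 := (((hh.const_mul K).const_sub a).add (hτ0.const_mul (2 * K))).sub hh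
    simpa using h1
  · have h1 : Continuous (fun y : Space d => (2⁻¹ : ℝ) • (B y + B.flip y)) := by fun_prop
    have h2 := (h1.comp htail).tendsto 0
    have h3 : tailPoint (0 : Space (d + 1)) = 0 := by ext; simp
    have h4 := h2.comp hw0
    simpa [Function.comp_def, h3] using h4
  · have hxρ : ∀ᶠ k in atTop, dist (x k) z₀.1 < ρ / 2 :=
      (tendsto_iff_dist_tendsto_zero.1 hx).eventually_lt_const (by positivity)
    filter_upwards [hxρ] with k hk r hr z hzr hUz
    have hzr' : r * ‖z‖ ≤ ρ / 2 := by rwa [le_div_iff₀ hr, mul_comm] at hzr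
    have hmem : x k + r • O z ∈ Metric.closedBall z₀.1 ρ := by
      rw [Metric.mem_closedBall, dist_eq_norm]
      rw [dist_eq_norm] at hk
      calc ‖x k + r • O z - z₀.1‖ = ‖(x k - z₀.1) + r • O z‖ := by congr 1; abel
        _ ≤ ‖x k - z₀.1‖ + ‖r • O z‖ := norm_add_le _ _
        _ = ‖x k - z₀.1‖ + r * ‖z‖ := by
          rw [norm_smul, O.norm_map, Real.norm_of_nonneg hr.le]
        _ ≤ ρ := by linarith
    have hmain := hcmp k _ hmem hUz
    have e1 : O.symm (x k + r • O z - z₀.1) = w k + r • z := by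
      have : x k + r • O z - z₀.1 = (x k - z₀.1) + r • O z := by abel
      rw [this, map_add, map_smul, O.symm_apply_apply]
    have e2 : (n k : ℝ) * h k - z₀.2 = τ k - h k := by simp only [hτ]; ring
    simp only [hψ, e1, e2, tailPoint_add, tailPoint_smul] at hmain
    simp only [map_add, map_smul, add_apply, smul_apply, smul_eq_mul, PiLp.add_apply,
      PiLp.smul_apply] at hmain
    have e3 : (0 : ℝ) ≤ r * (z 0) + r * (B (tailPoint (w k)) (tailPoint z) +
        B (tailPoint z) (tailPoint (w k))) / 2 +
        r ^ 2 * B (tailPoint z) (tailPoint z) / 2 -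
          h k * (a - K * h k + 2 * K * τ k - h k) := by
      have e4 : O.symm (x k - z₀.1) = w k := rfl
      have e5 : ((n k : ℝ) + 1) * h k - z₀.2 = τ k := rfl
      rw [e4, e5] at hmain
      linarith
    have e6 : z 0 + ((2⁻¹ : ℝ) • (B (tailPoint (w k)) + B.flip (tailPoint (w k)))) (tailPoint z) -
        (h k / r * (a - K * h k + 2 * K * τ k - h k) -
          r * (B (tailPoint z) (tailPoint z) / 2)) =
        r⁻¹ * (r * (z 0) + r * (B (tailPoint (w k)) (tailPoint z) +
        B (tailPoint z) (tailPoint (w k))) / 2 +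
        r ^ 2 * B (tailPoint z) (tailPoint z) / 2 -
          h k * (a - K * h k + 2 * K * τ k - h k)) := by
      simp only [smul_apply, add_apply, ContinuousLinearMap.flip_apply, smul_eq_mul]
      field_simp
      ring
    rw [e6]
    positivity

end IsFlow

/-! ### The spatial scale of the scheme -/

/-- The normal displacement of a front during one time step, in units of the spatial scale `r`. -/
def rate (α r : ℝ) : ℝ := if α < 1 then r ^ α else if α = 1 then r * |Real.log r| else r

/-- The scale is `r = σ(h) ^ (1/α)`, which is `h ^ (1 / (1 + α))`, `σ(h)` or `h ^ (1/2)`. The three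
definitions of `σ_α` express that one time step advances a front by `rate α r` in units of `r`. -/
theorem IsScaling.exists_radius {σ : ℝ → ℝ} (hσ : IsScaling α σ) (hα₀ : 0 < α) :
    ∃ r : ℝ → ℝ, Tendsto r (𝓝[>] 0) (𝓝[>] 0) ∧
      ∀ᶠ h in 𝓝[>] (0 : ℝ), σ h = r h ^ α ∧ h / r h = rate α (r h) := by
  have hpow : ∀ s : ℝ, 0 < s → Tendsto (fun h : ℝ => h ^ s) (𝓝[>] 0) (𝓝[>] 0) := by
    intro s hs
    refine tendsto_nhdsWithin_iff.2 ⟨?_, ?_⟩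
    · have := (Real.continuous_rpow_const hs.le).tendsto 0
      rw [Real.zero_rpow hs.ne'] at this
      exact this.mono_left nhdsWithin_le_nhds
    · filter_upwards [self_mem_nhdsWithin] with h hh
      exact Real.rpow_pos_of_pos hh s
  rcases lt_trichotomy α 1 with h1 | h1 | h1
  · refine ⟨fun h => h ^ (1 / (1 + α)), hpow _ (by positivity), ?_⟩
    filter_upwards [self_mem_nhdsWithin] with h hh
    have hh : 0 < h := hh
    rw [hσ.lt_one h1 h hh, rate, if_pos h1, ← Real.rpow_mul hh.le]
    have e1 : 1 / (1 + α) * α = α / (1 + α) := by ring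
    refine ⟨by rw [e1], ?_⟩
    rw [e1, div_eq_iff (by positivity), ← Real.rpow_add hh]
    have : α / (1 + α) + 1 / (1 + α) = 1 := by field_simp; ring
    rw [this, Real.rpow_one]
  · refine ⟨σ, (hσ.eq_one h1).1, ?_⟩
    have h2 := tendsto_nhdsWithin_iff.1 (hσ.eq_one h1).1
    filter_upwards [(hσ.eq_one h1).2, h2.2] with h hh hpos
    have hpos : 0 < σ h := hpos
    refine ⟨by rw [h1, Real.rpow_one], ?_⟩
    rw [rate, if_neg h1.not_lt, if_pos h1, div_eq_iff hpos.ne']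
    linarith
  · refine ⟨fun h => h ^ (1 / 2 : ℝ), hpow _ (by positivity), ?_⟩
    filter_upwards [self_mem_nhdsWithin] with h hh
    have hh : 0 < h := hh
    rw [hσ.one_lt h1 h hh, rate, if_neg h1.not_gt, if_neg h1.ne', ← Real.rpow_mul hh.le]
    refine ⟨by congr 1; ring, ?_⟩
    rw [div_eq_iff (by positivity), ← Real.rpow_add hh]
    norm_num

/-- The integrals of the scheme at contact sequences, in rescaled coordinates. -/
theorem IsFlow.exists_contact_scaled {σ : ℝ → ℝ} {U : ℝ → ℕ → Space (d + 1) → ℝ}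
    (hU : IsFlow α σ U) (hσ : IsScaling α σ) (hα₀ : 0 < α)
    {z₀ : Space (d + 1) × ℝ} (hz₀ : z₀ ∈ spaceTime (d + 1))
    (hc : z₀ ∈ contactSet U) (O : Space (d + 1) ≃ₗᵢ[ℝ] Space (d + 1)) (a : ℝ)
    (B : Space d →L[ℝ] Space d →L[ℝ] ℝ) (K : ℝ) {ρ : ℝ} (hρ : 0 < ρ)
    (hpos : ∀ (w : Space (d + 1)) (τ : ℝ), ‖w‖ ≤ ρ → |τ| ≤ ρ →
      (z₀.1 + O w, z₀.2 + τ) ∈ contactSet U → (w, τ) ≠ 0 →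
        0 < w 0 + a * τ + B (tailPoint w) (tailPoint w) / 2 + K * τ ^ 2) :
    ∃ (h r : ℕ → ℝ) (x : ℕ → Space (d + 1)) (n : ℕ → ℕ) (a' : ℕ → ℝ) (q : ℕ → Space d →L[ℝ] ℝ),
      (∀ k, 0 < h k) ∧ Tendsto h atTop (𝓝 0) ∧
      (∀ k, 0 < r k) ∧ (∀ k, r k < 1) ∧ Tendsto r atTop (𝓝 0) ∧
      Tendsto (fun k => (x k, (n k : ℝ) * h k)) atTop (𝓝 z₀) ∧
      Tendsto a' atTop (𝓝 a) ∧ Tendsto q atTop (𝓝 0) ∧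
      (∀ k y, U (h k) (n k) y = 1 ∨ U (h k) (n k) y = -1) ∧
      (∀ k, 0 ≤ ∫ z, profile α z * U (h k) (n k) (x k + r k • O z)) ∧
      ∀ k, ∀ z : Space (d + 1), ‖z‖ ≤ ρ / 2 / r k → U (h k) (n k) (x k + r k • O z) = 1 →
        0 ≤ z 0 + q k (tailPoint z) -
          (rate α (r k) * a' k - r k * (B (tailPoint z) (tailPoint z) / 2)) := by
  obtain ⟨h, x, n, a', q, h0, hh, hxn, ha', hq, hpm, hone, hcmp⟩ :=
    hU.exists_contact_graph hz₀ hc O a B K hρ hpos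
  obtain ⟨R, hR, hR'⟩ := hσ.exists_radius hα₀
  have hh' : Tendsto h atTop (𝓝[>] 0) := tendsto_nhdsWithin_iff.2 ⟨hh, Eventually.of_forall h0⟩
  have hr := tendsto_nhdsWithin_iff.1 (hR.comp hh')
  simp only [Function.comp_def] at hr
  -- Finitely many terms are dropped so that all asymptotic relations hold for every index.
  obtain ⟨k₀, hk₀⟩ := eventually_atTop.1 ((hcmp.and (hh'.eventually hR')).and
    (hr.2.and (hr.1.eventually_lt_const one_pos)))
  have hs : Tendsto (fun k => k + k₀) atTop atTop := tendsto_add_atTop_nat k₀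
  refine ⟨fun k => h (k + k₀), fun k => R (h (k + k₀)), fun k => x (k + k₀), fun k => n (k + k₀),
    fun k => a' (k + k₀), fun k => q (k + k₀), fun k => h0 _, hh.comp hs, fun k => ?_, fun k => ?_,
    hr.1.comp hs, hxn.comp hs, ha'.comp hs, hq.comp hs, fun k => hpm _, fun k => ?_,
    fun k z hz hUz => ?_⟩
  · exact (hk₀ (k + k₀) (by omega)).2.1
  · exact (hk₀ (k + k₀) (by omega)).2.2
  · obtain ⟨⟨-, h1, -⟩, h2, -⟩ := hk₀ (k + k₀) (by omega)
    have h3 := hU.integral_nonneg _ _ _ (hone (k + k₀))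
    rwa [h1, integral_kernel_mul hα₀ h2 O] at h3
  · obtain ⟨⟨h1, -, h2⟩, h3, -⟩ := hk₀ (k + k₀) (by omega)
    have h4 := h1 _ h3 z hz hUz
    rwa [h2] at h4

/-! ### Comparison with the sign of a graph -/

/-- Comparison of a function with values `±1` with the sign of a function which is nonnegative
wherever the former equals one in a ball. -/
theorem integral_profile_mul_le (hα₀ : 0 < α) (hα₂ : α < 2) {f s : Space (d + 1) → ℝ}
    (hfm : Measurable f) (hf : ∀ z, f z = 1 ∨ f z = -1) (hs : Measurable s) {G : Set (Space (d + 1))}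
    (hG : MeasurableSet G) {L : ℝ} (hLG : Metric.ball 0 L ⊆ G)
    (hfs : ∀ z ∈ Metric.ball (0 : Space (d + 1)) L, f z = 1 → 0 ≤ s z) :
    ∫ z, profile α z * f z ≤ (∫ p : ℝ × Space d, truncProfile α G p.1 p.2 *
      signUpper (s (consPoint p.1 p.2))) +
        2 * ∫ z in (Metric.ball (0 : Space (d + 1)) L)ᶜ, profile α z := by
  have hPi := profile_integrable (d := d) hα₀ hα₂
  have hi1 : Integrable (fun z => profile α z * f z) := by
    refine hPi.norm.mono' (hPi.aestronglyMeasurable.mul hfm.aestronglyMeasurable)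
      (Eventually.of_forall fun z => ?_)
    rcases hf z with h | h <;> simp [h]
  have hi2 : Integrable (fun z => G.indicator (profile α) z * signUpper (s z)) := by
    refine (hPi.indicator hG).norm.mono' ((hPi.indicator hG).aestronglyMeasurable.mul
      (measurable_signUpper.comp hs).aestronglyMeasurable) (Eventually.of_forall fun z => ?_)
    rw [norm_mul, Real.norm_eq_abs (signUpper _), abs_signUpper, mul_one]
  have h1 : (∫ p : ℝ × Space d, truncProfile α G p.1 p.2 * signUpper (s (consPoint p.1 p.2))) =
      ∫ z, G.indicator (profile α) z * signUpper (s z) :=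
    integral_consPoint (fun z => G.indicator (profile α) z * signUpper (s z))
  rw [h1, ← integral_indicator measurableSet_ball.compl, ← integral_const_mul,
    ← integral_add hi2 ((hPi.indicator measurableSet_ball.compl).const_mul 2)]
  refine integral_mono hi1 (hi2.add ((hPi.indicator measurableSet_ball.compl).const_mul 2))
    fun z => ?_
  have hP := profile_nonneg hα₀ hα₂ z
  have hsu := abs_le.1 (abs_signUpper (s z)).le
  -- In the ball only the points with `f = 1` need an argument. Outside, two functions bounded by
  -- one differ by at most two, which accounts for the factor of the tail.
  by_cases hz : z ∈ Metric.ball (0 : Space (d + 1)) L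
  · simp only [indicator_of_mem (hLG hz), indicator_of_notMem (notMem_compl_iff.2 hz), mul_zero,
      add_zero]
    refine mul_le_mul_of_nonneg_left ?_ hP
    rcases hf z with h | h
    · rw [h, signUpper, if_pos (hfs z hz h)]
    · rw [h]; exact hsu.1
  · simp only [indicator_of_mem (mem_compl hz)]
    have hf1 : f z ≤ 1 := by rcases hf z with h | h <;> simp [h]
    have h2 : profile α z * f z ≤ profile α z * 1 := by gcongr
    by_cases hzG : z ∈ G
    · rw [indicator_of_mem hzG]
      nlinarith
    · rw [indicator_of_notMem hzG]
      linarith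

theorem measurable_tailPoint : Measurable (tailPoint : Space (d + 1) → Space d) := by
  unfold tailPoint
  exact (Continuous.measurable (by fun_prop))

/-- The mass beyond `ρ / r` is `O(r^α)`. For `α ≥ 1` its quotient by the rate is of order `1 / |log
r|` or `r ^ (α - 1)`, so the equation is local; for `α < 1` the two orders would agree. -/
theorem tendsto_inv_rate_mul_tail (hα₁ : 1 ≤ α) (hα₂ : α < 2) {r : ℕ → ℝ} (hr0 : ∀ k, 0 < r k)
    (hr1 : ∀ k, r k < 1) (hr : Tendsto r atTop (𝓝 0)) {ρ : ℝ} (hρ : 0 < ρ) :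
    Tendsto (fun k => (rate α (r k))⁻¹ *
      (2 * ∫ z in (Metric.ball (0 : Space (d + 1)) (ρ / r k))ᶜ, profile α z)) atTop (𝓝 0) := by
  have hα₀ : 0 < α := by linarith
  obtain ⟨C, hC, hle⟩ := exists_setIntegral_profile_compl_ball_le (d := d) hα₀ hα₂
  have hrate : ∀ k, 0 < rate α (r k) := by
    intro k
    have h1 := hr0 k
    have h2 : 0 < |Real.log (r k)| := abs_pos.2 (Real.log_neg h1 (hr1 k)).ne
    unfold rate
    split_ifs <;> positivity
  have hlim : Tendsto (fun k => (rate α (r k))⁻¹ * r k ^ α) atTop (𝓝 0) := by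
    rcases hα₁.eq_or_lt with h1 | h1
    · have hlog : Tendsto (fun k => |Real.log (r k)|) atTop atTop := by
        have := (tendsto_abs_atBot_atTop.comp Real.tendsto_log_nhdsGT_zero).comp
          (tendsto_nhdsWithin_iff.2 ⟨hr, Eventually.of_forall hr0⟩)
        exact this
      refine (tendsto_inv_atTop_zero.comp hlog).congr fun k => ?_
      have := (hr0 k).ne'
      simp only [Function.comp_apply, rate, ← h1, lt_irrefl, if_false, if_true, Real.rpow_one,
        mul_inv]
      field_simp
    · have h2 := ((Real.continuous_rpow_const (show 0 ≤ α - 1 by linarith)).tendsto 0).comp hr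
      rw [Real.zero_rpow (by linarith)] at h2
      refine h2.congr fun k => ?_
      simp only [Function.comp_apply, rate, if_neg h1.not_gt, if_neg h1.ne']
      rw [Real.rpow_sub_one (hr0 k).ne']
      field_simp
  have hlim2 := hlim.const_mul (2 * C * ρ ^ (-α))
  rw [mul_zero] at hlim2
  refine squeeze_zero (fun k => ?_) (fun k => ?_) hlim2
  · have := (hrate k).le
    have h2 : 0 ≤ ∫ z in (Metric.ball (0 : Space (d + 1)) (ρ / r k))ᶜ, profile α z :=
      integral_nonneg fun z => profile_nonneg hα₀ hα₂ z
    positivity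
  · have h1 := hle (ρ / r k) (div_pos hρ (hr0 k))
    rw [Real.div_rpow hρ.le (hr0 k).le, Real.rpow_neg (hr0 k).le, div_inv_eq_mul] at h1
    have := inv_nonneg.2 (hrate k).le
    calc (rate α (r k))⁻¹ * (2 * ∫ z in (Metric.ball (0 : Space (d + 1)) (ρ / r k))ᶜ, profile α z)
        ≤ (rate α (r k))⁻¹ * (2 * (C * (ρ ^ (-α) * r k ^ α))) := by gcongr
      _ = _ := by ring

/-! ### The constants -/

/-- The numerator of the constant of the curvature equation. -/
def curvatureNumerator (d : ℕ) (α : ℝ) : ℝ :=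
  if α = 1 then (volume : Measure (Space d)).toSphere.real univ / (d : ℝ) * tailConst d 1
  else ∫ y' : Space d, (zeroCons y' 1) ^ 2 * profile α (zeroCons y')

/-- The profile is radial, so for `α = 1` the limit along one axis is the tail constant. -/
theorem curvatureConst_eq (d : ℕ) (α : ℝ) :
    curvatureConst d α = (hyperplaneMass d α)⁻¹ * curvatureNumerator d α := by
  unfold curvatureConst curvatureNumerator
  congr 1
  split_ifs with h
  · congr 1
    refine Tendsto.limUnder_eq ?_
    have h1 : Tendsto (fun R : ℝ => EuclideanSpace.single (1 : Fin (d + 1)) R) atTop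
        (Bornology.cobounded (Space (d + 1))) := by
      rw [← tendsto_norm_atTop_iff_cobounded]
      simp only [PiLp.norm_single]
      exact tendsto_norm_atTop_atTop
    refine ((tendsto_rpow_mul_profile (d := d) one_pos one_lt_two).comp h1).congr' ?_
    filter_upwards [eventually_gt_atTop 0] with R hR
    simp only [Function.comp_apply, PiLp.norm_single, Real.norm_of_nonneg hR.le]
    rw [← Real.rpow_natCast]
    congr 2
    push_cast
    ring
  · rfl

theorem integrable_profile_zeroCons (hα₀ : 0 < α) (hα₂ : α < 2) :
    Integrable (fun z : Space d => profile α (zeroCons z)) := by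
  obtain ⟨C, hC, h, -⟩ := exists_profile_consPoint_le (d := d) hα₀ hα₂
  refine ((integrable_one_add_norm (r := (d : ℝ) + 1 + α) (by simp; linarith)).const_mul C).mono'
    ((profile_continuous hα₀ hα₂).comp (zeroConsL d).continuous).aestronglyMeasurable
    (Eventually.of_forall fun z => h 0 z)

theorem hyperplaneMass_pos (hα₀ : 0 < α) (hα₂ : α < 2) : 0 < hyperplaneMass d α := by
  unfold hyperplaneMass
  have hc : Continuous (fun z : Space d => profile α (zeroCons z)) :=
    (profile_continuous hα₀ hα₂).comp (zeroConsL d).continuous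
  have h0 : zeroCons (0 : Space d) = 0 := (zeroConsL d).map_zero
  refine mul_pos two_pos ((integral_pos_iff_support_of_nonneg
    (fun z => profile_nonneg hα₀ hα₂ _) (integrable_profile_zeroCons hα₀ hα₂)).2 ?_)
  refine (hc.isOpen_support).measure_pos _ ⟨0, ?_⟩
  rw [Function.mem_support, h0]
  exact (profile_zero_pos hα₀ hα₂).ne'

theorem integrable_profile_zeroCons_mul_sq (hα₁ : 1 < α) (hα₂ : α < 2) :
    Integrable (fun z : Space d => profile α (zeroCons z) * ‖z‖ ^ 2) := by
  have hα₀ : 0 < α := by linarith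
  obtain ⟨C, hC, h, -⟩ := exists_profile_consPoint_le (d := d) hα₀ hα₂
  refine ((integrable_one_add_norm (r := (d : ℝ) + α - 1) (by simp; linarith)).const_mul C).mono'
    (((profile_continuous hα₀ hα₂).comp (zeroConsL d).continuous).mul
      (by fun_prop)).aestronglyMeasurable
    (Eventually.of_forall fun z => ?_)
  have h1 : 0 < 1 + ‖z‖ := by positivity
  rw [norm_mul, Real.norm_of_nonneg (by positivity : 0 ≤ ‖z‖ ^ 2)]
  calc ‖profile α (zeroCons z)‖ * ‖z‖ ^ 2
      ≤ C * (1 + ‖z‖) ^ (-((d : ℝ) + 1 + α)) * (1 + ‖z‖) ^ 2 := by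
        gcongr
        · exact h 0 z
        · linarith
    _ = C * (1 + ‖z‖) ^ (-((d : ℝ) + α - 1)) := by
        rw [mul_assoc, ← Real.rpow_two, ← Real.rpow_add h1]; congr 2; ring

theorem profile_zeroCons_isometry (O : Space d ≃ₗᵢ[ℝ] Space d) (z : Space d) :
    profile α (zeroCons (O z)) = profile α (zeroCons z) := by
  refine profile_eq_of_norm_eq ?_
  rw [← sq_eq_sq₀ (norm_nonneg _) (norm_nonneg _), zeroCons_eq, zeroCons_eq, norm_consPoint_sq,
    norm_consPoint_sq, O.norm_map]

theorem integral_profile_mul_form (hα₁ : 1 < α) (hα₂ : α < 2)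
    (B : Space d →L[ℝ] Space d →L[ℝ] ℝ) :
    ∫ z : Space d, profile α (zeroCons z) * B z z =
      (∑ i, B (EuclideanSpace.single i 1) (EuclideanSpace.single i 1)) *
        curvatureNumerator d α := by
  have hα₀ : 0 < α := by linarith
  rw [curvatureNumerator, if_neg hα₁.ne']
  cases d with
  | zero =>
    have : ∀ z : Space 0, z = 0 := fun z => Subsingleton.elim _ _
    simp [fun z => this z]
  | succ d =>
    rw [integral_radial_mul_bilin profile_zeroCons_isometry
      (integrable_profile_zeroCons_mul_sq hα₁ hα₂)
      ((profile_continuous hα₀ hα₂).comp (zeroConsL _).continuous).aestronglyMeasurable B 0]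
    congr 1
    refine integral_congr_ae (Eventually.of_forall fun z => ?_)
    exact mul_comm _ _

variable {σ : ℝ → ℝ} {U : ℝ → ℕ → Space (d + 1) → ℝ}

/-! ### The curvature equation where the gradient does not vanish -/

theorem measurable_graph (q : Space d →L[ℝ] ℝ) (B : Space d →L[ℝ] Space d →L[ℝ] ℝ) (s r : ℝ) :
    Measurable (fun z : Space (d + 1) => z 0 + q (tailPoint z) -
      (s - r * (B (tailPoint z) (tailPoint z) / 2))) := by
  have h1 : Continuous (fun z : Space d => q z) := q.continuous
  have h2 : Continuous (fun z : Space d => B z z) := by fun_prop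
  have h3 := h1.measurable.comp (measurable_tailPoint (d := d))
  have h4 := h2.measurable.comp (measurable_tailPoint (d := d))
  simp only [Function.comp_def] at h3 h4
  have h5 : Measurable (fun z : Space (d + 1) => z 0) := Continuous.measurable (by fun_prop)
  exact (h5.add h3).sub (measurable_const.sub ((h4.div_const 2).const_mul r))

/-- The inner product as a bilinear form. -/
def innerForm (d : ℕ) : Space d →L[ℝ] Space d →L[ℝ] ℝ := innerSL ℝ

/-- The bilinear form of a graph touching a superlevel set with normal derivative `P` and Hessian
`X`, up to a multiple `η` of the identity. -/
def graphForm (O : Space (d + 1) ≃ₗᵢ[ℝ] Space (d + 1))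
    (X : Space (d + 1) →L[ℝ] Space (d + 1) →L[ℝ] ℝ) (P η : ℝ) : Space d →L[ℝ] Space d →L[ℝ] ℝ :=
  P⁻¹ • tangentForm O X + η • innerForm d

theorem graphForm_self (O : Space (d + 1) ≃ₗᵢ[ℝ] Space (d + 1))
    (X : Space (d + 1) →L[ℝ] Space (d + 1) →L[ℝ] ℝ) (P η : ℝ) (z : Space d) :
    graphForm O X P η z z = P⁻¹ * tangentForm O X z z + η * ‖z‖ ^ 2 := by
  have : innerForm d z z = ‖z‖ ^ 2 := real_inner_self_eq_norm_sq z
  rw [graphForm, add_apply, add_apply, smul_apply, smul_apply, smul_apply, smul_apply, this]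
  rfl

/-- The speed of a limit front lying above a parabolic graph. -/
theorem IsFlow.speed_mul_hyperplaneMass_le (hU : IsFlow α σ U) (hσ : IsScaling α σ) (hα₁ : 1 ≤ α)
    (hα₂ : α < 2) {z₀ : Space (d + 1) × ℝ} (hz₀ : z₀ ∈ spaceTime (d + 1))
    (hc : z₀ ∈ contactSet U) (O : Space (d + 1) ≃ₗᵢ[ℝ] Space (d + 1)) (a : ℝ)
    (B : Space d →L[ℝ] Space d →L[ℝ] ℝ) (K : ℝ) {ρ : ℝ} (hρ : 0 < ρ)
    (hpos : ∀ (w : Space (d + 1)) (τ : ℝ), ‖w‖ ≤ ρ → |τ| ≤ ρ →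
      (z₀.1 + O w, z₀.2 + τ) ∈ contactSet U → (w, τ) ≠ 0 →
        0 < w 0 + a * τ + B (tailPoint w) (tailPoint w) / 2 + K * τ ^ 2) :
    a * hyperplaneMass d α ≤
      (∑ i, B (EuclideanSpace.single i 1) (EuclideanSpace.single i 1)) *
        curvatureNumerator d α := by
  have hα₀ : 0 < α := by linarith
  obtain ⟨h, r, x, n, a', q, h0, hh, hr0, hr1, hr, hxn, ha', hq, hpm, hinteg, hcmp⟩ :=
    hU.exists_contact_scaled hσ hα₀ hz₀ hc O a B K hρ hpos
  have hmeas : ∀ k, Measurable (fun z => U (h k) (n k) (x k + r k • O z)) := fun k =>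
    (hU.measurable _ _).comp (Continuous.measurable (by fun_prop))
  rcases hα₁.eq_or_lt with rfl | h1
  · rw [curvatureNumerator, if_pos rfl, hyperplaneMass]
    refine le_of_forall_pos_le_add fun ε hε => ?_
    obtain ⟨ρ₀, hρ₀, H⟩ := eventually_signIntegral_le_of_eq_one B (half_pos hε)
    -- The bound `ρ₀` belongs to the logarithmic asymptotics and `ρ / 2` to the range in which the
    -- contact inequality is available.
    set ρ' := min ρ₀ (ρ / 2) with hρ'
    have hρ'0 : 0 < ρ' := by positivity
    have htail := (tendsto_inv_rate_mul_tail (d := d) le_rfl hα₂ hr0 hr1 hr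
      hρ'0).eventually_lt_const (half_pos hε)
    obtain ⟨k, hk1, hk2⟩ := ((H hr0 hr1 hr ha' hq ρ' hρ'0 (min_le_left _ _)).and htail).exists
    have hrate : rate 1 (r k) = r k * |Real.log (r k)| := by simp [rate]
    have hrpos : 0 < r k * |Real.log (r k)| :=
      mul_pos (hr0 k) (abs_pos.2 (Real.log_neg (hr0 k) (hr1 k)).ne)
    have hle := integral_profile_mul_le hα₀ hα₂ (hmeas k) (fun z => hpm k _)
      (measurable_graph (q k) B (rate 1 (r k) * a' k) (r k)) (measurableSet_cylinder (ρ' / r k))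
      (L := ρ' / r k)
      (fun z hz => (norm_tailPoint_le z).trans_lt (by simpa using hz))
      (fun z hz hUz => hcmp k z (by
        have hz' : ‖z‖ < ρ' / r k := by simpa using hz
        refine hz'.le.trans ?_
        have := hr0 k
        gcongr
        exact min_le_right _ _) hUz)
    have hle2 := (hinteg k).trans hle
    simp only [consPoint_zero, tailPoint_consPoint] at hle2
    rw [hrate] at hle2 hk2
    have hle3 := mul_nonneg (inv_pos.2 hrpos).le hle2
    rw [mul_add] at hle3
    linarith
  · rw [← integral_profile_mul_form h1 hα₂, hyperplaneMass]
    have hlim := tendsto_signIntegral_of_one_lt h1 hα₂ B hr0 hr ha' hq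
    have htail := tendsto_inv_rate_mul_tail (d := d) hα₁ hα₂ hr0 hr1 hr (half_pos hρ)
    have hlim2 := hlim.add htail
    have hnn : ∀ k, 0 ≤ (r k)⁻¹ * (∫ p : ℝ × Space d, profile α (consPoint p.1 p.2) *
        signUpper (p.1 + q k p.2 - r k * (a' k - B p.2 p.2 / 2))) + (rate α (r k))⁻¹ *
      (2 * ∫ z in (Metric.ball (0 : Space (d + 1)) (ρ / 2 / r k))ᶜ, profile α z) := by
      intro k
      have hrate : rate α (r k) = r k := by simp [rate, h1.not_gt, h1.ne']
      have hle := integral_profile_mul_le hα₀ hα₂ (hmeas k) (fun z => hpm k _)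
        (measurable_graph (q k) B (rate α (r k) * a' k) (r k)) MeasurableSet.univ
        (L := ρ / 2 / r k) (subset_univ _)
        (fun z hz hUz => hcmp k z (by
          have hz' : ‖z‖ < ρ / 2 / r k := by simpa using hz
          exact hz'.le) hUz)
      have hle2 := (hinteg k).trans hle
      simp only [consPoint_zero, tailPoint_consPoint, truncProfile, indicator_univ] at hle2
      rw [hrate] at hle2 ⊢
      have hle3 := mul_nonneg (inv_pos.2 (hr0 k)).le hle2
      rw [mul_add] at hle3
      simpa only [mul_sub] using hle3
    have h2 := ge_of_tendsto hlim2 (Eventually.of_forall hnn)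
    have hi1 := integrable_profile_zeroCons (d := d) hα₀ hα₂
    have hi2 : Integrable (fun z : Space d => profile α (zeroCons z) * B z z) := by
      refine ((integrable_profile_zeroCons_mul_sq (d := d) h1 hα₂).const_mul ‖B‖).mono'
        (hi1.aestronglyMeasurable.mul (by fun_prop)) (Eventually.of_forall fun z => ?_)
      rw [norm_mul, Real.norm_of_nonneg (profile_nonneg hα₀ hα₂ _)]
      calc profile α (zeroCons z) * ‖B z z‖ ≤ profile α (zeroCons z) * (‖B‖ * ‖z‖ * ‖z‖) := by
            refine mul_le_mul_of_nonneg_left (B.le_opNorm₂ z z) (profile_nonneg hα₀ hα₂ _)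
        _ = _ := by ring
    have h3 : ∫ z : Space d, (a - B z z / 2) * profile α (zeroCons z) =
        a * (∫ z : Space d, profile α (zeroCons z)) -
          (∫ z : Space d, profile α (zeroCons z) * B z z) / 2 := by
      rw [← integral_const_mul, ← integral_div, ← integral_sub (hi1.const_mul a) (hi2.div_const 2)]
      refine integral_congr_ae (Eventually.of_forall fun z => ?_)
      simp only
      ring
    rw [h3] at h2
    linarith

/-- A contact point of the maximum of the upper relaxed limit minus a test function. -/
theorem IsFlow.le_of_isMaxOn (hU : IsFlow α σ U) {φ : Space (d + 1) × ℝ → ℝ}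
    {z₀ : Space (d + 1) × ℝ} (hz₀ : z₀ ∈ spaceTime (d + 1)) (hc : z₀ ∈ contactSet U)
    (hmax : IsMaxOn (fun w => upperRelaxed U w - φ w) (spaceTime (d + 1)) z₀)
    {z : Space (d + 1) × ℝ} (hz : z ∈ spaceTime (d + 1)) (hzc : z ∈ contactSet U) :
    φ z₀ ≤ φ z := by
  have h1 : upperRelaxed U z - φ z ≤ upperRelaxed U z₀ - φ z₀ := hmax hz
  rw [hU.upperRelaxed_of_mem hz hzc, hU.upperRelaxed_of_mem hz₀ hc] at h1
  linarith

theorem exists_isometry_single {p : Space (d + 1)} (hp : p ≠ 0) :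
    ∃ O : Space (d + 1) ≃ₗᵢ[ℝ] Space (d + 1),
      O (EuclideanSpace.single 0 1) = ‖p‖⁻¹ • p := by
  refine exists_isometry_map ?_
  rw [norm_smul, norm_inv, norm_norm, inv_mul_cancel₀ (norm_ne_zero_iff.2 hp)]
  simp

/-- At a contact point with nonvanishing gradient, the limit set lies strictly above a parabolic
graph. -/
theorem IsFlow.exists_graph (hU : IsFlow α σ U) {φ : Space (d + 1) × ℝ → ℝ}
    (hφ : ContDiffOn ℝ 2 φ (spaceTime (d + 1)))
    {z₀ : Space (d + 1) × ℝ} (hz₀ : z₀ ∈ spaceTime (d + 1)) (hc : z₀ ∈ contactSet U)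
    (hmax : IsMaxOn (fun w => upperRelaxed U w - φ w) (spaceTime (d + 1)) z₀)
    (hp : grad φ z₀ ≠ 0) {O : Space (d + 1) ≃ₗᵢ[ℝ] Space (d + 1)}
    (hO : O (EuclideanSpace.single 0 1) = ‖grad φ z₀‖⁻¹ • grad φ z₀) {η : ℝ} (hη : 0 < η) :
    ∃ K, ∃ ρ > 0, ∀ (w : Space (d + 1)) (τ : ℝ), ‖w‖ ≤ ρ → |τ| ≤ ρ →
      (z₀.1 + O w, z₀.2 + τ) ∈ contactSet U → (w, τ) ≠ 0 →
        0 < w 0 + timeDeriv φ z₀ / ‖grad φ z₀‖ * τ +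
          graphForm O (hessForm φ z₀) ‖grad φ z₀‖ η (tailPoint w) (tailPoint w) / 2 + K * τ ^ 2 := by
  have ht₀ : 0 < z₀.2 := hz₀.2
  -- Half of `η` is spent on the Taylor error; the other half, with the increase of `K` by one, pays
  -- for strictness.
  obtain ⟨K, hK, ρ, hρ, H⟩ := exists_superlevel_subset (contDiffAt_of_contDiffOn hφ hz₀) hp hO
    (half_pos hη)
  refine ⟨K + 1, min ρ (z₀.2 / 2), by positivity, fun w τ hw hτ hmem hne => ?_⟩
  have hz : (z₀.1 + O w, z₀.2 + τ) ∈ spaceTime (d + 1) := by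
    refine ⟨mem_univ _, ?_⟩
    have := (abs_le.1 (hτ.trans (min_le_right _ _))).1
    simp only [mem_Ioi]
    linarith
  have h1 := H w τ (hw.trans (min_le_left _ _)) (hτ.trans (min_le_left _ _))
    (hU.le_of_isMaxOn hz₀ hc hmax hz hmem)
  rw [graphForm_self]
  -- On the normal axis the added quadratic terms vanish, but there `w 0 ≥ 0` and `w ≠ 0` already
  -- give `w 0 > 0`.
  by_cases h3 : tailPoint w = 0 ∧ τ = 0
  · obtain ⟨h3, rfl⟩ := h3
    simp only [h3, map_zero, norm_zero, mul_zero] at h1 ⊢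
    have h4 : w 0 ≠ 0 := by
      intro h5
      refine hne ?_
      have : w = 0 := by
        rw [← consPoint_tailPoint w, h3, h5]
        ext i; refine Fin.cases ?_ (fun i => ?_) i <;> simp
      simp [this]
    have h5 : 0 ≤ w 0 := by simpa using h1
    simpa using lt_of_le_of_ne h5 h4.symm
  · have h4 : 0 < η / 2 * ‖tailPoint w‖ ^ 2 / 2 + τ ^ 2 := by
      by_cases h5 : tailPoint w = 0
      · have h6 : τ ≠ 0 := fun h => h3 ⟨h5, h⟩
        positivity
      · have := norm_pos_iff.2 h5
        positivity
    linarith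

/-- The speed inequality is applied with `a = φ_t / |Dφ|` and with the tangential Hessian divided by
`|Dφ|` plus `η` times the identity; then `η → 0`. -/
theorem IsFlow.timeDeriv_le_curvature (hU : IsFlow α σ U) (hσ : IsScaling α σ) (hα₁ : 1 ≤ α)
    (hα₂ : α < 2) {φ : Space (d + 1) × ℝ → ℝ} (hφ : ContDiffOn ℝ 2 φ (spaceTime (d + 1)))
    {z₀ : Space (d + 1) × ℝ} (hz₀ : z₀ ∈ spaceTime (d + 1)) (hc : z₀ ∈ contactSet U)
    (hmax : IsMaxOn (fun w => upperRelaxed U w - φ w) (spaceTime (d + 1)) z₀)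
    (hp : grad φ z₀ ≠ 0) :
    timeDeriv φ z₀ ≤ curvatureConst d α * curvatureTerm (grad φ z₀) (hess φ z₀) := by
  obtain ⟨O, hO⟩ := exists_isometry_single hp
  have hP : 0 < ‖grad φ z₀‖ := norm_pos_iff.2 hp
  have hm := hyperplaneMass_pos (d := d) (by linarith : 0 < α) hα₂
  have key : ∀ η > 0, timeDeriv φ z₀ / ‖grad φ z₀‖ * hyperplaneMass d α ≤
      (‖grad φ z₀‖⁻¹ * curvatureTerm (grad φ z₀) (hess φ z₀) + η * d) *
        curvatureNumerator d α := by
    intro η hη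
    obtain ⟨K, ρ, hρ, H⟩ := hU.exists_graph hφ hz₀ hc hmax hp hO hη
    have h1 := hU.speed_mul_hyperplaneMass_le hσ hα₁ hα₂ hz₀ hc O _ _ K hρ H
    have h2 : ∑ i : Fin d, graphForm O (hessForm φ z₀) ‖grad φ z₀‖ η
        (EuclideanSpace.single i 1) (EuclideanSpace.single i 1) =
        ‖grad φ z₀‖⁻¹ * curvatureTerm (grad φ z₀) (hess φ z₀) + η * d := by
      rw [hess_eq, ← sum_tangentForm _ hO, Finset.mul_sum]
      simp [graphForm_self, Finset.sum_add_distrib, mul_comm]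
    rwa [h2] at h1
  have hlim : Tendsto (fun η : ℝ => (‖grad φ z₀‖⁻¹ * curvatureTerm (grad φ z₀) (hess φ z₀) +
      η * d) * curvatureNumerator d α) (𝓝[>] 0)
      (𝓝 ((‖grad φ z₀‖⁻¹ * curvatureTerm (grad φ z₀) (hess φ z₀) + 0 * d) *
        curvatureNumerator d α)) :=
    (Continuous.tendsto (f := fun η : ℝ => (‖grad φ z₀‖⁻¹ *
      curvatureTerm (grad φ z₀) (hess φ z₀) + η * d) * curvatureNumerator d α)
      (by fun_prop) 0).mono_left nhdsWithin_le_nhds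
  have h1 := ge_of_tendsto hlim (by
    filter_upwards [self_mem_nhdsWithin] with η hη using key η hη)
  rw [zero_mul, add_zero] at h1
  rw [curvatureConst_eq]
  have h2 : timeDeriv φ z₀ = ‖grad φ z₀‖ * (hyperplaneMass d α)⁻¹ *
      (timeDeriv φ z₀ / ‖grad φ z₀‖ * hyperplaneMass d α) := by field_simp
  rw [h2]
  calc ‖grad φ z₀‖ * (hyperplaneMass d α)⁻¹ *
      (timeDeriv φ z₀ / ‖grad φ z₀‖ * hyperplaneMass d α) ≤ ‖grad φ z₀‖ * (hyperplaneMass d α)⁻¹ *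
        (‖grad φ z₀‖⁻¹ * curvatureTerm (grad φ z₀) (hess φ z₀) * curvatureNumerator d α) := by
        gcongr
    _ = _ := by field_simp

/-! ### Points where the gradient vanishes -/

theorem profile_neg (z : Space (d + 1)) : profile α (-z) = profile α z :=
  profile_eq_of_norm_eq (norm_neg z)

/-- The part of a ball where `‖z‖ ^ 2 + 2 k |z 0| < Λ`. -/
def nearSet (d : ℕ) (L Λ k : ℝ) : Set (Space (d + 1)) :=
  {z | ‖z‖ < L ∧ ‖z‖ ^ 2 + 2 * k * |z 0| < Λ}

/-- The part of a ball where `Λ + 2 k |z 0| ≤ ‖z‖ ^ 2`. -/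
def farSet (d : ℕ) (L Λ k : ℝ) : Set (Space (d + 1)) :=
  {z | ‖z‖ < L ∧ Λ + 2 * k * |z 0| ≤ ‖z‖ ^ 2}

theorem measurableSet_nearSet (L Λ k : ℝ) : MeasurableSet (nearSet d L Λ k) := by
  have h : Continuous (fun z : Space (d + 1) => ‖z‖ ^ 2 + 2 * k * |z 0|) := by fun_prop
  exact (measurableSet_lt measurable_norm measurable_const).inter
    (measurableSet_lt h.measurable measurable_const)

theorem measurableSet_farSet (L Λ k : ℝ) : MeasurableSet (farSet d L Λ k) := by
  have h : Continuous (fun z : Space (d + 1) => Λ + 2 * k * |z 0|) := by fun_prop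
  exact (measurableSet_lt measurable_norm measurable_const).inter
    (measurableSet_le h.measurable (measurable_norm.pow_const 2))

/-- Symmetrization of a function which is one only outside a ball centred at `-k e`. -/
theorem integral_profile_mul_le_of_ball (hα₀ : 0 < α) (hα₂ : α < 2) {f : Space (d + 1) → ℝ}
    (hfm : Measurable f) (hf : ∀ z, f z = 1 ∨ f z = -1) {L Λ k : ℝ} (hk : 0 ≤ k)
    (hfs : ∀ z ∈ Metric.ball (0 : Space (d + 1)) L, f z = 1 → Λ ≤ ‖z‖ ^ 2 + 2 * k * z 0) :
    ∫ z, profile α z * f z ≤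
      -(∫ z in nearSet d L Λ k, profile α z) + (∫ z in farSet d L Λ k, profile α z) +
      ∫ z in (Metric.ball (0 : Space (d + 1)) L)ᶜ, profile α z := by
  have hPi := profile_integrable (d := d) hα₀ hα₂
  set E₁ := nearSet d L Λ k with hE₁
  set E₂ := farSet d L Λ k with hE₂
  have hm₁ : MeasurableSet E₁ := measurableSet_nearSet L Λ k
  have hm₂ : MeasurableSet E₂ := measurableSet_farSet L Λ k
  have hi1 : Integrable (fun z => profile α z * f z) := by
    refine hPi.norm.mono' (hPi.aestronglyMeasurable.mul hfm.aestronglyMeasurable)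
      (Eventually.of_forall fun z => ?_)
    rcases hf z with h | h <;> simp [h]
  have hneg : ∫ z, profile α z * f z = ∫ z, profile α z * f (-z) := by
    rw [← integral_neg_eq_self (fun z => profile α z * f z)]
    simp only [profile_neg]
  have hi2 : Integrable (fun z => profile α z * f (-z)) := by
    have := hi1.comp_neg
    simpa only [profile_neg] using this
  -- The profile is even, so `f` may be averaged over `z` and `-z`. The average is `-1` on the near
  -- part, where neither point can carry the value one, and can be `1` inside the ball only on the
  -- far part, where both do.
  have hsum : ∫ z, profile α z * f z = ∫ z, profile α z * ((f z + f (-z)) / 2) := by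
    have h1 : ∫ z, profile α z * ((f z + f (-z)) / 2) =
        ((∫ z, profile α z * f z) + ∫ z, profile α z * f (-z)) / 2 := by
      rw [← integral_add hi1 hi2, ← integral_div]
      refine integral_congr_ae (Eventually.of_forall fun z => ?_)
      simp only
      ring
    rw [h1, ← hneg]
    ring
  have hrhs : -(∫ z in E₁, profile α z) + (∫ z in E₂, profile α z) +
      (∫ z in (Metric.ball (0 : Space (d + 1)) L)ᶜ, profile α z) =
      ∫ z, (-E₁.indicator (profile α) + E₂.indicator (profile α) +
        (Metric.ball (0 : Space (d + 1)) L)ᶜ.indicator (profile α)) z := by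
    rw [integral_add' ((hPi.indicator hm₁).neg.add (hPi.indicator hm₂))
      (hPi.indicator measurableSet_ball.compl),
      integral_add' (hPi.indicator hm₁).neg (hPi.indicator hm₂), integral_neg',
      integral_indicator hm₁, integral_indicator hm₂, integral_indicator measurableSet_ball.compl]
  rw [hsum, hrhs]
  refine integral_mono ?_ (((hPi.indicator hm₁).neg.add (hPi.indicator hm₂)).add
      (hPi.indicator measurableSet_ball.compl)) fun z => ?_
  · have := (hi1.add hi2).div_const 2
    refine this.congr (Eventually.of_forall fun z => ?_)
    simp only [Pi.add_apply]
    ring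
  have hP := profile_nonneg hα₀ hα₂ z
  simp only [Pi.add_apply, Pi.neg_apply]
  have hdisj : z ∈ E₁ → z ∉ E₂ := by
    rintro ⟨-, h1⟩ ⟨-, h2⟩
    have : 0 ≤ 2 * k * |z 0| := by positivity
    linarith
  have hn₁ : 0 ≤ E₂.indicator (profile α) z := indicator_nonneg (fun z _ => profile_nonneg hα₀ hα₂ z) z
  by_cases hz : z ∈ Metric.ball (0 : Space (d + 1)) L
  · have hzL : ‖z‖ < L := by simpa using hz
    have hz' : -z ∈ Metric.ball (0 : Space (d + 1)) L := by simpa using hz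
    rw [indicator_of_notMem (notMem_compl_iff.2 hz), add_zero]
    have h1 := hfs z hz
    have h2 := hfs (-z) hz'
    simp only [norm_neg, PiLp.neg_apply] at h2
    have habs := le_abs_self (z 0)
    have habs' := neg_abs_le (z 0)
    rcases hf z with hz1 | hz1 <;> rcases hf (-z) with hz2 | hz2
    · -- both values are one
      have h3 := h1 hz1
      have h4 := h2 hz2
      have hE : z ∈ E₂ := by
        refine ⟨hzL, ?_⟩
        rcases abs_cases (z 0) with h | h <;> rw [h.1] <;> linarith
      have hE' : z ∉ E₁ := fun h => hdisj h hE
      rw [indicator_of_mem hE, indicator_of_notMem hE', hz1, hz2]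
      linarith
    · have hE' : z ∉ E₁ := by
        rintro ⟨-, h3⟩
        have h4 := h1 hz1
        have : 2 * k * z 0 ≤ 2 * k * |z 0| := by gcongr
        linarith
      rw [indicator_of_notMem hE', hz1, hz2]
      simpa using hn₁
    · have hE' : z ∉ E₁ := by
        rintro ⟨-, h3⟩
        have h4 := h2 hz2
        have : 2 * k * (-z 0) ≤ 2 * k * |z 0| := by gcongr; exact neg_le_abs _
        linarith
      rw [indicator_of_notMem hE', hz1, hz2]
      simpa using hn₁
    · rw [hz1, hz2]
      have : E₁.indicator (profile α) z ≤ profile α z :=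
        indicator_le_self' (fun _ _ => hP) z
      linarith
  · have hE' : z ∉ E₁ := fun h => hz (by simpa using h.1)
    rw [indicator_of_notMem hE', indicator_of_mem (mem_compl hz)]
    have hf1 : (f z + f (-z)) / 2 ≤ 1 := by
      rcases hf z with h | h <;> rcases hf (-z) with h' | h' <;> rw [h, h'] <;> norm_num
    have : profile α z * ((f z + f (-z)) / 2) ≤ profile α z * 1 := by gcongr
    linarith

/-- The near part contains a box of fixed size in `z'` and of width proportional to `min 1 (Λ / (k +
1))` in the first coordinate, on which the profile is at least half its value at the origin. -/
theorem exists_le_setIntegral_profile_near (hα₀ : 0 < α) (hα₂ : α < 2) :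
    ∃ c > 0, ∀ L Λ k : ℝ, 1 ≤ L → 2 ≤ Λ → 0 ≤ k → c * min 1 (Λ / (k + 1)) ≤
      ∫ z in nearSet d L Λ k, profile α z := by
  have hPi := profile_integrable (d := d) hα₀ hα₂
  have hP0 := profile_zero_pos (d := d) hα₀ hα₂
  have hev : ∀ᶠ z in 𝓝 (0 : Space (d + 1)), profile α (0 : Space (d + 1)) / 2 < profile α z :=
    (profile_continuous hα₀ hα₂).continuousAt.eventually_const_lt (by linarith)
  obtain ⟨c₁, hc₁, hnear⟩ := Metric.eventually_nhds_iff_ball.1 hev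
  set c₀ := min 1 c₁ with hc₀
  have hc₀0 : 0 < c₀ := by positivity
  have hc₀1 : c₀ ≤ 1 := min_le_left _ _
  set p₀ := profile α (0 : Space (d + 1)) / 2 with hp₀
  have hp₀0 : 0 < p₀ := by positivity
  set V := (volume : Measure (Space d)).real (Metric.ball 0 (c₀ / 2)) with hV
  have hV0 : 0 < V := by
    refine ENNReal.toReal_pos (Metric.measure_ball_pos volume _ (by positivity)).ne'
      measure_ball_lt_top.ne
  refine ⟨p₀ * (2 * (c₀ / 4)) * V, by positivity, fun L Λ k hL hΛ hk => ?_⟩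
  set s := min (c₀ / 2) (Λ / (4 * (k + 1))) with hs
  have hk1 : 0 < k + 1 := by linarith
  have hs0 : 0 < s := by
    have : 0 < Λ := by linarith
    positivity
  have hsle : c₀ / 4 * min 1 (Λ / (k + 1)) ≤ s := by
    refine le_min ?_ ?_
    · have := mul_le_mul_of_nonneg_left (min_le_left 1 (Λ / (k + 1))) (by positivity : 0 ≤ c₀ / 4)
      linarith
    · calc c₀ / 4 * min 1 (Λ / (k + 1)) ≤ 1 / 4 * (Λ / (k + 1)) := by
            gcongr
            exact min_le_right _ _
        _ = Λ / (4 * (k + 1)) := by field_simp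
  set E := nearSet d L Λ k with hE
  have hm : MeasurableSet E := measurableSet_nearSet L Λ k
  rw [← integral_indicator hm, ← integral_consPoint]
  have hms : MeasurableSet (Ioo (-s) s ×ˢ Metric.ball (0 : Space d) (c₀ / 2)) :=
    measurableSet_Ioo.prod measurableSet_ball
  have hvol : (volume : Measure (ℝ × Space d)).real (Ioo (-s) s ×ˢ Metric.ball (0 : Space d) (c₀ / 2)) =
      2 * s * V := by
    rw [Measure.volume_eq_prod, measureReal_prod_prod, hV, Real.volume_real_Ioo_of_le (by linarith)]
    ring
  have hfin : volume (Ioo (-s) s ×ˢ Metric.ball (0 : Space d) (c₀ / 2)) ≠ ⊤ := by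
    rw [Measure.volume_eq_prod, Measure.prod_prod]
    exact ENNReal.mul_ne_top (by simp) measure_ball_lt_top.ne
  have h1 : ∫ p : ℝ × Space d, (Ioo (-s) s ×ˢ Metric.ball (0 : Space d) (c₀ / 2)).indicator
      (fun _ => p₀) p = p₀ * (2 * s * V) := by
    rw [integral_indicator_const _ hms, hvol, smul_eq_mul, mul_comm]
  calc p₀ * (2 * (c₀ / 4)) * V * min 1 (Λ / (k + 1))
      = p₀ * (2 * (c₀ / 4 * min 1 (Λ / (k + 1))) * V) := by ring
    _ ≤ p₀ * (2 * s * V) := by gcongr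
    _ = _ := h1.symm
    _ ≤ ∫ p : ℝ × Space d, E.indicator (profile α) (consPoint p.1 p.2) := by
      refine integral_mono ((integrable_indicator_iff hms).2 (integrableOn_const hfin))
        (integrable_consPoint.2 (hPi.indicator hm)) fun p => ?_
      by_cases hp : p ∈ Ioo (-s) s ×ˢ Metric.ball (0 : Space d) (c₀ / 2)
      · have hv : |p.1| < s := abs_lt.2 hp.1
        have hz : ‖p.2‖ < c₀ / 2 := by simpa using hp.2
        have hn : ‖consPoint p.1 p.2‖ < c₀ := by
          have := norm_consPoint_le p.1 p.2
          have := min_le_left (c₀ / 2) (Λ / (4 * (k + 1)))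
          linarith
        have hpE : consPoint p.1 p.2 ∈ E := by
          refine ⟨by linarith, ?_⟩
          rw [consPoint_zero]
          have h2 : ‖consPoint p.1 p.2‖ ^ 2 < 1 := by
            have := norm_nonneg (consPoint p.1 p.2)
            nlinarith
          have h3 : 2 * k * |p.1| ≤ Λ / 2 := by
            have h4 : |p.1| ≤ Λ / (4 * (k + 1)) := hv.le.trans (min_le_right _ _)
            calc 2 * k * |p.1| ≤ 2 * (k + 1) * (Λ / (4 * (k + 1))) := by gcongr; linarith
              _ = Λ / 2 := by field_simp; norm_num
          linarith
        rw [indicator_of_mem hp, indicator_of_mem hpE]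
        refine (hnear _ ?_).le
        rw [mem_ball_zero_iff]
        exact hn.trans_le (min_le_right _ _)
      · rw [indicator_of_notMem hp]
        exact indicator_nonneg (fun z _ => profile_nonneg hα₀ hα₂ z) _

theorem integrableOn_ball_one_add_norm_rpow (L s : ℝ) :
    IntegrableOn (fun z : Space d => (1 + ‖z‖) ^ s) (Metric.ball 0 L) := by
  have h : Continuous (fun z : Space d => (1 + ‖z‖) ^ s) :=
    (continuous_const.add continuous_norm).rpow_const fun z =>
      Or.inl (ne_of_gt (by positivity : (0:ℝ) < 1 + ‖z‖))
  exact (h.continuousOn.integrableOn_compact (isCompact_closedBall 0 L)).mono_set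
    Metric.ball_subset_closedBall

/-- The fibre over `z` is an interval of length `2 ‖z‖² / k`, and the profile on it is bounded by a
power of `1 + ‖z‖`. -/
theorem exists_setIntegral_profile_wedge_le (hα₀ : 0 < α) (hα₂ : α < 2) :
    ∃ C > 0, ∀ L k : ℝ, 0 < k →
      ∫ z in {z : Space (d + 1) | ‖tailPoint z‖ < L ∧ k * |z 0| ≤ ‖tailPoint z‖ ^ 2}, profile α z ≤
        C / k * ∫ z in Metric.ball (0 : Space d) L, (1 + ‖z‖) ^ (1 - (d : ℝ) - α) := by
  have hPi := profile_integrable (d := d) hα₀ hα₂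
  obtain ⟨C, hC, hle, -⟩ := exists_profile_consPoint_le (d := d) hα₀ hα₂
  refine ⟨2 * C, by positivity, fun L k hk => ?_⟩
  set E := {z : Space (d + 1) | ‖tailPoint z‖ < L ∧ k * |z 0| ≤ ‖tailPoint z‖ ^ 2} with hE
  have hm : MeasurableSet E := by
    have h : Continuous (fun z : Space (d + 1) => k * |z 0|) := by fun_prop
    exact (measurableSet_cylinder L).inter
      (measurableSet_le h.measurable (measurable_tailPoint.norm.pow_const 2))
  rw [← integral_indicator hm, ← integral_consPoint, Measure.volume_eq_prod,
    integral_prod_symm _ (integrable_consPoint.2 (hPi.indicator hm)), ← integral_const_mul,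
    ← integral_indicator measurableSet_ball]
  refine integral_mono_of_nonneg (Eventually.of_forall fun z => integral_nonneg fun v =>
    indicator_nonneg (fun z _ => profile_nonneg hα₀ hα₂ z) _)
    ((integrable_indicator_iff measurableSet_ball).2
      ((integrableOn_ball_one_add_norm_rpow L _).const_mul _))
    (Eventually.of_forall fun z => ?_)
  by_cases hz : z ∈ Metric.ball (0 : Space d) L
  · simp only [indicator_of_mem hz]
    have hzL : ‖z‖ < L := by simpa using hz
    have h1 : ∀ v, E.indicator (profile α) (consPoint v z) =
        (Icc (-(‖z‖ ^ 2 / k)) (‖z‖ ^ 2 / k)).indicator (fun v => profile α (consPoint v z)) v := by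
      intro v
      have hiff : consPoint v z ∈ E ↔ v ∈ Icc (-(‖z‖ ^ 2 / k)) (‖z‖ ^ 2 / k) := by
        simp only [hE, mem_ofPred_eq, tailPoint_consPoint, consPoint_zero, hzL, true_and]
        rw [mem_Icc, ← abs_le, le_div_iff₀ hk, mul_comm]
      by_cases hv : consPoint v z ∈ E
      · rw [indicator_of_mem hv, indicator_of_mem (hiff.1 hv)]
      · rw [indicator_of_notMem hv, indicator_of_notMem (mt hiff.2 hv)]
    simp only [h1]
    rw [integral_indicator measurableSet_Icc]
    have hz0 : 0 ≤ ‖z‖ ^ 2 / k := by positivity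
    have h2 := norm_setIntegral_le_of_norm_le_const (μ := volume)
      (s := Icc (-(‖z‖ ^ 2 / k)) (‖z‖ ^ 2 / k)) (by simp)
      (f := fun v => profile α (consPoint v z)) (fun v _ => hle v z)
    rw [Real.volume_real_Icc_of_le (by linarith)] at h2
    refine (le_abs_self _).trans (h2.trans ?_)
    have h3 : 0 < 1 + ‖z‖ := by positivity
    calc C * (1 + ‖z‖) ^ (-((d : ℝ) + 1 + α)) * (‖z‖ ^ 2 / k - -(‖z‖ ^ 2 / k))
        = 2 * C / k * ((1 + ‖z‖) ^ (-((d : ℝ) + 1 + α)) * ‖z‖ ^ 2) := by ring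
      _ ≤ 2 * C / k * ((1 + ‖z‖) ^ (-((d : ℝ) + 1 + α)) * (1 + ‖z‖) ^ 2) := by
        gcongr
        linarith
      _ = _ := by
        rw [← Real.rpow_two, ← Real.rpow_add h3]
        congr 2
        ring
  · simp only [indicator_of_notMem hz]
    refine le_of_eq (integral_eq_zero_of_ae (Eventually.of_forall fun v => ?_))
    refine indicator_of_notMem (fun h => hz ?_) _
    have := h.1
    rw [tailPoint_consPoint] at this
    simpa using this

theorem setIntegral_profile_mono (hα₀ : 0 < α) (hα₂ : α < 2) {s t : Set (Space (d + 1))}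
    (hst : s ⊆ t) : ∫ z in s, profile α z ≤ ∫ z in t, profile α z :=
  setIntegral_mono_set (profile_integrable hα₀ hα₂).integrableOn
    (Eventually.of_forall fun z => profile_nonneg hα₀ hα₂ z) hst.eventuallyLE

theorem setIntegral_profile_union_le (hα₀ : 0 < α) (hα₂ : α < 2) {s t u : Set (Space (d + 1))}
    (hs : MeasurableSet s) (ht : MeasurableSet t) (hu : MeasurableSet u)
    (hst : s ⊆ t ∪ u) : ∫ z in s, profile α z ≤ (∫ z in t, profile α z) + ∫ z in u, profile α z := by
  have hPi := profile_integrable (d := d) hα₀ hα₂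
  rw [← integral_indicator hs, ← integral_indicator ht, ← integral_indicator hu,
    ← integral_add (hPi.indicator ht) (hPi.indicator hu)]
  refine integral_mono (hPi.indicator hs) ((hPi.indicator ht).add (hPi.indicator hu)) fun z => ?_
  have hP := profile_nonneg hα₀ hα₂ z
  have h1 : 0 ≤ t.indicator (profile α) z := indicator_nonneg (fun z _ => profile_nonneg hα₀ hα₂ z) z
  have h2 : 0 ≤ u.indicator (profile α) z := indicator_nonneg (fun z _ => profile_nonneg hα₀ hα₂ z) z
  simp only
  by_cases hz : z ∈ s
  · rw [indicator_of_mem hz]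
    rcases hst hz with h | h
    · rw [indicator_of_mem h]; linarith
    · rw [indicator_of_mem h]; linarith
  · rw [indicator_of_notMem hz]; linarith

/-- The bound on the scale on which a front moves through a region without normal direction. -/
def degenerateBound (d : ℕ) (α L : ℝ) : ℝ :=
  1 + L ^ (1 - α) + ∫ z in Metric.ball (0 : Space d) L, (1 + ‖z‖) ^ (1 - (d : ℝ) - α)

/-- A function with values `±1` which is one, in a large ball, only outside of a still larger
excentric ball has a negative mean. -/
theorem exists_integral_profile_mul_neg (hα₀ : 0 < α) (hα₂ : α < 2) :
    ∃ ε > 0, ∀ (L Λ k : ℝ) (f : Space (d + 1) → ℝ), Measurable f → (∀ z, f z = 1 ∨ f z = -1) →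
      0 ≤ k → k ≤ L → 1 / ε ≤ L → degenerateBound d α L ≤ ε * Λ →
      (∀ z ∈ Metric.ball (0 : Space (d + 1)) L, f z = 1 → Λ ≤ ‖z‖ ^ 2 + 2 * k * z 0) →
      ∫ z, profile α z * f z < 0 := by
  obtain ⟨c, hc, hnear⟩ := exists_le_setIntegral_profile_near (d := d) hα₀ hα₂
  obtain ⟨C₁, hC₁, hwedge⟩ := exists_setIntegral_profile_wedge_le (d := d) hα₀ hα₂
  obtain ⟨C₂, hC₂, htail⟩ := exists_setIntegral_profile_compl_ball_le (d := d) hα₀ hα₂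
  set C := C₁ + C₂ with hC
  have hC0 : 0 < C := by positivity
  -- The first entry gives `L, Λ ≥ 2`. The second beats the near mass when `k > Λ`, the third when
  -- `k ≤ Λ`.
  set ε := min (1 / 2) (min (c / (16 * C)) ((c / (8 * C)) ^ (2 / α))) with hε
  have hε0 : 0 < ε := by positivity
  have hε1 : ε ≤ 1 / 2 := min_le_left _ _
  have hε2 : ε * (16 * C) ≤ c := by
    rw [← le_div_iff₀ (by positivity)]; exact (min_le_right _ _).trans (min_le_left _ _)
  have hε3 : ε ^ (α / 2) ≤ c / (8 * C) := by
    have h1 : ε ≤ (c / (8 * C)) ^ (2 / α) := (min_le_right _ _).trans (min_le_right _ _)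
    have h2 := Real.rpow_le_rpow hε0.le h1 (by positivity : 0 ≤ α / 2)
    rwa [← Real.rpow_mul (by positivity), show 2 / α * (α / 2) = 1 by field_simp,
      Real.rpow_one] at h2
  refine ⟨ε, hε0, fun L Λ k f hfm hf hk hkL hL hT hfs => ?_⟩
  have hint0 : 0 ≤ ∫ z in Metric.ball (0 : Space d) L, (1 + ‖z‖) ^ (1 - (d : ℝ) - α) :=
    integral_nonneg fun z => by positivity
  have hL2 : 2 ≤ L := by
    refine le_trans ?_ hL
    rw [le_div_iff₀ hε0]
    linarith
  have hL0 : 0 < L := by linarith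
  have hLα : 0 < L ^ (1 - α) := by positivity
  unfold degenerateBound at hT
  have hΛε : 1 / ε ≤ Λ := by
    rw [div_le_iff₀ hε0]
    linarith
  have hΛ2 : 2 ≤ Λ := by
    refine le_trans ?_ hΛε
    rw [le_div_iff₀ hε0]
    linarith
  have hΛ0 : 0 < Λ := by linarith
  have hmain := integral_profile_mul_le_of_ball hα₀ hα₂ hfm hf hk hfs
  have hM1 := hnear L Λ k (by linarith) hΛ2 hk
  have hM3 := htail L hL0
  -- For `k ≤ Λ` the near part has a fixed mass and the far part lies outside the radius `√Λ`. For
  -- `k > Λ` the near part is a slab of mass of order `Λ / k`. The far part then lies in the wedge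
  -- `k |z 0| ≤ ‖z'‖²` or outside the radius `k`, and together with the outer region it has mass at
  -- most a multiple of `degenerateBound d α L / k`.
  rcases le_or_gt k Λ with hkΛ | hkΛ
  · have h1 : 1 / 2 ≤ min 1 (Λ / (k + 1)) := by
      refine le_min (by norm_num) ?_
      rw [le_div_iff₀ (by linarith)]
      linarith
    have h2 : c * (1 / 2) ≤ c * min 1 (Λ / (k + 1)) := by gcongr
    have hM2 : ∫ z in farSet d L Λ k, profile α z ≤ C₂ * Λ ^ (-(α / 2)) := by
      have h3 : farSet d L Λ k ⊆ (Metric.ball (0 : Space (d + 1)) (Real.sqrt Λ))ᶜ := by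
        rintro z ⟨-, h4⟩
        have h5 : 0 ≤ 2 * k * |z 0| := by positivity
        simp only [mem_compl_iff, mem_ball_zero_iff, not_lt]
        exact Real.sqrt_le_left (norm_nonneg z) |>.2 (by linarith)
      refine (setIntegral_profile_mono hα₀ hα₂ h3).trans ((htail _ (Real.sqrt_pos.2 hΛ0)).trans
        (le_of_eq ?_))
      rw [Real.sqrt_eq_rpow, ← Real.rpow_mul hΛ0.le]
      congr 2
      ring
    have h4 : Λ ^ (-(α / 2)) ≤ ε ^ (α / 2) := by
      rw [Real.rpow_neg hΛ0.le, ← Real.inv_rpow hΛ0.le]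
      refine Real.rpow_le_rpow (by positivity) ?_ (by positivity)
      rw [inv_le_comm₀ hΛ0 hε0, ← one_div]
      exact hΛε
    have h5 : L ^ (-α) ≤ ε ^ (α / 2) := by
      have h6 : L ^ (-α) ≤ L ^ (-(α / 2)) :=
        Real.rpow_le_rpow_of_exponent_le (by linarith) (by linarith)
      refine h6.trans ?_
      rw [Real.rpow_neg hL0.le, ← Real.inv_rpow hL0.le]
      refine Real.rpow_le_rpow (by positivity) ?_ (by positivity)
      rw [inv_le_comm₀ hL0 hε0, ← one_div]
      exact hL
    have h6 : C₂ * Λ ^ (-(α / 2)) + C₂ * L ^ (-α) ≤ c / 4 := by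
      calc C₂ * Λ ^ (-(α / 2)) + C₂ * L ^ (-α) ≤ C * (c / (8 * C)) + C * (c / (8 * C)) := by
            have h7 : C₂ ≤ C := by rw [hC]; linarith
            gcongr
            · exact h4.trans hε3
            · exact h5.trans hε3
        _ = c / 4 := by field_simp; norm_num
    linarith
  · have hk0 : 0 < k := by linarith
    have h1 : Λ / (2 * k) ≤ min 1 (Λ / (k + 1)) := by
      refine le_min ?_ ?_
      · rw [div_le_one (by positivity)]; linarith
      · gcongr; linarith
    have h2 : c * (Λ / (2 * k)) ≤ c * min 1 (Λ / (k + 1)) := by gcongr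
    have hM2 : ∫ z in farSet d L Λ k, profile α z ≤
        C₁ / k * (∫ z in Metric.ball (0 : Space d) L, (1 + ‖z‖) ^ (1 - (d : ℝ) - α)) +
          C₂ * k ^ (-α) := by
      refine (setIntegral_profile_union_le hα₀ hα₂ (measurableSet_farSet L Λ k)
        (t := {z | ‖tailPoint z‖ < L ∧ k * |z 0| ≤ ‖tailPoint z‖ ^ 2})
        (u := (Metric.ball 0 k)ᶜ) ?_ measurableSet_ball.compl ?_).trans
          (add_le_add (hwedge L k hk0) (htail k hk0))
      · have h : Continuous (fun z : Space (d + 1) => k * |z 0|) := by fun_prop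
        exact (measurableSet_cylinder L).inter
          (measurableSet_le h.measurable (measurable_tailPoint.norm.pow_const 2))
      · rintro z ⟨h3, h4⟩
        have h5 : ‖z‖ ^ 2 = |z 0| ^ 2 + ‖tailPoint z‖ ^ 2 := by
          have := norm_consPoint_sq (z 0) (tailPoint z)
          rwa [consPoint_tailPoint, ← sq_abs (z 0)] at this
        rcases le_or_gt |z 0| ‖tailPoint z‖ with h6 | h6
        · left
          refine ⟨(norm_tailPoint_le z).trans_lt h3, ?_⟩
          have := pow_le_pow_left₀ (abs_nonneg _) h6 2
          linarith
        · right
          simp only [mem_compl_iff, mem_ball_zero_iff, not_lt]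
          refine le_trans ?_ (abs_apply_zero_le z)
          have h7 : 0 < |z 0| := (norm_nonneg _).trans_lt h6
          have h8 : k * |z 0| ≤ |z 0| * |z 0| := by
            have := pow_le_pow_left₀ (norm_nonneg _) h6.le 2
            nlinarith
          exact le_of_mul_le_mul_right h8 h7
    have h3 : k ^ (-α) ≤ (1 + L ^ (1 - α)) / k := by
      have h4 : k ^ (-α) = k ^ (1 - α) / k := by
        rw [← Real.rpow_sub_one hk0.ne']; congr 1; ring
      rw [h4]
      gcongr
      rcases le_total α 1 with h5 | h5
      · have := Real.rpow_le_rpow hk hkL (by linarith : 0 ≤ 1 - α)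
        linarith
      · have := Real.rpow_le_one_of_one_le_of_nonpos (by linarith : 1 ≤ k)
          (by linarith : 1 - α ≤ 0)
        linarith
    have h4 : L ^ (-α) ≤ (1 + L ^ (1 - α)) / k := by
      have h5 : L ^ (-α) = L ^ (1 - α) / L := by
        rw [← Real.rpow_sub_one hL0.ne']; congr 1; ring
      rw [h5]
      gcongr
      linarith
    have h5 : (∫ z in farSet d L Λ k, profile α z) +
        ∫ z in (Metric.ball (0 : Space (d + 1)) L)ᶜ, profile α z ≤ 2 * C / k * (ε * Λ) := by
      set I := ∫ z in Metric.ball (0 : Space d) L, (1 + ‖z‖) ^ (1 - (d : ℝ) - α) with hI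
      calc _ ≤ C₁ / k * I + C₂ * ((1 + L ^ (1 - α)) / k) + C₂ * ((1 + L ^ (1 - α)) / k) := by
            have e1 := mul_le_mul_of_nonneg_left h3 hC₂.le
            have e2 := mul_le_mul_of_nonneg_left h4 hC₂.le
            linarith
        _ = (C₁ * I + 2 * C₂ * (1 + L ^ (1 - α))) / k := by ring
        _ ≤ (2 * C * (ε * Λ)) / k := by
            gcongr
            have e1 : C₁ * I ≤ 2 * C * I := by gcongr; linarith
            have e2 : 2 * C₂ * (1 + L ^ (1 - α)) ≤ 2 * C * (1 + L ^ (1 - α)) := by gcongr; linarith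
            have e3 := mul_le_mul_of_nonneg_left hT (by positivity : 0 ≤ 2 * C)
            linarith
        _ = _ := by ring
    have h6 : 2 * C / k * (ε * Λ) < c * (Λ / (2 * k)) := by
      have h7 : 2 * C / k * (ε * Λ) = (4 * (ε * C)) * (Λ / (2 * k)) := by field_simp; ring
      rw [h7]
      have h8 : 0 < Λ / (2 * k) := by positivity
      refine mul_lt_mul_of_pos_right ?_ h8
      nlinarith [mul_pos hε0 hC0]
    linarith

/-! ### The degenerate scale compared with the rate -/

theorem eventually_le_div_nhdsGT {ρ : ℝ} (hρ : 0 < ρ) (M : ℝ) :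
    ∀ᶠ r in 𝓝[>] (0 : ℝ), M ≤ ρ / r := by
  have : Tendsto (fun r : ℝ => ρ / r) (𝓝[>] 0) atTop := by
    simpa only [div_eq_mul_inv] using tendsto_inv_nhdsGT_zero.const_mul_atTop hρ
  exact this.eventually_ge_atTop M

/-- Here `rate α r / r` is `|log r|` or `1`. The constant cannot be made small by shrinking `ρ`;
smallness must come from the paraboloid, hence from a vanishing Hessian. -/
theorem exists_degenerateBound_le (hα₁ : 1 ≤ α) :
    ∃ M > 0, ∀ ρ, 0 < ρ → ρ ≤ 1 → ∀ᶠ r in 𝓝[>] (0 : ℝ),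
      degenerateBound d α (ρ / r) ≤ M * (rate α r / r) := by
  rcases hα₁.eq_or_lt with rfl | h1
  · obtain ⟨C, hC, hle⟩ := exists_setIntegral_ball_le_log (d := d)
    refine ⟨2 + 2 * C, by positivity, fun ρ hρ hρ1 => ?_⟩
    have hlog : ∀ᶠ r in 𝓝[>] (0 : ℝ), Real.log r ≤ -1 :=
      Real.tendsto_log_nhdsGT_zero.eventually_le_atBot (-1)
    filter_upwards [eventually_le_div_nhdsGT hρ 1, hlog, self_mem_nhdsWithin] with r hr hl hr0
    have hr0 : 0 < r := hr0
    have hrate : rate 1 r / r = -Real.log r := by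
      simp only [rate, lt_irrefl, if_false, if_true]
      rw [abs_of_nonpos (by linarith), mul_div_cancel_left₀ _ hr0.ne']
    have h2 : Real.log (ρ / r) ≤ -Real.log r := by
      rw [Real.log_div hρ.ne' hr0.ne']
      have := Real.log_nonpos hρ.le hρ1
      linarith
    have h3 := hle (ρ / r) hr
    rw [hrate, degenerateBound, sub_self, Real.rpow_zero]
    have h4 := mul_le_mul_of_nonneg_left h2 hC
    have h5 := mul_le_mul_of_nonneg_left (by linarith : 1 ≤ -Real.log r) hC
    linarith
  · have hinteg : Integrable (fun z : Space d => (1 + ‖z‖) ^ (1 - (d : ℝ) - α)) := by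
      have := integrable_one_add_norm (E := Space d) (μ := volume) (r := (d : ℝ) + α - 1)
        (by simp; linarith)
      refine this.congr (Eventually.of_forall fun z => ?_)
      simp only
      congr 1
      ring
    have hint0 : 0 ≤ ∫ z : Space d, (1 + ‖z‖) ^ (1 - (d : ℝ) - α) :=
      integral_nonneg fun z => by positivity
    refine ⟨2 + ∫ z : Space d, (1 + ‖z‖) ^ (1 - (d : ℝ) - α), by positivity, fun ρ hρ hρ1 => ?_⟩
    filter_upwards [eventually_le_div_nhdsGT hρ 1, self_mem_nhdsWithin] with r hr hr0
    have hr0 : 0 < r := hr0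
    have hrate : rate α r / r = 1 := by
      rw [rate, if_neg h1.not_gt, if_neg h1.ne', div_self hr0.ne']
    have h2 := Real.rpow_le_one_of_one_le_of_nonpos hr (by linarith : 1 - α ≤ 0)
    have h3 := setIntegral_le_integral (s := Metric.ball (0 : Space d) (ρ / r)) hinteg
      (Eventually.of_forall fun z => by positivity)
    rw [hrate, degenerateBound]
    linarith

/-- Both sides grow like `r ^ (α - 1)`, but the left carries the factor `ρ ^ (1 - α)`. Shrinking `ρ`
replaces any condition on the Hessian. -/
theorem exists_degenerateBound_le_of_lt_one (hα₀ : 0 < α) (hα₁ : α < 1) {ε : ℝ} (hε : 0 < ε) :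
    ∃ ρ₀ > 0, ∀ ρ, 0 < ρ → ρ ≤ ρ₀ → ∀ᶠ r in 𝓝[>] (0 : ℝ),
      degenerateBound d α (ρ / r) ≤ ε * (rate α r / r) := by
  obtain ⟨C, hC, hle⟩ := exists_setIntegral_ball_le_of_lt_one (d := d) hα₀ hα₁
  have hs : 0 < 1 - α := by linarith
  refine ⟨(ε / (2 * (1 + C))) ^ (1 / (1 - α)), by positivity, fun ρ hρ hρ1 => ?_⟩
  have hρ2 : ρ ^ (1 - α) ≤ ε / (2 * (1 + C)) := by
    have := Real.rpow_le_rpow hρ.le hρ1 hs.le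
    rwa [← Real.rpow_mul (by positivity), one_div_mul_cancel hs.ne', Real.rpow_one] at this
  have hrp : ∀ᶠ r in 𝓝[>] (0 : ℝ), 2 / ε ≤ (1 / r) ^ (1 - α) := by
    have h1 : Tendsto (fun r : ℝ => 1 / r) (𝓝[>] 0) atTop := by
      simpa only [one_div] using tendsto_inv_nhdsGT_zero
    exact ((tendsto_rpow_atTop hs).comp h1).eventually_ge_atTop _
  filter_upwards [eventually_le_div_nhdsGT hρ 1, hrp, self_mem_nhdsWithin] with r hr hrp hr0
  have hr0 : 0 < r := hr0
  have hrate : rate α r / r = (1 / r) ^ (1 - α) := by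
    rw [rate, if_pos hα₁, one_div, Real.inv_rpow hr0.le, ← Real.rpow_neg hr0.le,
      ← Real.rpow_sub_one hr0.ne']
    congr 1
    ring
  have h1 : (ρ / r) ^ (1 - α) = ρ ^ (1 - α) * (1 / r) ^ (1 - α) := by
    rw [← Real.mul_rpow hρ.le (by positivity), mul_one_div]
  have h2 := hle (ρ / r) hr
  rw [hrate, degenerateBound, h1]
  rw [h1] at h2
  set R := (1 / r) ^ (1 - α) with hR
  have h3 : 1 ≤ ε / 2 * R := by
    calc 1 = ε / 2 * (2 / ε) := by field_simp
      _ ≤ _ := by gcongr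
  have h4 : (1 + C) * (ρ ^ (1 - α) * R) ≤ ε / 2 * R := by
    have hR0 : 0 ≤ R := by positivity
    calc (1 + C) * (ρ ^ (1 - α) * R) ≤ (1 + C) * (ε / (2 * (1 + C)) * R) := by gcongr
      _ = ε / 2 * R := by field_simp
  linarith

theorem exists_isometry_inner (w : Space (d + 1)) :
    ∃ O : Space (d + 1) ≃ₗᵢ[ℝ] Space (d + 1), ∀ z, inner ℝ w (O z) = ‖w‖ * z 0 := by
  rcases eq_or_ne w 0 with rfl | hw
  · exact ⟨LinearIsometryEquiv.refl ℝ _, fun z => by simp⟩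
  · obtain ⟨O, hO⟩ := exists_isometry_single hw
    refine ⟨O, fun z => ?_⟩
    have h1 : w = ‖w‖ • O (EuclideanSpace.single 0 1) := by
      rw [hO, smul_smul, mul_inv_cancel₀ (norm_ne_zero_iff.2 hw), one_smul]
    conv_lhs => rw [h1]
    rw [inner_smul_left, O.inner_map_map, EuclideanSpace.inner_single_left]
    simp

/-- The limit set cannot touch from above a paraboloid which opens too slowly. -/
theorem IsFlow.not_paraboloid_contact (hU : IsFlow α σ U) (hσ : IsScaling α σ) (hα₀ : 0 < α)
    {z₀ : Space (d + 1) × ℝ} (hz₀ : z₀ ∈ spaceTime (d + 1)) (hc : z₀ ∈ contactSet U)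
    {a κ K ρ₁ ρ₂ ε₀ : ℝ} (ha : 0 < a) (hκ : 0 < κ) (hK : 0 ≤ K) (hρ₁ : 0 < ρ₁) (hρ₂ : 0 < ρ₂)
    (hpos : ∀ (ξ : Space (d + 1)) (τ : ℝ), ‖ξ‖ ≤ ρ₁ → |τ| ≤ ρ₁ →
      (z₀.1 + ξ, z₀.2 + τ) ∈ contactSet U → 0 ≤ a * τ + κ * ‖ξ‖ ^ 2 + K * τ ^ 2)
    (hneg : ∀ (L Λ k : ℝ) (f : Space (d + 1) → ℝ), Measurable f → (∀ z, f z = 1 ∨ f z = -1) →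
      0 ≤ k → k ≤ L → 1 / ε₀ ≤ L → degenerateBound d α L ≤ ε₀ * Λ →
      (∀ z ∈ Metric.ball (0 : Space (d + 1)) L, f z = 1 → Λ ≤ ‖z‖ ^ 2 + 2 * k * z 0) →
      ∫ z, profile α z * f z < 0)
    (hbd : ∀ ρ, 0 < ρ → ρ ≤ ρ₂ → ∀ᶠ r in 𝓝[>] (0 : ℝ),
      degenerateBound d α (ρ / r) ≤ ε₀ * a / (4 * κ) * (rate α r / r)) : False := by
  -- Doubling `κ` and raising `K` by one makes the contact with the paraboloid strict.
  set ψ : Space (d + 1) × ℝ → ℝ := fun z => a * (z.2 - z₀.2) + 2 * κ * ‖z.1 - z₀.1‖ ^ 2 +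
    (K + 1) * (z.2 - z₀.2) ^ 2 with hψ
  have hcont : Continuous ψ := by rw [hψ]; fun_prop
  have hψ0 : ψ z₀ = 0 := by simp [hψ]
  have hψpos : ∀ z ∈ Metric.closedBall z₀ ρ₁, z ∈ contactSet U → z ≠ z₀ → 0 < ψ z := by
    intro z hz hzc hne
    rw [Metric.mem_closedBall, Prod.dist_eq, max_le_iff, dist_eq_norm, Real.dist_eq] at hz
    have h1 := hpos (z.1 - z₀.1) (z.2 - z₀.2) hz.1 hz.2 (by simpa using hzc)
    have h2 : 0 < κ * ‖z.1 - z₀.1‖ ^ 2 + (z.2 - z₀.2) ^ 2 := by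
      by_cases h3 : z.1 = z₀.1
      · have h4 : z.2 - z₀.2 ≠ 0 := fun h => hne (Prod.ext h3 (sub_eq_zero.1 h))
        positivity
      · have h4 : 0 < ‖z.1 - z₀.1‖ := norm_pos_iff.2 (sub_ne_zero.2 h3)
        positivity
    simp only [hψ]
    linarith
  set ρ := min ρ₂ (ρ₁ / 2) with hρ
  have hρ0 : 0 < ρ := by positivity
  have hρ1 : ρ ≤ ρ₁ / 2 := min_le_right _ _
  obtain ⟨R, hR, hR'⟩ := hσ.exists_radius hα₀
  have hev : ∀ᶠ h in 𝓝[>] (0 : ℝ), (σ h = R h ^ α ∧ h / R h = rate α (R h)) ∧ 0 < R h ∧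
      degenerateBound d α (ρ / R h) ≤ ε₀ * a / (4 * κ) * (rate α (R h) / R h) ∧
      1 / ε₀ ≤ ρ / R h :=
    hR'.and ((tendsto_nhdsWithin_iff.1 hR).2.and ((hR.eventually (hbd ρ hρ0 (min_le_left _ _))).and
      (hR.eventually (eventually_le_div_nhdsGT hρ0 _))))
  obtain ⟨δ, hδ, hev⟩ := (nhdsGT_basis (0 : ℝ)).eventually_iff.1 hev
  -- The last tolerance keeps the errors quadratic in time below `a h / 2`: their coefficients are
  -- `K + 2` and `2 (K + 1)`, with sum `3 K + 4`.
  obtain ⟨h, x, n, h0, hlt, hd, hpm, hone, hcmp⟩ := hU.exists_contact hz₀ hc hcont hψ0 hρ₁ hψpos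
    (ε := min δ (min ρ (a / (2 * (3 * K + 4))))) (by positivity)
  simp only [lt_min_iff] at hlt hd
  obtain ⟨⟨hσh, hrate⟩, hr, hbd, hL⟩ := hev ⟨h0, hlt.1⟩
  set r := R h with hrdef
  clear_value r
  set w := x - z₀.1 with hw
  set τ := ((n : ℝ) + 1) * h - z₀.2 with hτ
  have hτlt : |τ| < a / (2 * (3 * K + 4)) := by
    have := hd.2.2
    rw [Prod.dist_eq, max_lt_iff] at this
    exact this.2
  have hwlt : ‖w‖ < ρ := by
    have := hd.2.1
    rw [Prod.dist_eq, max_lt_iff, dist_eq_norm] at this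
    exact this.1
  obtain ⟨O, hO⟩ := exists_isometry_inner w
  have hinteg := hU.integral_nonneg h n x hone
  rw [hσh, integral_kernel_mul hα₀ hr O] at hinteg
  -- The contact inequality becomes `a h / 2 ≤ 2 κ (‖w + r O z‖² - ‖w‖²)`. Divided by `2 κ r²` it
  -- reads `Λ ≤ ‖z‖² + 2 k z 0` with these parameters, since `O` aligns `w` with the first axis.
  refine absurd hinteg (not_le.2 (hneg (ρ / r) (a * h / (4 * κ * r ^ 2)) (‖w‖ / r) _
    ((hU.measurable h n).comp (Continuous.measurable (by fun_prop))) (fun z => hpm _)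
    (by positivity) (by gcongr) hL ?_ ?_))
  · refine hbd.trans (le_of_eq ?_)
    rw [← hrate]
    field_simp
  · intro z hz hUz
    have hzL : ‖z‖ * r < ρ := by
      rw [← lt_div_iff₀ hr]
      simpa using hz
    have hnorm : ‖r • O z‖ = ‖z‖ * r := by
      rw [norm_smul, O.norm_map, Real.norm_of_nonneg hr.le, mul_comm]
    have hmem : x + r • O z ∈ Metric.closedBall z₀.1 ρ₁ := by
      rw [Metric.mem_closedBall, dist_eq_norm, add_sub_right_comm]
      refine (norm_add_le _ _).trans ?_
      rw [hnorm]
      linarith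
    have h1 := hcmp _ hmem hUz
    have e1 : x + r • O z - z₀.1 = w + r • O z := by rw [hw]; abel
    have e2 : (n : ℝ) * h - z₀.2 = τ - h := by simp only [hτ]; ring
    have e3 : ‖w + r • O z‖ ^ 2 = ‖w‖ ^ 2 + 2 * (r * (‖w‖ * z 0)) + (‖z‖ * r) ^ 2 := by
      rw [norm_add_sq_real, inner_smul_right, hO, hnorm]
    simp only [hψ] at h1
    rw [e1, e2, e3] at h1
    have hsmall : (K + 2) * h + 2 * (K + 1) * |τ| ≤ a / 2 := by
      have h2 : (K + 2) * h ≤ (K + 2) * (a / (2 * (3 * K + 4))) := by gcongr; exact hlt.2.2.le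
      have h3 : 2 * (K + 1) * |τ| ≤ 2 * (K + 1) * (a / (2 * (3 * K + 4))) := by gcongr
      have h4 : (K + 2) * (a / (2 * (3 * K + 4))) + 2 * (K + 1) * (a / (2 * (3 * K + 4))) = a / 2 := by
        field_simp
        ring
      linarith
    have h5 : a / 2 * h ≤ 2 * κ * (2 * (r * (‖w‖ * z 0)) + (‖z‖ * r) ^ 2) := by
      have h6 : ((K + 2) * h + 2 * (K + 1) * |τ|) * h ≤ a / 2 * h := by gcongr
      have h7 : 2 * (K + 1) * (-τ) * h ≤ 2 * (K + 1) * |τ| * h := by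
        gcongr; exact neg_le_abs _
      linarith
    have h8 : ‖z‖ ^ 2 + 2 * (‖w‖ / r) * z 0 =
        (2 * κ * (2 * (r * (‖w‖ * z 0)) + (‖z‖ * r) ^ 2)) / (2 * κ * r ^ 2) := by
      field_simp
      ring
    rw [h8]
    calc a * h / (4 * κ * r ^ 2) = (a / 2 * h) / (2 * κ * r ^ 2) := by field_simp; norm_num
      _ ≤ _ := by gcongr

/-- A positive time derivative would put the contact set above a paraboloid, opening downwards in
time at positive speed. Its coefficient is as small as desired when the Hessian vanishes; for `α <
1` any coefficient is excluded. -/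
theorem IsFlow.timeDeriv_nonpos (hU : IsFlow α σ U) (hσ : IsScaling α σ) (hα₀ : 0 < α)
    (hα₂ : α < 2) {φ : Space (d + 1) × ℝ → ℝ} (hφ : ContDiffOn ℝ 2 φ (spaceTime (d + 1)))
    {z₀ : Space (d + 1) × ℝ} (hz₀ : z₀ ∈ spaceTime (d + 1)) (hc : z₀ ∈ contactSet U)
    (hmax : IsMaxOn (fun w => upperRelaxed U w - φ w) (spaceTime (d + 1)) z₀)
    (hp : grad φ z₀ = 0) (hX : 1 ≤ α → hess φ z₀ = 0) : timeDeriv φ z₀ ≤ 0 := by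
  by_contra ha
  push Not at ha
  set a := timeDeriv φ z₀ with hadef
  have ht₀ : 0 < z₀.2 := hz₀.2
  have hφ' := contDiffAt_of_contDiffOn hφ hz₀
  obtain ⟨ε₀, hε₀, hneg⟩ := exists_integral_profile_mul_neg (d := d) hα₀ hα₂
  -- the limit set lies above a paraboloid
  have hpar : ∀ η > 0, ∃ K ≥ 0, ∃ ρ₁ > 0, ∀ (ξ : Space (d + 1)) (τ : ℝ), ‖ξ‖ ≤ ρ₁ → |τ| ≤ ρ₁ →
      (z₀.1 + ξ, z₀.2 + τ) ∈ contactSet U →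
        0 ≤ a * τ + (‖hessForm φ z₀‖ / 2 + η) * ‖ξ‖ ^ 2 + K * τ ^ 2 := by
    intro η hη
    obtain ⟨K, hK, hexp⟩ := exists_eventually_expansion_le hφ' hη
    obtain ⟨δ, hδ, hexp⟩ := Metric.eventually_nhds_iff_ball.1 hexp
    refine ⟨K, hK, min (δ / 2) (z₀.2 / 2), by positivity, fun ξ τ hξ hτ hmem => ?_⟩
    have hz : (z₀.1 + ξ, z₀.2 + τ) ∈ spaceTime (d + 1) := by
      refine ⟨mem_univ _, ?_⟩
      have := (abs_le.1 (hτ.trans (min_le_right _ _))).1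
      simp only [mem_Ioi]
      linarith
    have h1 := hU.le_of_isMaxOn hz₀ hc hmax hz hmem
    have h2 := hexp (ξ, τ) (by
      rw [mem_ball_zero_iff, Prod.norm_def, max_lt_iff]
      have h3 := hξ.trans (min_le_left _ _)
      have h4 := hτ.trans (min_le_left _ _)
      simp only [Real.norm_eq_abs]
      constructor <;> linarith)
    have h3 : φ (z₀ + (ξ, τ)) = φ (z₀.1 + ξ, z₀.2 + τ) := rfl
    rw [h3, hp, inner_zero_left] at h2
    have h4 : hessForm φ z₀ ξ ξ ≤ ‖hessForm φ z₀‖ * ‖ξ‖ * ‖ξ‖ :=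
      (le_abs_self _).trans ((hessForm φ z₀).le_opNorm₂ ξ ξ)
    simp only at h2
    linarith
  rcases le_or_gt 1 α with h1 | h1
  · obtain ⟨M, hM, hbd⟩ := exists_degenerateBound_le (d := d) h1
    -- With this coefficient for `κ`, the factor `ε₀ a / (4 κ)` equals `M`.
    have hη : 0 < ε₀ * a / (4 * M) := by positivity
    obtain ⟨K, hK, ρ₁, hρ₁, hpos⟩ := hpar _ hη
    have hX0 : ‖hessForm φ z₀‖ = 0 := by rw [hessForm_eq_zero (hX h1)]; exact ContinuousLinearMap.opNorm_zero
    simp only [hX0, zero_div, zero_add] at hpos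
    refine hU.not_paraboloid_contact hσ hα₀ hz₀ hc ha hη hK hρ₁ one_pos hpos hneg
      fun ρ hρ hρ1 => ?_
    filter_upwards [hbd ρ hρ hρ1] with r hr
    refine hr.trans (le_of_eq ?_)
    congr 1
    field_simp
  · obtain ⟨K, hK, ρ₁, hρ₁, hpos⟩ := hpar 1 one_pos
    have hκ : 0 < ‖hessForm φ z₀‖ / 2 + 1 := by positivity
    obtain ⟨ρ₂, hρ₂, hbd⟩ := exists_degenerateBound_le_of_lt_one (d := d) hα₀ h1
      (by positivity : 0 < ε₀ * a / (4 * (‖hessForm φ z₀‖ / 2 + 1)))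
    exact hU.not_paraboloid_contact hσ hα₀ hz₀ hc ha hκ hK hρ₁ hρ₂ hpos hneg hbd

/-- The upper limit has its least possible value `-1` there, so the test function itself has a
minimum. -/
theorem IsFlow.deriv_eq_zero_of_notMem (hU : IsFlow α σ U)
    {φ : Space (d + 1) × ℝ → ℝ} (hφ : ContDiffOn ℝ 2 φ (spaceTime (d + 1)))
    {z₀ : Space (d + 1) × ℝ} (hz₀ : z₀ ∈ spaceTime (d + 1)) (hc : z₀ ∉ contactSet U)
    (hmax : IsMaxOn (fun w => upperRelaxed U w - φ w) (spaceTime (d + 1)) z₀) :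
    grad φ z₀ = 0 ∧ timeDeriv φ z₀ = 0 := by
  have hmin : ∀ z ∈ spaceTime (d + 1), φ z₀ ≤ φ z := by
    intro z hz
    have h1 : upperRelaxed U z - φ z ≤ upperRelaxed U z₀ - φ z₀ := hmax hz
    rw [hU.upperRelaxed_of_notMem hz₀ hc] at h1
    have h2 := neg_abs_le (upperRelaxed U z)
    rw [hU.abs_upperRelaxed hz] at h2
    linarith
  have hφ' := contDiffAt_of_contDiffOn hφ hz₀
  constructor
  · have h1 : IsLocalMin (fun y => φ (y, z₀.2)) z₀.1 :=
      Eventually.of_forall fun y => hmin (y, z₀.2) ⟨mem_univ _, hz₀.2⟩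
    have h2 := fderiv_slice_apply hφ' (grad φ z₀)
    rw [h1.fderiv_eq_zero] at h2
    exact inner_self_eq_zero.1 h2.symm
  · have h1 : IsLocalMin (fun s => φ (z₀.1, s)) z₀.2 := by
      filter_upwards [Ioi_mem_nhds (show 0 < z₀.2 from hz₀.2)] with s hs
      exact hmin (z₀.1, s) ⟨mem_univ _, hs⟩
    exact h1.deriv_eq_zero

/-! ### The curvature equation -/

theorem IsFlow.isCurvatureSubsolution (hU : IsFlow α σ U) (hσ : IsScaling α σ) (hα₁ : 1 ≤ α)
    (hα₂ : α < 2) : IsCurvatureSubsolution (curvatureConst d α) (upperRelaxed U) where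
  usc := hU.upperSemicontinuousOn
  test φ hφ z hz hmax := by
    by_cases hc : z ∈ contactSet U
    · exact ⟨fun hp => hU.timeDeriv_le_curvature hσ hα₁ hα₂ hφ hz hc hmax hp, fun hp hX =>
        hU.timeDeriv_nonpos hσ (by linarith) hα₂ hφ hz hc hmax hp fun _ => hX⟩
    · have h1 := hU.deriv_eq_zero_of_notMem hφ hz hc hmax
      exact ⟨fun hp => absurd h1.1 hp, fun _ _ => h1.2.le⟩

/-! ### Polar coordinates -/

/-- The surface measure of the unit sphere. -/
abbrev sphereMeasure (d : ℕ) : Measure (Metric.sphere (0 : Space (d + 1)) 1) :=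
  (volume : Measure (Space (d + 1))).toSphere

theorem integral_polar {g : Space (d + 1) → ℝ} (hg : Integrable g) :
    ∫ y, g y = ∫ r in Ioi (0 : ℝ), r ^ d * ∫ ω, g (r • (ω : Space (d + 1))) ∂sphereMeasure d := by
  have hdim : Module.finrank ℝ (Space (d + 1)) - 1 = d := by simp
  set F : Metric.sphere (0 : Space (d + 1)) 1 × Ioi (0 : ℝ) → ℝ := fun p => g ((p.2 : ℝ) • (p.1 : Space (d + 1)))
    with hF
  have hmp := (volume : Measure (Space (d + 1))).measurePreserving_homeomorphUnitSphereProd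
  rw [hdim] at hmp
  have hcomp : ∀ x : ({(0 : Space (d + 1))}ᶜ : Set (Space (d + 1))),
      F (homeomorphUnitSphereProd (Space (d + 1)) x) = g x := by
    intro x
    simp only [hF, homeomorphUnitSphereProd_apply_fst_coe, homeomorphUnitSphereProd_apply_snd_coe]
    rw [smul_smul, mul_inv_cancel₀ (norm_ne_zero_iff.2 x.2), one_smul]
  have hFi : Integrable F ((sphereMeasure d).prod (Measure.volumeIoiPow d)) := by
    rw [← hmp.integrable_comp_emb (Homeomorph.measurableEmbedding _)]
    simp only [Function.comp_def, hcomp]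
    have h1 := (integrableOn_iff_comap_subtypeVal (μ := volume)
      (measurableSet_singleton (0 : Space (d + 1))).compl (f := g)).1 hg.integrableOn
    exact h1
  calc ∫ y, g y = ∫ x : ({(0 : Space (d + 1))}ᶜ : Set (Space (d + 1))), g x
        ∂((volume : Measure (Space (d + 1))).comap Subtype.val) := by
        rw [integral_subtype_comap (measurableSet_singleton _).compl g, restrict_compl_singleton]
    _ = ∫ p, F p ∂((sphereMeasure d).prod (Measure.volumeIoiPow d)) := by
        rw [← hmp.integral_comp (Homeomorph.measurableEmbedding _) F]
        simp only [hcomp]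
    _ = ∫ r : Ioi (0 : ℝ), ∫ ω, F (ω, r) ∂sphereMeasure d ∂Measure.volumeIoiPow d :=
        integral_prod_symm _ hFi
    _ = _ := by
        simp only [Measure.volumeIoiPow, ENNReal.ofReal]
        rw [integral_withDensity_eq_integral_smul
          (measurable_subtype_coe.pow_const _).real_toNNReal]
        simp only [hF]
        rw [integral_subtype_comap measurableSet_Ioi (fun r : ℝ => Real.toNNReal (r ^ d) •
          ∫ ω, g (r • (ω : Space (d + 1))) ∂sphereMeasure d)]
        refine setIntegral_congr_fun measurableSet_Ioi fun r hr => ?_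
        have hr : 0 < r := hr
        simp only [NNReal.smul_def, Real.coe_toNNReal _ (pow_nonneg hr.le _), smul_eq_mul]

/-! ### Nonlocal terms as radial integrals -/

/-- The radial integrand of a nonlocal term. -/
def radialIntegrand (α : ℝ) (F : Space (d + 1) → ℝ) (r : ℝ) : ℝ :=
  r ^ (-(1 + α)) * ∫ ω, F (r • (ω : Space (d + 1))) ∂sphereMeasure d

theorem measurable_radialIntegrand {F : Space (d + 1) → ℝ} (hF : Measurable F) :
    Measurable (radialIntegrand α F) := by
  refine (measurable_id.pow_const _).mul (StronglyMeasurable.measurable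
    (StronglyMeasurable.integral_prod_right' (f := fun p : ℝ × Metric.sphere (0 : Space (d + 1)) 1 =>
      F (p.1 • (p.2 : Space (d + 1)))) ?_))
  exact (hF.comp (Continuous.measurable (by fun_prop))).stronglyMeasurable

theorem integrable_sphere {F : Space (d + 1) → ℝ} (hF : Measurable F) (hF1 : ∀ y, |F y| ≤ 1) (r : ℝ) :
    Integrable (fun ω : Metric.sphere (0 : Space (d + 1)) 1 => F (r • (ω : Space (d + 1))))
      (sphereMeasure d) := by
  refine Integrable.of_bound
    (hF.comp (Continuous.measurable (by fun_prop))).aestronglyMeasurable 1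
    (Eventually.of_forall fun ω => hF1 _)

theorem abs_integral_sphere_le {F : Space (d + 1) → ℝ} (hF1 : ∀ y, |F y| ≤ 1) (r : ℝ) :
    |∫ ω, F (r • (ω : Space (d + 1))) ∂sphereMeasure d| ≤ (sphereMeasure d).real univ := by
  have := norm_integral_le_of_norm_le_const (μ := sphereMeasure d) (C := 1)
    (f := fun ω => F (r • (ω : Space (d + 1)))) (Eventually.of_forall fun ω => hF1 _)
  simpa using this

theorem integrableOn_radialIntegrand (hα₀ : 0 < α) {F : Space (d + 1) → ℝ} (hF : Measurable F)
    (hF1 : ∀ y, |F y| ≤ 1) {ρ : ℝ} (hρ : 0 < ρ) :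
    IntegrableOn (radialIntegrand α F) (Ici ρ) := by
  have h1 : IntegrableOn (fun r : ℝ => r ^ (-(1 + α)) * (sphereMeasure d).real univ) (Ici ρ) := by
    rw [integrableOn_Ici_iff_integrableOn_Ioi]
    exact (integrableOn_Ioi_rpow_of_lt (by linarith) hρ).mul_const _
  refine Integrable.mono' h1 (measurable_radialIntegrand hF).aestronglyMeasurable ?_
  refine (ae_restrict_iff' measurableSet_Ici).2 (Eventually.of_forall fun r hr => ?_)
  have hr0 : 0 < r := hρ.trans_le hr
  rw [radialIntegrand, norm_mul, Real.norm_of_nonneg (by positivity)]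
  gcongr
  exact abs_integral_sphere_le hF1 r

theorem norm_smul_sphere {r : ℝ} (hr : 0 < r) (ω : Metric.sphere (0 : Space (d + 1)) 1) :
    ‖r • (ω : Space (d + 1))‖ = r := by
  rw [norm_smul, Real.norm_of_nonneg hr.le, norm_eq_of_mem_sphere, mul_one]

theorem setIntegral_compl_ball_polar (hα₀ : 0 < α) {F : Space (d + 1) → ℝ} (hF : Measurable F)
    (hF1 : ∀ y, |F y| ≤ 1) {ρ : ℝ} (hρ : 0 < ρ) :
    ∫ y in (Metric.ball (0 : Space (d + 1)) ρ)ᶜ, ‖y‖ ^ (-((d : ℝ) + 1 + α)) * F y =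
      ∫ r in Ici ρ, radialIntegrand α F r := by
  have hi : Integrable ((Metric.ball (0 : Space (d + 1)) ρ)ᶜ.indicator
      (fun y => ‖y‖ ^ (-((d : ℝ) + 1 + α)) * F y)) := by
    rw [integrable_indicator_iff measurableSet_ball.compl]
    refine Integrable.mono' (integrableOn_norm_rpow_compl_ball hα₀ hρ)
      ((measurable_norm.pow_const _).mul hF).aestronglyMeasurable (Eventually.of_forall fun y => ?_)
    rw [norm_mul, Real.norm_of_nonneg (by positivity)]
    exact mul_le_of_le_one_right (by positivity) (hF1 y)
  rw [← integral_indicator measurableSet_ball.compl, integral_polar hi]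
  have h1 : ∀ r ∈ Ioi (0 : ℝ), r ^ d * ∫ ω, (Metric.ball (0 : Space (d + 1)) ρ)ᶜ.indicator
      (fun y => ‖y‖ ^ (-((d : ℝ) + 1 + α)) * F y) (r • (ω : Space (d + 1))) ∂sphereMeasure d =
      (Ici ρ).indicator (radialIntegrand α F) r := by
    intro r hr
    have hr : 0 < r := hr
    by_cases hrρ : r ∈ Ici ρ
    · rw [indicator_of_mem hrρ]
      have h2 : ∀ ω : Metric.sphere (0 : Space (d + 1)) 1,
          (Metric.ball (0 : Space (d + 1)) ρ)ᶜ.indicator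
          (fun y => ‖y‖ ^ (-((d : ℝ) + 1 + α)) * F y) (r • (ω : Space (d + 1))) =
          r ^ (-((d : ℝ) + 1 + α)) * F (r • (ω : Space (d + 1))) := by
        intro ω
        rw [indicator_of_mem, norm_smul_sphere hr]
        simpa [norm_smul_sphere hr] using hrρ
      simp only [h2]
      rw [integral_const_mul, ← mul_assoc, radialIntegrand, ← Real.rpow_natCast, ← Real.rpow_add hr]
      congr 2
      ring
    · rw [indicator_of_notMem hrρ]
      have h2 : ∀ ω : Metric.sphere (0 : Space (d + 1)) 1,
          (Metric.ball (0 : Space (d + 1)) ρ)ᶜ.indicator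
          (fun y => ‖y‖ ^ (-((d : ℝ) + 1 + α)) * F y) (r • (ω : Space (d + 1))) = 0 := by
        intro ω
        rw [indicator_of_notMem]
        simpa [norm_smul_sphere hr] using hrρ
      simp only [h2, integral_zero, mul_zero]
  rw [setIntegral_congr_fun measurableSet_Ioi h1, setIntegral_indicator measurableSet_Ici]
  congr 2
  rw [inter_eq_right]
  exact fun r hr => hρ.trans_le hr

theorem nonlocalTerm_ball (s : ℝ → ℝ) (δ : ℝ) (v : Space (d + 1) × ℝ → ℝ) (z : Space (d + 1) × ℝ) :
    nonlocalTerm s α (Metric.ball 0 δ) v z =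
      ∫ r in Ioo 0 δ, radialIntegrand α (fun y => s (v (z.1 + y, z.2) - v z)) r := by
  have h1 : ∀ r ∈ Ioi (0 : ℝ), r ^ (-(1 + α)) * ∫ ω, (Metric.ball (0 : Space (d + 1)) δ).indicator
      (fun y => s (v (z.1 + y, z.2) - v z)) (r • (ω : Space (d + 1))) ∂sphereMeasure d =
      (Iio δ).indicator (radialIntegrand α (fun y => s (v (z.1 + y, z.2) - v z))) r := by
    intro r hr
    have hr : 0 < r := hr
    by_cases hrδ : r ∈ Iio δ
    · rw [indicator_of_mem hrδ, radialIntegrand]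
      congr 1
      refine integral_congr_ae (Eventually.of_forall fun ω => ?_)
      simp only
      rw [indicator_of_mem]
      simpa [norm_smul_sphere hr] using hrδ
    · rw [indicator_of_notMem hrδ]
      have h2 : ∀ ω : Metric.sphere (0 : Space (d + 1)) 1,
          (Metric.ball (0 : Space (d + 1)) δ).indicator
          (fun y => s (v (z.1 + y, z.2) - v z)) (r • (ω : Space (d + 1))) = 0 := by
        intro ω
        rw [indicator_of_notMem]
        simpa [norm_smul_sphere hr] using hrδ
      simp only [h2, integral_zero, mul_zero]
  rw [nonlocalTerm, setIntegral_congr_fun measurableSet_Ioi h1, setIntegral_indicator measurableSet_Iio,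
    Ioi_inter_Iio]

theorem nonlocalTerm_compl_ball (s : ℝ → ℝ) {δ : ℝ} (hδ : 0 < δ) (v : Space (d + 1) × ℝ → ℝ)
    (z : Space (d + 1) × ℝ) :
    nonlocalTerm s α (Metric.ball 0 δ)ᶜ v z =
      ∫ r in Ici δ, radialIntegrand α (fun y => s (v (z.1 + y, z.2) - v z)) r := by
  have h1 : ∀ r ∈ Ioi (0 : ℝ), r ^ (-(1 + α)) *
      ∫ ω, (Metric.ball (0 : Space (d + 1)) δ)ᶜ.indicator
      (fun y => s (v (z.1 + y, z.2) - v z)) (r • (ω : Space (d + 1))) ∂sphereMeasure d =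
      (Ici δ).indicator (radialIntegrand α (fun y => s (v (z.1 + y, z.2) - v z))) r := by
    intro r hr
    have hr : 0 < r := hr
    by_cases hrδ : r ∈ Ici δ
    · rw [indicator_of_mem hrδ, radialIntegrand]
      congr 1
      refine integral_congr_ae (Eventually.of_forall fun ω => ?_)
      simp only
      rw [indicator_of_mem]
      simpa [norm_smul_sphere hr] using hrδ
    · rw [indicator_of_notMem hrδ]
      have h2 : ∀ ω : Metric.sphere (0 : Space (d + 1)) 1,
          (Metric.ball (0 : Space (d + 1)) δ)ᶜ.indicator
          (fun y => s (v (z.1 + y, z.2) - v z)) (r • (ω : Space (d + 1))) = 0 := by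
        intro ω
        rw [indicator_of_notMem]
        simpa [norm_smul_sphere hr] using hrδ
      simp only [h2, integral_zero, mul_zero]
  rw [nonlocalTerm, setIntegral_congr_fun measurableSet_Ioi h1, setIntegral_indicator measurableSet_Ici]
  congr 2
  rw [inter_eq_right]
  exact fun r hr => hδ.trans_le hr

/-! ### Cancellation on small spheres -/

-- The measure of a subset of the sphere is a multiple of the volume of the cone over it, and the
-- volume is even.
open scoped Pointwise in
theorem measurePreserving_neg_sphere :
    MeasurePreserving (fun ω : Metric.sphere (0 : Space (d + 1)) 1 => -ω) (sphereMeasure d)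
      (sphereMeasure d) := by
  refine ⟨continuous_neg.measurable, Measure.ext fun s hs => ?_⟩
  have hs' : MeasurableSet ((fun ω : Metric.sphere (0 : Space (d + 1)) 1 => -ω) ⁻¹' s) :=
    continuous_neg.measurable hs
  rw [Measure.map_apply continuous_neg.measurable hs, Measure.toSphere_apply' _ hs,
    Measure.toSphere_apply' _ hs']
  congr 1
  have h1 : Ioo (0 : ℝ) 1 • (Subtype.val '' ((fun ω : Metric.sphere (0 : Space (d + 1)) 1 => -ω) ⁻¹' s)) =
      -(Ioo (0 : ℝ) 1 • (Subtype.val '' s : Set (Space (d + 1)))) := by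
    ext x
    simp only [Set.mem_smul, Set.mem_neg]
    constructor
    · rintro ⟨t, ht, _, ⟨ω, hω, rfl⟩, rfl⟩
      exact ⟨t, ht, _, ⟨-ω, hω, rfl⟩, by simp⟩
    · rintro ⟨t, ht, _, ⟨ω, hω, rfl⟩, hx⟩
      refine ⟨t, ht, _, ⟨-ω, by simpa using hω, rfl⟩, ?_⟩
      rw [← neg_neg x, ← hx]
      simp
  rw [h1, Measure.measure_neg]

-- The cone over the band lies in the slab `|⟨p, x⟩| ≤ s` of the unit ball, because shrinking a
-- vector shrinks its inner product with `p`. The volume of the slab is linear in `s`.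
open scoped Pointwise in
theorem exists_sphereMeasure_band_le {p : Space (d + 1)} (hp : p ≠ 0) :
    ∃ C ≥ 0, ∀ s, 0 ≤ s → (sphereMeasure d).real
      {ω | |inner ℝ p (ω : Space (d + 1))| ≤ s} ≤ C * s := by
  have hP : 0 < ‖p‖ := norm_pos_iff.2 hp
  set V := (volume : Measure (Space d)).real (Metric.ball 0 1) with hV
  refine ⟨(d + 1) * (2 / ‖p‖ * V), by positivity, fun s hs => ?_⟩
  obtain ⟨O, hO⟩ := exists_isometry_inner p
  have hm : MeasurableSet {ω : Metric.sphere (0 : Space (d + 1)) 1 |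
      |inner ℝ p (ω : Space (d + 1))| ≤ s} :=
    (isClosed_le (by fun_prop) continuous_const).measurableSet
  set E : Set (Space (d + 1)) := {x | |inner ℝ p x| ≤ s ∧ ‖x‖ < 1} with hE
  have hEm : MeasurableSet E := by
    have h1 : Continuous (fun x : Space (d + 1) => |inner ℝ p x|) := by fun_prop
    exact (measurableSet_le h1.measurable measurable_const).inter
      (measurableSet_lt measurable_norm measurable_const)
  have hsub : Ioo (0 : ℝ) 1 • (Subtype.val '' {ω : Metric.sphere (0 : Space (d + 1)) 1 |
      |inner ℝ p (ω : Space (d + 1))| ≤ s} : Set (Space (d + 1))) ⊆ E := by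
    intro x hx
    obtain ⟨t, ht, _, ⟨ω, hω, rfl⟩, rfl⟩ := Set.mem_smul.1 hx
    refine ⟨?_, ?_⟩
    · rw [inner_smul_right, abs_mul, abs_of_pos ht.1]
      exact (mul_le_of_le_one_left (abs_nonneg _) ht.2.le).trans hω
    · rw [norm_smul_sphere ht.1]
      exact ht.2
  have hEvol : volume E ≤ ENNReal.ofReal (2 / ‖p‖ * V * s) := by
    rw [← O.measurePreserving.measure_preimage hEm.nullMeasurableSet,
      ← (measurePreserving_consEquiv (d := d)).measure_preimage
        (O.continuous.measurable hEm).nullMeasurableSet]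
    have h1 : consEquiv d ⁻¹' (O ⁻¹' E) ⊆
        Icc (-(s / ‖p‖)) (s / ‖p‖) ×ˢ Metric.ball (0 : Space d) 1 := by
      rintro ⟨v, z⟩ ⟨h2, h3⟩
      rw [consEquiv_apply, hO, consPoint_zero, abs_mul, abs_of_pos hP, mul_comm,
        ← le_div_iff₀ hP] at h2
      rw [consEquiv_apply, O.norm_map] at h3
      refine ⟨abs_le.1 h2, ?_⟩
      rw [mem_ball_zero_iff]
      exact (norm_le_norm_consPoint v z).trans_lt h3
    refine (measure_mono h1).trans (le_of_eq ?_)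
    rw [Measure.volume_eq_prod, Measure.prod_prod, Real.volume_Icc, hV, Measure.real]
    rw [show s / ‖p‖ - -(s / ‖p‖) = 2 / ‖p‖ * s by ring, mul_right_comm,
      ENNReal.ofReal_mul (p := 2 / ‖p‖ * s) (by positivity),
      ENNReal.ofReal_toReal measure_ball_lt_top.ne]
  rw [Measure.real, Measure.toSphere_apply' _ hm]
  have h2 : ((Module.finrank ℝ (Space (d + 1)) : ENNReal) * volume (Ioo (0 : ℝ) 1 •
      (Subtype.val '' {ω : Metric.sphere (0 : Space (d + 1)) 1 |
      |inner ℝ p (ω : Space (d + 1))| ≤ s} : Set (Space (d + 1))))) ≤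
      ENNReal.ofReal ((d + 1) * (2 / ‖p‖ * V * s)) := by
    rw [ENNReal.ofReal_mul (by positivity)]
    refine mul_le_mul' (le_of_eq ?_) ((measure_mono hsub).trans hEvol)
    simp only [finrank_euclideanSpace, Fintype.card_fin]
    rw [← ENNReal.ofReal_natCast]
    push_cast
    rfl
  refine (ENNReal.toReal_le_of_le_ofReal (by positivity) h2).trans (le_of_eq ?_)
  ring

/-- The spherical means of the sign of a function with nonvanishing gradient are of the order of
the radius. -/
theorem exists_abs_integral_sphere_signUpper_le {f : Space (d + 1) → ℝ} {x p : Space (d + 1)}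
    (hfc : Continuous f) (hf : ContDiffAt ℝ 2 f x) (hfp : ∀ ξ, fderiv ℝ f x ξ = inner ℝ p ξ)
    (hp : p ≠ 0) : ∃ C ≥ 0, ∀ r, 0 < r →
      |∫ ω, signUpper (f (x + r • (ω : Space (d + 1))) - f x) ∂sphereMeasure d| ≤ C * r := by
  obtain ⟨C₂, hC₂, hband⟩ := exists_sphereMeasure_band_le hp
  set D := fderiv ℝ (fderiv ℝ f) x with hD
  obtain ⟨r₀, hr₀, htay⟩ := Metric.eventually_nhds_iff_ball.1 (eventually_abs_taylor_le hf one_pos)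
  set C₁ := ‖D‖ / 2 + 1 with hC₁
  set S := (sphereMeasure d).real univ with hS
  have hS0 : 0 ≤ S := measureReal_nonneg
  have hquad : ∀ ξ ∈ Metric.ball (0 : Space (d + 1)) r₀,
      |f (x + ξ) - f x - inner ℝ p ξ| ≤ C₁ * ‖ξ‖ ^ 2 := by
    intro ξ hξ
    have h1 := htay ξ hξ
    rw [hfp, ← hD] at h1
    have h2 : |D ξ ξ / 2| ≤ ‖D‖ / 2 * ‖ξ‖ ^ 2 := by
      rw [abs_div, abs_two]
      have := D.le_opNorm₂ ξ ξ
      rw [Real.norm_eq_abs] at this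
      linarith
    have h3 := abs_add_le (f (x + ξ) - f x - inner ℝ p ξ - D ξ ξ / 2) (D ξ ξ / 2)
    rw [sub_add_cancel] at h3
    rw [hC₁]
    linarith
  refine ⟨C₂ * C₁ + S / r₀, by positivity, fun r hr => ?_⟩
  set F : Space (d + 1) → ℝ := fun y => signUpper (f (x + y) - f x) with hF
  have hFm : Measurable F :=
    measurable_signUpper.comp (Continuous.measurable (by fun_prop))
  have hF1 : ∀ y, |F y| ≤ 1 := fun y => (abs_signUpper _).le
  -- For small `r` the signs at `r ω` and `-r ω` cancel unless `|⟨p, ω⟩| ≤ C₁ r`, since elsewhere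
  -- the linear term beats the quadratic remainder. For `r ≥ r₀` the total mass is at most `(S / r₀)
  -- r`.
  rcases lt_or_ge r r₀ with hrr | hrr
  · have hneg : ∫ ω, F (r • (ω : Space (d + 1))) ∂sphereMeasure d =
        ∫ ω, F (-(r • (ω : Space (d + 1)))) ∂sphereMeasure d := by
      rw [← measurePreserving_neg_sphere.integral_comp
        (Homeomorph.neg (Metric.sphere (0 : Space (d + 1)) 1)).measurableEmbedding
        (fun ω => F (r • (ω : Space (d + 1))))]
      simp
    have hi1 := integrable_sphere hFm hF1 r
    have hi2 : Integrable (fun ω : Metric.sphere (0 : Space (d + 1)) 1 =>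
        F (-(r • (ω : Space (d + 1))))) (sphereMeasure d) := by
      have := integrable_sphere hFm hF1 (-r)
      simpa only [neg_smul] using this
    have hsum : 2 * ∫ ω, F (r • (ω : Space (d + 1))) ∂sphereMeasure d =
        ∫ ω, (F (r • (ω : Space (d + 1))) + F (-(r • (ω : Space (d + 1))))) ∂sphereMeasure d := by
      rw [integral_add hi1 hi2, ← hneg, two_mul]
    set b : Set (Metric.sphere (0 : Space (d + 1)) 1) :=
      {ω | |inner ℝ p (ω : Space (d + 1))| ≤ C₁ * r} with hb
    have hbm : MeasurableSet b := (isClosed_le (by fun_prop) continuous_const).measurableSet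
    have hpt : ∀ ω : Metric.sphere (0 : Space (d + 1)) 1,
        ‖F (r • (ω : Space (d + 1))) + F (-(r • (ω : Space (d + 1))))‖ ≤ b.indicator (fun _ => 2) ω := by
      intro ω
      have hn := norm_smul_sphere hr ω
      have hq1 := hquad (r • (ω : Space (d + 1))) (by rw [mem_ball_zero_iff, hn]; exact hrr)
      have hq2 := hquad (-(r • (ω : Space (d + 1)))) (by rw [mem_ball_zero_iff, norm_neg, hn]; exact hrr)
      rw [norm_neg, inner_neg_right, hn, inner_smul_right] at hq2
      rw [hn, inner_smul_right] at hq1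
      by_cases hω : ω ∈ b
      · rw [indicator_of_mem hω]
        refine (norm_add_le _ _).trans ?_
        have := hF1 (r • (ω : Space (d + 1)))
        have := hF1 (-(r • (ω : Space (d + 1))))
        simp only [Real.norm_eq_abs]
        linarith
      · rw [indicator_of_notMem hω]
        have hω' : C₁ * r < |inner ℝ p (ω : Space (d + 1))| := not_le.1 hω
        have hω'' : C₁ * r ^ 2 < r * |inner ℝ p (ω : Space (d + 1))| := by
          calc C₁ * r ^ 2 = r * (C₁ * r) := by ring
            _ < _ := by gcongr
        rw [abs_le] at hq1 hq2
        rcases abs_cases (inner ℝ p (ω : Space (d + 1))) with h | h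
        · rw [h.1] at hω''
          have e1 : F (r • (ω : Space (d + 1))) = 1 := if_pos (by linarith)
          have e2 : F (-(r • (ω : Space (d + 1)))) = -1 := if_neg (by linarith)
          rw [e1, e2]
          simp
        · rw [h.1] at hω''
          have e1 : F (r • (ω : Space (d + 1))) = -1 := if_neg (by linarith)
          have e2 : F (-(r • (ω : Space (d + 1)))) = 1 := if_pos (by linarith)
          rw [e1, e2]
          simp
    have h1 := norm_integral_le_of_norm_le (μ := sphereMeasure d)
      ((integrable_const (2 : ℝ)).indicator hbm) (Eventually.of_forall hpt)
    rw [← hsum, integral_indicator_const _ hbm, smul_eq_mul, norm_mul, Real.norm_eq_abs,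
      Real.norm_eq_abs, abs_two] at h1
    have h2 := hband (C₁ * r) (by positivity)
    have h3 : 0 ≤ S / r₀ * r := by positivity
    have h4 : (sphereMeasure d).real b ≤ C₂ * (C₁ * r) := h2
    change |∫ ω, F (r • (ω : Space (d + 1))) ∂sphereMeasure d| ≤ _
    linarith
  · have h1 := abs_integral_sphere_le hF1 r
    have h2 : S ≤ S / r₀ * r := by
      rw [div_mul_eq_mul_div, le_div_iff₀ hr₀]
      gcongr
    have h3 : 0 ≤ C₂ * C₁ * r := by positivity
    change |∫ ω, F (r • (ω : Space (d + 1))) ∂sphereMeasure d| ≤ _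
    linarith

/-! ### The nonlocal equation -/

/-- The rescaled profile, normalized so as to converge away from the origin. -/
def scaledProfile (α r : ℝ) (y : Space (d + 1)) : ℝ :=
  r ^ (-((d : ℝ) + 1 + α)) * profile α (r⁻¹ • y)

/-- The second factor is bounded and tends to the tail constant as `r → 0`. -/
theorem scaledProfile_eq {r : ℝ} (hr : 0 < r) {y : Space (d + 1)} (hy : y ≠ 0) :
    scaledProfile α r y = ‖y‖ ^ (-((d : ℝ) + 1 + α)) *
      (‖r⁻¹ • y‖ ^ ((d : ℝ) + 1 + α) * profile α (r⁻¹ • y)) := by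
  have hy0 : 0 < ‖y‖ := norm_pos_iff.2 hy
  rw [scaledProfile, ← mul_assoc, norm_smul, norm_inv, Real.norm_of_nonneg hr.le,
    Real.mul_rpow (by positivity) hy0.le, Real.inv_rpow hr.le, Real.rpow_neg hr.le,
    Real.rpow_neg hy0.le]
  congr 1
  field_simp

theorem integral_compl_ball_rescale {r : ℝ} (hr : 0 < r)
    (O : Space (d + 1) ≃ₗᵢ[ℝ] Space (d + 1)) (x : Space (d + 1)) (f : Space (d + 1) → ℝ) (ρ : ℝ) :
    (r ^ α)⁻¹ * ∫ z in (Metric.ball (0 : Space (d + 1)) (ρ / r))ᶜ, profile α z * f (x + r • O z) =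
      ∫ y in (Metric.ball (0 : Space (d + 1)) ρ)ᶜ, scaledProfile α r y * f (x + y) := by
  rw [← integral_indicator measurableSet_ball.compl, ← integral_indicator measurableSet_ball.compl]
  set G := (Metric.ball (0 : Space (d + 1)) ρ)ᶜ.indicator
    (fun y => scaledProfile α r y * f (x + y)) with hG
  have h1 : ∫ z, G (r • O z) = (r ^ (d + 1))⁻¹ * ∫ y, G y := by
    rw [O.measurePreserving.integral_comp O.toHomeomorph.measurableEmbedding
      (fun z => G (r • z)), Measure.integral_comp_smul volume G]
    simp [abs_of_pos hr]
  have h2 : ∀ z, G (r • O z) = r ^ (-((d : ℝ) + 1 + α)) *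
      (Metric.ball (0 : Space (d + 1)) (ρ / r))ᶜ.indicator
        (fun z => profile α z * f (x + r • O z)) z := by
    intro z
    have hiff : r • O z ∈ (Metric.ball (0 : Space (d + 1)) ρ)ᶜ ↔
        z ∈ (Metric.ball (0 : Space (d + 1)) (ρ / r))ᶜ := by
      simp only [mem_compl_iff, mem_ball_zero_iff, norm_smul, O.norm_map,
        Real.norm_of_nonneg hr.le, lt_div_iff₀ hr, mul_comm r]
    by_cases hz : z ∈ (Metric.ball (0 : Space (d + 1)) (ρ / r))ᶜ
    · rw [hG, indicator_of_mem (hiff.2 hz), indicator_of_mem hz, scaledProfile, smul_smul,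
        inv_mul_cancel₀ hr.ne', one_smul, profile_map_isometry, mul_assoc]
    · rw [hG, indicator_of_notMem (mt hiff.1 hz), indicator_of_notMem hz, mul_zero]
  simp only [h2] at h1
  rw [integral_const_mul] at h1
  have h3 : (r ^ α)⁻¹ = r ^ (d + 1) * r ^ (-((d : ℝ) + 1 + α)) := by
    rw [← Real.rpow_neg hr.le, ← Real.rpow_natCast, ← Real.rpow_add hr]
    congr 1
    push_cast
    ring
  rw [h3, mul_assoc, h1, mul_inv_cancel_left₀ (by positivity)]

theorem IsFlow.measurable_upperRelaxed_slice (hU : IsFlow α σ U) {z₀ : Space (d + 1) × ℝ}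
    (hz₀ : z₀ ∈ spaceTime (d + 1)) :
    Measurable (fun y => upperRelaxed U (z₀.1 + y, z₀.2)) := by
  have h1 : (fun y => upperRelaxed U (z₀.1 + y, z₀.2)) = fun y =>
      2 * ((fun y => (z₀.1 + y, z₀.2)) ⁻¹' contactSet U).indicator 1 y - 1 := by
    ext y
    have hy : (z₀.1 + y, z₀.2) ∈ spaceTime (d + 1) := ⟨mem_univ _, hz₀.2⟩
    by_cases h : (z₀.1 + y, z₀.2) ∈ contactSet U
    · have h' : y ∈ (fun y => (z₀.1 + y, z₀.2)) ⁻¹' contactSet U := h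
      rw [hU.upperRelaxed_of_mem hy h, indicator_of_mem h', Pi.one_apply]
      norm_num
    · have h' : y ∉ (fun y => (z₀.1 + y, z₀.2)) ⁻¹' contactSet U := h
      rw [hU.upperRelaxed_of_notMem hy h, indicator_of_notMem h']
      norm_num
  have h2 : MeasurableSet ((fun y => (z₀.1 + y, z₀.2)) ⁻¹' contactSet U) :=
    ((isClosed_contactSet U).preimage (by fun_prop)).measurableSet
  rw [h1]
  exact ((measurable_one.indicator h2).const_mul 2).sub_const 1

/-- The contribution of the complement of a ball at contact sequences. -/
theorem IsFlow.eventually_integral_compl_ball_le (hU : IsFlow α σ U) (hα₀ : 0 < α) (hα₂ : α < 2)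
    {z₀ : Space (d + 1) × ℝ} (hz₀ : z₀ ∈ spaceTime (d + 1))
    {h r : ℕ → ℝ} {x : ℕ → Space (d + 1)} {n : ℕ → ℕ} (h0 : ∀ k, 0 < h k)
    (hh : Tendsto h atTop (𝓝 0)) (hr0 : ∀ k, 0 < r k) (hr : Tendsto r atTop (𝓝 0))
    (hxn : Tendsto (fun k => (x k, (n k : ℝ) * h k)) atTop (𝓝 z₀))
    (hpm : ∀ k y, U (h k) (n k) y = 1 ∨ U (h k) (n k) y = -1) {ρ ε : ℝ} (hρ : 0 < ρ) (hε : 0 < ε) :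
    ∀ᶠ k in atTop, ∫ y in (Metric.ball (0 : Space (d + 1)) ρ)ᶜ,
        scaledProfile α (r k) y * U (h k) (n k) (x k + y) ≤
      tailConst d α * (∫ y in (Metric.ball (0 : Space (d + 1)) ρ)ᶜ,
        ‖y‖ ^ (-((d : ℝ) + 1 + α)) * upperRelaxed U (z₀.1 + y, z₀.2)) + ε := by
  set v : Space (d + 1) → ℝ := fun y => upperRelaxed U (z₀.1 + y, z₀.2) with hv
  have hvm : Measurable v := hU.measurable_upperRelaxed_slice hz₀
  have hst : ∀ y, (z₀.1 + y, z₀.2) ∈ spaceTime (d + 1) := fun y => ⟨mem_univ _, hz₀.2⟩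
  have hv1 : ∀ y, |v y| = 1 := fun y => hU.abs_upperRelaxed (hst y)
  obtain ⟨C, hC, hle⟩ := exists_profile_le (d := d) hα₀ hα₂
  have hm0 : 0 ≤ (d : ℝ) + 1 + α := by positivity
  have hne : ∀ y ∈ (Metric.ball (0 : Space (d + 1)) ρ)ᶜ, y ≠ 0 := by
    rintro y hy rfl
    exact hy (Metric.mem_ball_self hρ)
  have hQ0 : ∀ k (y : Space (d + 1)), 0 ≤ scaledProfile α (r k) y := fun k y =>
    mul_nonneg (Real.rpow_nonneg (hr0 k).le _) (profile_nonneg hα₀ hα₂ _)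
  have hQle : ∀ k, ∀ y ∈ (Metric.ball (0 : Space (d + 1)) ρ)ᶜ,
      scaledProfile α (r k) y ≤ C * ‖y‖ ^ (-((d : ℝ) + 1 + α)) := by
    intro k y hy
    rw [scaledProfile_eq (hr0 k) (hne y hy), mul_comm C]
    refine mul_le_mul_of_nonneg_left ?_ (by positivity)
    have hw : 0 < ‖(r k)⁻¹ • y‖ :=
      norm_pos_iff.2 (smul_ne_zero (inv_ne_zero (hr0 k).ne') (hne y hy))
    calc ‖(r k)⁻¹ • y‖ ^ ((d : ℝ) + 1 + α) * profile α ((r k)⁻¹ • y)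
        ≤ ‖(r k)⁻¹ • y‖ ^ ((d : ℝ) + 1 + α) * (C * ‖(r k)⁻¹ • y‖ ^ (-((d : ℝ) + 1 + α))) := by
          gcongr
          refine (hle _).trans ?_
          refine mul_le_mul_of_nonneg_left (Real.rpow_le_rpow_of_nonpos hw (by linarith)
            (by linarith)) hC.le
      _ = C := by
          rw [Real.rpow_neg hw.le, mul_left_comm,
            mul_inv_cancel₀ (Real.rpow_pos_of_pos hw _).ne', mul_one]
  have hQm : ∀ k, Measurable (fun y : Space (d + 1) => scaledProfile α (r k) y) := fun k =>
    (((profile_continuous hα₀ hα₂).comp (continuous_const_smul _)).measurable).const_mul _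
  have hQlim : ∀ y ∈ (Metric.ball (0 : Space (d + 1)) ρ)ᶜ,
      Tendsto (fun k => scaledProfile α (r k) y) atTop
        (𝓝 (‖y‖ ^ (-((d : ℝ) + 1 + α)) * tailConst d α)) := by
    intro y hy
    have h1 : Tendsto (fun k => (r k)⁻¹ • y) atTop (Bornology.cobounded _) := by
      rw [← tendsto_norm_atTop_iff_cobounded]
      have h2 : Tendsto (fun k => (r k)⁻¹) atTop atTop :=
        tendsto_inv_nhdsGT_zero.comp (tendsto_nhdsWithin_iff.2 ⟨hr, Eventually.of_forall hr0⟩)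
      refine (h2.atTop_mul_const (norm_pos_iff.2 (hne y hy))).congr fun k => ?_
      rw [norm_smul, norm_inv, Real.norm_of_nonneg (hr0 k).le]
    refine (((tendsto_rpow_mul_profile (d := d) hα₀ hα₂).comp h1).const_mul
      (‖y‖ ^ (-((d : ℝ) + 1 + α)))).congr fun k => ?_
    rw [scaledProfile_eq (hr0 k) (hne y hy)]
    rfl
  have hUm : ∀ k, Measurable (fun y => U (h k) (n k) (x k + y)) := fun k =>
    (hU.measurable _ _).comp (measurable_const_add _)
  have hU1 : ∀ k y, |U (h k) (n k) (x k + y)| ≤ 1 := fun k y => hU.abs_le_one _ _ _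
  -- Where the limit function is one, `U` itself need not converge. Its maximum with `v` converges
  -- to `v` everywhere, and replacing `U` by it costs nothing in an upper bound.
  have hmax1 : ∀ k y, |max (U (h k) (n k) (x k + y)) (v y)| ≤ 1 := by
    intro k y
    rcases max_choice (U (h k) (n k) (x k + y)) (v y) with h | h <;> rw [h]
    · exact hU1 k y
    · exact (hv1 y).le
  have hmaxlim : ∀ y, Tendsto (fun k => max (U (h k) (n k) (x k + y)) (v y)) atTop (𝓝 (v y)) := by
    intro y
    by_cases hyc : (z₀.1 + y, z₀.2) ∈ contactSet U
    · have h1 : v y = 1 := hU.upperRelaxed_of_mem (hst y) hyc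
      refine tendsto_const_nhds.congr fun k => ?_
      rw [max_eq_right]
      rw [h1]
      exact (abs_le.1 (hU1 k y)).2
    · have h1 : v y = -1 := hU.upperRelaxed_of_notMem (hst y) hyc
      refine tendsto_const_nhds.congr' ?_
      obtain ⟨δ, hδ, H⟩ := notMem_contactSet_iff.1 hyc
      have h2 : Tendsto (fun k => (x k + y, (n k : ℝ) * h k)) atTop (𝓝 (z₀.1 + y, z₀.2)) := by
        have h3 : Continuous (fun z : Space (d + 1) × ℝ => (z.1 + y, z.2)) := by fun_prop
        exact (h3.tendsto z₀).comp hxn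
      filter_upwards [hh.eventually_lt_const hδ, h2.eventually (Metric.ball_mem_nhds _ hδ)]
        with k hk1 hk2
      rw [(hpm k (x k + y)).resolve_left (H (h k) (x k + y) (n k) (h0 k) hk1 hk2), h1, max_self]
  have hbound := (integrableOn_norm_rpow_compl_ball (d := d) hα₀ hρ).const_mul C
  have hlim : Tendsto (fun k => ∫ y in (Metric.ball (0 : Space (d + 1)) ρ)ᶜ,
      scaledProfile α (r k) y * max (U (h k) (n k) (x k + y)) (v y)) atTop
      (𝓝 (∫ y in (Metric.ball (0 : Space (d + 1)) ρ)ᶜ,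
        ‖y‖ ^ (-((d : ℝ) + 1 + α)) * tailConst d α * v y)) := by
    refine tendsto_integral_of_dominated_convergence _
      (fun k => ((hQm k).mul ((hUm k).max hvm)).aestronglyMeasurable) hbound (fun k => ?_) ?_
    · refine (ae_restrict_iff' measurableSet_ball.compl).2 (Eventually.of_forall fun y hy => ?_)
      rw [norm_mul, Real.norm_of_nonneg (hQ0 k y)]
      exact (mul_le_of_le_one_right (hQ0 k y) (hmax1 k y)).trans (hQle k y hy)
    · refine (ae_restrict_iff' measurableSet_ball.compl).2 (Eventually.of_forall fun y hy => ?_)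
      exact (hQlim y hy).mul (hmaxlim y)
  have hconst : ∫ y in (Metric.ball (0 : Space (d + 1)) ρ)ᶜ,
      ‖y‖ ^ (-((d : ℝ) + 1 + α)) * tailConst d α * v y = tailConst d α *
      ∫ y in (Metric.ball (0 : Space (d + 1)) ρ)ᶜ, ‖y‖ ^ (-((d : ℝ) + 1 + α)) * v y := by
    rw [← integral_const_mul]
    congr 1
    ext y
    ring
  rw [hconst] at hlim
  filter_upwards [hlim.eventually_lt_const (lt_add_of_pos_right _ hε)] with k hk
  refine le_trans ?_ hk.le
  have hinteg : ∀ g : Space (d + 1) → ℝ, Measurable g → (∀ y, |g y| ≤ 1) →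
      IntegrableOn (fun y => scaledProfile α (r k) y * g y) (Metric.ball (0 : Space (d + 1)) ρ)ᶜ := by
    intro g hg hg1
    refine Integrable.mono' hbound ((hQm k).mul hg).aestronglyMeasurable ?_
    refine (ae_restrict_iff' measurableSet_ball.compl).2 (Eventually.of_forall fun y hy => ?_)
    rw [norm_mul, Real.norm_of_nonneg (hQ0 k y)]
    exact (mul_le_of_le_one_right (hQ0 k y) (hg1 y)).trans (hQle k y hy)
  exact setIntegral_mono (hinteg _ (hUm k) (hU1 k)) (hinteg _ ((hUm k).max hvm) (hmax1 k)) fun y =>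
    mul_le_mul_of_nonneg_left (le_max_left _ _) (hQ0 k y)

/-- The integral of a function with values `±1`, compared inside of a ball only. -/
theorem integral_profile_mul_le_add (hα₀ : 0 < α) (hα₂ : α < 2) {f s : Space (d + 1) → ℝ}
    (hfm : Measurable f) (hf : ∀ z, f z = 1 ∨ f z = -1) (hs : Measurable s) {L : ℝ}
    (hfs : ∀ z ∈ Metric.ball (0 : Space (d + 1)) L, f z = 1 → 0 ≤ s z) :
    ∫ z, profile α z * f z ≤ (∫ p : ℝ × Space d, truncProfile α (Metric.ball 0 L) p.1 p.2 *
      signUpper (s (consPoint p.1 p.2))) +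
        ∫ z in (Metric.ball (0 : Space (d + 1)) L)ᶜ, profile α z * f z := by
  have hPi := profile_integrable (d := d) hα₀ hα₂
  have hi1 : Integrable (fun z => profile α z * f z) := by
    refine hPi.norm.mono' (hPi.aestronglyMeasurable.mul hfm.aestronglyMeasurable)
      (Eventually.of_forall fun z => ?_)
    rcases hf z with h | h <;> simp [h]
  have hi2 : Integrable (fun z =>
      (Metric.ball (0 : Space (d + 1)) L).indicator (profile α) z * signUpper (s z)) := by
    have hG := hPi.indicator (measurableSet_ball (x := (0 : Space (d + 1))) (ε := L))
    refine hG.norm.mono' (hG.aestronglyMeasurable.mul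
      (measurable_signUpper.comp hs).aestronglyMeasurable) (Eventually.of_forall fun z => ?_)
    rw [norm_mul, Real.norm_eq_abs (signUpper _), abs_signUpper, mul_one]
  have h1 : (∫ p : ℝ × Space d, truncProfile α (Metric.ball 0 L) p.1 p.2 *
      signUpper (s (consPoint p.1 p.2))) =
      ∫ z, (Metric.ball (0 : Space (d + 1)) L).indicator (profile α) z * signUpper (s z) :=
    integral_consPoint (fun z =>
      (Metric.ball (0 : Space (d + 1)) L).indicator (profile α) z * signUpper (s z))
  rw [h1, ← integral_add_compl (measurableSet_ball (x := (0 : Space (d + 1))) (ε := L)) hi1,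
    ← integral_indicator measurableSet_ball]
  refine add_le_add (integral_mono (hi1.indicator measurableSet_ball) hi2 fun z => ?_) le_rfl
  by_cases hz : z ∈ Metric.ball (0 : Space (d + 1)) L
  · simp only [indicator_of_mem hz]
    refine mul_le_mul_of_nonneg_left ?_ (profile_nonneg hα₀ hα₂ z)
    rcases hf z with h | h
    · rw [h, signUpper, if_pos (hfs z hz h)]
    · rw [h]; exact (abs_le.1 (abs_signUpper (s z)).le).1
  · simp [indicator_of_notMem hz]

/-- The speed of a limit front lying above a parabolic graph. -/
theorem IsFlow.speed_le_nonlocal (hU : IsFlow α σ U) (hσ : IsScaling α σ) (hα₀ : 0 < α)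
    (hα₁ : α < 1) {z₀ : Space (d + 1) × ℝ} (hz₀ : z₀ ∈ spaceTime (d + 1))
    (hc : z₀ ∈ contactSet U) (O : Space (d + 1) ≃ₗᵢ[ℝ] Space (d + 1)) (a : ℝ)
    (B : Space d →L[ℝ] Space d →L[ℝ] ℝ) (K : ℝ) {ρ₀ : ℝ} (hρ₀ : 0 < ρ₀)
    (hpos : ∀ (w : Space (d + 1)) (τ : ℝ), ‖w‖ ≤ ρ₀ → |τ| ≤ ρ₀ →
      (z₀.1 + O w, z₀.2 + τ) ∈ contactSet U → (w, τ) ≠ 0 →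
        0 < w 0 + a * τ + B (tailPoint w) (tailPoint w) / 2 + K * τ ^ 2) :
    ∃ C ≥ 0, ∀ ρ, 0 < ρ → ρ ≤ ρ₀ / 2 → a * hyperplaneMass d α ≤
      tailConst d α * (∫ y in (Metric.ball (0 : Space (d + 1)) ρ)ᶜ,
        ‖y‖ ^ (-((d : ℝ) + 1 + α)) * upperRelaxed U (z₀.1 + y, z₀.2)) + C * ρ ^ (1 - α) := by
  have hα₂ : α < 2 := by linarith
  obtain ⟨h, r, x, n, a', q, h0, hh, hr0, hr1, hr, hxn, ha', hq, hpm, hinteg, hcmp⟩ :=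
    hU.exists_contact_scaled hσ hα₀ hz₀ hc O a B K hρ₀ hpos
  obtain ⟨C, hC, H⟩ := eventually_signIntegral_le_of_lt_one hα₀ hα₁ B
  -- The contact sequences and the constant are fixed before `ρ`, which may therefore tend to zero
  -- in the conclusion.
  refine ⟨C, hC, fun ρ hρ hρ1 => le_of_forall_pos_le_add fun ε hε => ?_⟩
  have hmeas : ∀ k, Measurable (fun z => U (h k) (n k) (x k + r k • O z)) := fun k =>
    (hU.measurable _ _).comp (Continuous.measurable (by fun_prop))
  obtain ⟨k, hk1, hk2⟩ := ((H hr0 hr ha' hq ρ hρ (ε / 2) (half_pos hε)).and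
    (hU.eventually_integral_compl_ball_le hα₀ hα₂ hz₀ h0 hh hr0 hr hxn hpm hρ
      (half_pos hε))).exists
  have hrate : rate α (r k) = r k ^ α := by rw [rate, if_pos hα₁]
  have hle := integral_profile_mul_le_add hα₀ hα₂ (hmeas k) (fun z => hpm k _)
    (measurable_graph (q k) B (rate α (r k) * a' k) (r k)) (L := ρ / r k)
    (fun z hz hUz => hcmp k z (by
      have hz' : ‖z‖ < ρ / r k := by simpa using hz
      refine hz'.le.trans ?_
      have := hr0 k
      gcongr) hUz)
  have hle2 := (hinteg k).trans hle
  simp only [consPoint_zero, tailPoint_consPoint] at hle2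
  rw [hrate] at hle2
  have hpow : 0 < r k ^ α := Real.rpow_pos_of_pos (hr0 k) α
  have hle3 := mul_nonneg (inv_pos.2 hpow).le hle2
  rw [mul_add, integral_compl_ball_rescale (hr0 k) O (x k) (U (h k) (n k)) ρ] at hle3
  rw [hyperplaneMass]
  linarith

theorem setIntegral_Ioo_rpow (hα₁ : α < 1) {ρ : ℝ} (hρ : 0 < ρ) :
    IntegrableOn (fun r : ℝ => r ^ (-α)) (Ioo 0 ρ) ∧
      ∫ r in Ioo 0 ρ, r ^ (-α) = ρ ^ (1 - α) / (1 - α) := by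
  constructor
  · have := (intervalIntegral.intervalIntegrable_rpow' (a := 0) (b := ρ) (r := -α) (by linarith)).1
    exact this.mono_set Ioo_subset_Ioc_self
  · rw [← integral_Ioc_eq_integral_Ioo, ← intervalIntegral.integral_of_le hρ.le,
      integral_rpow (Or.inl (by linarith)), Real.zero_rpow (by linarith), sub_zero,
      show -α + 1 = 1 - α by ring]

/-- The speed inequality involves the upper limit outside a ball of radius `ρ`. Between `ρ` and `δ`
it is at most the sign of `φ - φ(z₀)`, because contact points satisfy `φ ≥ φ(z₀)`. The missing
integral over radii below `ρ` and the curvature error are both `O(ρ ^ (1 - α))`. -/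
theorem IsFlow.timeDeriv_le_nonlocal (hU : IsFlow α σ U) (hσ : IsScaling α σ) (hα₀ : 0 < α)
    (hα₁ : α < 1) {φ : Space (d + 1) × ℝ → ℝ} (hφ : ContDiffOn ℝ 2 φ (spaceTime (d + 1)))
    {z₀ : Space (d + 1) × ℝ} (hz₀ : z₀ ∈ spaceTime (d + 1)) (hc : z₀ ∈ contactSet U)
    (hmax : IsMaxOn (fun w => upperRelaxed U w - φ w) (spaceTime (d + 1)) z₀)
    (hp : grad φ z₀ ≠ 0) {δ : ℝ} (hδ : 0 < δ) :
    timeDeriv φ z₀ ≤ nonlocalConst d α * ‖grad φ z₀‖ *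
      (nonlocalTerm signUpper α (Metric.ball 0 δ) φ z₀ +
        nonlocalTerm signUpper α (Metric.ball 0 δ)ᶜ (upperRelaxed U) z₀) := by
  have hα₂ : α < 2 := by linarith
  obtain ⟨O, hO⟩ := exists_isometry_single hp
  have hP : 0 < ‖grad φ z₀‖ := norm_pos_iff.2 hp
  have hm := hyperplaneMass_pos (d := d) hα₀ hα₂
  have hA := tailConst_nonneg (d := d) hα₀ hα₂
  have hφ' := contDiffAt_of_contDiffOn hφ hz₀
  -- Any `η` would do: the quadratic form only affects the constant `C`, whose contribution vanishes
  -- with `ρ`.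
  obtain ⟨K, ρ₀, hρ₀, H⟩ := hU.exists_graph hφ hz₀ hc hmax hp hO one_pos
  obtain ⟨C, hC, hspeed⟩ := hU.speed_le_nonlocal hσ hα₀ hα₁ hz₀ hc O _ _ K hρ₀ H
  set v : Space (d + 1) → ℝ := fun y => upperRelaxed U (z₀.1 + y, z₀.2) with hv
  set F : Space (d + 1) → ℝ := fun y => signUpper (φ (z₀.1 + y, z₀.2) - φ z₀) with hF
  have hst : ∀ y, (z₀.1 + y, z₀.2) ∈ spaceTime (d + 1) := fun y => ⟨mem_univ _, hz₀.2⟩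
  have hvm : Measurable v := hU.measurable_upperRelaxed_slice hz₀
  have hv1 : ∀ y, |v y| = 1 := fun y => hU.abs_upperRelaxed (hst y)
  have hz₀1 : upperRelaxed U z₀ = 1 := hU.upperRelaxed_of_mem hz₀ hc
  have hslice : Continuous (fun y => φ (y, z₀.2)) :=
    hφ.continuousOn.comp_continuous (by fun_prop) fun y => ⟨mem_univ _, hz₀.2⟩
  have hFm : Measurable F := measurable_signUpper.comp
    (((hslice.comp (continuous_const_add z₀.1)).sub continuous_const).measurable)
  have hF1 : ∀ y, |F y| ≤ 1 := fun y => (abs_signUpper _).le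
  have hvF : ∀ y, v y ≤ F y := by
    intro y
    by_cases hy : (z₀.1 + y, z₀.2) ∈ contactSet U
    · have h1 := hU.le_of_isMaxOn hz₀ hc hmax (hst y) hy
      have h2 : F y = 1 := if_pos (by linarith)
      rw [h2]
      exact (le_abs_self _).trans (hv1 y).le
    · have h1 : v y = -1 := hU.upperRelaxed_of_notMem (hst y) hy
      rw [h1]
      exact (abs_le.1 (hF1 y)).1
  -- The upper limit is `1` at `z₀` and has values `±1`, so the sign of its increment is the upper
  -- limit itself.
  have hsu : (fun y => signUpper (upperRelaxed U (z₀.1 + y, z₀.2) - upperRelaxed U z₀)) = v := by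
    ext y
    rw [hz₀1]
    by_cases hy : (z₀.1 + y, z₀.2) ∈ contactSet U
    · rw [hv]
      simp only [hU.upperRelaxed_of_mem (hst y) hy]
      norm_num [signUpper]
    · rw [hv]
      simp only [hU.upperRelaxed_of_notMem (hst y) hy]
      norm_num [signUpper]
  rw [nonlocalTerm_ball, nonlocalTerm_compl_ball _ hδ, hsu]
  -- the integrand near the origin
  obtain ⟨C', hC', hsph⟩ := exists_abs_integral_sphere_signUpper_le hslice (contDiffAt_slice hφ')
    (fderiv_slice_apply hφ') hp
  -- Cancellation on spheres gains one power of `r`, and `r ^ (-α)` is integrable at zero precisely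
  -- because `α < 1`.
  have hgle : ∀ r, 0 < r → ‖radialIntegrand α F r‖ ≤ C' * r ^ (-α) := by
    intro r hr
    rw [radialIntegrand, norm_mul, Real.norm_of_nonneg (by positivity)]
    calc r ^ (-(1 + α)) * ‖∫ ω, F (r • (ω : Space (d + 1))) ∂sphereMeasure d‖
        ≤ r ^ (-(1 + α)) * (C' * r) := by
          gcongr
          exact hsph r hr
      _ = C' * (r ^ (-(1 + α)) * r ^ (1 : ℝ)) := by rw [Real.rpow_one]; ring
      _ = C' * r ^ (-α) := by rw [← Real.rpow_add hr]; congr 2; ring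
  have hgi : ∀ ρ, 0 < ρ → IntegrableOn (radialIntegrand α F) (Ioo 0 ρ) := by
    intro ρ hρ
    refine Integrable.mono' ((setIntegral_Ioo_rpow hα₁ hρ).1.const_mul C')
      (measurable_radialIntegrand hFm).aestronglyMeasurable ?_
    exact (ae_restrict_iff' measurableSet_Ioo).2 (Eventually.of_forall fun r hr => hgle r hr.1)
  have hgsmall : ∀ ρ, 0 < ρ → -(C' * (ρ ^ (1 - α) / (1 - α))) ≤
      ∫ r in Ioo 0 ρ, radialIntegrand α F r := by
    intro ρ hρ
    have h1 := norm_integral_le_of_norm_le (μ := volume.restrict (Ioo 0 ρ))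
      ((setIntegral_Ioo_rpow hα₁ hρ).1.const_mul C')
      ((ae_restrict_iff' measurableSet_Ioo).2 (Eventually.of_forall fun r hr => hgle r hr.1))
    rw [integral_const_mul, (setIntegral_Ioo_rpow hα₁ hρ).2] at h1
    exact (abs_le.1 h1).1
  set I₁ := ∫ r in Ioo 0 δ, radialIntegrand α F r with hI₁
  set I₂ := ∫ r in Ici δ, radialIntegrand α v r with hI₂
  set a := timeDeriv φ z₀ / ‖grad φ z₀‖ with ha
  have key : ∀ ρ, 0 < ρ → ρ ≤ ρ₀ / 2 → ρ < δ → a * hyperplaneMass d α ≤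
      tailConst d α * (I₁ + C' * (ρ ^ (1 - α) / (1 - α)) + I₂) + C * ρ ^ (1 - α) := by
    intro ρ hρ hρ1 hρδ
    refine (hspeed ρ hρ hρ1).trans ?_
    rw [setIntegral_compl_ball_polar hα₀ hvm (fun y => (hv1 y).le) hρ]
    gcongr
    have hvi := integrableOn_radialIntegrand hα₀ hvm (fun y => (hv1 y).le) hρ
    have hFi := integrableOn_radialIntegrand hα₀ hFm hF1 hρ
    have hsplit : Ici ρ = Ico ρ δ ∪ Ici δ := (Ico_union_Ici_eq_Ici hρδ.le).symm
    have hdisj : Disjoint (Ico ρ δ) (Ici δ) := by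
      rw [Set.disjoint_left]
      exact fun r hr hr' => absurd hr.2 (not_lt.2 hr')
    have h1 : ∫ r in Ici ρ, radialIntegrand α v r =
        (∫ r in Ico ρ δ, radialIntegrand α v r) + I₂ := by
      rw [hsplit, setIntegral_union hdisj measurableSet_Ici
        (hvi.mono_set Ico_subset_Ici_self) (hvi.mono_set (Ici_subset_Ici.2 hρδ.le))]
    have h2 : ∫ r in Ico ρ δ, radialIntegrand α v r ≤ ∫ r in Ico ρ δ, radialIntegrand α F r := by
      refine setIntegral_mono_on (hvi.mono_set Ico_subset_Ici_self)
        (hFi.mono_set Ico_subset_Ici_self) measurableSet_Ico fun r hr => ?_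
      have hr0 : 0 < r := hρ.trans_le hr.1
      exact mul_le_mul_of_nonneg_left (integral_mono (integrable_sphere hvm (fun y => (hv1 y).le) r)
        (integrable_sphere hFm hF1 r) fun ω => hvF _) (by positivity)
    have h3 : I₁ = (∫ r in Ioo 0 ρ, radialIntegrand α F r) +
        ∫ r in Ico ρ δ, radialIntegrand α F r := by
      rw [hI₁, ← Ioo_union_Ico_eq_Ioo hρ hρδ.le, setIntegral_union _ measurableSet_Ico
        (hgi ρ hρ) (hFi.mono_set Ico_subset_Ici_self)]
      rw [Set.disjoint_left]
      exact fun r hr hr' => absurd hr.2 (not_lt.2 hr'.1)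
    have h4 := hgsmall ρ hρ
    rw [h1]
    linarith
  have hs : 0 < 1 - α := by linarith
  have hlim : Tendsto (fun ρ : ℝ => tailConst d α * (I₁ + C' * (ρ ^ (1 - α) / (1 - α)) + I₂) +
      C * ρ ^ (1 - α)) (𝓝[>] 0) (𝓝 (tailConst d α * (I₁ + C' * (0 / (1 - α)) + I₂) + C * 0)) := by
    have h1 : Tendsto (fun ρ : ℝ => ρ ^ (1 - α)) (𝓝[>] 0) (𝓝 0) := by
      have := (Real.continuous_rpow_const hs.le).tendsto 0
      rw [Real.zero_rpow hs.ne'] at this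
      exact this.mono_left nhdsWithin_le_nhds
    exact ((((h1.div_const _).const_mul C').const_add I₁).add_const I₂ |>.const_mul _).add
      (h1.const_mul C)
  have h1 := ge_of_tendsto hlim (by
    filter_upwards [Ioo_mem_nhdsGT (show (0:ℝ) < min (ρ₀ / 2) δ by positivity)] with ρ hρ
    exact key ρ hρ.1 (hρ.2.le.trans (min_le_left _ _)) (hρ.2.trans_le (min_le_right _ _)))
  rw [zero_div, mul_zero, mul_zero, add_zero, add_zero] at h1
  have h2 : timeDeriv φ z₀ = ‖grad φ z₀‖ * (hyperplaneMass d α)⁻¹ * (a * hyperplaneMass d α) := by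
    rw [ha]; field_simp
  rw [h2, nonlocalConst]
  calc ‖grad φ z₀‖ * (hyperplaneMass d α)⁻¹ * (a * hyperplaneMass d α)
      ≤ ‖grad φ z₀‖ * (hyperplaneMass d α)⁻¹ * (tailConst d α * (I₁ + I₂)) := by gcongr
    _ = _ := by ring

theorem IsFlow.isNonlocalSubsolution (hU : IsFlow α σ U) (hσ : IsScaling α σ) (hα₀ : 0 < α)
    (hα₁ : α < 1) : IsNonlocalSubsolution α (nonlocalConst d α) (upperRelaxed U) where
  bounded := hU.locallyBounded
  usc := hU.upperSemicontinuousOn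
  test φ hφ z hz hmax δ hδ := by
    by_cases hp : grad φ z = 0
    · rw [hp, norm_zero, mul_zero, zero_mul]
      by_cases hc : z ∈ contactSet U
      · exact hU.timeDeriv_nonpos hσ hα₀ (by linarith) hφ hz hc hmax hp
          fun h => absurd hα₁ (not_lt.2 h)
      · exact (hU.deriv_eq_zero_of_notMem hφ hz hc hmax).2.le
    · by_cases hc : z ∈ contactSet U
      · exact hU.timeDeriv_le_nonlocal hσ hα₀ hα₁ hφ hz hc hmax hp hδ
      · exact absurd (hU.deriv_eq_zero_of_notMem hφ hz hc hmax).1 hp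

/-! ### Supersolutions -/

section Duality

variable {N : ℕ} (φ : Space N × ℝ → ℝ) (z : Space N × ℝ)

theorem grad_neg : grad (fun w => -φ w) z = -grad φ z := by
  rw [grad, grad, gradient, gradient, fderiv_fun_neg, map_neg]

theorem timeDeriv_neg : timeDeriv (fun w => -φ w) z = -timeDeriv φ z := by
  rw [timeDeriv, timeDeriv, deriv.fun_neg]

theorem hess_neg : hess (fun w => -φ w) z = -hess φ z := by
  ext i j
  simp only [hess, Matrix.of_apply, Matrix.neg_apply]
  have h1 : fderiv ℝ (fun y => -φ (y, z.2)) = fun y => -fderiv ℝ (fun y => φ (y, z.2)) y := by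
    ext1 y
    exact fderiv_fun_neg
  rw [h1, fderiv_fun_neg]
  rfl

theorem curvatureTerm_neg (p : Space N) (X : Matrix (Fin N) (Fin N) ℝ) :
    curvatureTerm (-p) (-X) = -curvatureTerm p X := by
  have h1 : Matrix.vecMulVec (fun i => (‖-p‖⁻¹ • -p) i) (fun i => (‖-p‖⁻¹ • -p) i) =
      Matrix.vecMulVec (fun i => (‖p‖⁻¹ • p) i) (fun i => (‖p‖⁻¹ • p) i) := by
    ext i j
    simp [Matrix.vecMulVec_apply]
  rw [curvatureTerm, h1, mul_neg, Matrix.trace_neg, curvatureTerm]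

/-- Negation exchanges closed and open superlevel sets, which is why the supersolution inequality
carries the other sign function. -/
theorem signUpper_neg (s : ℝ) : signUpper (-s) = -signLower s := by
  unfold signUpper signLower
  by_cases h : 0 < s
  · rw [if_neg (by linarith), if_pos h]
  · rw [if_pos (by linarith), if_neg h, neg_neg]

theorem nonlocalTerm_neg (A : Set (Space N)) (v : Space N × ℝ → ℝ) :
    nonlocalTerm signUpper α A (fun w => -v w) z = -nonlocalTerm signLower α A v z := by
  rw [nonlocalTerm, nonlocalTerm, ← integral_neg]
  congr 1
  ext r
  rw [← mul_neg, ← integral_neg]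
  congr 2
  ext ω
  have h1 : ∀ y, signUpper (-v (z.1 + y, z.2) - -v z) = -signLower (v (z.1 + y, z.2) - v z) := by
    intro y
    rw [← signUpper_neg]
    congr 1
    ring
  simp only [h1]
  by_cases h : r • (ω : Space N) ∈ A <;> simp [h]

end Duality

theorem IsCurvatureSubsolution.neg {N : ℕ} {C : ℝ} {u v : Space N × ℝ → ℝ}
    (h : IsCurvatureSubsolution C u) (huv : ∀ z ∈ spaceTime N, v z = -u z) :
    IsCurvatureSupersolution C v where
  lsc z hz c hc := by
    have hc : c < v z := hc
    rw [huv z hz] at hc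
    filter_upwards [h.usc z hz (-c) (by linarith), self_mem_nhdsWithin] with w hw hws
    have hw : u w < -c := hw
    change c < v w
    rw [huv w hws]
    linarith
  test φ hφ z hz hmin := by
    have h1 := h.test (fun w => -φ w) hφ.neg z hz (fun w hw => by
      have h2 : v z - φ z ≤ v w - φ w := hmin hw
      rw [huv z hz, huv w hw] at h2
      change u w - -φ w ≤ u z - -φ z
      linarith)
    rw [grad_neg, timeDeriv_neg, hess_neg, curvatureTerm_neg] at h1
    refine ⟨fun hp => ?_, fun hp hX => ?_⟩
    · have := h1.1 (neg_ne_zero.2 hp)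
      linarith
    · have := h1.2 (by rw [hp, neg_zero]) (by rw [hX, neg_zero])
      linarith

/-- Only values at the time of `z` enter, so agreement at positive times suffices; the duality of
the two relaxed limits is known only there. -/
theorem nonlocalTerm_congr {N : ℕ} (s : ℝ → ℝ) (A : Set (Space N)) {u v : Space N × ℝ → ℝ}
    {z : Space N × ℝ} (hz : z ∈ spaceTime N) (huv : ∀ z ∈ spaceTime N, u z = v z) :
    nonlocalTerm s α A u z = nonlocalTerm s α A v z := by
  have h1 : ∀ y, u (z.1 + y, z.2) = v (z.1 + y, z.2) := fun y => huv _ ⟨mem_univ _, hz.2⟩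
  simp only [nonlocalTerm, h1, huv z hz]

theorem IsNonlocalSubsolution.neg {N : ℕ} {C : ℝ} {u v : Space N × ℝ → ℝ}
    (h : IsNonlocalSubsolution α C u) (huv : ∀ z ∈ spaceTime N, v z = -u z) :
    IsNonlocalSupersolution α C v where
  bounded z hz := by
    obtain ⟨M, hM⟩ := h.bounded z hz
    refine ⟨M, ?_⟩
    filter_upwards [hM, self_mem_nhdsWithin] with w hw hws
    rwa [huv w hws, abs_neg]
  lsc z hz c hc := by
    have hc : c < v z := hc
    rw [huv z hz] at hc
    filter_upwards [h.usc z hz (-c) (by linarith), self_mem_nhdsWithin] with w hw hws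
    have hw : u w < -c := hw
    change c < v w
    rw [huv w hws]
    linarith
  test φ hφ z hz hmin δ hδ := by
    have h1 := h.test (fun w => -φ w) hφ.neg z hz (fun w hw => by
      have h2 : v z - φ z ≤ v w - φ w := hmin hw
      rw [huv z hz, huv w hw] at h2
      change u w - -φ w ≤ u z - -φ z
      linarith) δ hδ
    rw [nonlocalTerm_congr signUpper _ hz (u := u) (v := fun w => -v w)
      (fun w hw => by rw [huv w hw, neg_neg]), grad_neg, timeDeriv_neg, nonlocalTerm_neg,
      nonlocalTerm_neg, norm_neg] at h1
    linarith

end Threshold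

end

/-! ### Conclusion for the scheme and, by duality, for its negative -/

theorem proposition2p1 (d : ℕ) (α : ℝ) (hα₀ : 0 < α) (hα₂ : α < 2)
    (σ : ℝ → ℝ) (hσ : Threshold.IsScaling α σ)
    (Ω₀ : Set (Threshold.Space (d + 1))) (hΩ₀ : IsOpen Ω₀) :
    (1 ≤ α →
      Threshold.IsCurvatureSubsolution (Threshold.curvatureConst d α)
        (Threshold.upperRelaxed (Threshold.scheme α σ Ω₀)) ∧
      Threshold.IsCurvatureSupersolution (Threshold.curvatureConst d α)
        (Threshold.lowerRelaxed (Threshold.scheme α σ Ω₀))) ∧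
    (α < 1 →
      Threshold.IsNonlocalSubsolution α (Threshold.nonlocalConst d α)
        (Threshold.upperRelaxed (Threshold.scheme α σ Ω₀)) ∧
      Threshold.IsNonlocalSupersolution α (Threshold.nonlocalConst d α)
        (Threshold.lowerRelaxed (Threshold.scheme α σ Ω₀))) := by
  have hU := Threshold.isFlow_scheme hα₀ σ hΩ₀
  have hU' := Threshold.isFlow_neg_scheme hα₀ σ hΩ₀
  have hlow : ∀ z ∈ Threshold.spaceTime (d + 1),
      Threshold.lowerRelaxed (Threshold.scheme α σ Ω₀) z =
        -Threshold.upperRelaxed (fun h n x => -Threshold.scheme α σ Ω₀ h n x) z :=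
    fun z hz => Threshold.lowerRelaxed_eq hU.abs_le_one hz
  refine ⟨fun h1 => ⟨hU.isCurvatureSubsolution hσ h1 hα₂, ?_⟩, fun h1 =>
    ⟨hU.isNonlocalSubsolution hσ hα₀ h1, ?_⟩⟩
  · exact (hU'.isCurvatureSubsolution hσ h1 hα₂).neg hlow
  · exact (hU'.isNonlocalSubsolution hσ hα₀ h1).neg hlow
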